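/- **Conventions.** For $u:\mathbb R^3\to\mathbb C^3$ the Fourier transform $\hat u$ is normalized by $u(x)=\int_{\mathbb R^3}e^{ik\cdot x}\hat u(k)\,dk$ with $\hat u$ measurable and integrable, so that products go to convolutions $(\hat a\,\hat*\,\hat b)(k)=\int \hat a(q)\hat b(k-q)\,dq$ and $\partial_j$ goes to $ik_j$. Put $\|\hat u\|_{\mu,\beta}=\sup_{k\in\mathbb R^3}(1+|k|)^\mu e^{\beta|k|}|\hat u(k)|$ and $P_k w=w-k\,(k\cdot w)/|k|^2$, and let $\mathcal P=I-\nabla\Delta^{-1}\nabla\cdot$ be the Fourier multiplier with symbol $P_k$ (the Hodge projection). The Navier–Stokes problem is $$v_t-\Delta v=-\mathcal P[v\cdot\nabla v]+f(x),\qquad \nabla\cdot v=0,\qquad v(x,0)=v_0(x),\qquad x\in\mathbb R^3 .$$ A classical solution on $[0,T)$ is a function $v$ continuous on $[0,T)\times\mathbb R^3$ whose derivatives $v_t,\nabla v,D^2v$ exist and are continuous on $(0,T)\times\mathbb R^3$ and which satisfies the problem; for $t$ in an open set of complex numbers, $v_t$ is the complex derivative. With $J_1,Y_1$ the Bessel functions,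 let $\mathcal G(z,z')=z'\left(-J_1(z)Y_1(z')+Y_1(z)J_1(z')\right)$, $$C_0=\frac{32\pi\,2^\mu}{(\mu-1)(\mu-2)(\mu-3)},\qquad C_2=2\pi C_0\sup_{0<z'\le z}|\mathcal G(z,z')| ,\qquad \hat v_1(k)=-|k|^2\hat v_0-ik_jP_k[\hat v_{0,j}\,\hat*\,\hat v_0]+\hat f .$$ **Theorem.** Let $\mu>3$, $\beta\ge0$, and let $v_0,f$ be divergence free (that is, $k\cdot\hat v_0(k)=k\cdot\hat f(k)=0$ for almost every $k$) with $\|\hat v_0\|_{\mu+2,\beta}<\infty$ and $\|\hat f\|_{\mu,\beta}<\infty$. Let $\alpha>0$ satisfy $$2C_2\sqrt\pi\,\alpha^{-1/2}\left(\|\hat v_0\|_{\mu,\beta}+2\alpha^{-1}\|\hat v_1\|_{\mu,\beta}\right)<1 .$$ Let $D=\{t\in\mathbb C:\mathrm{Re}\,\tfrac1t>\alpha\}$. Then there is $v(x,t)$, defined for $t\in D\cup\{0\}$, such that: 1. $v$ is a classical solution of the Navier–Stokes problem on $[0,1/\alpha)$, and of the equation for complex $t\in D$; $\|\hat v(\cdot,t)\|_{\mu,\beta}<\infty$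 for all $t\in D\cup\{0\}$, uniformly for $t\in[0,T']$ whenever $T'<1/\alpha$. If $v_0$ and $f$ are real-valued, so is $v(\cdot,t)$ for $t\in[0,1/\alpha)$. 2. $v$ is unique: if $0<T\le1/\alpha$ and $w$ is a classical solution on $[0,T)$ with $\sup_{0\le t\le T'}\|\hat w(\cdot,t)\|_{\mu,\beta}<\infty$ for all $T'<T$, then $w=v$ on $[0,T)$; and if $w$ solves the equation classically for complex $t\in D$ and its restriction to real times is such a solution on $[0,1/\alpha)$, then $w=v$ on $D$. 3. There is a measurable $\hat U(k,p)$ and a constant $C$ with $\|\hat U(\cdot,p)\|_{\mu,\beta}\le Ce^{\alpha p}$ for $p\ge0$ such that, with $U(\cdot,p)$ the inverse Fourier transform of $\hat U(\cdot,p)$, for all $t\in D$, $$\hat v(k,t)=\hat v_0(k)+\int_0^\infty e^{-p/t}\hat U(k,p)\,dp,\qquad v(x,t)=v_0(x)+\int_0^\infty e^{-p/t}U(x,p)\,dp .$$ 4. $t\mapsto\hat v(\cdot,t)$ is analytic on $D$ with respect to the norm $\|\cdot\|_{\mu,\beta}$, and $t\mapsto v(x,t)$ is analytic on $D$ for every $x$.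 5. $\sup_{0\le t\le T}\|\hat v(\cdot,t)\|_{\mu+2,\beta}<\infty$ for every $T<1/\alpha$; in particular $\|\hat v(\cdot,t)\|_{\mu+2,\beta}<\infty$ for $t\in[0,1/\alpha)$. 6. If $\beta>0$, then for every $t\in D\cup\{0\}$ (in particular for $t\in[0,1/\alpha)$) $v(\cdot,t)$ extends holomorphically to the strip $\{z\in\mathbb C^3:|\mathrm{Im}\,z|<\beta\}$. -/

import Mathlib

open scoped ENNReal NNReal

namespace NSBorel

noncomputable section

/-- Physical space and wave-vector space `ℝ³`. -/
abbrev E3 : Type := EuclideanSpace ℝ (Fin 3)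

/-- Values `ℂ³` of the velocity fields and of their Fourier transforms. -/
abbrev C3 : Type := EuclideanSpace ℂ (Fin 3)

/-! ### Fourier transform

The normalization is `û(k) = (2π)⁻³ ∫ e^{-i k·x} u(x) dx`, so that `u(x) = ∫ e^{i k·x} û(k) dk`,
`∂_j` becomes `i k_j`, and products become plain convolutions. -/

/-- The inverse Fourier transform `x ↦ ∫ e^{i k·x} û(k) dk`. -/
def invFourier (uhat : E3 → C3) (x : E3) : C3 :=
  ∫ k : E3, Complex.exp (Complex.I * ((inner ℝ k x : ℝ) : ℂ)) • uhat k

/-- `uhat` is (a representative of) the Fourier transform of `u`, and is integrable. This is stated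
through the inversion formula because the fields considered here need not be integrable. -/
structure IsFourierTransform (u uhat : E3 → C3) : Prop where
  measurable : Measurable uhat
  integrable : MeasureTheory.Integrable uhat
  inversion : ∀ x, u x = invFourier uhat x

/-- The Fourier convolution `(a *̂ b)(k) = ∫ a(q) b(k - q) dq`. -/
def fconv (a : E3 → ℂ) (b : E3 → C3) (k : E3) : C3 :=
  ∫ q : E3, a q • b (k - q)

/-- The bilinear product `k · w = ∑ k_j w_j` of a real and a complex vector. -/
def kdot (k : E3) (w : C3) : ℂ := ∑ j, ((k j : ℝ) : ℂ) * w j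

/-- The inclusion `ℝ³ ⊂ ℂ³`. -/
def toC3 (x : E3) : C3 := WithLp.toLp 2 fun j => ((x j : ℝ) : ℂ)

/-- The componentwise imaginary part `ℂ³ → ℝ³`. -/
def imPart (z : C3) : E3 := WithLp.toLp 2 fun j => (z j).im

/-- The symbol `P_k w = w - k (k·w) / |k|²` of the Hodge projection. -/
def projSymbol (k : E3) (w : C3) : C3 :=
  w - (kdot k w / ((‖k‖ ^ 2 : ℝ) : ℂ)) • toC3 k

/-! ### The weighted norm -/

/-- The weight `(1+|k|)^μ e^{β|k|}`. -/
def weight (μ β : ℝ) (k : E3) : ℝ := (1 + ‖k‖) ^ μ * Real.exp (β * ‖k‖)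

/-- `‖g‖_{μ,β} = sup_k (1+|k|)^μ e^{β|k|} |g(k)|`, with values in `[0,∞]`. -/
def wnorm (μ β : ℝ) (g : E3 → C3) : ℝ≥0∞ :=
  ⨆ k : E3, ENNReal.ofReal (weight μ β k * ‖g k‖)

/-! ### The Navier–Stokes problem -/

/-- `h = 𝒫 g`, where `𝒫 = I - ∇ Δ⁻¹ ∇·` is the Hodge projection (Fourier multiplier `P_k`). -/
def IsHodgeProjection (g h : E3 → C3) : Prop :=
  ∃ ghat : E3 → C3, IsFourierTransform g ghat ∧
    ∀ x, h x = invFourier (fun k => projSymbol k (ghat k)) x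

/-- The partial derivative `∂_j u`. -/
def partialD (j : Fin 3) (u : E3 → C3) (x : E3) : C3 :=
  fderiv ℝ u x (EuclideanSpace.single j 1)

/-- The advection term `u · ∇u = ∑ u_j ∂_j u`. -/
def advection (u : E3 → C3) (x : E3) : C3 := ∑ j, u x j • partialD j u x

/-- The divergence `∇ · u`. -/
def divergence (u : E3 → C3) (x : E3) : ℂ := ∑ j, partialD j u x j

/-- `w` is a classical divergence-free solution of `w_t - Δw = -𝒫[w·∇w] + f` for times in the open
set `Ω`: all the derivatives in the equation exist and are continuous in `(t, x)`. The time variable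
is real (`𝕜 = ℝ`) or complex (`𝕜 = ℂ`). -/
structure SolvesNSOn {𝕜 : Type} [NontriviallyNormedField 𝕜] [NormedSpace 𝕜 C3]
    (f : E3 → C3) (Ω : Set 𝕜) (w : 𝕜 → E3 → C3) : Prop where
  contDiff : ∀ t ∈ Ω, ContDiff ℝ 2 (w t)
  differentiable_time : ∀ t ∈ Ω, ∀ x, DifferentiableAt 𝕜 (fun s => w s x) t
  continuous_dx : ContinuousOn (fun q : 𝕜 × E3 => fderiv ℝ (w q.1) q.2) (Ω ×ˢ Set.univ)
  continuous_dxx : ContinuousOn (fun q : 𝕜 × E3 => fderiv ℝ (fderiv ℝ (w q.1)) q.2) (Ω ×ˢ Set.univ)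
  continuous_dt : ContinuousOn (fun q : 𝕜 × E3 => deriv (fun s => w s q.2) q.1) (Ω ×ˢ Set.univ)
  divergence_free : ∀ t ∈ Ω, ∀ x, divergence (w t) x = 0
  equation : ∀ t ∈ Ω, ∃ h : E3 → C3, IsHodgeProjection (advection (w t)) h ∧
    ∀ x, deriv (fun s => w s x) t - Laplacian.laplacian (w t) x = -h x + f x

/-- `w` is a classical solution of the initial value problem on the real time interval `[0, T)`. -/
structure IsClassicalSolution (v0 f : E3 → C3) (T : ℝ) (w : ℝ → E3 → C3) : Prop where
  initial : w 0 = v0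
  continuousOn : ContinuousOn (fun q : ℝ × E3 => w q.1 q.2) (Set.Ico 0 T ×ˢ Set.univ)
  solves : SolvesNSOn f (Set.Ioo 0 T) w

/-- `‖ŵ(·,t)‖_{μ,β}` is finite on `[0, T)`, with a bound that is uniform on each `[0, T']`,
`T' < T`. -/
def LocallyBoundedNorm (μ β T : ℝ) (w : ℝ → E3 → C3) : Prop :=
  ∀ T' < T, ∃ C : ℝ≥0, ∀ t ∈ Set.Icc 0 T', ∃ what : E3 → C3,
    IsFourierTransform (w t) what ∧ wnorm μ β what ≤ C

/-! ### The constant `α` -/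

/-- The Bessel function `J₁` (Bessel's integral). -/
def besselJ1 (z : ℝ) : ℝ :=
  (1 / Real.pi) * ∫ θ in (0 : ℝ)..Real.pi, Real.cos (θ - z * Real.sin θ)

/-- The Bessel function `Y₁` of the second kind, for `z > 0` (Schläfli's integral). -/
def besselY1 (z : ℝ) : ℝ :=
  (1 / Real.pi) * (∫ θ in (0 : ℝ)..Real.pi, Real.sin (z * Real.sin θ - θ))
    - (2 / Real.pi) * ∫ s in Set.Ioi (0 : ℝ), Real.sinh s * Real.exp (-z * Real.sinh s)

/-- The kernel `𝒢(z,z') = z' (-J₁(z) Y₁(z') + Y₁(z) J₁(z'))`. -/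
def kernelG (z z' : ℝ) : ℝ :=
  z' * (-besselJ1 z * besselY1 z' + besselY1 z * besselJ1 z')

/-- The supremum of `|𝒢(z,z')|` over `0 < z' ≤ z` (a finite number, about `0.6`). -/
def supG : ℝ := sSup {y : ℝ | ∃ z z' : ℝ, 0 < z' ∧ z' ≤ z ∧ y = |kernelG z z'|}

/-- `C₀(μ) = 2^{μ+2} ∫ (1+|k|)^{-μ} dk`, in closed form. -/
def constC0 (μ : ℝ) : ℝ :=
  32 * Real.pi * (2 : ℝ) ^ μ / ((μ - 1) * (μ - 2) * (μ - 3))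

/-- `C₂(μ) = 2 π C₀(μ) sup |𝒢|`. -/
def constC2 (μ : ℝ) : ℝ := 2 * Real.pi * constC0 μ * supG

/-- `v̂₁ = -|k|² v̂₀ - i k_j P_k[v̂₀,ⱼ *̂ v̂₀] + f̂`. -/
def v1hat (v0hat fhat : E3 → C3) (k : E3) : C3 :=
  -(((‖k‖ ^ 2 : ℝ) : ℂ) • v0hat k)
    - Complex.I • (∑ j, ((k j : ℝ) : ℂ) • projSymbol k (fconv (fun q => v0hat q j) v0hat k))
    + fhat k

/-- The smallness condition
`2 C₂ √π α^{-1/2} (‖v̂₀‖_{μ,β} + 2 α⁻¹ ‖v̂₁‖_{μ,β}) < 1`, as an inequality in `[0,∞]`. -/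
def AlphaCondition (μ β α : ℝ) (v0hat fhat : E3 → C3) : Prop :=
  ENNReal.ofReal (2 * constC2 μ * Real.sqrt Real.pi * α ^ (-(1 / 2) : ℝ)) *
    (wnorm μ β v0hat + ENNReal.ofReal (2 * α⁻¹) * wnorm μ β (v1hat v0hat fhat)) < 1

/-- The disc `{t ∈ ℂ : Re (1/t) > α}`; for `α > 0` it does not contain `0`, where `0⁻¹ = 0`. -/
def timeDisc (α : ℝ) : Set ℂ := {t : ℂ | α < (t⁻¹).re}

end

end NSBorel

open NSBorel

/-! Put τ = 1/t and look for the Fourier transform of the solution as a Laplace integral, v̂ = v̂₀ +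
∫₀^∞ e^{-pτ} U(k,p) dp. The time derivative is -τ² ∂_τ, and -∂_τ multiplies U by p; products of
Laplace transforms are transforms of convolutions in p. The Navier–Stokes equation becomes (pU)'' +
|k|² U = R[U] with (pU)(0) = 0, (pU)'(0) = v̂₁, where R[U] collects the linear and quadratic parts
of the nonlinearity in U; the force and the part depending on v̂₀ alone sit in v̂₁.

In the variable z = 2|k|√p the left-hand operator is Bessel's, and it is inverted by the kernel
π/(2|k|√p) 𝒢(2|k|√p, 2|k|√p'). The nonlinearity costs a factor |k|, and the kernel returns 1/|k| at
the price of the integrable singularity p^{-1/2} (`mul_abs_borelKernel_le`), so no derivative is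
lost. This needs 𝒢 to be bounded: 𝒢 and a companion kernel of order zero have a sum of squares that
decreases in z and starts from the Wronskian value (2/π)² (`kernelG_sq_add_sq_le`). The weighted sup
norm is stable under convolution in k (`integral_weight_conv_le`), and the profile e^{αp} p^{-1/2}
under convolution in p (`integrable_borelProfile_conv`). Hence the integral equation is a
contraction with factor 1/2 in a ball, the condition on α being exactly of the size required
(`exists_borel_solution`). A second look at the fixed point removes the singularity at p = 0
(`BorelBounded.exp_bound`).

No inversion of the Laplace transform is needed on the way back: the transform of the fixed point is
computed with Fubini and seen to satisfy the equation (`borel_duhamel_laplace`,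
`laplace_solves_fourier`). Analyticity for Re(1/t) > α comes with the representation. The equation
bounds |k|² v̂ by v̂_t, the nonlinearity and f̂, so two powers of |k| are gained
(`exists_bootstrap_bound`); with them the inverse Fourier integral may be differentiated twice and
is a classical solution (`FourierFlow.solvesNSOn`). The weight e^{β|k|} gives the holomorphic
extension in x, and Hermitian symmetry, preserved by the iteration, gives real solutions.

For uniqueness the competitor is merely classical, with no decay assumed for its derivatives. The
difference of two solutions is therefore tested against cutoffs times e^{-ik·x}. Each such mode
solves a scalar heat equation with decay rate |k|² whose source grows by a factor 1+|k| relative to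
the weight, and the heat factor turns this into r + √r after time r (`one_add_mul_heat_le`). All
constants are uniform in the size of the cutoff, so the bound survives its removal
(`ae_norm_le_of_modes`); the resulting short-time contraction makes the difference vanish
(`SolutionPair.exists_step`). Complex times follow from the identity theorem. -/

open scoped ENNReal NNReal
namespace NSBorel
open MeasureTheory Set Filter Topology

/-! ### Bessel functions of order zero and one -/

noncomputable section

/-- The Bessel function `J₀`. -/
def besselJ0 (z : ℝ) : ℝ :=
  (1 / Real.pi) * ∫ θ in (0 : ℝ)..Real.pi, Real.cos (z * Real.sin θ)

/-- The integrals `∫₀^∞ sinhⁿ s e^{-z sinh s} ds`. -/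
def sinhLaplace (n : ℕ) (z : ℝ) : ℝ :=
  ∫ s in Ioi (0 : ℝ), Real.sinh s ^ n * Real.exp (-z * Real.sinh s)

/-- The Bessel function `Y₀`, for `z > 0`. -/
def besselY0 (z : ℝ) : ℝ :=
  (1 / Real.pi) * (∫ θ in (0 : ℝ)..Real.pi, Real.sin (z * Real.sin θ))
    - (2 / Real.pi) * sinhLaplace 0 z

/-! ### Integral representations and recurrences of the Bessel functions -/

theorem integral_eq_zero_of_reflect {f : ℝ → ℝ} (h : ∀ θ, f (Real.pi - θ) = -f θ) :
    ∫ θ in (0 : ℝ)..Real.pi, f θ = 0 := by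
  have h1 := intervalIntegral.integral_comp_sub_left (a := 0) (b := Real.pi) f Real.pi
  simp only [h, sub_self, sub_zero, intervalIntegral.integral_neg] at h1
  linarith

/-- In Bessel's integral the part containing cos θ is odd about θ = π/2 and drops out. The same
cancellation simplifies `besselY1`. -/
theorem besselJ1_eq (z : ℝ) :
    besselJ1 z = (1 / Real.pi) * ∫ θ in (0 : ℝ)..Real.pi, Real.sin θ * Real.sin (z * Real.sin θ) := by
  have h0 : ∫ θ in (0 : ℝ)..Real.pi, Real.cos θ * Real.cos (z * Real.sin θ) = 0 :=
    integral_eq_zero_of_reflect fun θ => by simp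
  unfold besselJ1
  congr 1
  simp only [Real.cos_sub]
  rw [intervalIntegral.integral_add, h0, zero_add] <;>
    exact Continuous.intervalIntegrable (by fun_prop) _ _

theorem besselY1_eq (z : ℝ) :
    besselY1 z = -(1 / Real.pi) * (∫ θ in (0 : ℝ)..Real.pi, Real.sin θ * Real.cos (z * Real.sin θ))
      - (2 / Real.pi) * sinhLaplace 1 z := by
  have h0 : ∫ θ in (0 : ℝ)..Real.pi, Real.sin (z * Real.sin θ) * Real.cos θ = 0 :=
    integral_eq_zero_of_reflect fun θ => by simp
  unfold besselY1 sinhLaplace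
  simp only [Real.sin_sub, pow_one]
  rw [intervalIntegral.integral_sub, h0]
  · simp only [mul_comm (Real.cos _) (Real.sin _)]; ring
  all_goals exact Continuous.intervalIntegrable (by fun_prop) _ _

/-- Half of the exponential absorbs the power of sinh; the other half is integrable because sinh s ≥
s. -/
theorem integrableOn_sinh_pow_mul_exp (n : ℕ) {z : ℝ} (hz : 0 < z) :
    IntegrableOn (fun s => Real.sinh s ^ n * Real.exp (-z * Real.sinh s)) (Ioi 0) := by
  obtain ⟨C, hC⟩ : ∃ C : ℝ, ∀ x : ℝ, 0 ≤ x → x ^ n * Real.exp (-(z / 2) * x) ≤ C := by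
    -- The constant comes from yⁿ/n! ≤ e^y at y = zx/2.
    refine ⟨n.factorial / (z / 2) ^ n, fun x hx => ?_⟩
    have h1 := Real.pow_div_factorial_le_exp (x := z / 2 * x) (by positivity) n
    have h2 : Real.exp (-(z / 2) * x) = (Real.exp (z / 2 * x))⁻¹ := by
      rw [← Real.exp_neg]; congr 1; ring
    rw [h2, ← div_eq_mul_inv, div_le_div_iff₀ (Real.exp_pos _) (by positivity)]
    rw [div_le_iff₀ (by positivity), mul_pow] at h1
    linarith
  have hint : IntegrableOn (fun s => C * Real.exp (-(z / 2) * s)) (Ioi 0) :=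
    (exp_neg_integrableOn_Ioi 0 (by positivity)).const_mul C
  refine Integrable.mono' hint (Continuous.aestronglyMeasurable (by fun_prop)) ?_
  refine (ae_restrict_mem measurableSet_Ioi).mono fun s hs => ?_
  have hs : 0 < s := hs
  have hsh : s ≤ Real.sinh s := Real.self_le_sinh_iff.2 hs.le
  have h0 : 0 ≤ Real.sinh s := hs.le.trans hsh
  rw [Real.norm_of_nonneg (by positivity)]
  calc _ = Real.sinh s ^ n * Real.exp (-(z / 2) * Real.sinh s) * Real.exp (-(z / 2) * Real.sinh s) := by
        rw [mul_assoc, ← Real.exp_add]; congr 2; ring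
    _ ≤ C * Real.exp (-(z / 2) * s) := by
        have := hC _ h0
        have h3 : Real.exp (-(z / 2) * Real.sinh s) ≤ Real.exp (-(z / 2) * s) :=
          Real.exp_le_exp.2 (by nlinarith)
        have h4 : 0 ≤ Real.sinh s ^ n * Real.exp (-(z / 2) * Real.sinh s) := by positivity
        exact mul_le_mul this h3 (Real.exp_pos _).le (h4.trans this)

theorem hasDerivAt_sinhLaplace (n : ℕ) {z : ℝ} (hz : 0 < z) :
    HasDerivAt (sinhLaplace n) (-sinhLaplace (n + 1) z) z := by
  have h := (hasDerivAt_integral_of_dominated_loc_of_deriv_le (μ := volume.restrict (Ioi (0 : ℝ)))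
    (F := fun z s => Real.sinh s ^ n * Real.exp (-z * Real.sinh s))
    (F' := fun z s => -(Real.sinh s ^ (n + 1) * Real.exp (-z * Real.sinh s)))
    (bound := fun s => Real.sinh s ^ (n + 1) * Real.exp (-(z / 2) * Real.sinh s))
    (x₀ := z) (Ioi_mem_nhds (half_lt_self hz))
    (Eventually.of_forall fun _ => Continuous.aestronglyMeasurable (by fun_prop))
    (integrableOn_sinh_pow_mul_exp n hz) (Continuous.aestronglyMeasurable (by fun_prop))
    ?_ (integrableOn_sinh_pow_mul_exp (n + 1) (half_pos hz)) ?_).2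
  · rw [integral_neg] at h; exact h
  · refine (ae_restrict_mem measurableSet_Ioi).mono fun s hs x hx => ?_
    have h0 : 0 < Real.sinh s := Real.sinh_pos_iff.2 hs
    have hx : z / 2 < x := hx
    rw [norm_neg, Real.norm_of_nonneg (by positivity)]
    gcongr
  · refine Eventually.of_forall fun s x _ => ?_
    have : HasDerivAt (fun x : ℝ => Real.sinh s ^ n * Real.exp (-x * Real.sinh s))
        (Real.sinh s ^ n * (Real.exp (-x * Real.sinh s) * (-1 * Real.sinh s))) x :=
      ((((hasDerivAt_id x).neg).mul_const _).exp).const_mul _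
    refine HasDerivAt.congr_deriv this ?_
    ring

theorem tendsto_cosh_mul_exp {z : ℝ} (hz : 0 < z) :
    Tendsto (fun s => Real.cosh s * Real.exp (-z * Real.sinh s)) atTop (𝓝 0) := by
  have hsinh : Tendsto Real.sinh atTop atTop :=
    tendsto_atTop_mono' _ ((eventually_ge_atTop 0).mono fun s hs => Real.self_le_sinh_iff.2 hs)
      tendsto_id
  have h1 : Tendsto (fun x : ℝ => (1 + x) * Real.exp (-z * x)) atTop (𝓝 0) := by
    have h0 : Tendsto (fun x : ℝ => Real.exp (-z * x)) atTop (𝓝 0) := by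
      have := Real.tendsto_exp_neg_atTop_nhds_zero.comp (tendsto_id.const_mul_atTop hz)
      refine this.congr fun x => ?_
      simp
    have h2 := tendsto_rpow_mul_exp_neg_mul_atTop_nhds_zero 1 z hz
    simp only [Real.rpow_one] at h2
    simpa [add_mul] using h0.add h2
  refine squeeze_zero' (Eventually.of_forall fun s => by positivity) ?_ (h1.comp hsinh)
  filter_upwards [eventually_ge_atTop 0] with s hs
  have : Real.cosh s ≤ 1 + Real.sinh s := by
    have := Real.cosh_sub_sinh s
    have h3 : Real.exp (-s) ≤ 1 := Real.exp_le_one_iff.2 (by linarith)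
    linarith
  simp only [Function.comp]
  gcongr

/-- The left side is the integral of the derivative of cosh s · e^{-z sinh s}, so only the boundary
value at s = 0 remains. This inhomogeneous term is needed in the recurrence for `besselY1`. -/
theorem sinhLaplace_relation {z : ℝ} (hz : 0 < z) :
    sinhLaplace 1 z - z * (sinhLaplace 0 z + sinhLaplace 2 z) = -1 := by
  have i0 := integrableOn_sinh_pow_mul_exp 0 hz
  have i1 := integrableOn_sinh_pow_mul_exp 1 hz
  have i2 := integrableOn_sinh_pow_mul_exp 2 hz
  have i02 : IntegrableOn (fun s => z * (Real.sinh s ^ 0 * Real.exp (-z * Real.sinh s) +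
      Real.sinh s ^ 2 * Real.exp (-z * Real.sinh s))) (Ioi 0) := by
    have i3 : IntegrableOn (fun s => Real.sinh s ^ 0 * Real.exp (-z * Real.sinh s) +
      Real.sinh s ^ 2 * Real.exp (-z * Real.sinh s)) (Ioi 0) := i0.add i2
    exact Integrable.const_mul i3 z
  have h := integral_Ioi_of_hasDerivAt_of_tendsto' (a := 0)
    (f := fun s => Real.cosh s * Real.exp (-z * Real.sinh s))
    (f' := fun s => Real.sinh s ^ 1 * Real.exp (-z * Real.sinh s) -
      z * (Real.sinh s ^ 0 * Real.exp (-z * Real.sinh s) +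
        Real.sinh s ^ 2 * Real.exp (-z * Real.sinh s))) (m := 0)
    (fun s _ => ?_) (i1.sub i02) (tendsto_cosh_mul_exp hz)
  · have e : (∫ s in Ioi (0 : ℝ), (Real.sinh s ^ 1 * Real.exp (-z * Real.sinh s) -
        z * (Real.sinh s ^ 0 * Real.exp (-z * Real.sinh s) +
        Real.sinh s ^ 2 * Real.exp (-z * Real.sinh s)))) =
        sinhLaplace 1 z - z * (sinhLaplace 0 z + sinhLaplace 2 z) := by
      rw [integral_sub i1 i02, integral_const_mul, integral_add i0 i2]
      rfl
    rw [← e, h]; simp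
  · have := (Real.hasDerivAt_cosh s).mul (((Real.hasDerivAt_sinh s).const_mul (-z)).exp)
    refine HasDerivAt.congr_deriv this ?_
    have := Real.cosh_sq s
    linear_combination (-z * Real.exp (-z * Real.sinh s)) * this

/-- Since sinh s + e^{-s} = cosh s, the integrand times z is the exact derivative of -e^{-z sinh s}.
The identity supplies the behaviour of the `sinhLaplace` integrals as z → 0 without any asymptotic
expansion. -/
theorem integral_cosh_mul_exp {z : ℝ} (hz : 0 < z) :
    z * (sinhLaplace 1 z + ∫ s in Ioi (0 : ℝ), Real.exp (-s) * Real.exp (-z * Real.sinh s)) = 1 := by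
  have i1 := integrableOn_sinh_pow_mul_exp 1 hz
  have i2 : IntegrableOn (fun s => Real.exp (-s) * Real.exp (-z * Real.sinh s)) (Ioi 0) := by
    refine Integrable.mono' (integrableOn_sinh_pow_mul_exp 0 hz)
      (Continuous.aestronglyMeasurable (by fun_prop)) ?_
    refine (ae_restrict_mem measurableSet_Ioi).mono fun s (hs : 0 < s) => ?_
    rw [Real.norm_of_nonneg (by positivity), pow_zero]
    gcongr
    exact Real.exp_le_one_iff.2 (by linarith)
  have i12 : IntegrableOn (fun s => Real.sinh s ^ 1 * Real.exp (-z * Real.sinh s) +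
      Real.exp (-s) * Real.exp (-z * Real.sinh s)) (Ioi 0) := i1.add i2
  have hlim : Tendsto (fun s => -Real.exp (-z * Real.sinh s)) atTop (𝓝 (-0)) := by
    refine Tendsto.neg (squeeze_zero (fun s => (Real.exp_pos _).le) (fun s => ?_)
      (tendsto_cosh_mul_exp hz))
    have := Real.one_le_cosh s
    have h := Real.exp_pos (-z * Real.sinh s)
    nlinarith
  have h := integral_Ioi_of_hasDerivAt_of_tendsto' (a := 0)
    (f := fun s => -Real.exp (-z * Real.sinh s))
    (f' := fun s => z * (Real.sinh s ^ 1 * Real.exp (-z * Real.sinh s) +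
      Real.exp (-s) * Real.exp (-z * Real.sinh s))) (m := -0)
    (fun s _ => ?_) (Integrable.const_mul i12 z) hlim
  · rw [integral_const_mul, integral_add i1 i2] at h
    simpa [sinhLaplace] using h
  · have := (((Real.hasDerivAt_sinh s).const_mul (-z)).exp).neg
    refine HasDerivAt.congr_deriv this ?_
    rw [← Real.cosh_sub_sinh s]; ring

/-- Differentiation under the integral sign for `∫₀^π g(θ) h(z sin θ) dθ`. -/
theorem hasDerivAt_integral_trig {g h h' : ℝ → ℝ} (hg : Continuous g)
    (hh : ∀ x, HasDerivAt h (h' x) x) (hh' : Continuous h') (hb : ∀ x, |h' x| ≤ 1) (z : ℝ) :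
    HasDerivAt (fun z => ∫ θ in (0 : ℝ)..Real.pi, g θ * h (z * Real.sin θ))
      (∫ θ in (0 : ℝ)..Real.pi, g θ * Real.sin θ * h' (z * Real.sin θ)) z := by
  have hc : Continuous h := continuous_iff_continuousAt.2 fun x => (hh x).continuousAt
  refine (intervalIntegral.hasDerivAt_integral_of_dominated_loc_of_deriv_le
    (F := fun z θ => g θ * h (z * Real.sin θ))
    (F' := fun z θ => g θ * Real.sin θ * h' (z * Real.sin θ))
    (bound := fun θ => |g θ|) (s := univ) univ_mem
    (Eventually.of_forall fun z => Continuous.aestronglyMeasurable (by fun_prop))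
    (Continuous.intervalIntegrable (by fun_prop) _ _)
    (Continuous.aestronglyMeasurable (by fun_prop)) ?_
    (Continuous.intervalIntegrable (by fun_prop) _ _) ?_).2
  · refine Eventually.of_forall fun θ _ x _ => ?_
    rw [norm_mul, norm_mul, Real.norm_eq_abs, Real.norm_eq_abs, Real.norm_eq_abs, mul_assoc]
    exact mul_le_of_le_one_right (abs_nonneg _)
      (mul_le_one₀ (Real.abs_sin_le_one θ) (abs_nonneg _) (hb _))
  · refine Eventually.of_forall fun θ _ x _ => ?_
    have := ((hh (x * Real.sin θ)).comp x ((hasDerivAt_id x).mul_const (Real.sin θ))).const_mul (g θ)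
    refine HasDerivAt.congr_deriv this ?_
    simp; ring

theorem hasDerivAt_besselJ0 (z : ℝ) : HasDerivAt besselJ0 (-besselJ1 z) z := by
  have h := (hasDerivAt_integral_trig (g := fun _ => 1) continuous_const Real.hasDerivAt_cos
    (by fun_prop) (fun x => by simpa using Real.abs_sin_le_one x) z).const_mul (1 / Real.pi)
  simp only [one_mul] at h
  refine HasDerivAt.congr_deriv h ?_
  rw [besselJ1_eq, ← mul_neg, ← intervalIntegral.integral_neg]
  simp

theorem hasDerivAt_besselJ1 {z : ℝ} (hz : z ≠ 0) :
    HasDerivAt besselJ1 (besselJ0 z - besselJ1 z / z) z := by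
  have h := (hasDerivAt_integral_trig (g := Real.sin) (by fun_prop) Real.hasDerivAt_sin
    (by fun_prop) Real.abs_cos_le_one z).const_mul (1 / Real.pi)
  have e : besselJ1 = fun z =>
      (1 / Real.pi) * ∫ θ in (0 : ℝ)..Real.pi, Real.sin θ * Real.sin (z * Real.sin θ) :=
    funext besselJ1_eq
  rw [e]
  refine HasDerivAt.congr_deriv h ?_
  -- The integrand is the θ-derivative of cos θ sin(z sin θ), which vanishes at both ends.
  have key : ∫ θ in (0 : ℝ)..Real.pi, (z * Real.cos (z * Real.sin θ) -
      z * (Real.sin θ * Real.sin θ * Real.cos (z * Real.sin θ)) -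
        Real.sin θ * Real.sin (z * Real.sin θ)) = 0 := by
    rw [intervalIntegral.integral_eq_sub_of_hasDerivAt
      (f := fun θ => Real.cos θ * Real.sin (z * Real.sin θ))]
    · simp
    · intro θ _
      have := (Real.hasDerivAt_cos θ).mul (((Real.hasDerivAt_sin θ).const_mul z).sin)
      refine HasDerivAt.congr_deriv this ?_
      linear_combination (z * Real.cos (z * Real.sin θ)) * Real.sin_sq_add_cos_sq θ
    · exact Continuous.intervalIntegrable (by fun_prop) _ _
  rw [intervalIntegral.integral_sub, intervalIntegral.integral_sub,
    intervalIntegral.integral_const_mul, intervalIntegral.integral_const_mul] at key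
  · unfold besselJ0
    have hpi := Real.pi_ne_zero
    generalize (∫ θ in (0 : ℝ)..Real.pi, Real.sin θ * Real.sin θ * Real.cos (z * Real.sin θ)) = a at *
    field_simp
    linear_combination -key
  all_goals exact Continuous.intervalIntegrable (by fun_prop) _ _

theorem hasDerivAt_besselY0 {z : ℝ} (hz : 0 < z) : HasDerivAt besselY0 (-besselY1 z) z := by
  have h := ((hasDerivAt_integral_trig (g := fun _ => 1) continuous_const Real.hasDerivAt_sin
    (by fun_prop) Real.abs_cos_le_one z).const_mul (1 / Real.pi)).sub
      ((hasDerivAt_sinhLaplace 0 hz).const_mul (2 / Real.pi))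
  simp only [one_mul] at h
  refine HasDerivAt.congr_deriv h ?_
  rw [besselY1_eq]
  ring

theorem hasDerivAt_besselY1 {z : ℝ} (hz : 0 < z) :
    HasDerivAt besselY1 (besselY0 z - besselY1 z / z) z := by
  have h := ((hasDerivAt_integral_trig (g := Real.sin) (by fun_prop) Real.hasDerivAt_cos
    (by fun_prop) (fun x => by simpa using Real.abs_sin_le_one x) z).const_mul (-(1 / Real.pi))).sub
      ((hasDerivAt_sinhLaplace 1 hz).const_mul (2 / Real.pi))
  have e : besselY1 = fun z =>
      -(1 / Real.pi) * (∫ θ in (0 : ℝ)..Real.pi, Real.sin θ * Real.cos (z * Real.sin θ))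
        - (2 / Real.pi) * sinhLaplace 1 z := funext besselY1_eq
  rw [e]
  refine HasDerivAt.congr_deriv h ?_
  -- Unlike for J₁ the boundary term is not zero; its value 2 cancels against twice the -1 in
  -- `sinhLaplace_relation`.
  have key : ∫ θ in (0 : ℝ)..Real.pi, (z * Real.sin (z * Real.sin θ) +
      z * (Real.sin θ * Real.sin θ * -Real.sin (z * Real.sin θ)) +
        Real.sin θ * Real.cos (z * Real.sin θ)) = 2 := by
    rw [intervalIntegral.integral_eq_sub_of_hasDerivAt
      (f := fun θ => -(Real.cos θ * Real.cos (z * Real.sin θ)))]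
    · simp; norm_num
    · intro θ _
      have := ((Real.hasDerivAt_cos θ).mul (((Real.hasDerivAt_sin θ).const_mul z).cos)).neg
      refine HasDerivAt.congr_deriv this ?_
      linear_combination (z * Real.sin (z * Real.sin θ)) * Real.sin_sq_add_cos_sq θ
    · exact Continuous.intervalIntegrable (by fun_prop) _ _
  rw [intervalIntegral.integral_add, intervalIntegral.integral_add,
    intervalIntegral.integral_const_mul, intervalIntegral.integral_const_mul] at key
  · unfold besselY0
    have hpi := Real.pi_ne_zero
    have := sinhLaplace_relation hz
    rw [show 1 + 1 = 2 from rfl]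
    generalize (∫ θ in (0 : ℝ)..Real.pi, Real.sin θ * Real.sin θ * -Real.sin (z * Real.sin θ)) = a at *
    field_simp
    linear_combination -key - 2 * this
  all_goals exact Continuous.intervalIntegrable (by fun_prop) _ _

theorem abs_integral_zero_pi_le {f : ℝ → ℝ} {C : ℝ} (h : ∀ θ, |f θ| ≤ C) :
    |(1 / Real.pi) * ∫ θ in (0 : ℝ)..Real.pi, f θ| ≤ C := by
  have hpi := Real.pi_pos
  have := intervalIntegral.norm_integral_le_of_norm_le_const (a := 0) (b := Real.pi) (f := f)
    (C := C) fun θ _ => h θ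
  rw [abs_mul, abs_of_pos (by positivity), div_mul_eq_mul_div, one_mul, div_le_iff₀ hpi]
  simpa [abs_of_pos hpi] using this

theorem abs_besselJ0_le (z : ℝ) : |besselJ0 z| ≤ 1 :=
  abs_integral_zero_pi_le fun _ => Real.abs_cos_le_one _

theorem abs_besselJ1_le {z : ℝ} (hz : 0 ≤ z) : |besselJ1 z| ≤ z := by
  rw [besselJ1_eq]
  refine abs_integral_zero_pi_le fun θ => ?_
  rw [abs_mul]
  calc |Real.sin θ| * |Real.sin (z * Real.sin θ)| ≤ 1 * |z * Real.sin θ| :=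
        mul_le_mul (Real.abs_sin_le_one _) (Real.abs_sin_le_abs) (abs_nonneg _) zero_le_one
    _ ≤ z := by
        rw [one_mul, abs_mul, abs_of_nonneg hz]
        exact mul_le_of_le_one_right hz (Real.abs_sin_le_one θ)

theorem sinhLaplace_zero_le {z : ℝ} (hz : 0 < z) :
    0 ≤ sinhLaplace 0 z ∧ z * sinhLaplace 0 z ≤ 1 := by
  have hn : ∀ n, 0 ≤ sinhLaplace n z := fun n => setIntegral_nonneg measurableSet_Ioi
    fun s (hs : 0 < s) => by have := Real.sinh_pos_iff.2 hs; positivity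
  refine ⟨hn 0, ?_⟩
  have i0 := integrableOn_sinh_pow_mul_exp 0 hz
  have i1 := integrableOn_sinh_pow_mul_exp 1 hz
  rw [← integral_cosh_mul_exp hz]
  refine mul_le_mul_of_nonneg_left ?_ hz.le
  have i2 : IntegrableOn (fun s => Real.exp (-s) * Real.exp (-z * Real.sinh s)) (Ioi 0) := by
    refine Integrable.mono' i0 (Continuous.aestronglyMeasurable (by fun_prop)) ?_
    refine (ae_restrict_mem measurableSet_Ioi).mono fun s (hs : 0 < s) => ?_
    rw [Real.norm_of_nonneg (by positivity), pow_zero]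
    gcongr
    exact Real.exp_le_one_iff.2 (by linarith)
  unfold sinhLaplace
  rw [← integral_add i1 i2]
  refine setIntegral_mono_on i0 (i1.add i2) measurableSet_Ioi fun s (hs : 0 < s) => ?_
  have := Real.cosh_sub_sinh s
  have h1 := Real.one_le_cosh s
  have h2 := Real.exp_pos (-z * Real.sinh s)
  simp only [pow_zero, pow_one]
  nlinarith

theorem abs_one_sub_mul_sinhLaplace_one_le {z : ℝ} (hz : 0 < z) :
    |1 - z * sinhLaplace 1 z| ≤ z := by
  have h := integral_cosh_mul_exp hz
  have h1 : (∫ s in Ioi (0 : ℝ), Real.exp (-s) * Real.exp (-z * Real.sinh s)) ≤ 1 := by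
    rw [← integral_exp_neg_Ioi_zero]
    refine integral_mono_of_nonneg (Eventually.of_forall fun s => by positivity)
      (by simpa [IntegrableOn] using exp_neg_integrableOn_Ioi 0 one_pos) ?_
    refine (ae_restrict_mem measurableSet_Ioi).mono fun s (hs : 0 < s) => ?_
    have := Real.sinh_pos_iff.2 hs
    exact mul_le_of_le_one_right (Real.exp_pos _).le (Real.exp_le_one_iff.2 (by nlinarith))
  have h2 : 0 ≤ (∫ s in Ioi (0 : ℝ), Real.exp (-s) * Real.exp (-z * Real.sinh s)) :=
    integral_nonneg fun s => by positivity
  rw [show 1 - z * sinhLaplace 1 z =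
    z * (∫ s in Ioi (0 : ℝ), Real.exp (-s) * Real.exp (-z * Real.sinh s)) by linarith,
    abs_of_nonneg (by positivity)]
  nlinarith

/-! ### The Wronskian and the boundedness of the kernel 𝒢 -/

theorem eqOn_const_of_hasDerivAt_zero {f : ℝ → ℝ} (h : ∀ z, 0 < z → HasDerivAt f 0 z) {a b : ℝ}
    (ha : 0 < a) (hb : 0 < b) : f a = f b :=
  (convex_Ioi (0 : ℝ)).is_const_of_fderivWithin_eq_zero (𝕜 := ℝ)
    (fun z hz => (h z hz).differentiableAt.differentiableWithinAt)
    (fun z hz => by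
      rw [fderivWithin_of_isOpen isOpen_Ioi hz]
      ext; simp [(h z hz).deriv]) ha hb

/-- The recurrences make the expression constant on z > 0, so it equals its limit at 0⁺. There J₀ →
1 and z Y₁ → -2/π, while z J₁ Y₀ → 0 because |J₁| ≤ z beats the singularity of Y₀. -/
theorem bessel_wronskian {z : ℝ} (hz : 0 < z) :
    z * (besselJ1 z * besselY0 z - besselJ0 z * besselY1 z) = 2 / Real.pi := by
  set W : ℝ → ℝ := fun z => z * (besselJ1 z * besselY0 z - besselJ0 z * besselY1 z) with hW
  have hd : ∀ z, 0 < z → HasDerivAt W 0 z := fun z hz => by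
    have := (hasDerivAt_id z).mul (((hasDerivAt_besselJ1 hz.ne').mul (hasDerivAt_besselY0 hz)).sub
      ((hasDerivAt_besselJ0 z).mul (hasDerivAt_besselY1 hz)))
    refine HasDerivAt.congr_deriv this ?_
    have := hz.ne'
    simp only [id, Pi.sub_apply, Pi.mul_apply]
    field_simp
    ring
  have hlim : Tendsto W (𝓝[>] 0) (𝓝 (2 / Real.pi)) := by
    have hid : Tendsto (fun z : ℝ => z) (𝓝[>] 0) (𝓝 0) := tendsto_nhdsWithin_of_tendsto_nhds tendsto_id
    have hJ0 : Tendsto besselJ0 (𝓝[>] 0) (𝓝 1) := by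
      have := ((hasDerivAt_besselJ0 0).continuousAt.tendsto).mono_left
        (nhdsWithin_le_nhds (s := Ioi 0))
      simpa [besselJ0, Real.pi_ne_zero] using this
    have hfirst : Tendsto (fun z => z * besselJ1 z * besselY0 z) (𝓝[>] 0) (𝓝 0) := by
      have hg : Tendsto (fun z : ℝ => z * z + z) (𝓝[>] 0) (𝓝 0) := by
        simpa using (hid.mul hid).add hid
      refine squeeze_zero_norm' ?_ hg
      filter_upwards [self_mem_nhdsWithin] with z hz
      have hz : 0 < z := hz
      have h1 := abs_besselJ1_le hz.le
      have h3 := sinhLaplace_zero_le hz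
      have h2 : |besselY0 z| ≤ 1 + sinhLaplace 0 z := by
        unfold besselY0
        refine (abs_sub _ _).trans (add_le_add (abs_integral_zero_pi_le fun _ =>
          Real.abs_sin_le_one _) ?_)
        rw [abs_mul, abs_of_nonneg h3.1, abs_of_pos (by have := Real.pi_pos; positivity)]
        refine mul_le_of_le_one_left h3.1 ?_
        rw [div_le_one Real.pi_pos]
        exact Real.two_le_pi
      rw [Real.norm_eq_abs, abs_mul, abs_mul, abs_of_pos hz]
      calc z * |besselJ1 z| * |besselY0 z| ≤ z * z * (1 + sinhLaplace 0 z) := by gcongr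
        _ = z * z + z * (z * sinhLaplace 0 z) := by ring
        _ ≤ z * z + z := by nlinarith
    have hK : Tendsto (fun z => z * sinhLaplace 1 z) (𝓝[>] 0) (𝓝 1) := by
      have : Tendsto (fun z => 1 - z * sinhLaplace 1 z) (𝓝[>] 0) (𝓝 0) := by
        refine squeeze_zero_norm' ?_ hid
        filter_upwards [self_mem_nhdsWithin] with z hz
        exact abs_one_sub_mul_sinhLaplace_one_le hz
      simpa using (this.const_sub 1)
    have hY : Tendsto (fun z => z * besselY1 z) (𝓝[>] 0) (𝓝 (-(2 / Real.pi))) := by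
      have hb : Tendsto (fun z => z * ((1 / Real.pi) *
          ∫ θ in (0 : ℝ)..Real.pi, Real.sin θ * Real.cos (z * Real.sin θ))) (𝓝[>] 0) (𝓝 0) := by
        refine squeeze_zero_norm' ?_ hid
        filter_upwards [self_mem_nhdsWithin] with z hz
        have hz : 0 < z := hz
        rw [norm_mul, Real.norm_of_nonneg hz.le]
        refine mul_le_of_le_one_right hz.le (abs_integral_zero_pi_le fun θ => ?_)
        rw [abs_mul]
        exact mul_le_one₀ (Real.abs_sin_le_one _) (abs_nonneg _) (Real.abs_cos_le_one _)
      have := hb.neg.sub (hK.const_mul (2 / Real.pi))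
      simp only [neg_zero, mul_one, zero_sub] at this
      refine this.congr fun z => ?_
      rw [besselY1_eq]; ring
    have := hfirst.sub (hJ0.mul hY)
    simp only [zero_sub, one_mul, neg_neg] at this
    refine this.congr fun z => ?_
    simp only [hW]; ring
  have hconst : ∀ᶠ y in 𝓝[>] (0 : ℝ), W y = W z := by
    filter_upwards [self_mem_nhdsWithin] with y hy
    exact eqOn_const_of_hasDerivAt_zero hd hy hz
  exact tendsto_nhds_unique ((tendsto_const_nhds (x := W z)).congr' (hconst.mono fun _ h => h.symm)) hlim

/-- The companion kernel `z' (-J₀(z) Y₁(z') + Y₀(z) J₁(z'))`. -/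
def kernelG0 (z z' : ℝ) : ℝ :=
  z' * (-besselJ0 z * besselY1 z' + besselY0 z * besselJ1 z')

/-- For fixed z' the pair (𝒢, 𝒢₀) inherits from (J₁, J₀) and (Y₁, Y₀) the first-order system 𝒢' = 𝒢₀
- 𝒢/z, 𝒢₀' = -𝒢. The rotation part conserves 𝒢² + 𝒢₀² and the remaining term is damping. -/
theorem hasDerivAt_kernelG {z : ℝ} (z' : ℝ) (hz : 0 < z) :
    HasDerivAt (fun z => kernelG z z') (kernelG0 z z' - kernelG z z' / z) z := by
  have := (((hasDerivAt_besselJ1 hz.ne').neg.mul_const (besselY1 z')).add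
    ((hasDerivAt_besselY1 hz).mul_const (besselJ1 z'))).const_mul z'
  refine HasDerivAt.congr_deriv this ?_
  unfold kernelG kernelG0
  ring

theorem hasDerivAt_kernelG0 {z : ℝ} (z' : ℝ) (hz : 0 < z) :
    HasDerivAt (fun z => kernelG0 z z') (-kernelG z z') z := by
  have := (((hasDerivAt_besselJ0 z).neg.mul_const (besselY1 z')).add
    ((hasDerivAt_besselY0 hz).mul_const (besselJ1 z'))).const_mul z'
  refine HasDerivAt.congr_deriv this ?_
  unfold kernelG
  ring

theorem kernelG_self (z : ℝ) : kernelG z z = 0 := by simp only [kernelG]; ring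

theorem kernelG0_self {z : ℝ} (hz : 0 < z) : kernelG0 z z = 2 / Real.pi := by
  rw [← bessel_wronskian hz, kernelG0]; ring

/-- The energy 𝒢² + 𝒢₀² has derivative -2𝒢²/z ≤ 0 in z, and on the diagonal it is (2/π)² by the
Wronskian. -/
theorem kernelG_sq_add_sq_le {z z' : ℝ} (hz' : 0 < z') (hz : z' ≤ z) :
    kernelG z z' ^ 2 + kernelG0 z z' ^ 2 ≤ (2 / Real.pi) ^ 2 := by
  have hd : ∀ y, 0 < y → HasDerivAt (fun y => kernelG y z' ^ 2 + kernelG0 y z' ^ 2)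
      (-2 * kernelG y z' ^ 2 / y) y := fun y hy => by
    have := ((hasDerivAt_kernelG z' hy).pow 2).add ((hasDerivAt_kernelG0 z' hy).pow 2)
    refine HasDerivAt.congr_deriv this ?_
    have := hy.ne'
    field_simp
    ring
  have hanti : AntitoneOn (fun y => kernelG y z' ^ 2 + kernelG0 y z' ^ 2) (Ioi 0) := by
    refine antitoneOn_of_deriv_nonpos (convex_Ioi 0)
      (fun y hy => (hd y hy).continuousAt.continuousWithinAt)
      (fun y hy => ?_) (fun y hy => ?_)
    · rw [interior_Ioi] at hy
      exact (hd y hy).differentiableAt.differentiableWithinAt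
    · rw [interior_Ioi] at hy
      rw [(hd y hy).deriv]
      have hy : 0 < y := hy
      exact div_nonpos_of_nonpos_of_nonneg (by nlinarith [sq_nonneg (kernelG y z')]) hy.le
  have := hanti (show z' ∈ Ioi (0 : ℝ) from hz') (show z ∈ Ioi (0 : ℝ) from hz'.trans_le hz) hz
  simpa [kernelG_self, kernelG0_self hz'] using this

theorem abs_kernelG_le_two_div_pi {z z' : ℝ} (hz' : 0 < z') (hz : z' ≤ z) :
    |kernelG z z'| ≤ 2 / Real.pi :=
  abs_le_of_sq_le_sq (by nlinarith [kernelG_sq_add_sq_le hz' hz, sq_nonneg (kernelG0 z z')])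
    (by have := Real.pi_pos; positivity)

theorem abs_kernelG0_le_two_div_pi {z z' : ℝ} (hz' : 0 < z') (hz : z' ≤ z) :
    |kernelG0 z z'| ≤ 2 / Real.pi :=
  abs_le_of_sq_le_sq (by nlinarith [kernelG_sq_add_sq_le hz' hz, sq_nonneg (kernelG z z')])
    (by have := Real.pi_pos; positivity)

theorem abs_kernelG_le_supG {z z' : ℝ} (hz' : 0 < z') (hz : z' ≤ z) : |kernelG z z'| ≤ supG :=
  -- Boundedness above is what makes `supG` a true supremum instead of the default value 0 of
  -- `sSup`.
  le_csSup ⟨2 / Real.pi, by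
    rintro _ ⟨z, z', h1, h2, rfl⟩
    exact abs_kernelG_le_two_div_pi h1 h2⟩ ⟨z, z', hz', hz, rfl⟩

theorem supG_nonneg : 0 ≤ supG :=
  (abs_nonneg _).trans (abs_kernelG_le_supG one_pos le_rfl)

theorem measurable_besselJ1 : Measurable besselJ1 := by
  have h : Continuous fun z : ℝ => ∫ θ in (0 : ℝ)..Real.pi, Real.cos (θ - z * Real.sin θ) :=
    intervalIntegral.continuous_parametric_intervalIntegral_of_continuous' (by fun_prop) _ _
  exact (h.measurable.const_mul _)

theorem measurable_besselY1 : Measurable besselY1 := by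
  have h1 : Continuous fun z : ℝ => ∫ θ in (0 : ℝ)..Real.pi, Real.sin (z * Real.sin θ - θ) :=
    intervalIntegral.continuous_parametric_intervalIntegral_of_continuous' (by fun_prop) _ _
  have h2 : StronglyMeasurable fun z : ℝ =>
      ∫ s in Ioi (0 : ℝ), Real.sinh s * Real.exp (-z * Real.sinh s) := by
    refine StronglyMeasurable.integral_prod_right
      (f := fun z s : ℝ => Real.sinh s * Real.exp (-z * Real.sinh s))
      (Continuous.stronglyMeasurable (by fun_prop))
  exact (h1.measurable.const_mul _).sub (h2.measurable.const_mul _)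

end

end NSBorel

namespace NSBorel
open MeasureTheory Set Filter Topology

/-! ### Weights -/

noncomputable section

theorem weight_pos (μ β : ℝ) (k : E3) : 0 < weight μ β k := by
  unfold weight; positivity

theorem weight_add_one (μ β : ℝ) (k : E3) : weight (μ + 1) β k = weight μ β k * (1 + ‖k‖) := by
  unfold weight
  rw [Real.rpow_add_one (by positivity)]; ring

theorem weight_add_two (μ β : ℝ) (k : E3) : weight (μ + 2) β k = weight μ β k * (1 + ‖k‖) ^ 2 := by
  rw [show μ + 2 = μ + 1 + 1 by ring, weight_add_one, weight_add_one]; ring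

theorem continuous_weight (μ β : ℝ) : Continuous (weight μ β) := by
  unfold weight
  refine Continuous.mul (Continuous.rpow_const (by fun_prop) fun k => Or.inl ?_) (by fun_prop)
  positivity

theorem rpow_neg_le_weight {μ β : ℝ} (hβ : 0 ≤ β) (k : E3) :
    (weight μ β k)⁻¹ ≤ (1 + ‖k‖) ^ (-μ) := by
  rw [Real.rpow_neg (by positivity)]
  refine inv_anti₀ (by positivity) ?_
  unfold weight
  exact le_mul_of_one_le_right (by positivity) (Real.one_le_exp (by positivity))

theorem weight_zero_le {μ β : ℝ} (hβ : 0 ≤ β) (k : E3) : weight μ 0 k ≤ weight μ β k := by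
  unfold weight
  gcongr

theorem nonneg_of_norm_le_div_weight {μ β C : ℝ} {g : E3 → C3}
    (h : ∀ k, ‖g k‖ ≤ C / weight μ β k) : 0 ≤ C := by
  have := (norm_nonneg _).trans (h 0)
  by_contra hc
  exact absurd this (not_le.2 (div_neg_of_neg_of_pos (not_le.1 hc) (weight_pos _ _ 0)))

theorem integrable_one_add_norm_rpow {μ : ℝ} (hμ : 3 < μ) :
    Integrable fun k : E3 => (1 + ‖k‖) ^ (-μ) :=
  integrable_one_add_norm (by simpa using hμ)

/-- Polar coordinates reduce this to a radial integral. Multiplied by 2^{μ+2} the value is `constC0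
μ`. -/
theorem integral_one_add_norm_rpow {μ : ℝ} (hμ : 3 < μ) :
    ∫ k : E3, (1 + ‖k‖) ^ (-μ) = 8 * Real.pi / ((μ - 1) * (μ - 2) * (μ - 3)) := by
  have h := integral_fun_norm_addHaar (volume : Measure E3) fun r : ℝ => (1 + r) ^ (-μ)
  have hvol : (volume : Measure E3).real (Metric.ball 0 1) = Real.pi * 4 / 3 := by
    rw [Measure.real, EuclideanSpace.volume_ball_fin_three]
    simp only [ENNReal.ofReal_one, one_pow, one_mul]
    exact ENNReal.toReal_ofReal (by have := Real.pi_pos; positivity)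
  rw [hvol] at h
  simp only [finrank_euclideanSpace, Fintype.card_fin, smul_eq_mul, nsmul_eq_mul] at h
  have hj : ∀ a : ℝ, a < -1 → IntegrableOn (fun y : ℝ => (1 + y) ^ a) (Ioi 0) ∧
      ∫ y in Ioi (0 : ℝ), (1 + y) ^ a = -1 / (a + 1) := fun a ha => by
    have hmp : MeasurePreserving (fun y : ℝ => 1 + y) volume volume := measurePreserving_add_left _ 1
    have hme : MeasurableEmbedding (fun y : ℝ => 1 + y) := measurableEmbedding_addLeft 1
    have hpre : (fun y : ℝ => 1 + y) ⁻¹' (Ioi 1) = Ioi 0 := by ext; simp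
    constructor
    · have := (hmp.integrableOn_comp_preimage hme (f := fun y : ℝ => y ^ a) (s := Ioi 1)).2
        (integrableOn_Ioi_rpow_of_lt ha one_pos)
      rwa [hpre] at this
    · have := hmp.setIntegral_preimage_emb hme (fun y : ℝ => y ^ a) (Ioi 1)
      rw [hpre] at this
      rw [this, integral_Ioi_rpow_of_lt ha one_pos]
      simp
  -- The Jacobian is expanded as y² = (1+y)² - 2(1+y) + 1, leaving pure powers of 1+y.
  have hexp : ∀ y ∈ Ioi (0 : ℝ), y ^ (3 - 1) * (1 + y) ^ (-μ) =
      (1 + y) ^ (2 - μ) - 2 * (1 + y) ^ (1 - μ) + (1 + y) ^ (-μ) := fun y hy => by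
    have hy : 0 < 1 + y := by have : 0 < y := hy; linarith
    rw [sub_eq_add_neg 2 μ, sub_eq_add_neg 1 μ, Real.rpow_add hy, Real.rpow_add hy]
    norm_num
    ring
  obtain ⟨i2, e2⟩ := hj (2 - μ) (by linarith)
  obtain ⟨i1, e1⟩ := hj (1 - μ) (by linarith)
  obtain ⟨i0, e0⟩ := hj (-μ) (by linarith)
  have i1' : IntegrableOn (fun y : ℝ => 2 * (1 + y) ^ (1 - μ)) (Ioi 0) := Integrable.const_mul i1 2
  have i21 : IntegrableOn (fun y : ℝ => (1 + y) ^ (2 - μ) - 2 * (1 + y) ^ (1 - μ)) (Ioi 0) :=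
    Integrable.sub i2 i1'
  rw [h, setIntegral_congr_fun measurableSet_Ioi hexp, integral_add i21 i0, integral_sub i2 i1',
    integral_const_mul, e2, e1, e0]
  have h1 : μ - 1 ≠ 0 := by linarith
  have h2 : μ - 2 ≠ 0 := by linarith
  have h3 : μ - 3 ≠ 0 := by linarith
  rw [show 2 - μ + 1 = -(μ - 3) by ring, show 1 - μ + 1 = -(μ - 2) by ring,
    show -μ + 1 = -(μ - 1) by ring]
  simp only [div_neg]
  field_simp
  push_cast
  ring

theorem constC0_pos {μ : ℝ} (hμ : 3 < μ) : 0 < constC0 μ := by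
  have h1 : 0 < μ - 1 := by linarith
  have h2 : 0 < μ - 2 := by linarith
  have h3 : 0 < μ - 3 := by linarith
  have := Real.pi_pos
  unfold constC0; positivity

theorem integrable_inv_weight {μ β : ℝ} (hμ : 3 < μ) (hβ : 0 ≤ β) :
    Integrable fun k : E3 => (weight μ β k)⁻¹ := by
  refine (integrable_one_add_norm_rpow hμ).mono'
    ((continuous_weight μ β).inv₀ fun k => (weight_pos μ β k).ne').aestronglyMeasurable
    (Eventually.of_forall fun k => ?_)
  rw [Real.norm_of_nonneg (inv_nonneg.2 (weight_pos _ _ _).le)]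
  exact rpow_neg_le_weight hβ k

/-- One of |q|, |k-q| is at least |k|/2, so 1+|k| is at most twice the corresponding 1+|q| or
1+|k-q|; the exponential factors obey the triangle inequality. This is why the weighted norm is an
algebra norm for convolution. -/
theorem inv_weight_mul_inv_weight_le {μ β : ℝ} (hμ : 0 ≤ μ) (hβ : 0 ≤ β) (k q : E3) :
    (weight μ β q)⁻¹ * (weight μ β (k - q))⁻¹ ≤
      2 ^ μ * (weight μ β k)⁻¹ * ((1 + ‖q‖) ^ (-μ) + (1 + ‖k - q‖) ^ (-μ)) := by
  have htri : ‖k‖ ≤ ‖q‖ + ‖k - q‖ := by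
    simpa using norm_add_le q (k - q)
  have hexp : Real.exp (β * ‖k‖) ≤ Real.exp (β * ‖q‖) * Real.exp (β * ‖k - q‖) := by
    rw [← Real.exp_add, ← mul_add]; gcongr
  have hpow : ∀ a b : ℝ, 0 < a → 0 < b → 1 + ‖k‖ ≤ 2 * a →
      (1 + ‖k‖) ^ μ ≤ 2 ^ μ * a ^ μ := fun a b ha _ h => by
    rw [← Real.mul_rpow zero_le_two ha.le]
    exact Real.rpow_le_rpow (by positivity) h hμ
  have hq : 0 < (1 + ‖q‖) ^ μ := by positivity
  have hkq : 0 < (1 + ‖k - q‖) ^ μ := by positivity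
  have key : (1 + ‖k‖) ^ μ ≤ 2 ^ μ * ((1 + ‖q‖) ^ μ + (1 + ‖k - q‖) ^ μ) := by
    have h2 : (0 : ℝ) < 2 ^ μ := by positivity
    rcases le_total ‖q‖ ‖k - q‖ with h | h
    · have := hpow (1 + ‖k - q‖) 1 (by positivity) one_pos (by linarith)
      nlinarith
    · have := hpow (1 + ‖q‖) 1 (by positivity) one_pos (by linarith)
      nlinarith
  rw [Real.rpow_neg (by positivity), Real.rpow_neg (by positivity)]
  unfold weight
  have hk : 0 < (1 + ‖k‖) ^ μ := by positivity
  generalize (1 + ‖k‖) ^ μ = K at *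
  generalize (1 + ‖q‖) ^ μ = Q at *
  generalize (1 + ‖k - q‖) ^ μ = R at *
  have e1 := Real.exp_pos (β * ‖k‖)
  have e2 := Real.exp_pos (β * ‖q‖)
  have e3 := Real.exp_pos (β * ‖k - q‖)
  generalize Real.exp (β * ‖k‖) = eK at *
  generalize Real.exp (β * ‖q‖) = eQ at *
  generalize Real.exp (β * ‖k - q‖) = eR at *
  have hgoal : (2 : ℝ) ^ μ * (K * eK)⁻¹ * (Q⁻¹ + R⁻¹) = 2 ^ μ * (Q + R) / ((K * eK) * (Q * R)) := by
    field_simp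
    ring
  rw [hgoal, ← mul_inv, inv_eq_one_div, div_le_div_iff₀ (by positivity) (by positivity), one_mul]
  calc K * eK * (Q * R) ≤ (2 ^ μ * (Q + R)) * (eQ * eR) * (Q * R) := by gcongr
    _ = _ := by ring

theorem integrable_weight_conv {μ β : ℝ} (hμ : 3 < μ) (hβ : 0 ≤ β) (k : E3) :
    Integrable fun q : E3 => (weight μ β q)⁻¹ * (weight μ β (k - q))⁻¹ := by
  have hi := integrable_one_add_norm_rpow hμ
  have hi2 : Integrable fun q : E3 => (1 + ‖q‖) ^ (-μ) + (1 + ‖k - q‖) ^ (-μ) :=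
    hi.add (hi.comp_sub_left k)
  refine (hi2.const_mul (2 ^ μ * (weight μ β k)⁻¹)).mono' ?_ (Eventually.of_forall fun q => ?_)
  · have h1 := (continuous_weight μ β).inv₀ fun k => (weight_pos μ β k).ne'
    exact (h1.mul (h1.comp (continuous_const.sub continuous_id))).aestronglyMeasurable
  · have h1 := weight_pos μ β q
    have h2 := weight_pos μ β (k - q)
    rw [Real.norm_of_nonneg (by positivity)]
    exact inv_weight_mul_inv_weight_le (by linarith) hβ k q

/-- Each of the two terms of the pointwise bound contributes 2^μ ∫(1+|q|)^{-μ} dq, together half of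
`constC0 μ`. The other factor 2 is reserved for the norm of P_k. -/
theorem integral_weight_conv_le {μ β : ℝ} (hμ : 3 < μ) (hβ : 0 ≤ β) (k : E3) :
    ∫ q : E3, (weight μ β q)⁻¹ * (weight μ β (k - q))⁻¹ ≤ constC0 μ / 2 / weight μ β k := by
  have hi := integrable_one_add_norm_rpow hμ
  have hi' : Integrable fun q : E3 => (1 + ‖k - q‖) ^ (-μ) := hi.comp_sub_left k
  have hi2 : Integrable fun q : E3 => (1 + ‖q‖) ^ (-μ) + (1 + ‖k - q‖) ^ (-μ) := hi.add hi'
  calc _ ≤ ∫ q : E3, 2 ^ μ * (weight μ β k)⁻¹ * ((1 + ‖q‖) ^ (-μ) + (1 + ‖k - q‖) ^ (-μ)) :=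
        integral_mono (integrable_weight_conv hμ hβ k) (hi2.const_mul _)
          fun q => inv_weight_mul_inv_weight_le (by linarith) hβ k q
    _ = constC0 μ / 2 / weight μ β k := by
        rw [integral_const_mul, integral_add hi hi',
          integral_sub_left_eq_self (fun q : E3 => (1 + ‖q‖) ^ (-μ)) volume k,
          integral_one_add_norm_rpow hμ, constC0]
        field_simp
        ring

theorem norm_le_of_wnorm_le {μ β C : ℝ} {g : E3 → C3} (hC : 0 ≤ C)
    (h : wnorm μ β g ≤ ENNReal.ofReal C) (k : E3) : ‖g k‖ ≤ C / weight μ β k := by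
  have h1 := (le_iSup (fun k : E3 => ENNReal.ofReal (weight μ β k * ‖g k‖)) k).trans h
  rw [ENNReal.ofReal_le_ofReal_iff hC] at h1
  rw [le_div_iff₀ (weight_pos μ β k), mul_comm]
  exact h1

theorem wnorm_le_of_norm_le {μ β C : ℝ} {g : E3 → C3}
    (h : ∀ k, ‖g k‖ ≤ C / weight μ β k) : wnorm μ β g ≤ ENNReal.ofReal C := by
  refine iSup_le fun k => ENNReal.ofReal_le_ofReal ?_
  rw [mul_comm, ← le_div_iff₀ (weight_pos μ β k)]
  exact h k

theorem norm_le_toReal_wnorm {μ β : ℝ} {g : E3 → C3} (h : wnorm μ β g < ⊤) (k : E3) :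
    ‖g k‖ ≤ (wnorm μ β g).toReal / weight μ β k :=
  norm_le_of_wnorm_le ENNReal.toReal_nonneg (ENNReal.ofReal_toReal h.ne).ge k

theorem norm_le_of_wnorm_le_nnreal {μ β : ℝ} {C : ℝ≥0} {g : E3 → C3}
    (h : wnorm μ β g ≤ C) (k : E3) : ‖g k‖ ≤ C / weight μ β k :=
  norm_le_of_wnorm_le C.2 (by simpa [ENNReal.ofReal] using h) k

theorem integrable_of_norm_le_div_weight {μ β C : ℝ} (hμ : 3 < μ) (hβ : 0 ≤ β)
    {E : Type*} [NormedAddCommGroup E] {g : E3 → E} (hg : AEStronglyMeasurable g)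
    (h : ∀ k, ‖g k‖ ≤ C / weight μ β k) : Integrable g :=
  ((integrable_inv_weight hμ hβ).const_mul C).mono' hg
    (Eventually.of_forall fun k => by rw [← div_eq_mul_inv]; exact h k)

/-! ### The bilinear symbol of the nonlinearity -/

theorem kdot_eq_inner (k : E3) (w : C3) : kdot k w = inner ℂ (toC3 k) w := by
  simp [kdot, toC3, PiLp.inner_apply, mul_comm]

theorem norm_toC3 (k : E3) : ‖toC3 k‖ = ‖k‖ := by
  simp [toC3, EuclideanSpace.norm_eq]

theorem norm_kdot_le (k : E3) (w : C3) : ‖kdot k w‖ ≤ ‖k‖ * ‖w‖ := by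
  rw [kdot_eq_inner, ← norm_toC3 k]
  exact norm_inner_le_norm _ _

/-- `w ↦ k · w` as a linear form. -/
def kdotL (k : E3) : C3 →L[ℂ] ℂ := innerSL ℂ (toC3 k)

theorem kdotL_apply (k : E3) (w : C3) : kdotL k w = kdot k w := by
  rw [kdot_eq_inner]; rfl

/-- `P_k` as a linear map. -/
def projL (k : E3) : C3 →L[ℂ] C3 :=
  ContinuousLinearMap.id ℂ C3 -
    (((‖k‖ ^ 2 : ℝ) : ℂ)⁻¹ • (kdotL k)).smulRight (toC3 k)

theorem projL_apply (k : E3) (w : C3) : projL k w = projSymbol k w := by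
  simp [projL, projSymbol, kdotL_apply, div_eq_inv_mul]

/-- The factor 2 is crude, P_k being an orthogonal projection, but it is the one built into
`constC0`. At k = 0 division by zero makes P_k the identity. -/
theorem norm_projSymbol_le (k : E3) (w : C3) : ‖projSymbol k w‖ ≤ 2 * ‖w‖ := by
  unfold projSymbol
  refine (norm_sub_le _ _).trans ?_
  rw [two_mul, norm_smul, norm_div, norm_toC3]
  gcongr
  rcases eq_or_ne k 0 with rfl | hk
  · simp
  · have hk : 0 < ‖k‖ := norm_pos_iff.2 hk
    have := norm_kdot_le k w
    rw [Complex.norm_real, Real.norm_of_nonneg (by positivity), div_mul_eq_mul_div,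
      div_le_iff₀ (by positivity)]
    nlinarith

theorem kdot_projSymbol (k : E3) (w : C3) : kdot k (projSymbol k w) = 0 := by
  rcases eq_or_ne k 0 with rfl | hk
  · simp [kdot]
  · have hk : ((‖k‖ : ℝ) : ℂ) ≠ 0 := by exact_mod_cast (norm_pos_iff.2 hk).ne'
    have h : kdot k (toC3 k) = ((‖k‖ ^ 2 : ℝ) : ℂ) := by
      rw [kdot_eq_inner, inner_self_eq_norm_sq_to_K, norm_toC3]; simp
    rw [← kdotL_apply, projSymbol, map_sub, map_smul, kdotL_apply, kdotL_apply, h, smul_eq_mul]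
    push_cast
    field_simp
    ring

theorem continuous_toC3 : Continuous toC3 := by
  unfold toC3
  exact (PiLp.continuous_toLp 2 _).comp (by fun_prop)

theorem continuous_kdot : Continuous fun x : E3 × C3 => kdot x.1 x.2 := by
  unfold kdot; fun_prop

theorem measurable_projSymbol : Measurable fun x : E3 × C3 => projSymbol x.1 x.2 := by
  unfold projSymbol
  refine measurable_snd.sub (Measurable.smul (continuous_kdot.measurable.div ?_)
    (continuous_toC3.measurable.comp measurable_fst))
  exact Continuous.measurable (by fun_prop)

/-- The bilinear map `(a, b) ↦ (k · a) b`. -/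
def kbil (k : E3) : C3 →L[ℂ] C3 →L[ℂ] C3 :=
  (ContinuousLinearMap.lsmul ℂ ℂ).comp (kdotL k)

theorem kbil_apply (k : E3) (a b : C3) : kbil k a b = kdot k a • b := by
  simp [kbil, kdotL_apply]

theorem norm_kdot_smul_le (k : E3) (a b : C3) : ‖kdot k a • b‖ ≤ ‖k‖ * ‖a‖ * ‖b‖ := by
  rw [norm_smul]
  exact mul_le_mul_of_nonneg_right (norm_kdot_le k a) (norm_nonneg _)

/-- `∑ k_j (a_j *̂ b)(k)`. -/
def kconv (a b : E3 → C3) (k : E3) : C3 := ∫ q : E3, kdot k (a q) • b (k - q)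

/-- The quadratic term `-i k_j P_k (a_j *̂ b)(k)`. -/
def nonlin (a b : E3 → C3) (k : E3) : C3 := -(Complex.I • projSymbol k (kconv a b k))

theorem measurable_kdot_smul {a b : E3 → C3} (ha : Measurable a) (hb : Measurable b) :
    Measurable fun x : E3 × E3 => kdot x.1 (a x.2) • b (x.1 - x.2) :=
  Measurable.smul (continuous_kdot.measurable.comp (measurable_fst.prodMk (ha.comp measurable_snd)))
    (hb.comp (measurable_fst.sub measurable_snd))

theorem measurable_kconv {a b : E3 → C3} (ha : Measurable a) (hb : Measurable b) :
    Measurable (kconv a b) :=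
  (StronglyMeasurable.integral_prod_right (f := fun k q : E3 => kdot k (a q) • b (k - q))
    (measurable_kdot_smul ha hb).stronglyMeasurable).measurable

theorem measurable_nonlin {a b : E3 → C3} (ha : Measurable a) (hb : Measurable b) :
    Measurable (nonlin a b) :=
  ((measurable_projSymbol.comp (measurable_id.prodMk (measurable_kconv ha hb))).const_smul
    Complex.I).neg

theorem norm_kdot_smul_le_weight {μ β A B : ℝ} {a b : E3 → C3} (hA : 0 ≤ A)
    {k q : E3} (ha : ‖a q‖ ≤ A / weight μ β q) (hb : ‖b (k - q)‖ ≤ B / weight μ β (k - q)) :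
    ‖kdot k (a q) • b (k - q)‖ ≤
      ‖k‖ * A * B * ((weight μ β q)⁻¹ * (weight μ β (k - q))⁻¹) := by
  have h1 := weight_pos μ β q
  calc _ ≤ ‖k‖ * ‖a q‖ * ‖b (k - q)‖ := norm_kdot_smul_le _ _ _
    _ ≤ ‖k‖ * (A / weight μ β q) * (B / weight μ β (k - q)) := by gcongr
    _ = _ := by simp only [div_eq_mul_inv]; ring

theorem integrable_kconv {μ β A B : ℝ} (hμ : 3 < μ) (hβ : 0 ≤ β) {a b : E3 → C3}
    (ham : Measurable a) (hbm : Measurable b) (hA : 0 ≤ A)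
    (ha : ∀ᵐ k, ‖a k‖ ≤ A / weight μ β k) (hb : ∀ᵐ k, ‖b k‖ ≤ B / weight μ β k) (k : E3) :
    Integrable fun q => kdot k (a q) • b (k - q) := by
  refine ((integrable_weight_conv hμ hβ k).const_mul (‖k‖ * A * B)).mono'
    ((measurable_kdot_smul ham hbm).comp measurable_prodMk_left).aestronglyMeasurable ?_
  have hb' : ∀ᵐ q, ‖b (k - q)‖ ≤ B / weight μ β (k - q) :=
    (Measure.measurePreserving_sub_left volume k).quasiMeasurePreserving.ae hb
  filter_upwards [ha, hb'] with q h1 h2 using norm_kdot_smul_le_weight hA h1 h2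

theorem norm_integral_le_weight_conv {μ β C : ℝ} (hμ : 3 < μ) (hβ : 0 ≤ β) (hC : 0 ≤ C)
    {E : Type*} [NormedAddCommGroup E] [NormedSpace ℝ E] {k : E3} {F : E3 → E}
    (h : ∀ᵐ q, ‖F q‖ ≤ C * ((weight μ β q)⁻¹ * (weight μ β (k - q))⁻¹)) :
    ‖∫ q, F q‖ ≤ C * (constC0 μ / 2) / weight μ β k := by
  refine (norm_integral_le_of_norm_le ((integrable_weight_conv hμ hβ k).const_mul C) h).trans ?_
  rw [integral_const_mul, mul_div_assoc]
  exact mul_le_mul_of_nonneg_left (integral_weight_conv_le hμ hβ k) hC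

/-- The bounds on a and b are assumed only almost everywhere: in the uniqueness proof the difference
of two Fourier transforms is controlled in no better sense. -/
theorem norm_kconv_le {μ β A B : ℝ} (hμ : 3 < μ) (hβ : 0 ≤ β) {a b : E3 → C3}
    (hA : 0 ≤ A) (hB : 0 ≤ B)
    (ha : ∀ᵐ k, ‖a k‖ ≤ A / weight μ β k) (hb : ∀ᵐ k, ‖b k‖ ≤ B / weight μ β k) (k : E3) :
    ‖kconv a b k‖ ≤ ‖k‖ * A * B * (constC0 μ / 2) / weight μ β k := by
  refine norm_integral_le_weight_conv hμ hβ (by positivity) ?_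
  have hb' : ∀ᵐ q, ‖b (k - q)‖ ≤ B / weight μ β (k - q) :=
    (Measure.measurePreserving_sub_left volume k).quasiMeasurePreserving.ae hb
  filter_upwards [ha, hb'] with q h1 h2 using norm_kdot_smul_le_weight hA h1 h2

theorem norm_neg_I_smul_projSymbol_le (k : E3) (w : C3) :
    ‖-(Complex.I • projSymbol k w)‖ ≤ 2 * ‖w‖ := by
  rw [norm_neg, norm_smul, Complex.norm_I, one_mul]
  exact norm_projSymbol_le k w

theorem norm_nonlin_le {μ β A B : ℝ} (hμ : 3 < μ) (hβ : 0 ≤ β) {a b : E3 → C3}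
    (hA : 0 ≤ A) (hB : 0 ≤ B)
    (ha : ∀ᵐ k, ‖a k‖ ≤ A / weight μ β k) (hb : ∀ᵐ k, ‖b k‖ ≤ B / weight μ β k) (k : E3) :
    ‖nonlin a b k‖ ≤ ‖k‖ * A * B * constC0 μ / weight μ β k := by
  refine (norm_neg_I_smul_projSymbol_le k _).trans ?_
  have := norm_kconv_le hμ hβ hA hB ha hb k
  calc _ ≤ 2 * (‖k‖ * A * B * (constC0 μ / 2) / weight μ β k) := by gcongr
    _ = _ := by ring

/-- The componentwise convolutions are gathered into one integral with the scalar factor k · a(q),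
the form in which all estimates are made. Integrability of each component is what allows the sum to
enter the integral. -/
theorem sum_smul_fconv {μ β A B : ℝ} (hμ : 3 < μ) (hβ : 0 ≤ β) {a b : E3 → C3}
    (ham : Measurable a) (hbm : Measurable b)
    (ha : ∀ k, ‖a k‖ ≤ A / weight μ β k) (hb : ∀ k, ‖b k‖ ≤ B / weight μ β k) (k : E3) :
    ∑ j, ((k j : ℝ) : ℂ) • fconv (fun q => a q j) b k = kconv a b k := by
  have hi : ∀ j : Fin 3, Integrable fun q => a q j • b (k - q) := fun j => by
    refine ((integrable_weight_conv hμ hβ k).const_mul (A * B)).mono' ?_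
      (Eventually.of_forall fun q => ?_)
    · have hj : Measurable fun w : C3 => w j := Continuous.measurable (by fun_prop)
      exact ((hj.comp ham).smul (hbm.comp (measurable_const.sub measurable_id))).aestronglyMeasurable
    · rw [norm_smul]
      have h1 := (PiLp.norm_apply_le (a q) j).trans (ha q)
      calc _ ≤ (A / weight μ β q) * (B / weight μ β (k - q)) :=
            mul_le_mul h1 (hb _) (norm_nonneg _) ((norm_nonneg _).trans h1)
        _ = _ := by simp only [div_eq_mul_inv]; ring
  unfold fconv kconv kdot
  simp only [← integral_smul]
  rw [← integral_finsetSum]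
  · simp only [Finset.sum_smul, smul_smul]
  · exact fun j _ => (hi j).fun_smul _

theorem v1hat_eq {μ β A : ℝ} (hμ : 3 < μ) (hβ : 0 ≤ β) {a f : E3 → C3} (ham : Measurable a)
    (ha : ∀ k, ‖a k‖ ≤ A / weight μ β k) (k : E3) :
    v1hat a f k = -(((‖k‖ ^ 2 : ℝ) : ℂ) • a k) + nonlin a a k + f k := by
  unfold v1hat nonlin
  rw [← sum_smul_fconv hμ hβ ham ham ha ha k, ← projL_apply, map_sum]
  simp only [map_smul, projL_apply]
  rw [sub_eq_add_neg]

end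

end NSBorel

namespace NSBorel
open MeasureTheory Set Filter Topology

/-! ### The kernel of the Borel-transformed heat operator -/

noncomputable section

theorem norm_exp_neg_mul (p : ℝ) (τ : ℂ) :
    ‖Complex.exp (-(p : ℂ) * τ)‖ = Real.exp (-(τ.re * p)) := by
  rw [Complex.norm_exp]; simp [mul_comm]

theorem integrableOn_pow_mul_exp_neg (n : ℕ) {a : ℝ} (ha : 0 < a) :
    IntegrableOn (fun p : ℝ => p ^ n * Real.exp (-(a * p))) (Ioi 0) := by
  have := integrableOn_rpow_mul_exp_neg_mul_rpow (s := n) (p := 1) (b := a)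
    (by have : (0 : ℝ) ≤ n := n.cast_nonneg
        linarith) one_pos ha
  simpa [neg_mul] using this

theorem integral_exp_neg_mul_Ioi {a : ℝ} (ha : 0 < a) :
    ∫ p in Ioi (0 : ℝ), Real.exp (-(a * p)) = a⁻¹ := by
  have := integral_exp_mul_Ioi (a := -a) (by linarith) 0
  simpa [neg_mul] using this

theorem integral_mul_exp_neg_mul_Ioi {a : ℝ} (ha : 0 < a) :
    ∫ p in Ioi (0 : ℝ), p * Real.exp (-(a * p)) = a⁻¹ ^ 2 := by
  have := Real.integral_rpow_mul_exp_neg_mul_Ioi (a := 2) (r := a) two_pos ha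
  norm_num at this
  rw [this]; norm_num

/-- A solution of `W'' = -κ² W / p` on `(a, ∞)` with `W(a) = 0`, `W'(a) = 1` and `|W'| ≤ 1`. -/
structure IsUnitSolution (κ a : ℝ) (W W1 : ℝ → ℝ) : Prop where
  nonneg : 0 ≤ a
  deriv : ∀ p, a < p → HasDerivAt W (W1 p) p
  deriv_one : ∀ p, a < p → HasDerivAt W1 (-(κ ^ 2 * (W p / p))) p
  continuous : ContinuousWithinAt W (Ici a) a
  continuous_one : ContinuousWithinAt W1 (Ici a) a
  initial : W a = 0
  initial_one : W1 a = 1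
  bound : ∀ p, a < p → |W1 p| ≤ 1

namespace IsUnitSolution

variable {κ a : ℝ} {W W1 : ℝ → ℝ}

/-- By the mean value theorem |W p| ≤ p - a, and a ≥ 0. -/
theorem abs_le (h : IsUnitSolution κ a W W1) {p : ℝ} (hp : a < p) : |W p| ≤ p := by
  have hc : ContinuousOn W (Icc a p) := fun x hx => by
    rcases hx.1.eq_or_lt with rfl | hx1
    · exact h.continuous.mono fun y hy => hy.1
    · exact (h.deriv x hx1).continuousAt.continuousWithinAt
  obtain ⟨c, hc, hc'⟩ := exists_hasDerivAt_eq_slope W W1 hp hc fun x hx => h.deriv x hx.1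
  have h1 := h.bound c hc.1
  rw [hc', h.initial, sub_zero, abs_div, abs_of_pos (sub_pos.2 hp),
    div_le_one (sub_pos.2 hp)] at h1
  have := h.nonneg
  linarith

theorem continuousOn (h : IsUnitSolution κ a W W1) : ContinuousOn W (Ioi a) :=
  fun x hx => (h.deriv x hx).continuousAt.continuousWithinAt

theorem integrableOn (h : IsUnitSolution κ a W W1) {τ : ℂ} (hτ : 0 < τ.re) :
    IntegrableOn (fun p : ℝ => Complex.exp (-(p : ℂ) * τ) * (W p : ℂ)) (Ioi a) := by
  refine Integrable.mono' ((integrableOn_pow_mul_exp_neg 1 hτ).mono_set (Ioi_subset_Ioi h.nonneg))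
    (ContinuousOn.aestronglyMeasurable (ContinuousOn.mul (by fun_prop)
      (Complex.continuous_ofReal.comp_continuousOn h.continuousOn)) measurableSet_Ioi) ?_
  refine (ae_restrict_mem measurableSet_Ioi).mono fun p hp => ?_
  rw [norm_mul, norm_exp_neg_mul, Complex.norm_real, pow_one, mul_comm]
  exact mul_le_mul_of_nonneg_right (h.abs_le hp) (Real.exp_pos _).le

theorem integrableOn_div (h : IsUnitSolution κ a W W1) {τ : ℂ} (hτ : 0 < τ.re) :
    IntegrableOn (fun p : ℝ => Complex.exp (-(p : ℂ) * τ) * ((W p / p : ℝ) : ℂ)) (Ioi a) := by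
  refine Integrable.mono' ((integrableOn_pow_mul_exp_neg 0 hτ).mono_set (Ioi_subset_Ioi h.nonneg))
    (ContinuousOn.aestronglyMeasurable (ContinuousOn.mul (by fun_prop)
      (Complex.continuous_ofReal.comp_continuousOn (h.continuousOn.div continuousOn_id
        fun p hp => (h.nonneg.trans_lt hp).ne'))) measurableSet_Ioi) ?_
  refine (ae_restrict_mem measurableSet_Ioi).mono fun p hp => ?_
  have hp0 : 0 < p := h.nonneg.trans_lt hp
  rw [norm_mul, norm_exp_neg_mul, Complex.norm_real, pow_zero, mul_comm]
  refine mul_le_mul_of_nonneg_right ?_ (Real.exp_pos _).le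
  rw [Real.norm_eq_abs, abs_div, abs_of_pos hp0, div_le_one hp0]
  exact h.abs_le hp

/-- The integrand e^{-pτ}(τ² W + κ² W/p) has the primitive -e^{-pτ}(W' + τ W). It vanishes at
infinity, and the initial data W(a) = 0, W'(a) = 1 turn its value at a into the right-hand side. -/
theorem laplace (h : IsUnitSolution κ a W W1) {τ : ℂ} (hτ : 0 < τ.re) :
    τ ^ 2 * (∫ p in Ioi a, Complex.exp (-(p : ℂ) * τ) * (W p : ℂ)) +
      (κ : ℂ) ^ 2 * (∫ p in Ioi a, Complex.exp (-(p : ℂ) * τ) * ((W p / p : ℝ) : ℂ)) =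
        Complex.exp (-(a : ℂ) * τ) := by
  have i1 := (h.integrableOn hτ).const_mul (τ ^ 2)
  have i2 := (h.integrableOn_div hτ).const_mul ((κ : ℂ) ^ 2)
  have i12 : IntegrableOn (fun p : ℝ => τ ^ 2 * (Complex.exp (-(p : ℂ) * τ) * (W p : ℂ)) +
      (κ : ℂ) ^ 2 * (Complex.exp (-(p : ℂ) * τ) * ((W p / p : ℝ) : ℂ))) (Ioi a) := i1.add i2
  rw [← integral_const_mul, ← integral_const_mul, ← integral_add i1 i2]
  have hexp : ∀ p : ℝ, HasDerivAt (fun p : ℝ => Complex.exp (-(p : ℂ) * τ))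
      (Complex.exp (-(p : ℂ) * τ) * (-1 * τ)) p := fun p => by
    have := ((Complex.ofRealCLM.hasDerivAt (x := p)).neg.mul_const τ).cexp
    simpa using this
  have hexp0 : Tendsto (fun p : ℝ => Real.exp (-(τ.re * p))) atTop (𝓝 0) :=
    Real.tendsto_exp_neg_atTop_nhds_zero.comp (tendsto_id.const_mul_atTop hτ)
  have hexp1 : Tendsto (fun p : ℝ => p * Real.exp (-(τ.re * p))) atTop (𝓝 0) := by
    have := tendsto_rpow_mul_exp_neg_mul_atTop_nhds_zero 1 τ.re hτ
    simpa [neg_mul] using this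
  have hlim : Tendsto (fun p : ℝ => -(Complex.exp (-(p : ℂ) * τ) * ((W1 p : ℂ) + τ * (W p : ℂ))))
      atTop (𝓝 0) := by
    refine squeeze_zero_norm' (a := fun p => Real.exp (-(τ.re * p)) +
      ‖τ‖ * (p * Real.exp (-(τ.re * p)))) ?_ (by simpa using hexp0.add (hexp1.const_mul ‖τ‖))
    filter_upwards [eventually_gt_atTop a] with p hp
    rw [norm_neg, norm_mul, norm_exp_neg_mul]
    have h1 : ‖(W1 p : ℂ) + τ * (W p : ℂ)‖ ≤ 1 + ‖τ‖ * p := by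
      refine (norm_add_le _ _).trans ?_
      rw [norm_mul, Complex.norm_real, Complex.norm_real]
      exact add_le_add (h.bound p hp) (mul_le_mul_of_nonneg_left (h.abs_le hp) (norm_nonneg _))
    calc _ ≤ Real.exp (-(τ.re * p)) * (1 + ‖τ‖ * p) := by gcongr
      _ = _ := by ring
  have key := integral_Ioi_of_hasDerivAt_of_tendsto (a := a) (m := 0)
    (f := fun p : ℝ => -(Complex.exp (-(p : ℂ) * τ) * ((W1 p : ℂ) + τ * (W p : ℂ))))
    (f' := fun p : ℝ => τ ^ 2 * (Complex.exp (-(p : ℂ) * τ) * (W p : ℂ)) +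
      (κ : ℂ) ^ 2 * (Complex.exp (-(p : ℂ) * τ) * ((W p / p : ℝ) : ℂ))) ?_ ?_ i12 hlim
  · rw [key, h.initial, h.initial_one]; simp
  · refine ContinuousWithinAt.neg (ContinuousWithinAt.mul
      (hexp a).continuousAt.continuousWithinAt (ContinuousWithinAt.add ?_
        (continuousWithinAt_const.mul ?_)))
    · exact Complex.continuous_ofReal.continuousAt.comp_continuousWithinAt h.continuous_one
    · exact Complex.continuous_ofReal.continuousAt.comp_continuousWithinAt h.continuous
  · intro p hp
    have := ((hexp p).mul ((h.deriv_one p hp).ofReal_comp.add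
      ((h.deriv p hp).ofReal_comp.const_mul τ))).neg
    refine HasDerivAt.congr_deriv this ?_
    push_cast
    simp only [Pi.add_apply]
    ring

end IsUnitSolution

/-- The integral kernel of the inverse of `p ∂ₚ² + 2 ∂ₚ + κ²`. -/
def borelKernel (κ p s : ℝ) : ℝ :=
  if 0 < s ∧ s < p then Real.pi / (2 * κ * √p) * kernelG (2 * κ * √p) (2 * κ * √s)
  else 0

/-- The solution of `p u'' + 2 u' + κ² u = 0` with `u(0) = 1`, extended by `0` to `p ≤ 0`. -/
def borelHom (κ p : ℝ) : ℝ :=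
  if p ≤ 0 then 0 else if κ = 0 then 1 else besselJ1 (2 * κ * √p) / (κ * √p)

theorem hasDerivAt_two_mul_sqrt (κ : ℝ) {p : ℝ} (hp : 0 < p) :
    HasDerivAt (fun p => 2 * κ * √p) (κ / √p) p := by
  refine HasDerivAt.congr_deriv ((Real.hasDerivAt_sqrt hp.ne').const_mul (2 * κ)) ?_
  have := (Real.sqrt_pos.2 hp).ne'
  field_simp

/-- With z = 2κ√p the system for (𝒢, 𝒢₀) becomes W'' = -κ² W/p, the derivative of W being (π/2) 𝒢₀.
The Wronskian normalizes the initial slope to 1, and the energy bound for 𝒢₀ gives |W'| ≤ 1. -/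
theorem isUnitSolution_kernel {κ p' : ℝ} (hκ : 0 < κ) (hp' : 0 < p') :
    IsUnitSolution κ p' (fun p => Real.pi / (2 * κ) * (√p * kernelG (2 * κ * √p) (2 * κ * √p')))
      (fun p => Real.pi / 2 * kernelG0 (2 * κ * √p) (2 * κ * √p')) := by
  have hz' : 0 < 2 * κ * √p' := by positivity
  have hpi := Real.pi_pos
  have hd : ∀ p, 0 < p → HasDerivAt
      (fun p => Real.pi / (2 * κ) * (√p * kernelG (2 * κ * √p) (2 * κ * √p')))
      (Real.pi / 2 * kernelG0 (2 * κ * √p) (2 * κ * √p')) p := fun p hp => by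
    have hz : 0 < 2 * κ * √p := by positivity
    have := (((Real.hasDerivAt_sqrt hp.ne').mul
      ((hasDerivAt_kernelG (2 * κ * √p') hz).comp p (hasDerivAt_two_mul_sqrt κ hp))).const_mul
        (Real.pi / (2 * κ)))
    refine HasDerivAt.congr_deriv this ?_
    have := (Real.sqrt_pos.2 hp).ne'
    simp only [Function.comp]
    field_simp
    ring
  have hd1 : ∀ p, 0 < p → HasDerivAt
      (fun p => Real.pi / 2 * kernelG0 (2 * κ * √p) (2 * κ * √p'))
      (-(κ ^ 2 * (Real.pi / (2 * κ) * (√p * kernelG (2 * κ * √p) (2 * κ * √p')) / p))) p :=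
    fun p hp => by
    have hz : 0 < 2 * κ * √p := by positivity
    have := (((hasDerivAt_kernelG0 (2 * κ * √p') hz).comp p
      (hasDerivAt_two_mul_sqrt κ hp))).const_mul (Real.pi / 2)
    refine HasDerivAt.congr_deriv this ?_
    have h1 := (Real.sqrt_pos.2 hp).ne'
    have h2 := Real.mul_self_sqrt hp.le
    generalize kernelG (2 * κ * √p) (2 * κ * √p') = y at *
    have h3 : √p / p = 1 / √p := by rw [div_eq_div_iff hp.ne' h1]; linarith
    calc Real.pi / 2 * (-y * (κ / √p)) = -(κ * Real.pi / 2 * y * (1 / √p)) := by ring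
      _ = -(κ * Real.pi / 2 * y * (√p / p)) := by rw [h3]
      _ = _ := by field_simp
  refine ⟨hp'.le, fun p hp => hd p (hp'.trans hp), fun p hp => hd1 p (hp'.trans hp),
    (hd p' hp').continuousAt.continuousWithinAt, (hd1 p' hp').continuousAt.continuousWithinAt,
    by simp [kernelG_self], ?_, fun p hp => ?_⟩
  · rw [kernelG0_self hz']; field_simp
  · have := abs_kernelG0_le_two_div_pi hz'
      (show 2 * κ * √p' ≤ 2 * κ * √p by gcongr)
    rw [abs_mul, abs_of_pos (by positivity)]
    calc _ ≤ Real.pi / 2 * (2 / Real.pi) := by gcongr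
      _ = 1 := by field_simp

/-- Here W' = J₀(2κ√p), so the slope bound is |J₀| ≤ 1. At the starting point p = 0 the square root
is not differentiable, which is why `IsUnitSolution` asks only for one-sided continuity at a. -/
theorem isUnitSolution_hom {κ : ℝ} (hκ : 0 < κ) :
    IsUnitSolution κ 0 (fun p => √p * besselJ1 (2 * κ * √p) / κ) (fun p => besselJ0 (2 * κ * √p)) := by
  have hJ0 : Continuous besselJ0 :=
    continuous_iff_continuousAt.2 fun z => (hasDerivAt_besselJ0 z).continuousAt
  refine ⟨le_rfl, fun p hp => ?_, fun p hp => ?_, ?_, ?_, by simp, ?_, fun p _ => abs_besselJ0_le _⟩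
  · have hz : 0 < 2 * κ * √p := by positivity
    have := (((Real.hasDerivAt_sqrt hp.ne').mul
      ((hasDerivAt_besselJ1 hz.ne').comp p (hasDerivAt_two_mul_sqrt κ hp)))).div_const κ
    refine HasDerivAt.congr_deriv this ?_
    have := (Real.sqrt_pos.2 hp).ne'
    simp only [Function.comp]
    field_simp
    ring
  · have := (hasDerivAt_besselJ0 (2 * κ * √p)).comp p (hasDerivAt_two_mul_sqrt κ hp)
    refine HasDerivAt.congr_deriv this ?_
    have h1 := (Real.sqrt_pos.2 hp).ne'
    have h2 := Real.mul_self_sqrt hp.le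
    have h3 : √p / p = 1 / √p := by rw [div_eq_div_iff hp.ne' h1]; linarith
    generalize besselJ1 (2 * κ * √p) = y at *
    calc -y * (κ / √p) = -(κ * y * (1 / √p)) := by ring
      _ = -(κ * y * (√p / p)) := by rw [h3]
      _ = _ := by field_simp
  · have hJ1 : Continuous besselJ1 := by
      refine continuous_const.mul
        (intervalIntegral.continuous_parametric_intervalIntegral_of_continuous' (by fun_prop) _ _)
    exact Continuous.continuousWithinAt (by fun_prop)
  · exact Continuous.continuousWithinAt (by fun_prop)
  · simp [besselJ0, Real.pi_ne_zero]

theorem isUnitSolution_zero : IsUnitSolution 0 0 (fun p => p) (fun _ => 1) := by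
  refine ⟨le_rfl, fun p _ => hasDerivAt_id p, fun p _ => ?_, continuousWithinAt_id,
    continuousWithinAt_const, rfl, rfl, fun p _ => by simp⟩
  refine (hasDerivAt_const p (1 : ℝ)).congr_deriv (by simp)

theorem exists_isUnitSolution_borelHom {κ : ℝ} (hκ : 0 ≤ κ) :
    ∃ W W1, IsUnitSolution κ 0 W W1 ∧ ∀ p, 0 < p → W p = p * borelHom κ p := by
  rcases hκ.eq_or_lt with rfl | hκ
  · exact ⟨_, _, isUnitSolution_zero, fun p hp => by simp [borelHom, hp.not_ge]⟩
  · refine ⟨_, _, isUnitSolution_hom hκ, fun p hp => ?_⟩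
    have h1 := (Real.sqrt_pos.2 hp).ne'
    have h2 := Real.mul_self_sqrt hp.le
    simp only [borelHom, hp.not_ge, hκ.ne', if_false]
    rw [mul_div_assoc', div_eq_div_iff hκ.ne' (by positivity)]
    linear_combination (κ * besselJ1 (2 * κ * √p)) * h2

theorem kernel_eq_mul_borelKernel {κ p p' : ℝ} (hp' : 0 < p') (hp : p' < p) :
    Real.pi / (2 * κ) * (√p * kernelG (2 * κ * √p) (2 * κ * √p')) = p * borelKernel κ p p' := by
  have hp0 := hp'.trans hp
  have h1 := (Real.sqrt_pos.2 hp0).ne'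
  have h3 : √p = p * (1 / √p) := by
    rw [mul_one_div, eq_div_iff h1, Real.mul_self_sqrt hp0.le]
  simp only [borelKernel, hp', hp, and_self, if_true]
  generalize kernelG (2 * κ * √p) (2 * κ * √p') = y
  calc Real.pi / (2 * κ) * (√p * y) = Real.pi / (2 * κ) * y * √p := by ring
    _ = Real.pi / (2 * κ) * y * (p * (1 / √p)) := by rw [← h3]
    _ = _ := by rw [show Real.pi / (2 * κ * √p) = Real.pi / (2 * κ) * (1 / √p) by
                  rw [div_mul_div_comm, mul_one]]; ring

theorem borelHom_of_nonpos {κ p : ℝ} (hp : p ≤ 0) : borelHom κ p = 0 := by simp [borelHom, hp]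

theorem borelKernel_of_not {κ p p' : ℝ} (h : ¬(0 < p' ∧ p' < p)) : borelKernel κ p p' = 0 := by
  simp [borelKernel, h]

theorem abs_borelHom_le {κ : ℝ} (hκ : 0 ≤ κ) (p : ℝ) : |borelHom κ p| ≤ 1 := by
  rcases le_or_gt p 0 with hp | hp
  · simp [borelHom_of_nonpos hp]
  · obtain ⟨W, W1, h, hW⟩ := exists_isUnitSolution_borelHom hκ
    have := h.abs_le hp
    rw [hW p hp, abs_mul, abs_of_pos hp] at this
    nlinarith

/-- This is |W p| ≤ p divided by p. It is uniform in κ and serves integrability questions; for κ = 0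
division by zero makes the kernel vanish. -/
theorem abs_borelKernel_le_one {κ : ℝ} (hκ : 0 ≤ κ) (p p' : ℝ) : |borelKernel κ p p'| ≤ 1 := by
  by_cases h : 0 < p' ∧ p' < p
  · rcases hκ.eq_or_lt with rfl | hκ
    · simp [borelKernel]
    have hp0 := h.1.trans h.2
    have := (isUnitSolution_kernel hκ h.1).abs_le h.2
    rw [kernel_eq_mul_borelKernel h.1 h.2, abs_mul, abs_of_pos hp0] at this
    nlinarith
  · simp [borelKernel_of_not h]

/-- The decisive gain: the prefactor π/(2κ√p) of the kernel absorbs one factor κ = |k|, the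
derivative in the nonlinearity, at the price of p^{-1/2}. -/
theorem mul_abs_borelKernel_le {κ : ℝ} (hκ : 0 ≤ κ) (p p' : ℝ) :
    κ * |borelKernel κ p p'| ≤ Real.pi / 2 * supG / √p := by
  have hpi := Real.pi_pos
  have hS := supG_nonneg
  by_cases h : 0 < p' ∧ p' < p
  · rcases hκ.eq_or_lt with rfl | hκ
    · simp only [zero_mul]; positivity
    have hp0 := h.1.trans h.2
    have h1 : 0 < √p := Real.sqrt_pos.2 hp0
    have h0 : 0 < √p' := Real.sqrt_pos.2 h.1
    simp only [borelKernel, h, and_self, if_true]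
    rw [abs_mul, abs_of_pos (by positivity)]
    have := abs_kernelG_le_supG (z := 2 * κ * √p) (z' := 2 * κ * √p') (by positivity)
      (by have := Real.sqrt_le_sqrt h.2.le; gcongr)
    calc _ ≤ κ * (Real.pi / (2 * κ * √p) * supG) := by gcongr
      _ = _ := by field_simp
  · rw [borelKernel_of_not h, abs_zero, mul_zero]; positivity

theorem measurable_borelKernel : Measurable fun x : ℝ × ℝ × ℝ => borelKernel x.1 x.2.1 x.2.2 := by
  unfold borelKernel
  refine Measurable.ite ?_ ?_ measurable_const
  · exact (measurableSet_lt measurable_const measurable_snd.snd).inter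
      (measurableSet_lt measurable_snd.snd measurable_snd.fst)
  · unfold kernelG
    have hJ := measurable_besselJ1
    have hY := measurable_besselY1
    fun_prop

theorem measurable_borelHom : Measurable fun x : ℝ × ℝ => borelHom x.1 x.2 := by
  unfold borelHom
  have hJ := measurable_besselJ1
  refine Measurable.ite (measurableSet_le (by fun_prop) measurable_const) measurable_const
    (Measurable.ite (measurableSet_eq_fun (by fun_prop) measurable_const) measurable_const
      (by fun_prop))

/-! ### Laplace transforms of the homogeneous solution and of the kernel -/

theorem setIntegral_Ioi_eq_integral {E : Type*} [NormedAddCommGroup E] [NormedSpace ℝ E]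
    {f : ℝ → E} {a : ℝ} (h : ∀ p, p ≤ a → f p = 0) : ∫ p in Ioi a, f p = ∫ p, f p :=
  setIntegral_eq_integral_of_forall_compl_eq_zero fun p hp => h p (not_lt.1 hp)

theorem borelHom_laplace {κ : ℝ} (hκ : 0 ≤ κ) {τ : ℂ} (hτ : 0 < τ.re) :
    τ ^ 2 * (∫ p : ℝ, Complex.exp (-(p : ℂ) * τ) * ((p * borelHom κ p : ℝ) : ℂ)) +
      (κ : ℂ) ^ 2 * (∫ p : ℝ, Complex.exp (-(p : ℂ) * τ) * ((borelHom κ p : ℝ) : ℂ)) = 1 := by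
  obtain ⟨W, W1, h, hW⟩ := exists_isUnitSolution_borelHom hκ
  have := h.laplace hτ
  rw [← setIntegral_Ioi_eq_integral (a := 0) fun p hp => by simp [borelHom_of_nonpos hp],
    ← setIntegral_Ioi_eq_integral (a := 0) fun p hp => by simp [borelHom_of_nonpos hp]]
  rw [← Complex.exp_zero, show (0 : ℂ) = -((0 : ℝ) : ℂ) * τ by simp, ← this]
  congr 2 <;> refine setIntegral_congr_fun measurableSet_Ioi fun p hp => ?_
  · simp only [hW p hp]
  · simp only [hW p hp, mul_div_cancel_left₀ _ (show p ≠ 0 from ne_of_gt hp)]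

theorem borelKernel_laplace {κ p' : ℝ} (hκ : 0 < κ) (hp' : 0 < p') {τ : ℂ} (hτ : 0 < τ.re) :
    τ ^ 2 * (∫ p : ℝ, Complex.exp (-(p : ℂ) * τ) * ((p * borelKernel κ p p' : ℝ) : ℂ)) +
      (κ : ℂ) ^ 2 * (∫ p : ℝ, Complex.exp (-(p : ℂ) * τ) * ((borelKernel κ p p' : ℝ) : ℂ)) =
        Complex.exp (-(p' : ℂ) * τ) := by
  have hz : ∀ p, p ≤ p' → borelKernel κ p p' = 0 := fun p hp =>
    borelKernel_of_not fun h => absurd h.2 hp.not_gt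
  have := (isUnitSolution_kernel hκ hp').laplace hτ
  rw [← setIntegral_Ioi_eq_integral (a := p') fun p hp => by simp [hz p hp],
    ← setIntegral_Ioi_eq_integral (a := p') fun p hp => by simp [hz p hp]]
  rw [← this]
  congr 2 <;> refine setIntegral_congr_fun measurableSet_Ioi fun p hp => ?_
  · simp only [kernel_eq_mul_borelKernel hp' hp]
  · simp only [kernel_eq_mul_borelKernel hp' hp, mul_div_cancel_left₀ _ (show p ≠ 0 from ne_of_gt (hp'.trans hp))]

/-- Fubini: on the support p' < p of the kernel e^{sp} e^{-sp'} ≥ 1, so the double integrand is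
dominated by the product of e^{sp}|c(p)| and e^{-sp'}|r(p')|. -/
theorem integral_smul_borelKernel {κ s : ℝ} (hκ : 0 ≤ κ) (hs : 0 ≤ s) {c : ℝ → ℂ}
    (hcm : Measurable c) (hc : IntegrableOn (fun p => Real.exp (s * p) * ‖c p‖) (Ioi 0))
    {r : ℝ → C3} (hrm : Measurable r) (hr : Integrable fun p => Real.exp (-(s * p)) * ‖r p‖) :
    Integrable (fun p => c p • ∫ p', (borelKernel κ p p' : ℂ) • r p') ∧
    Integrable (fun p' => (∫ p, c p * (borelKernel κ p p' : ℂ)) • r p') ∧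
    ∫ p, c p • ∫ p', (borelKernel κ p p' : ℂ) • r p' =
      ∫ p', (∫ p, c p * (borelKernel κ p p' : ℂ)) • r p' := by
  have hbk : Measurable fun x : ℝ × ℝ => borelKernel κ x.1 x.2 :=
    measurable_borelKernel.comp (measurable_const.prodMk measurable_id)
  have hint : Integrable (Function.uncurry fun p p' : ℝ => (c p * (borelKernel κ p p' : ℂ)) • r p')
      (volume.prod volume) := by
    have hg := ((integrable_indicator_iff measurableSet_Ioi).2 hc).mul_prod hr
    refine hg.mono' ?_ (Eventually.of_forall fun x => ?_)
    · exact (Measurable.smul ((hcm.comp measurable_fst).mul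
        (Complex.measurable_ofReal.comp hbk)) (hrm.comp measurable_snd)).aestronglyMeasurable
    · obtain ⟨p, p'⟩ := x
      simp only [Function.uncurry]
      by_cases h : 0 < p' ∧ p' < p
      · have hp : p ∈ Ioi (0 : ℝ) := h.1.trans h.2
        rw [indicator_of_mem hp, norm_smul, norm_mul, Complex.norm_real]
        have h1 : 1 ≤ Real.exp (s * p) * Real.exp (-(s * p')) := by
          rw [← Real.exp_add]
          exact Real.one_le_exp (by nlinarith [h.2])
        have h2 := abs_borelKernel_le_one hκ p p'
        calc ‖c p‖ * |borelKernel κ p p'| * ‖r p'‖ ≤ ‖c p‖ * 1 * ‖r p'‖ := by gcongr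
          _ ≤ (‖c p‖ * ‖r p'‖) * (Real.exp (s * p) * Real.exp (-(s * p'))) := by
              rw [mul_one]; exact le_mul_of_one_le_right (by positivity) h1
          _ = _ := by ring
      · rw [borelKernel_of_not h]
        simp only [Complex.ofReal_zero, mul_zero, zero_smul, norm_zero]
        exact mul_nonneg (indicator_nonneg (fun _ _ => by positivity) _) (by positivity)
  have e1 : ∀ p, c p • ∫ p', (borelKernel κ p p' : ℂ) • r p' =
      ∫ p', (c p * (borelKernel κ p p' : ℂ)) • r p' := fun p => by
    rw [← integral_smul]; simp only [smul_smul]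
  have e2 : ∀ p', (∫ p, c p * (borelKernel κ p p' : ℂ)) • r p' =
      ∫ p, (c p * (borelKernel κ p p' : ℂ)) • r p' := fun p' => (integral_smul_const _ _).symm
  simp only [e1, e2]
  exact ⟨hint.integral_prod_left, hint.integral_prod_right, integral_integral_swap hint⟩

/-- The Laplace transform turns the integral equation `U = h a + ∫ K r` into
`(τ² (-∂_τ) + κ²) L[U] = a + L[r]`. -/
theorem borel_duhamel_laplace {κ s : ℝ} (hκ : 0 ≤ κ) (hs : 0 ≤ s) {τ : ℂ} (hτ : s < τ.re) (a : C3)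
    {r : ℝ → C3} (hrm : Measurable r) (hr0 : ∀ p, p ≤ 0 → r p = 0)
    (hr : Integrable fun p => Real.exp (-(s * p)) * ‖r p‖) (hκr : κ = 0 → ∀ p, r p = 0)
    {U : ℝ → C3}
    (hU : ∀ p, U p = (borelHom κ p : ℂ) • a + ∫ p', (borelKernel κ p p' : ℂ) • r p') :
    τ ^ 2 • (∫ p : ℝ, (Complex.exp (-(p : ℂ) * τ) * p) • U p) +
      ((κ : ℂ) ^ 2) • (∫ p : ℝ, Complex.exp (-(p : ℂ) * τ) • U p) =
        a + ∫ p : ℝ, Complex.exp (-(p : ℂ) * τ) • r p := by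
  have hτ0 : 0 < τ.re := hs.trans_lt hτ
  have hhom : Measurable (borelHom κ) := measurable_borelHom.comp measurable_prodMk_left
  have hc : ∀ n : ℕ, IntegrableOn (fun p : ℝ => Real.exp (s * p) *
      ‖Complex.exp (-(p : ℂ) * τ) * (p : ℂ) ^ n‖) (Ioi 0) := fun n => by
    refine (integrableOn_pow_mul_exp_neg n (sub_pos.2 hτ)).congr_fun (fun p hp => ?_)
      measurableSet_Ioi
    have hp : 0 < p := hp
    simp only [norm_mul, norm_exp_neg_mul, norm_pow, Complex.norm_real, Real.norm_of_nonneg hp.le]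
    rw [show -((τ.re - s) * p) = s * p + -(τ.re * p) by ring, Real.exp_add]; ring
  have hh : ∀ n : ℕ, Integrable fun p : ℝ => Complex.exp (-(p : ℂ) * τ) * (p : ℂ) ^ n *
      (borelHom κ p : ℂ) := fun n => by
    have h0 := (integrable_indicator_iff measurableSet_Ioi).2 (integrableOn_pow_mul_exp_neg n hτ0)
    refine h0.mono' (Measurable.aestronglyMeasurable (by fun_prop)) (Eventually.of_forall fun p => ?_)
    by_cases hp : 0 < p
    · rw [indicator_of_mem (show p ∈ Ioi (0 : ℝ) from hp), norm_mul, norm_mul, norm_exp_neg_mul,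
        norm_pow, Complex.norm_real, Complex.norm_real, Real.norm_of_nonneg hp.le]
      have := abs_borelHom_le hκ p
      calc _ ≤ Real.exp (-(τ.re * p)) * p ^ n * 1 := by gcongr; exact this
        _ = _ := by ring
    · rw [borelHom_of_nonpos (not_lt.1 hp)]
      simp [indicator_of_notMem (show p ∉ Ioi (0 : ℝ) from hp)]
  -- The case n = 1 is the transform of pU and n = 0 that of U; after the swap each kernel transform
  -- multiplies r, and the two combine through `borelKernel_laplace`.
  have main : ∀ n : ℕ, ∫ p : ℝ, (Complex.exp (-(p : ℂ) * τ) * (p : ℂ) ^ n) • U p =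
      (∫ p : ℝ, Complex.exp (-(p : ℂ) * τ) * (p : ℂ) ^ n * (borelHom κ p : ℂ)) • a +
      ∫ p' : ℝ, (∫ p : ℝ, Complex.exp (-(p : ℂ) * τ) * (p : ℂ) ^ n *
        (borelKernel κ p p' : ℂ)) • r p' := fun n => by
    obtain ⟨h1, h2, h3⟩ := integral_smul_borelKernel hκ hs
      (c := fun p => Complex.exp (-(p : ℂ) * τ) * (p : ℂ) ^ n) (by fun_prop) (hc n) hrm hr
    rw [← h3, ← integral_smul_const, ← integral_add ((hh n).smul_const a) h1]
    refine integral_congr_ae (Eventually.of_forall fun p => ?_)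
    simp only [hU p, smul_add, smul_smul]
  have hI : ∀ n : ℕ, Integrable (fun p' : ℝ => (∫ p : ℝ, Complex.exp (-(p : ℂ) * τ) * (p : ℂ) ^ n *
        (borelKernel κ p p' : ℂ)) • r p') := fun n =>
    (integral_smul_borelKernel hκ hs
      (c := fun p => Complex.exp (-(p : ℂ) * τ) * (p : ℂ) ^ n) (by fun_prop) (hc n) hrm hr).2.1
  have m1 := main 1
  have m0 := main 0
  have hb := borelHom_laplace hκ hτ0
  simp only [pow_one] at m1
  simp only [pow_zero, mul_one] at m0
  have hI1 := (hI 1).fun_smul (τ ^ 2)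
  have hI0 := (hI 0).fun_smul ((κ : ℂ) ^ 2)
  simp only [pow_one] at hI1
  simp only [pow_zero, mul_one] at hI0
  rw [m1, m0, smul_add, smul_add, smul_smul, smul_smul, add_add_add_comm, ← add_smul]
  congr 1
  · simp only [Complex.ofReal_mul, ← mul_assoc] at hb
    rw [hb, one_smul]
  · rw [← integral_smul, ← integral_smul, ← integral_add hI1 hI0]
    refine integral_congr_ae (Eventually.of_forall fun p' => ?_)
    simp only
    rcases le_or_gt p' 0 with hp | hp
    · simp [hr0 p' hp]
    -- At κ = 0 the kernel is 0 by convention and `borelKernel_laplace` is unavailable; nothing is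
    -- lost, since the source vanishes there.
    rcases hκ.eq_or_lt with h0 | h0
    · simp [hκr h0.symm p']
    rw [← borelKernel_laplace h0 hp hτ0, smul_smul, smul_smul, ← add_smul]
    simp only [Complex.ofReal_mul, mul_assoc]

end

end NSBorel

namespace NSBorel
open MeasureTheory Set Filter Topology

/-! ### The integral equation in the Borel plane -/

noncomputable section

/-- The growth profile `e^{αp} p^{-1/2}` (which is `0` for `p ≤ 0`). -/
def borelProfile (α p : ℝ) : ℝ := Real.exp (α * p) / √p

theorem borelProfile_nonneg (α p : ℝ) : 0 ≤ borelProfile α p := by unfold borelProfile; positivity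

theorem borelProfile_of_nonpos {α p : ℝ} (hp : p ≤ 0) : borelProfile α p = 0 := by
  simp [borelProfile, Real.sqrt_eq_zero_of_nonpos hp]

theorem measurable_borelProfile (α : ℝ) : Measurable (borelProfile α) := by
  unfold borelProfile; fun_prop

theorem inv_sqrt_eq_rpow (s : ℝ) : 1 / √s = s ^ (-(1 / 2) : ℝ) ∨ s < 0 := by
  rcases le_or_gt 0 s with h | h
  · left; rw [Real.rpow_neg h, ← Real.sqrt_eq_rpow, one_div]
  · exact Or.inr h

theorem intervalIntegrable_inv_sqrt {p : ℝ} (hp : 0 ≤ p) :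
    IntervalIntegrable (fun s => 1 / √s) volume 0 p := by
  refine (intervalIntegral.intervalIntegrable_rpow' (r := -(1 / 2)) (by norm_num)).congr ?_
  intro s hs
  rw [uIoc_of_le hp] at hs
  rcases inv_sqrt_eq_rpow s with h | h
  · exact h.symm
  · exact absurd hs.1 (by linarith)

theorem integral_inv_sqrt {p : ℝ} (hp : 0 ≤ p) : ∫ s in (0 : ℝ)..p, 1 / √s = 2 * √p := by
  have : ∫ s in (0 : ℝ)..p, 1 / √s = ∫ s in (0 : ℝ)..p, s ^ (-(1 / 2) : ℝ) := by
    refine intervalIntegral.integral_congr fun s hs => ?_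
    rw [uIcc_of_le hp] at hs
    rcases inv_sqrt_eq_rpow s with h | h
    · exact h
    · exact absurd hs.1 (by linarith)
  rw [this, integral_rpow (Or.inl (by norm_num))]
  norm_num
  rw [Real.sqrt_eq_rpow]; ring

/-- Dividing √p ≤ √s + √(p-s) by √s √(p-s) separates the two endpoint singularities. -/
theorem borelProfile_mul_le {α p s : ℝ} (hs : 0 < s) (hsp : s < p) :
    borelProfile α s * borelProfile α (p - s) ≤
      Real.exp (α * p) / √p * (1 / √s + 1 / √(p - s)) := by
  have h1 : 0 < √s := Real.sqrt_pos.2 hs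
  have h2 : 0 < √(p - s) := Real.sqrt_pos.2 (by linarith)
  have h3 : 0 < √p := Real.sqrt_pos.2 (by linarith)
  have h4 : √p ≤ √s + √(p - s) := by
    rw [Real.sqrt_le_left (by positivity)]
    nlinarith [Real.sq_sqrt hs.le, Real.sq_sqrt (show 0 ≤ p - s by linarith), mul_pos h1 h2]
  unfold borelProfile
  rw [div_mul_div_comm, ← Real.exp_add, show α * s + α * (p - s) = α * p by ring,
    div_add_div _ _ h1.ne' h2.ne', div_mul_div_comm, div_le_div_iff₀ (by positivity) (by positivity)]
  have := Real.exp_pos (α * p)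
  have : √p * (√s * √(p - s)) ≤ (√s + √(p - s)) * (√s * √(p - s)) := by gcongr
  nlinarith

/-- The self-convolution of p^{-1/2} on (0,p) is a constant, so the quadratic term loses the
singularity at p = 0. The exact constant is π; the elementary splitting gives 4. -/
theorem integrable_borelProfile_conv (α p : ℝ) :
    Integrable (fun s => borelProfile α s * borelProfile α (p - s)) ∧
      ∫ s, borelProfile α s * borelProfile α (p - s) ≤ 4 * Real.exp (α * p) := by
  have hzero : ∀ s, s ∉ Ioo 0 p → borelProfile α s * borelProfile α (p - s) = 0 := fun s hs => by
    rcases le_or_gt s 0 with h | h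
    · rw [borelProfile_of_nonpos h, zero_mul]
    · rw [borelProfile_of_nonpos (show p - s ≤ 0 by by_contra h'; exact hs ⟨h, by linarith⟩),
        mul_zero]
  rcases le_or_gt p 0 with hp | hp
  · have : (fun s => borelProfile α s * borelProfile α (p - s)) = fun _ => 0 :=
      funext fun s => hzero s fun h => by linarith [h.1, h.2]
    rw [this]
    exact ⟨integrable_zero _ _ _, by rw [integral_zero]; positivity⟩
  set g : ℝ → ℝ := fun s => Real.exp (α * p) / √p * (1 / √s + 1 / √(p - s)) with hg
  have h2 : IntervalIntegrable (fun s => 1 / √(p - s)) volume 0 p := by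
    have := (intervalIntegrable_inv_sqrt hp.le).comp_sub_left p
    simpa using this.symm
  have h1 := intervalIntegrable_inv_sqrt hp.le
  have hgi : IntervalIntegrable g volume 0 p := (h1.add h2).const_mul _
  have hgint : ∫ s in (0 : ℝ)..p, g s = 4 * Real.exp (α * p) := by
    have e2 : ∫ s in (0 : ℝ)..p, 1 / √(p - s) = 2 * √p := by
      rw [intervalIntegral.integral_comp_sub_left (fun s => 1 / √s), sub_self, sub_zero,
        integral_inv_sqrt hp.le]
    rw [hg, intervalIntegral.integral_const_mul, intervalIntegral.integral_add h1 h2, e2,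
      integral_inv_sqrt hp.le]
    have := (Real.sqrt_pos.2 hp).ne'
    field_simp
    ring
  have hgo : IntegrableOn g (Ioo 0 p) := by
    rw [intervalIntegrable_iff_integrableOn_Ioo_of_le hp.le] at hgi; exact hgi
  have hm : Measurable fun s => borelProfile α s * borelProfile α (p - s) := by
    unfold borelProfile; fun_prop
  have hmi : IntegrableOn (fun s => borelProfile α s * borelProfile α (p - s)) (Ioo 0 p) := by
    refine Integrable.mono' hgo hm.aestronglyMeasurable ?_
    refine (ae_restrict_mem measurableSet_Ioo).mono fun s hs => ?_
    rw [Real.norm_of_nonneg (mul_nonneg (borelProfile_nonneg _ _) (borelProfile_nonneg _ _))]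
    exact borelProfile_mul_le hs.1 hs.2
  refine ⟨(integrableOn_iff_integrable_of_support_subset fun s hs => ?_).1 hmi, ?_⟩
  · by_contra h; exact hs (hzero s h)
  · rw [← setIntegral_eq_integral_of_forall_compl_eq_zero hzero, ← hgint,
      intervalIntegral.integral_of_le hp.le, integral_Ioc_eq_integral_Ioo]
    exact setIntegral_mono_on hmi hgo measurableSet_Ioo fun s hs => borelProfile_mul_le hs.1 hs.2

theorem integrableOn_borelProfile {α p : ℝ} (hα : 0 ≤ α) (hp : 0 ≤ p) :
    IntegrableOn (borelProfile α) (Icc 0 p) := by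
  have h1 := (intervalIntegrable_iff_integrableOn_Icc_of_le hp).1
    ((intervalIntegrable_inv_sqrt hp).const_mul (Real.exp (α * p)))
  refine Integrable.mono' h1 (measurable_borelProfile α).aestronglyMeasurable ?_
  refine (ae_restrict_mem measurableSet_Icc).mono fun s hs => ?_
  rw [Real.norm_of_nonneg (borelProfile_nonneg _ _), borelProfile, mul_one_div]
  have := hs.2
  gcongr

/-- The right-hand side vanishes at p = 0 and its derivative dominates the integrand. The factor
√p/(1+αp) is kept because it is bounded both by √p, for the behaviour near 0, and by 1/(2√α), for
the contraction. -/
theorem integral_borelProfile_le {α p : ℝ} (hα : 0 < α) (hp : 0 ≤ p) :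
    ∫ s in (0 : ℝ)..p, borelProfile α s ≤ 3 * (√p / (1 + α * p)) * Real.exp (α * p) := by
  have h := intervalIntegral.integral_le_sub_of_hasDeriv_right_of_le (a := 0) (b := p)
    (g := fun s => 3 * (√s / (1 + α * s)) * Real.exp (α * s))
    (g' := fun s => 3 * ((1 / (2 * √s) * (1 + α * s) - √s * (α * 1)) / (1 + α * s) ^ 2) *
      Real.exp (α * s) + 3 * (√s / (1 + α * s)) * (Real.exp (α * s) * (α * 1)))
    (φ := borelProfile α) hp ?_ ?_ (integrableOn_borelProfile hα.le hp) ?_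
  · simpa using h
  · refine ContinuousOn.mul (continuousOn_const.mul (ContinuousOn.div (by fun_prop) (by fun_prop)
      fun s hs => ?_)) (by fun_prop)
    have := hs.1
    positivity
  · intro s hs
    have hs0 : 0 < s := hs.1
    have hd1 : HasDerivAt (fun s => 1 + α * s) (α * 1) s :=
      ((hasDerivAt_id s).const_mul α).const_add 1
    have hd2 : HasDerivAt (fun s => Real.exp (α * s)) (Real.exp (α * s) * (α * 1)) s :=
      ((hasDerivAt_id s).const_mul α).exp
    exact ((((Real.hasDerivAt_sqrt hs0.ne').div hd1 (by positivity)).const_mul 3).mul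
      hd2).hasDerivWithinAt
  · intro s hs
    have hs0 : 0 < s := hs.1
    have h1 : 0 < √s := Real.sqrt_pos.2 hs0
    have h2 : s = √s * √s := (Real.mul_self_sqrt hs0.le).symm
    have e := Real.exp_pos (α * s)
    unfold borelProfile
    generalize Real.exp (α * s) = y at *
    generalize √s = r at *
    subst h2
    -- With x = αs the excess of the derivative over the integrand is a positive multiple of 1 - x +
    -- 4x², whose discriminant is negative.
    have key : 3 * ((1 / (2 * r) * (1 + α * (r * r)) - r * (α * 1)) / (1 + α * (r * r)) ^ 2) * y +
        3 * (r / (1 + α * (r * r))) * (y * (α * 1)) - y / r =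
        y * (1 - α * r ^ 2 + 4 * (α * r ^ 2) ^ 2) / (2 * r * (1 + α * r ^ 2) ^ 2) := by
      field_simp
      ring
    have : 0 ≤ y * (1 - α * r ^ 2 + 4 * (α * r ^ 2) ^ 2) / (2 * r * (1 + α * r ^ 2) ^ 2) := by
      refine div_nonneg (mul_nonneg e.le ?_) (by positivity)
      nlinarith [sq_nonneg (α * r ^ 2 - 1 / 2), sq_nonneg (α * r ^ 2)]
    linarith

/-- Arithmetic–geometric mean: 2√(αp) ≤ 1 + αp. -/
theorem sqrt_div_one_add_le {α p : ℝ} (hα : 0 < α) (hp : 0 ≤ p) :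
    √p / (1 + α * p) ≤ 1 / (2 * √α) := by
  have h1 : 0 < √α := Real.sqrt_pos.2 hα
  rw [div_le_div_iff₀ (by positivity) (by positivity), one_mul]
  have h2 := Real.mul_self_sqrt hα.le
  have h3 := Real.mul_self_sqrt hp
  have : α * p = (√α * √p) ^ 2 := by rw [mul_pow, sq, sq, h2, h3]
  nlinarith [sq_nonneg (√α * √p - 1)]

theorem integral_exp_mul_le {α p : ℝ} (hα : 0 < α) :
    ∫ s in (0 : ℝ)..p, Real.exp (α * s) ≤ Real.exp (α * p) / α := by
  rw [intervalIntegral.integral_comp_mul_left (fun s => Real.exp s) hα.ne', integral_exp]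
  simp only [mul_zero, Real.exp_zero, smul_eq_mul]
  rw [inv_mul_eq_div]
  gcongr
  linarith

/-- The quadratic source term of the Borel equation, before integration over wave vectors. -/
def sourceIntegrand (a : E3 → C3) (U : ℝ → E3 → C3) (p : ℝ) (k q : E3) : C3 :=
  kdot k (a q) • U p (k - q) + kdot k (U p q) • a (k - q) +
    ∫ s : ℝ, kdot k (U s q) • U (p - s) (k - q)

/-- The quadratic source term of the Borel equation. -/
def borelSource (a : E3 → C3) (U : ℝ → E3 → C3) (p : ℝ) (k : E3) : C3 :=
  -(Complex.I • projSymbol k (∫ q, sourceIntegrand a U p k q))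

/-- The map whose fixed point is the Borel transform of the velocity field. -/
def borelStep (a b : E3 → C3) (U : ℝ → E3 → C3) (p : ℝ) (k : E3) : C3 :=
  (borelHom ‖k‖ p : ℂ) • b k + ∫ p', (borelKernel ‖k‖ p p' : ℂ) • borelSource a U p' k

theorem measurable_sourceIntegrand {a : E3 → C3} {U : ℝ → E3 → C3} (ha : Measurable a)
    (hU : Measurable fun x : ℝ × E3 => U x.1 x.2) :
    Measurable fun x : (ℝ × E3) × E3 => sourceIntegrand a U x.1.1 x.1.2 x.2 := by
  have h1 : Measurable fun x : (ℝ × E3) × E3 =>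
      kdot x.1.2 (a x.2) • U x.1.1 (x.1.2 - x.2) :=
    (continuous_kdot.measurable.comp (measurable_fst.snd.prodMk (ha.comp measurable_snd))).smul
      (hU.comp (measurable_fst.fst.prodMk (measurable_fst.snd.sub measurable_snd)))
  have h2 : Measurable fun x : (ℝ × E3) × E3 =>
      kdot x.1.2 (U x.1.1 x.2) • a (x.1.2 - x.2) :=
    (continuous_kdot.measurable.comp (measurable_fst.snd.prodMk
      (hU.comp (measurable_fst.fst.prodMk measurable_snd)))).smul
      (ha.comp (measurable_fst.snd.sub measurable_snd))
  have h3 : Measurable fun y : ((ℝ × E3) × E3) × ℝ =>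
      kdot y.1.1.2 (U y.2 y.1.2) • U (y.1.1.1 - y.2) (y.1.1.2 - y.1.2) :=
    (continuous_kdot.measurable.comp (measurable_fst.fst.snd.prodMk
      (hU.comp (measurable_snd.prodMk measurable_fst.snd)))).smul
      (hU.comp ((measurable_fst.fst.fst.sub measurable_snd).prodMk
        (measurable_fst.fst.snd.sub measurable_fst.snd)))
  have h4 : StronglyMeasurable fun x : (ℝ × E3) × E3 =>
      ∫ s : ℝ, kdot x.1.2 (U s x.2) • U (x.1.1 - s) (x.1.2 - x.2) :=
    StronglyMeasurable.integral_prod_right' (f := fun y : ((ℝ × E3) × E3) × ℝ =>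
      kdot y.1.1.2 (U y.2 y.1.2) • U (y.1.1.1 - y.2) (y.1.1.2 - y.1.2)) h3.stronglyMeasurable
  unfold sourceIntegrand
  exact (h1.add h2).add h4.measurable

theorem measurable_borelSource {a : E3 → C3} {U : ℝ → E3 → C3} (ha : Measurable a)
    (hU : Measurable fun x : ℝ × E3 => U x.1 x.2) :
    Measurable fun x : ℝ × E3 => borelSource a U x.1 x.2 := by
  have h := (StronglyMeasurable.integral_prod_right
    (f := fun (x : ℝ × E3) (q : E3) => sourceIntegrand a U x.1 x.2 q) (ν := volume)
    (measurable_sourceIntegrand ha hU).stronglyMeasurable).measurable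
  exact ((measurable_projSymbol.comp (measurable_snd.prodMk h)).const_smul Complex.I).neg

theorem measurable_borelStep {a b : E3 → C3} {U : ℝ → E3 → C3} (ha : Measurable a)
    (hb : Measurable b) (hU : Measurable fun x : ℝ × E3 => U x.1 x.2) :
    Measurable fun x : ℝ × E3 => borelStep a b U x.1 x.2 := by
  have hs := measurable_borelSource ha hU
  have h1 : Measurable fun x : ℝ × E3 => borelHom ‖x.2‖ x.1 :=
    measurable_borelHom.comp (measurable_snd.norm.prodMk measurable_fst)
  have hf : Measurable fun y : (ℝ × E3) × ℝ => (y.2, y.1.2) :=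
    measurable_snd.prodMk measurable_fst.snd
  have hg : Measurable fun y : (ℝ × E3) × ℝ => (‖y.1.2‖, y.1.1, y.2) :=
    measurable_fst.snd.norm.prodMk (measurable_fst.fst.prodMk measurable_snd)
  have h2 := (Complex.measurable_ofReal.comp (measurable_borelKernel.comp hg)).smul (hs.comp hf)
  have h3 : StronglyMeasurable fun x : ℝ × E3 =>
      ∫ p', (borelKernel ‖x.2‖ x.1 p' : ℂ) • borelSource a U p' x.2 :=
    StronglyMeasurable.integral_prod_right' (f := fun y : (ℝ × E3) × ℝ =>
      (borelKernel ‖y.1.2‖ y.1.1 y.2 : ℂ) • borelSource a U y.2 y.1.2) h2.stronglyMeasurable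
  have h4 : Measurable fun x : ℝ × E3 => (borelHom ‖x.2‖ x.1 : ℂ) • b x.2 :=
    (Complex.measurable_ofReal.comp h1).smul (hb.comp measurable_snd)
  unfold borelStep
  exact h4.add h3.measurable

theorem kdot_conv_bound {α F G : ℝ} (hF : 0 ≤ F) {f g : ℝ → C3} (hf : Measurable f)
    (hg : Measurable g) (hfb : ∀ s, ‖f s‖ ≤ F * borelProfile α s)
    (hgb : ∀ s, ‖g s‖ ≤ G * borelProfile α s) (k : E3) (p : ℝ) :
    Integrable (fun s => kdot k (f s) • g (p - s)) ∧
      ‖∫ s, kdot k (f s) • g (p - s)‖ ≤ ‖k‖ * F * G * (4 * Real.exp (α * p)) := by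
  obtain ⟨h1, h2⟩ := integrable_borelProfile_conv α p
  have hG : 0 ≤ G := by
    have := (norm_nonneg _).trans (hgb 1)
    have h : 0 < borelProfile α 1 := by unfold borelProfile; positivity
    exact nonneg_of_mul_nonneg_left this h
  have hb : ∀ s, ‖kdot k (f s) • g (p - s)‖ ≤
      ‖k‖ * F * G * (borelProfile α s * borelProfile α (p - s)) := fun s => by
    have := borelProfile_nonneg α s
    calc _ ≤ ‖k‖ * ‖f s‖ * ‖g (p - s)‖ := norm_kdot_smul_le _ _ _
      _ ≤ ‖k‖ * (F * borelProfile α s) * (G * borelProfile α (p - s)) := by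
          gcongr
          · exact hfb s
          · exact hgb _
      _ = _ := by ring
  constructor
  · refine (h1.const_mul (‖k‖ * F * G)).mono' ?_ (Eventually.of_forall hb)
    exact (Measurable.smul (continuous_kdot.measurable.comp (measurable_const.prodMk hf))
      (hg.comp (measurable_const.sub measurable_id))).aestronglyMeasurable
  · refine (norm_integral_le_of_norm_le (h1.const_mul (‖k‖ * F * G))
      (Eventually.of_forall hb)).trans ?_
    rw [integral_const_mul]
    gcongr

/-- `U` is measurable and `‖U(p,·)‖_{μ,β} ≤ ρ e^{αp} p^{-1/2}`. -/
structure BorelBounded (μ β α ρ : ℝ) (U : ℝ → E3 → C3) : Prop where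
  measurable : Measurable fun x : ℝ × E3 => U x.1 x.2
  bound : ∀ p k, ‖U p k‖ ≤ ρ * (borelProfile α p / weight μ β k)

namespace BorelBounded

variable {μ β α ρ A d : ℝ} {a b : E3 → C3} {U V : ℝ → E3 → C3}

theorem nonneg (hU : BorelBounded μ β α ρ U) : 0 ≤ ρ := by
  have h1 := (norm_nonneg _).trans (hU.bound 1 0)
  have h2 : 0 < borelProfile α 1 := by unfold borelProfile; positivity
  exact nonneg_of_mul_nonneg_left h1 (div_pos h2 (weight_pos μ β 0))

theorem sub (hU : BorelBounded μ β α ρ U) (hV : BorelBounded μ β α ρ V)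
    (hd : ∀ p k, ‖U p k - V p k‖ ≤ d * (borelProfile α p / weight μ β k)) :
    BorelBounded μ β α d (fun p k => U p k - V p k) :=
  ⟨hU.measurable.sub hV.measurable, hd⟩

theorem measurable_right (hU : BorelBounded μ β α ρ U) (k : E3) : Measurable fun p => U p k :=
  hU.measurable.comp measurable_prodMk_right

theorem conv_bound (hU : BorelBounded μ β α ρ U) (hV : BorelBounded μ β α d V) (k q : E3) (p : ℝ) :
    Integrable (fun s => kdot k (U s q) • V (p - s) (k - q)) ∧
      ‖∫ s, kdot k (U s q) • V (p - s) (k - q)‖ ≤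
        ‖k‖ * ρ * d * (4 * Real.exp (α * p)) * ((weight μ β q)⁻¹ * (weight μ β (k - q))⁻¹) := by
  have hρ := hU.nonneg
  have hw := weight_pos μ β q
  obtain ⟨h1, h2⟩ := kdot_conv_bound (α := α) (F := ρ / weight μ β q) (G := d / weight μ β (k - q))
    (f := fun s => U s q) (g := fun s => V s (k - q)) (by positivity)
    (hU.measurable_right q) (hV.measurable_right _)
    (fun s => (hU.bound s q).trans_eq (by ring)) (fun s => (hV.bound s _).trans_eq (by ring)) k p
  exact ⟨h1, h2.trans_eq (by simp only [div_eq_mul_inv]; ring)⟩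

theorem linear_bound (hU : BorelBounded μ β α ρ U) (hA : 0 ≤ A)
    (ha : ∀ k, ‖a k‖ ≤ A / weight μ β k) (p : ℝ) (k q : E3) :
    ‖kdot k (a q) • U p (k - q) + kdot k (U p q) • a (k - q)‖ ≤
      ‖k‖ * (2 * A * ρ * borelProfile α p) *
        ((weight μ β q)⁻¹ * (weight μ β (k - q))⁻¹) := by
  have hρ := hU.nonneg
  have hm := borelProfile_nonneg α p
  have h1 := norm_kdot_smul_le_weight (μ := μ) (β := β) (a := a) (b := U p) (k := k)
    (B := ρ * borelProfile α p) hA (ha q)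
    ((hU.bound p (k - q)).trans_eq (by ring))
  have h2 := norm_kdot_smul_le_weight (μ := μ) (β := β) (a := U p) (b := a) (k := k)
    (A := ρ * borelProfile α p) (by positivity)
    ((hU.bound p q).trans_eq (by ring)) (ha (k - q))
  exact (norm_add_le _ _).trans ((add_le_add h1 h2).trans_eq (by ring))

/-- The terms linear in U keep the profile e^{αp} p^{-1/2}; the convolution term is bounded by
e^{αp} alone. The two are tracked separately because they integrate differently against the kernel.
-/
theorem norm_sourceIntegrand_le (hU : BorelBounded μ β α ρ U) (hA : 0 ≤ A)
    (ha : ∀ k, ‖a k‖ ≤ A / weight μ β k) (p : ℝ) (k q : E3) :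
    ‖sourceIntegrand a U p k q‖ ≤ ‖k‖ * (2 * A * ρ * borelProfile α p +
      4 * ρ ^ 2 * Real.exp (α * p)) * ((weight μ β q)⁻¹ * (weight μ β (k - q))⁻¹) :=
  (norm_add_le _ _).trans ((add_le_add (hU.linear_bound hA ha p k q)
    (hU.conv_bound hU k q p).2).trans_eq (by ring))

theorem integrable_sourceIntegrand (hU : BorelBounded μ β α ρ U) (hμ : 3 < μ) (hβ : 0 ≤ β)
    (ham : Measurable a) (hA : 0 ≤ A)
    (ha : ∀ k, ‖a k‖ ≤ A / weight μ β k) (p : ℝ) (k : E3) :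
    Integrable (sourceIntegrand a U p k) := by
  have hm := (measurable_sourceIntegrand ham hU.measurable).comp
      (measurable_prodMk_left (x := ((p, k) : ℝ × E3)))
  exact ((integrable_weight_conv hμ hβ k).const_mul _).mono' hm.aestronglyMeasurable
    (Eventually.of_forall (hU.norm_sourceIntegrand_le hA ha p k))

theorem norm_sourceIntegrand_sub_le (hU : BorelBounded μ β α ρ U) (hV : BorelBounded μ β α ρ V)
    (hD : BorelBounded μ β α d (fun p k => U p k - V p k)) (hA : 0 ≤ A)
    (ha : ∀ k, ‖a k‖ ≤ A / weight μ β k) (p : ℝ) (k q : E3) :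
    ‖sourceIntegrand a U p k q - sourceIntegrand a V p k q‖ ≤
      ‖k‖ * (d * (2 * A * borelProfile α p + 8 * ρ * Real.exp (α * p))) *
        ((weight μ β q)⁻¹ * (weight μ β (k - q))⁻¹) := by
  have hkd : ∀ w w' : C3, kdot k (w - w') = kdot k w - kdot k w' := fun w w' => by
    simp only [← kdotL_apply, map_sub]
  -- Bilinearity: U∗U - V∗V = (U-V)∗U + V∗(U-V). The two convolution terms account for the constant
  -- 8 = 2 · 4.
  have e : sourceIntegrand a U p k q - sourceIntegrand a V p k q =
      (kdot k (a q) • (U p (k - q) - V p (k - q)) + kdot k (U p q - V p q) • a (k - q)) +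
      ((∫ s : ℝ, kdot k (U s q - V s q) • U (p - s) (k - q)) +
        ∫ s : ℝ, kdot k (V s q) • (U (p - s) (k - q) - V (p - s) (k - q))) := by
    rw [← integral_add (hD.conv_bound hU k q p).1 (hV.conv_bound hD k q p).1]
    have : ∀ s, kdot k (U s q - V s q) • U (p - s) (k - q) +
        kdot k (V s q) • (U (p - s) (k - q) - V (p - s) (k - q)) =
        kdot k (U s q) • U (p - s) (k - q) - kdot k (V s q) • V (p - s) (k - q) := fun s => by
      rw [hkd, sub_smul, smul_sub]; abel
    simp only [this]
    rw [integral_sub (hU.conv_bound hU k q p).1 (hV.conv_bound hV k q p).1, hkd, sub_smul, smul_sub]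
    unfold sourceIntegrand
    abel
  rw [e]
  refine (norm_add_le _ _).trans ((add_le_add (hD.linear_bound hA ha p k q)
    ((norm_add_le _ _).trans (add_le_add (hD.conv_bound hU k q p).2
      (hV.conv_bound hD k q p).2))).trans_eq ?_)
  ring

theorem norm_borelSource_le (hU : BorelBounded μ β α ρ U) (hμ : 3 < μ) (hβ : 0 ≤ β) (hA : 0 ≤ A)
    (ha : ∀ k, ‖a k‖ ≤ A / weight μ β k) (p : ℝ) (k : E3) :
    ‖borelSource a U p k‖ ≤ ‖k‖ * constC0 μ / weight μ β k *
      (2 * A * ρ * borelProfile α p + 4 * ρ ^ 2 * Real.exp (α * p)) := by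
  have hρ := hU.nonneg
  have hm := borelProfile_nonneg α p
  refine (norm_neg_I_smul_projSymbol_le k _).trans ?_
  have := norm_integral_le_weight_conv hμ hβ (by positivity)
    (Eventually.of_forall (hU.norm_sourceIntegrand_le hA ha p k))
  calc _ ≤ 2 * (‖k‖ * (2 * A * ρ * borelProfile α p +
      4 * ρ ^ 2 * Real.exp (α * p)) * (constC0 μ / 2) / weight μ β k) := by gcongr
    _ = _ := by ring

theorem norm_borelSource_sub_le (hU : BorelBounded μ β α ρ U) (hV : BorelBounded μ β α ρ V)
    (hD : BorelBounded μ β α d (fun p k => U p k - V p k)) (hμ : 3 < μ) (hβ : 0 ≤ β)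
    (ham : Measurable a) (hA : 0 ≤ A)
    (ha : ∀ k, ‖a k‖ ≤ A / weight μ β k) (p : ℝ) (k : E3) :
    ‖borelSource a U p k - borelSource a V p k‖ ≤ ‖k‖ * constC0 μ / weight μ β k *
      (d * (2 * A * borelProfile α p + 8 * ρ * Real.exp (α * p))) := by
  have hρ := hU.nonneg
  have hd := hD.nonneg
  have hm := borelProfile_nonneg α p
  have e : borelSource a U p k - borelSource a V p k = -(Complex.I • projSymbol k
      (∫ q, (sourceIntegrand a U p k q - sourceIntegrand a V p k q))) := by
    rw [integral_sub (hU.integrable_sourceIntegrand hμ hβ ham hA ha p k)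
      (hV.integrable_sourceIntegrand hμ hβ ham hA ha p k)]
    simp only [borelSource, ← projL_apply, map_sub, smul_sub]
    abel
  rw [e]
  refine (norm_neg_I_smul_projSymbol_le k _).trans ?_
  have := norm_integral_le_weight_conv hμ hβ (by positivity)
    (Eventually.of_forall (hU.norm_sourceIntegrand_sub_le hV hD hA ha p k))
  calc _ ≤ 2 * (‖k‖ * (d * (2 * A * borelProfile α p + 8 * ρ * Real.exp (α * p))) *
      (constC0 μ / 2) / weight μ β k) := by gcongr
    _ = _ := by ring

theorem borelSource_of_nonpos (hU : BorelBounded μ β α ρ U) {p : ℝ} (hp : p ≤ 0) (k : E3) :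
    borelSource a U p k = 0 := by
  have h0 : ∀ s, s ≤ 0 → ∀ q, U s q = 0 := fun s hs q => by
    have := hU.bound s q
    rw [borelProfile_of_nonpos hs] at this
    simpa using this
  have : ∀ q, sourceIntegrand a U p k q = 0 := fun q => by
    have h1 : ∀ s : ℝ, kdot k (U s q) • U (p - s) (k - q) = 0 := fun s => by
      rcases le_or_gt s 0 with hs | hs
      · rw [h0 s hs, ← kdotL_apply, map_zero, zero_smul]
      · rw [h0 (p - s) (by linarith), smul_zero]
    simp only [sourceIntegrand, h1, h0 p hp, integral_zero, add_zero, smul_zero, zero_add]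
    rw [← kdotL_apply, map_zero, zero_smul]
  simp only [borelSource, this, integral_zero, ← projL_apply, map_zero, smul_zero, neg_zero]

end BorelBounded

/-- The Duhamel integral of a source bounded by `‖k‖ C (x p^{-1/2} + y) e^{αp}`. -/
theorem norm_integral_borelKernel_le {α κ C x y : ℝ} (hα : 0 < α) (hκ : 0 ≤ κ) (hC : 0 ≤ C)
    (hx : 0 ≤ x) (hy : 0 ≤ y) {r : ℝ → C3}
    (hr : ∀ p, 0 < p → ‖r p‖ ≤ κ * C * (x * borelProfile α p + y * Real.exp (α * p))) (p : ℝ) :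
    ‖∫ p', (borelKernel κ p p' : ℂ) • r p'‖ ≤
      Real.pi / 2 * supG * C / √p * (3 * x * (√p / (1 + α * p)) * Real.exp (α * p) +
        y * ∫ s in (0 : ℝ)..p, Real.exp (α * s)) := by
  have hpi := Real.pi_pos
  have hS := supG_nonneg
  rcases le_or_gt p 0 with hp | hp
  · have : ∀ p', borelKernel κ p p' = 0 := fun p' =>
      borelKernel_of_not fun h => by linarith [h.1, h.2]
    simp [this, Real.sqrt_eq_zero_of_nonpos hp]
  have i1 := integrableOn_borelProfile hα.le hp.le
  have i2 : IntegrableOn (fun s => Real.exp (α * s)) (Icc 0 p) :=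
    Continuous.integrableOn_Icc (by fun_prop)
  have i3 : IntegrableOn (fun s => x * borelProfile α s + y * Real.exp (α * s)) (Icc 0 p) :=
    (i1.const_mul x).add (i2.const_mul y)
  have i4 := (i3.mono_set Ioc_subset_Icc_self).const_mul (Real.pi / 2 * supG * C / √p)
  have hzero : ∀ p', p' ∉ Ioc 0 p → (borelKernel κ p p' : ℂ) • r p' = 0 := fun p' hp' => by
    rw [borelKernel_of_not fun h => hp' ⟨h.1, h.2.le⟩]; simp
  rw [← setIntegral_eq_integral_of_forall_compl_eq_zero hzero]
  refine (norm_integral_le_of_norm_le i4 ((ae_restrict_mem measurableSet_Ioc).mono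
    fun s hs => ?_)).trans ?_
  · rw [norm_smul, Complex.norm_real]
    -- The factor κ in the bound for r is handed to the kernel; the estimate becomes uniform in κ.
    have h1 := mul_abs_borelKernel_le hκ p s
    have h2 := borelProfile_nonneg α s
    calc _ ≤ |borelKernel κ p s| * (κ * C * (x * borelProfile α s + y * Real.exp (α * s))) := by
          rw [Real.norm_eq_abs]; gcongr; exact hr s hs.1
      _ = (κ * |borelKernel κ p s|) * (C * (x * borelProfile α s + y * Real.exp (α * s))) := by ring
      _ ≤ (Real.pi / 2 * supG / √p) * (C * (x * borelProfile α s + y * Real.exp (α * s))) := by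
          gcongr
      _ = _ := by ring
  · rw [integral_const_mul, ← intervalIntegral.integral_of_le hp.le,
      intervalIntegral.integral_add, intervalIntegral.integral_const_mul,
      intervalIntegral.integral_const_mul]
    · have := integral_borelProfile_le hα hp.le
      gcongr ?_ * ?_
      calc _ ≤ x * (3 * (√p / (1 + α * p)) * Real.exp (α * p)) +
            y * ∫ s in (0 : ℝ)..p, Real.exp (α * s) := by gcongr
        _ = _ := by ring
    · exact ((intervalIntegrable_iff_integrableOn_Icc_of_le hp.le).2 i1).const_mul x
    · exact ((intervalIntegrable_iff_integrableOn_Icc_of_le hp.le).2 i2).const_mul y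

end

end NSBorel

namespace NSBorel
open MeasureTheory Set Filter Topology

/-! ### Solution of the integral equation -/

noncomputable section

/-- A contraction principle for functions dominated by a fixed weight. -/
theorem exists_fixed_point_of_dominated {X E : Type*} [NormedAddCommGroup E] [CompleteSpace E]
    {g : X → ℝ} {ρ : ℝ} {S : Set (X → E)} {T : (X → E) → X → E}
    (hne : ∃ u, u ∈ S) (hmaps : ∀ u ∈ S, T u ∈ S)
    (hbound : ∀ u ∈ S, ∀ x, ‖u x‖ ≤ ρ * g x)
    (hclosed : ∀ (u : ℕ → X → E) (v : X → E), (∀ n, u n ∈ S) →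
      (∀ x, Tendsto (fun n => u n x) atTop (𝓝 (v x))) → v ∈ S)
    (hlip : ∀ u ∈ S, ∀ v ∈ S, ∀ d : ℝ, (∀ x, ‖u x - v x‖ ≤ d * g x) →
      ∀ x, ‖T u x - T v x‖ ≤ d / 2 * g x) :
    ∃ u ∈ S, T u = u := by
  obtain ⟨u0, hu0⟩ := hne
  set u : ℕ → X → E := fun n => T^[n] u0 with hu
  have hS : ∀ n, u n ∈ S := fun n => by
    induction n with
    | zero => exact hu0
    | succ n ih =>
      simp only [hu, Function.iterate_succ_apply']
      exact hmaps _ ih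
  have hsucc : ∀ n, u (n + 1) = T (u n) := fun n => by
    simp only [hu, Function.iterate_succ_apply']
  -- Two elements of S differ by at most 2ρ g, which starts a geometric series with ratio 1/2. Since
  -- g may vanish, convergence is taken pointwise and S is only required to be closed under
  -- pointwise limits.
  have hstep : ∀ n x, ‖u (n + 1) x - u n x‖ ≤ 2 * ρ / 2 ^ n * g x := fun n => by
    induction n with
    | zero =>
      intro x
      refine (norm_sub_le _ _).trans ((add_le_add (hbound _ (hS 1) x) (hbound _ (hS 0) x)).trans_eq ?_)
      ring
    | succ n ih =>
      intro x
      have := hlip _ (hS (n + 1)) _ (hS n) _ ih x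
      rw [← hsucc, ← hsucc] at this
      refine this.trans_eq ?_
      rw [pow_succ]; ring
  have hdist : ∀ x n, dist (u n x) (u (n + 1) x) ≤ (4 * ρ * g x) / 2 / 2 ^ n := fun x n => by
    rw [dist_comm, dist_eq_norm]
    refine (hstep n x).trans_eq ?_
    ring
  choose v hv using fun x => cauchySeq_tendsto_of_complete (cauchySeq_of_le_geometric_two (hdist x))
  have hvS := hclosed u v hS hv
  have hclose : ∀ n x, ‖u n x - v x‖ ≤ 4 * ρ / 2 ^ n * g x := fun n x => by
    rw [← dist_eq_norm]
    refine (dist_le_of_le_geometric_two_of_tendsto (hdist x) (hv x) n).trans_eq ?_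
    ring
  refine ⟨v, hvS, funext fun x => ?_⟩
  have h1 : Tendsto (fun n => T (u n) x) atTop (𝓝 (T v x)) := by
    rw [tendsto_iff_norm_sub_tendsto_zero]
    refine squeeze_zero (fun _ => norm_nonneg _) (fun n => hlip _ (hS n) _ hvS _ (hclose n) x) ?_
    have : Tendsto (fun n : ℕ => (1 / 2 : ℝ) ^ n) atTop (𝓝 0) :=
      tendsto_pow_atTop_nhds_zero_of_lt_one (by norm_num) (by norm_num)
    have := this.const_mul (4 * ρ / 2 * g x)
    rw [mul_zero] at this
    refine this.congr fun n => ?_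
    rw [one_div, inv_pow]; ring
  have h2 : Tendsto (fun n => T (u n) x) atTop (𝓝 (v x)) := by
    simp only [← hsucc]
    exact (hv x).comp (tendsto_add_atTop_nat 1)
  exact tendsto_nhds_unique h1 h2

/-- Componentwise complex conjugation on `ℂ³`. -/
def conj3 : C3 ≃L[ℝ] C3 :=
  LinearEquiv.toContinuousLinearEquiv
    { toFun := fun w => WithLp.toLp 2 fun j => (starRingEnd ℂ) (w j)
      invFun := fun w => WithLp.toLp 2 fun j => (starRingEnd ℂ) (w j)
      map_add' := fun w w' => by ext j; simp
      map_smul' := fun c w => by ext j; simp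
      left_inv := fun w => by ext j; simp
      right_inv := fun w => by ext j; simp }

theorem conj3_apply (w : C3) (j : Fin 3) : conj3 w j = (starRingEnd ℂ) (w j) := rfl

theorem conj3_smul (c : ℂ) (w : C3) : conj3 (c • w) = (starRingEnd ℂ) c • conj3 w := by
  ext j; simp [conj3_apply]

theorem kdot_neg_conj3 (k : E3) (w : C3) : kdot (-k) (conj3 w) = -(starRingEnd ℂ) (kdot k w) := by
  simp [kdot, conj3_apply]

theorem projSymbol_neg_conj3 (k : E3) (w : C3) :
    projSymbol (-k) (conj3 w) = conj3 (projSymbol k w) := by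
  have h : toC3 (-k) = -toC3 k := by ext j; simp [toC3]
  have h' : conj3 (toC3 k) = toC3 k := by ext j; simp [toC3, conj3_apply]
  simp only [projSymbol, map_sub, conj3_smul, h, h', kdot_neg_conj3, norm_neg, map_div₀,
    Complex.conj_ofReal, neg_div, neg_smul, smul_neg, neg_neg]

/-- Hermitian symmetry, almost everywhere: the Fourier side of being real-valued. -/
def HermitianSymm (a : E3 → C3) : Prop := ∀ᵐ k : E3, a (-k) = conj3 (a k)

theorem ae_comp_sub {P : E3 → Prop} (h : ∀ᵐ q : E3, P q) (k : E3) : ∀ᵐ q : E3, P (k - q) :=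
  (Measure.measurePreserving_sub_left volume k).quasiMeasurePreserving.ae h

/-- After the substitution q ↦ -q every factor k · w is conjugated and changes sign; conjugating the
prefactor -i changes the sign back. -/
theorem borelSource_neg {a : E3 → C3} {U : ℝ → E3 → C3} (ha : HermitianSymm a)
    (hU : ∀ᵐ k : E3, ∀ p, U p (-k) = conj3 (U p k)) (p : ℝ) (k : E3) :
    borelSource a U p (-k) = conj3 (borelSource a U p k) := by
  have key : ∀ᵐ q : E3, sourceIntegrand a U p (-k) (-q) = -conj3 (sourceIntegrand a U p k q) := by
    filter_upwards [ha, hU, ae_comp_sub ha k, ae_comp_sub hU k] with q h1 h2 h3 h4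
    have e : -k - -q = -(k - q) := by abel
    simp only [sourceIntegrand, e, h1, h2, h3, h4, map_add, conj3_smul, kdot_neg_conj3, neg_smul,
      integral_neg, neg_add, ← ContinuousLinearEquiv.integral_comp_comm]
  have : ∫ q, sourceIntegrand a U p (-k) q = -conj3 (∫ q, sourceIntegrand a U p k q) := by
    rw [← integral_neg_eq_self, integral_congr_ae key, integral_neg,
      ContinuousLinearEquiv.integral_comp_comm]
  unfold borelSource
  rw [this, map_neg, conj3_smul, ← projSymbol_neg_conj3, ← projL_apply, ← projL_apply, map_neg]
  simp

/-- One null set of k serves all p at once, so that integrals over p at fixed k respect the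
symmetry. -/
theorem borelStep_neg {a b : E3 → C3} {U : ℝ → E3 → C3} (ha : HermitianSymm a)
    (hb : HermitianSymm b) (hU : ∀ᵐ k : E3, ∀ p, U p (-k) = conj3 (U p k)) :
    ∀ᵐ k : E3, ∀ p, borelStep a b U p (-k) = conj3 (borelStep a b U p k) := by
  filter_upwards [hb] with k hk p
  simp only [borelStep, norm_neg, hk, borelSource_neg ha hU, map_add, conj3_smul,
    Complex.conj_ofReal, ← ContinuousLinearEquiv.integral_comp_comm]

theorem integrable_borelKernel_smul {α κ C : ℝ} (hα : 0 < α) (hκ : 0 ≤ κ) {x y : ℝ}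
    {r : ℝ → C3} (hrm : Measurable r)
    (hr : ∀ p, 0 < p → ‖r p‖ ≤ C * (x * borelProfile α p + y * Real.exp (α * p))) (p : ℝ) :
    Integrable fun p' => (borelKernel κ p p' : ℂ) • r p' := by
  rcases le_or_gt p 0 with hp | hp
  · have : ∀ p', borelKernel κ p p' = 0 := fun p' =>
      borelKernel_of_not fun h => by linarith [h.1, h.2]
    simp [this]
  have hm : Measurable fun p' => (borelKernel κ p p' : ℂ) • r p' :=
    (Complex.measurable_ofReal.comp (measurable_borelKernel.comp
      (measurable_const.prodMk (measurable_const.prodMk measurable_id)))).smul hrm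
  have i3 : IntegrableOn (fun s => x * borelProfile α s + y * Real.exp (α * s)) (Icc 0 p) :=
    ((integrableOn_borelProfile hα.le hp.le).const_mul x).add
      (Continuous.integrableOn_Icc (by fun_prop))
  have h : IntegrableOn (fun p' => (borelKernel κ p p' : ℂ) • r p') (Ioc 0 p) := by
    refine Integrable.mono' ((i3.mono_set Ioc_subset_Icc_self).const_mul C)
      hm.aestronglyMeasurable ((ae_restrict_mem measurableSet_Ioc).mono fun s hs => ?_)
    rw [norm_smul, Complex.norm_real]
    exact (mul_le_of_le_one_left (norm_nonneg _) (abs_borelKernel_le_one hκ p s)).trans (hr s hs.1)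
  refine (integrableOn_iff_integrable_of_support_subset fun s hs => ?_).1 h
  by_contra hs'
  exact hs (by simp only; rw [borelKernel_of_not fun h => hs' ⟨h.1, h.2.le⟩]; simp)

theorem measurable_borelSource_left {a : E3 → C3} {U : ℝ → E3 → C3} (ha : Measurable a)
    (hU : Measurable fun x : ℝ × E3 => U x.1 x.2) (k : E3) :
    Measurable fun p => borelSource a U p k := by
  have h := (measurable_borelSource ha hU).comp (measurable_prodMk_right (y := k))
  exact h

/-- The homogeneous part cancels and the Duhamel bound applies with x = 2Ad, y = 8ρd. Its prefactor
(π/2) `supG` `constC0 μ` is `constC2 μ`/4, the bounds 1/(2√α) and 1/α replace the p-dependent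
factors, and the kernel's 1/√p restores the profile. -/
theorem borelStep_sub_le {μ β α ρ A d : ℝ} {a b : E3 → C3} {U V : ℝ → E3 → C3}
    (hμ : 3 < μ) (hβ : 0 ≤ β) (hα : 0 < α) (ham : Measurable a) (hA : 0 ≤ A)
    (ha : ∀ k, ‖a k‖ ≤ A / weight μ β k)
    (hU : BorelBounded μ β α ρ U) (hV : BorelBounded μ β α ρ V)
    (hd : ∀ p k, ‖U p k - V p k‖ ≤ d * (borelProfile α p / weight μ β k)) (p : ℝ) (k : E3) :
    ‖borelStep a b U p k - borelStep a b V p k‖ ≤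
      constC2 μ / 4 * (3 * A / √α + 8 * ρ / α) * d * (borelProfile α p / weight μ β k) := by
  have hD := hU.sub hV hd
  have hρ := hU.nonneg
  have hd0 := hD.nonneg
  have hC0 := constC0_pos hμ
  have hw := weight_pos μ β k
  have hpi := Real.pi_pos
  have hS := supG_nonneg
  have hmU := measurable_borelSource_left ham hU.measurable k
  have hmV := measurable_borelSource_left ham hV.measurable k
  have iU := integrable_borelKernel_smul hα (norm_nonneg k) hmU
    (fun p _ => hU.norm_borelSource_le hμ hβ hA ha p k) p
  have iV := integrable_borelKernel_smul hα (norm_nonneg k) hmV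
    (fun p _ => hV.norm_borelSource_le hμ hβ hA ha p k) p
  have e : borelStep a b U p k - borelStep a b V p k =
      ∫ p', (borelKernel ‖k‖ p p' : ℂ) • (borelSource a U p' k - borelSource a V p' k) := by
    simp only [borelStep, add_sub_add_left_eq_sub, smul_sub]
    rw [integral_sub iU iV]
  rw [e]
  have hb := norm_integral_borelKernel_le (x := 2 * A * d) (y := 8 * ρ * d)
    (C := constC0 μ / weight μ β k)
    (r := fun p => borelSource a U p k - borelSource a V p k) hα
    (norm_nonneg k) (by positivity) (by positivity) (by positivity)
    (fun p' _ => (hU.norm_borelSource_sub_le hV hD hμ hβ ham hA ha p' k).trans_eq (by ring)) p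
  refine hb.trans ?_
  rcases le_or_gt p 0 with hp | hp
  · simp [Real.sqrt_eq_zero_of_nonpos hp, borelProfile]
  have h1 := sqrt_div_one_add_le hα hp.le
  have h2 := integral_exp_mul_le (p := p) hα
  have hs : 0 < √p := Real.sqrt_pos.2 hp
  have hsα : 0 < √α := Real.sqrt_pos.2 hα
  calc _ ≤ Real.pi / 2 * supG * (constC0 μ / weight μ β k) / √p *
        (3 * (2 * A * d) * (1 / (2 * √α)) * Real.exp (α * p) +
          8 * ρ * d * (Real.exp (α * p) / α)) := by gcongr
    _ = _ := by
        unfold constC2 borelProfile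
        field_simp
        ring

theorem borelStep_zero (a b : E3 → C3) (p : ℝ) (k : E3) :
    borelStep a b (fun _ _ => 0) p k = (borelHom ‖k‖ p : ℂ) • b k := by
  have : ∀ p k, borelSource a (fun _ _ => 0) p k = 0 := fun p k => by
    have h0 : kdot k 0 = 0 := by rw [← kdotL_apply, map_zero]
    simp only [borelSource, sourceIntegrand, smul_zero, h0, zero_smul, add_zero, integral_zero,
      ← projL_apply, map_zero, neg_zero]
  simp [borelStep, this]

/-- The chain is 2√(αp) ≤ 1 + αp ≤ e^{αp}. It lets a bounded datum be measured in the singular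
profile. -/
theorem one_le_borelProfile {α p : ℝ} (hα : 0 < α) (hp : 0 < p) :
    1 ≤ borelProfile α p / (2 * √α) := by
  have hs : 0 < √p := Real.sqrt_pos.2 hp
  have hsα : 0 < √α := Real.sqrt_pos.2 hα
  unfold borelProfile
  rw [div_div, le_div_iff₀ (by positivity), one_mul]
  have h1 := Real.add_one_le_exp (α * p)
  have h2 : α * p = (√α * √p) ^ 2 := by
    rw [mul_pow, Real.sq_sqrt hα.le, Real.sq_sqrt hp.le]
  nlinarith [sq_nonneg (√α * √p - 1)]

theorem exists_borel_solution {μ β α A B : ℝ} {a b : E3 → C3}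
    (hμ : 3 < μ) (hβ : 0 ≤ β) (hα : 0 < α) (ham : Measurable a) (hbm : Measurable b)
    (hA : 0 ≤ A) (hB : 0 ≤ B)
    (ha : ∀ k, ‖a k‖ ≤ A / weight μ β k) (hb : ∀ k, ‖b k‖ ≤ B / weight μ β k)
    (hcond : constC2 μ / 4 * (3 * A / √α + 8 * (B / √α) / α) ≤ 1 / 2) :
    ∃ U, BorelBounded μ β α (B / √α) U ∧ (∀ p k, U p k = borelStep a b U p k) ∧
      (HermitianSymm a → HermitianSymm b → ∀ᵐ k : E3, ∀ p, U p (-k) = conj3 (U p k)) := by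
  -- By `one_le_borelProfile` the inhomogeneous term has size at most B/(2√α) = ρ/2. The contraction
  -- factor 1/2 applied to U and 0 supplies the other half, so the ball of radius ρ is mapped to
  -- itself.
  set ρ := B / √α with hρ
  have hρ0 : 0 ≤ ρ := by positivity
  have hsα : 0 < √α := Real.sqrt_pos.2 hα
  -- Symmetry is put into the invariant set as an implication, so that one fixed point serves real
  -- and complex data alike.
  set S : Set (ℝ × E3 → C3) := {u | BorelBounded μ β α ρ (fun p k => u (p, k)) ∧
    (HermitianSymm a → HermitianSymm b → ∀ᵐ k : E3, ∀ p, u (p, -k) = conj3 (u (p, k)))} with hS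
  have hlip : ∀ u v : ℝ × E3 → C3, BorelBounded μ β α ρ (fun p k => u (p, k)) →
      BorelBounded μ β α ρ (fun p k => v (p, k)) → ∀ d : ℝ,
      (∀ x : ℝ × E3, ‖u x - v x‖ ≤ d * (borelProfile α x.1 / weight μ β x.2)) → ∀ x : ℝ × E3,
      ‖borelStep a b (fun p k => u (p, k)) x.1 x.2 - borelStep a b (fun p k => v (p, k)) x.1 x.2‖ ≤
        d / 2 * (borelProfile α x.1 / weight μ β x.2) := fun u v hu hv d hd x => by
    have h := borelStep_sub_le (b := b) hμ hβ hα ham hA ha hu hv (fun p k => hd (p, k)) x.1 x.2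
    have hd0 := (hu.sub hv (fun p k => hd (p, k))).nonneg
    have h1 : 0 ≤ borelProfile α x.1 / weight μ β x.2 :=
      div_nonneg (borelProfile_nonneg _ _) (weight_pos _ _ _).le
    refine h.trans (mul_le_mul_of_nonneg_right ?_ h1)
    nlinarith
  have hzero : BorelBounded μ β α ρ (fun _ _ => 0) := ⟨measurable_const, fun p k => by
    rw [norm_zero]
    exact mul_nonneg hρ0 (div_nonneg (borelProfile_nonneg _ _) (weight_pos _ _ _).le)⟩
  suffices h : ∃ u ∈ S, (fun x : ℝ × E3 => borelStep a b (fun p k => u (p, k)) x.1 x.2) = u by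
    obtain ⟨u, hu, hfix⟩ := h
    exact ⟨fun p k => u (p, k), hu.1, fun p k => (congrFun hfix (p, k)).symm, hu.2⟩
  refine exists_fixed_point_of_dominated (S := S) (ρ := ρ)
    (g := fun x : ℝ × E3 => borelProfile α x.1 / weight μ β x.2)
    (T := fun u x => borelStep a b (fun p k => u (p, k)) x.1 x.2)
    ⟨fun _ => 0, hzero, fun _ _ => Eventually.of_forall fun k p => by simp⟩
    (fun u hu => ⟨⟨measurable_borelStep ham hbm hu.1.measurable, fun p k => ?_⟩,
      fun h1 h2 => borelStep_neg h1 h2 (hu.2 h1 h2)⟩)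
    (fun u hu x => hu.1.bound x.1 x.2)
    (fun u v hu hv => ⟨⟨?_, fun p k => ?_⟩, fun h1 h2 => ?_⟩)
    (fun u hu v hv d hd => hlip u v hu.1 hv.1 d hd)
  · have h := hlip u (fun _ => 0) hu.1 hzero ρ
      (fun x => by simpa using hu.1.bound x.1 x.2) (p, k)
    simp only [borelStep_zero] at h
    have h1 : ‖(borelHom ‖k‖ p : ℂ) • b k‖ ≤ ρ / 2 * (borelProfile α p / weight μ β k) := by
      rcases le_or_gt p 0 with hp | hp
      · simp [borelHom_of_nonpos hp, borelProfile_of_nonpos hp]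
      rw [norm_smul, Complex.norm_real]
      have hw := weight_pos μ β k
      calc _ ≤ 1 * (B / weight μ β k) := mul_le_mul (abs_borelHom_le (norm_nonneg k) p) (hb k)
            (norm_nonneg _) zero_le_one
        _ ≤ (borelProfile α p / (2 * √α)) * (B / weight μ β k) := by
            gcongr
            exact one_le_borelProfile hα hp
        _ = _ := by rw [hρ]; field_simp
    calc _ ≤ ‖borelStep a b (fun p k => u (p, k)) p k - (borelHom ‖k‖ p : ℂ) • b k‖ +
          ‖(borelHom ‖k‖ p : ℂ) • b k‖ := by
            simpa using norm_add_le (borelStep a b (fun p k => u (p, k)) p k -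
              (borelHom ‖k‖ p : ℂ) • b k) ((borelHom ‖k‖ p : ℂ) • b k)
      _ ≤ _ := (add_le_add h h1).trans_eq (by ring)
  · exact measurable_of_tendsto_metrizable (fun n => (hu n).1.measurable)
      (tendsto_pi_nhds.2 fun x => hv x)
  · exact le_of_tendsto (hv (p, k)).norm (Eventually.of_forall fun n => (hu n).1.bound p k)
  · have : ∀ᵐ k : E3, ∀ n p, u n (p, -k) = conj3 (u n (p, k)) :=
      ae_all_iff.2 fun n => (hu n).2 h1 h2
    filter_upwards [this] with k hk p
    exact tendsto_nhds_unique (hv (p, -k))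
      (((conj3.continuous.tendsto _).comp (hv (p, k))).congr fun n => (hk n p).symm)

/-- Solutions of the Borel equation are bounded near `p = 0`. -/
theorem BorelBounded.exp_bound {μ β α ρ A B : ℝ} {a b : E3 → C3} {U : ℝ → E3 → C3}
    (hU : BorelBounded μ β α ρ U) (hμ : 3 < μ) (hβ : 0 ≤ β) (hα : 0 < α)
    (hA : 0 ≤ A) (ha : ∀ k, ‖a k‖ ≤ A / weight μ β k) (hb : ∀ k, ‖b k‖ ≤ B / weight μ β k)
    (hB : 0 ≤ B) (hfix : ∀ p k, U p k = borelStep a b U p k) :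
    ∃ C, 0 ≤ C ∧ ∀ p k, ‖U p k‖ ≤ C * Real.exp (α * p) / weight μ β k := by
  have hρ := hU.nonneg
  have hC0 := constC0_pos hμ
  have hpi := Real.pi_pos
  have hS := supG_nonneg
  have hsα : 0 < √α := Real.sqrt_pos.2 hα
  refine ⟨B + Real.pi / 2 * supG * constC0 μ * (6 * A * ρ + 4 * ρ ^ 2 / √α), by positivity,
    fun p k => ?_⟩
  have hw := weight_pos μ β k
  rcases le_or_gt p 0 with hp | hp
  · have := hU.bound p k
    rw [borelProfile_of_nonpos hp, zero_div, mul_zero] at this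
    exact this.trans (by positivity)
  have hs : 0 < √p := Real.sqrt_pos.2 hp
  have h1 := norm_integral_borelKernel_le (x := 2 * A * ρ) (y := 4 * ρ ^ 2)
    (C := constC0 μ / weight μ β k)
    (r := fun p => borelSource a U p k) hα
    (norm_nonneg k) (by positivity) (by positivity) (by positivity)
    (fun p' _ => (hU.norm_borelSource_le hμ hβ hA ha p' k).trans_eq (by ring)) p
  have h2 : ‖(borelHom ‖k‖ p : ℂ) • b k‖ ≤ B * Real.exp (α * p) / weight μ β k := by
    rw [norm_smul, Complex.norm_real]
    calc _ ≤ 1 * (B / weight μ β k) := mul_le_mul (abs_borelHom_le (norm_nonneg k) p) (hb k)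
            (norm_nonneg _) zero_le_one
      _ ≤ Real.exp (α * p) * (B / weight μ β k) := by
          gcongr
          exact Real.one_le_exp (by positivity)
      _ = _ := by ring
  -- For αp ≤ 1 the integral is at most p e^{αp} with p ≤ √p/√α; for αp > 1 it is at most e^{αp}/α
  -- with 1/α ≤ √p/√α. The factor √p cancels the kernel's 1/√p.
  have h3 : ∫ s in (0 : ℝ)..p, Real.exp (α * s) ≤ √p / √α * Real.exp (α * p) := by
    rcases le_or_gt (α * p) 1 with h | h
    · have hle : ∫ s in (0 : ℝ)..p, Real.exp (α * s) ≤ ∫ s in (0 : ℝ)..p, Real.exp (α * p) := by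
        refine intervalIntegral.integral_mono_on hp.le (Continuous.intervalIntegrable (by fun_prop) _ _)
          (by simp) fun s hs => ?_
        have := hs.2
        gcongr
      refine hle.trans ?_
      rw [intervalIntegral.integral_const, smul_eq_mul, sub_zero]
      gcongr
      rw [le_div_iff₀ hsα]
      have h4 : √α * √p ≤ 1 := by
        rw [← Real.sqrt_mul hα.le]; exact Real.sqrt_le_one.2 h
      nlinarith [Real.mul_self_sqrt hp.le]
    · refine (integral_exp_mul_le hα).trans ?_
      rw [div_eq_inv_mul]
      gcongr
      rw [inv_eq_one_div, div_le_div_iff₀ hα hsα, one_mul]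
      have h4 : 1 ≤ √α * √p := by
        rw [← Real.sqrt_mul hα.le]; exact Real.one_le_sqrt.2 h.le
      nlinarith [Real.mul_self_sqrt hα.le]
  have h4 : √p / (1 + α * p) ≤ √p := div_le_self hs.le (by nlinarith)
  rw [hfix]
  calc _ ≤ B * Real.exp (α * p) / weight μ β k +
        Real.pi / 2 * supG * (constC0 μ / weight μ β k) / √p *
          (3 * (2 * A * ρ) * √p * Real.exp (α * p) + 4 * ρ ^ 2 * (√p / √α * Real.exp (α * p))) := by
          refine (norm_add_le _ _).trans (add_le_add h2 (h1.trans ?_))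
          gcongr
    _ = _ := by field_simp; ring

end

end NSBorel

namespace NSBorel
open MeasureTheory Set Filter Topology

/-! ### Laplace transform of the Borel solution -/

noncomputable section

/-- `U` is measurable, vanishes for `p ≤ 0` and `‖U(p,·)‖_{μ,β} ≤ C e^{αp}`. -/
structure ExpBounded (μ β α C : ℝ) (U : ℝ → E3 → C3) : Prop where
  measurable : Measurable fun x : ℝ × E3 => U x.1 x.2
  zero : ∀ p, p ≤ 0 → ∀ k, U p k = 0
  bound : ∀ p k, ‖U p k‖ ≤ C * Real.exp (α * p) / weight μ β k

/-- The moments `∫₀^∞ pⁿ e^{-pτ} U(p,k) dp`. -/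
def laplaceMoment (n : ℕ) (U : ℝ → E3 → C3) (τ : ℂ) (k : E3) : C3 :=
  ∫ p : ℝ, (Complex.exp (-(p : ℂ) * τ) * (p : ℂ) ^ n) • U p k

namespace ExpBounded

variable {μ β α C : ℝ} {U : ℝ → E3 → C3}

theorem nonneg (hU : ExpBounded μ β α C U) : 0 ≤ C := by
  have h1 := (norm_nonneg _).trans (hU.bound 0 0)
  rw [mul_zero, Real.exp_zero, mul_one] at h1
  by_contra h
  exact absurd h1 (not_le.2 (div_neg_of_neg_of_pos (not_le.1 h) (weight_pos μ β 0)))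

theorem measurable_right (hU : ExpBounded μ β α C U) (k : E3) : Measurable fun p => U p k :=
  hU.measurable.comp measurable_prodMk_right

theorem norm_moment_integrand_le (hU : ExpBounded μ β α C U) (n : ℕ) (τ : ℂ) (p : ℝ) (k : E3) :
    ‖(Complex.exp (-(p : ℂ) * τ) * (p : ℂ) ^ n) • U p k‖ ≤ C / weight μ β k *
      (Ioi 0).indicator (fun p : ℝ => p ^ n * Real.exp (-((τ.re - α) * p))) p := by
  by_cases hp : 0 < p
  · rw [indicator_of_mem (show p ∈ Ioi (0 : ℝ) from hp), norm_smul, norm_mul, norm_exp_neg_mul,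
      norm_pow, Complex.norm_real, Real.norm_of_nonneg hp.le]
    calc _ ≤ Real.exp (-(τ.re * p)) * p ^ n * (C * Real.exp (α * p) / weight μ β k) := by
          gcongr; exact hU.bound p k
      _ = _ := by
          rw [show -((τ.re - α) * p) = -(τ.re * p) + α * p by ring, Real.exp_add]; ring
  · rw [hU.zero p (not_lt.1 hp), smul_zero, norm_zero,
      indicator_of_notMem (show p ∉ Ioi (0 : ℝ) from hp), mul_zero]

theorem integrable_indicator_pow (n : ℕ) {a : ℝ} (ha : 0 < a) :
    Integrable ((Ioi 0).indicator fun p : ℝ => p ^ n * Real.exp (-(a * p))) :=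
  (integrable_indicator_iff measurableSet_Ioi).2 (integrableOn_pow_mul_exp_neg n ha)

theorem integrable_moment (hU : ExpBounded μ β α C U) (n : ℕ) {τ : ℂ} (hτ : α < τ.re) (k : E3) :
    Integrable fun p : ℝ => (Complex.exp (-(p : ℂ) * τ) * (p : ℂ) ^ n) • U p k := by
  refine ((integrable_indicator_pow n (sub_pos.2 hτ)).const_mul (C / weight μ β k)).mono' ?_
    (Eventually.of_forall fun p => hU.norm_moment_integrand_le n τ p k)
  have he : Measurable fun p : ℝ => Complex.exp (-(p : ℂ) * τ) * (p : ℂ) ^ n := by fun_prop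
  exact (he.smul (hU.measurable_right k)).aestronglyMeasurable

theorem integrable_exp (hU : ExpBounded μ β α C U) {τ : ℂ} (hτ : α < τ.re) (k : E3) :
    Integrable fun p : ℝ => Complex.exp (-(p : ℂ) * τ) • U p k := by
  simpa using hU.integrable_moment 0 hτ k

theorem norm_laplaceMoment_le (hU : ExpBounded μ β α C U) (n : ℕ) {τ : ℂ} (hτ : α < τ.re) (k : E3) :
    ‖laplaceMoment n U τ k‖ ≤ C / weight μ β k *
      ∫ p in Ioi (0 : ℝ), p ^ n * Real.exp (-((τ.re - α) * p)) := by
  rw [← integral_indicator measurableSet_Ioi, ← integral_const_mul]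
  exact norm_integral_le_of_norm_le ((integrable_indicator_pow n (sub_pos.2 hτ)).const_mul _)
    (Eventually.of_forall fun p => hU.norm_moment_integrand_le n τ p k)

theorem norm_laplaceMoment_zero_le (hU : ExpBounded μ β α C U) {τ : ℂ} (hτ : α < τ.re) (k : E3) :
    ‖laplaceMoment 0 U τ k‖ ≤ C / (τ.re - α) / weight μ β k := by
  have := hU.norm_laplaceMoment_le 0 hτ k
  simp only [pow_zero, one_mul, integral_exp_neg_mul_Ioi (sub_pos.2 hτ)] at this
  exact this.trans_eq (by ring)

theorem norm_laplaceMoment_one_le (hU : ExpBounded μ β α C U) {τ : ℂ} (hτ : α < τ.re) (k : E3) :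
    ‖laplaceMoment 1 U τ k‖ ≤ C / (τ.re - α) ^ 2 / weight μ β k := by
  have := hU.norm_laplaceMoment_le 1 hτ k
  simp only [pow_one, integral_mul_exp_neg_mul_Ioi (sub_pos.2 hτ)] at this
  exact this.trans_eq (by rw [inv_pow]; ring)

theorem measurable_laplaceMoment (hU : ExpBounded μ β α C U) (n : ℕ) (τ : ℂ) :
    Measurable (laplaceMoment n U τ) := by
  have he : Measurable fun x : E3 × ℝ => Complex.exp (-(x.2 : ℂ) * τ) * (x.2 : ℂ) ^ n := by fun_prop
  have h := he.smul (hU.measurable.comp (measurable_snd.prodMk measurable_fst))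
  exact (StronglyMeasurable.integral_prod_right' h.stronglyMeasurable).measurable

/-- Taylor's formula for e^{-pη} to second order, with remainder (p‖η‖)² e^{p‖η‖}. Restricting η to
half the gap Re τ - α leaves the other half as decay. Since K is independent of k, the same bound
gives the derivative pointwise and in the weighted sup norm. -/
theorem laplaceMoment_remainder (hU : ExpBounded μ β α C U) {τ : ℂ} (hτ : α < τ.re) :
    ∃ K, 0 ≤ K ∧ ∀ η : ℂ, ‖η‖ ≤ (τ.re - α) / 2 → ∀ k,
      ‖laplaceMoment 0 U (τ + η) k - laplaceMoment 0 U τ k - η • (-laplaceMoment 1 U τ k)‖ ≤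
        K * ‖η‖ ^ 2 / weight μ β k := by
  have hC := hU.nonneg
  have hpos : 0 < (τ.re - α) / 2 := by linarith
  refine ⟨C * ∫ p in Ioi (0 : ℝ), p ^ 2 * Real.exp (-((τ.re - α) / 2 * p)),
    mul_nonneg hC (setIntegral_nonneg measurableSet_Ioi fun p hp => by positivity),
    fun η hη k => ?_⟩
  have hτη : α < (τ + η).re := by
    have := (abs_le.1 (Complex.abs_re_le_norm η)).1
    rw [Complex.add_re]; linarith
  have e : laplaceMoment 0 U (τ + η) k - laplaceMoment 0 U τ k - η • (-laplaceMoment 1 U τ k) =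
      ∫ p : ℝ, (Complex.exp (-(p : ℂ) * τ) *
        (Complex.exp (-(p : ℂ) * η) - ∑ m ∈ Finset.range 2, (-(p : ℂ) * η) ^ m / m.factorial)) •
          U p k := by
    have i1 := hU.integrable_moment 0 hτη k
    have i2 := hU.integrable_moment 0 hτ k
    have i3 := (hU.integrable_moment 1 hτ k).fun_smul η
    have i12 : Integrable fun p : ℝ => (Complex.exp (-(p : ℂ) * (τ + η)) * (p : ℂ) ^ 0) • U p k -
      (Complex.exp (-(p : ℂ) * τ) * (p : ℂ) ^ 0) • U p k := i1.sub i2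
    unfold laplaceMoment
    rw [smul_neg, sub_neg_eq_add, ← integral_smul, ← integral_sub i1 i2, ← integral_add i12 i3]
    refine integral_congr_ae (Eventually.of_forall fun p => ?_)
    simp only [smul_smul, ← sub_smul, ← add_smul]
    congr 1
    rw [mul_add, Complex.exp_add]
    simp [Finset.sum_range_succ]
    ring
  rw [e, ← integral_indicator measurableSet_Ioi]
  calc _ ≤ ∫ p : ℝ, C / weight μ β k * ‖η‖ ^ 2 * (Ioi 0).indicator
        (fun p : ℝ => p ^ 2 * Real.exp (-((τ.re - α) / 2 * p))) p := by
        refine norm_integral_le_of_norm_le ((integrable_indicator_pow 2 hpos).const_mul _)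
          (Eventually.of_forall fun p => ?_)
        by_cases hp : 0 < p
        · rw [indicator_of_mem (show p ∈ Ioi (0 : ℝ) from hp), norm_smul, norm_mul, norm_exp_neg_mul]
          have h1 := Complex.norm_exp_sub_sum_le_norm_mul_exp (-(p : ℂ) * η) 2
          have h2 : ‖-(p : ℂ) * η‖ = p * ‖η‖ := by
            rw [norm_mul, norm_neg, Complex.norm_real, Real.norm_of_nonneg hp.le]
          rw [h2] at h1
          calc _ ≤ Real.exp (-(τ.re * p)) * ((p * ‖η‖) ^ 2 * Real.exp (p * ((τ.re - α) / 2))) *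
                (C * Real.exp (α * p) / weight μ β k) := by
                gcongr
                · exact h1.trans (by gcongr)
                · exact hU.bound p k
            _ = C / weight μ β k * ‖η‖ ^ 2 * (p ^ 2 * (Real.exp (-(τ.re * p)) *
                Real.exp (p * ((τ.re - α) / 2)) * Real.exp (α * p))) := by ring
            _ = _ := by
                rw [← Real.exp_add, ← Real.exp_add]
                congr 4
                ring
        · rw [hU.zero p (not_lt.1 hp), smul_zero, norm_zero,
            indicator_of_notMem (show p ∉ Ioi (0 : ℝ) from hp), mul_zero]
    _ = _ := by rw [integral_const_mul]; ring

end ExpBounded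

theorem hasDerivAt_of_quadratic_remainder {E : Type*} [NormedAddCommGroup E] [NormedSpace ℂ E]
    {f : ℂ → E} {f' : E} {τ : ℂ} {ε K : ℝ} (hε : 0 < ε)
    (h : ∀ η : ℂ, ‖η‖ ≤ ε → ‖f (τ + η) - f τ - η • f'‖ ≤ K * ‖η‖ ^ 2) : HasDerivAt f f' τ := by
  rw [hasDerivAt_iff_isLittleO_nhds_zero]
  have h1 : (fun η : ℂ => f (τ + η) - f τ - η • f') =O[𝓝 0] fun η : ℂ => η ^ 2 := by
    refine Asymptotics.IsBigO.of_bound K ?_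
    filter_upwards [Metric.closedBall_mem_nhds (0 : ℂ) hε] with η hη
    rw [norm_pow]
    exact h η (by simpa using hη)
  refine h1.trans_isLittleO ?_
  simpa using Asymptotics.isLittleO_pow_pow (𝕜 := ℂ) (m := 1) (n := 2) one_lt_two

theorem ExpBounded.hasDerivAt_laplace {μ β α C : ℝ} {U : ℝ → E3 → C3} (hU : ExpBounded μ β α C U)
    {τ : ℂ} (hτ : α < τ.re) (k : E3) :
    HasDerivAt (fun τ => laplaceMoment 0 U τ k) (-laplaceMoment 1 U τ k) τ := by
  obtain ⟨K, hK, h⟩ := hU.laplaceMoment_remainder hτ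
  exact hasDerivAt_of_quadratic_remainder (ε := (τ.re - α) / 2) (K := K / weight μ β k)
    (by linarith) fun η hη => (h η hη k).trans_eq (by ring)

/-- Sup-norm analyticity of the weighted Laplace transform. -/
theorem ExpBounded.exists_lp_laplace {μ β α C : ℝ} {U : ℝ → E3 → C3} (hU : ExpBounded μ β α C U) :
    ∃ F : ℂ → lp (fun _ : E3 => C3) ⊤,
      (∀ τ, α < τ.re → ∀ k, F τ k = ((weight μ β k : ℝ) : ℂ) • laplaceMoment 0 U τ k) ∧
      ∀ τ, α < τ.re → DifferentiableAt ℂ F τ := by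
  have hw : ∀ k (w : C3), ‖((weight μ β k : ℝ) : ℂ) • w‖ = weight μ β k * ‖w‖ := fun k w => by
    rw [norm_smul, Complex.norm_real, Real.norm_of_nonneg (weight_pos μ β k).le]
  have hmem : ∀ g : E3 → C3, ∀ B : ℝ, (∀ k, ‖g k‖ ≤ B / weight μ β k) →
      Memℓp (fun k => ((weight μ β k : ℝ) : ℂ) • g k) ⊤ := fun g B hg => by
    refine memℓp_infty ⟨B, ?_⟩
    rintro _ ⟨k, rfl⟩
    simp only [hw]
    have := hg k
    rwa [le_div_iff₀ (weight_pos μ β k), mul_comm] at this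
  -- Outside the half-plane the moments need not be bounded, and F takes the arbitrary value 0.
  set F : ℂ → lp (fun _ : E3 => C3) ⊤ := fun τ => if h : α < τ.re then
    ⟨_, hmem _ _ (hU.norm_laplaceMoment_zero_le h)⟩ else 0 with hF
  have hFk : ∀ τ, α < τ.re → ∀ k, F τ k = ((weight μ β k : ℝ) : ℂ) • laplaceMoment 0 U τ k :=
    fun τ hτ k => by simp only [hF, dif_pos hτ]
  refine ⟨F, hFk, fun τ hτ => ?_⟩
  set F' : lp (fun _ : E3 => C3) ⊤ :=
    ⟨_, hmem (fun k => -laplaceMoment 1 U τ k) _ fun k => by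
      rw [norm_neg]; exact hU.norm_laplaceMoment_one_le hτ k⟩ with hF'
  obtain ⟨K, hK, h⟩ := hU.laplaceMoment_remainder hτ
  refine (hasDerivAt_of_quadratic_remainder (f' := F') (ε := (τ.re - α) / 2) (K := K)
    (by linarith) fun η hη => ?_).differentiableAt
  have hτη : α < (τ + η).re := by
    have := (abs_le.1 (Complex.abs_re_le_norm η)).1
    rw [Complex.add_re]; linarith
  refine lp.norm_le_of_forall_le (by positivity) fun k => ?_
  have e : (F (τ + η) - F τ - η • F') k = ((weight μ β k : ℝ) : ℂ) •
      (laplaceMoment 0 U (τ + η) k - laplaceMoment 0 U τ k - η • (-laplaceMoment 1 U τ k)) := by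
    rw [lp.coeFn_sub, lp.coeFn_sub, lp.coeFn_smul]
    simp only [Pi.sub_apply, Pi.smul_apply, hFk _ hτη, hFk _ hτ, hF', smul_sub]
    rw [smul_comm]
  rw [e, hw]
  have := h η hη k
  rwa [le_div_iff₀ (weight_pos μ β k), mul_comm] at this

theorem integrable_borelProfile_exp {α σ x y : ℝ} (hσ : α < σ) :
    Integrable ((Ioi 0).indicator fun p : ℝ =>
      Real.exp (-(σ * p)) * (x * borelProfile α p + y * Real.exp (α * p))) := by
  rw [integrable_indicator_iff measurableSet_Ioi]
  have h1 : IntegrableOn (fun p : ℝ => x * (p ^ (-(1 / 2) : ℝ) * Real.exp (-(σ - α) * p ^ (1 : ℝ))) +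
      y * (p ^ 0 * Real.exp (-((σ - α) * p)))) (Ioi 0) :=
    ((integrableOn_rpow_mul_exp_neg_mul_rpow (s := -(1 / 2)) (p := 1) (b := σ - α) (by norm_num)
      one_pos (sub_pos.2 hσ)).const_mul x).add
      ((integrableOn_pow_mul_exp_neg 0 (sub_pos.2 hσ)).const_mul y)
  refine h1.congr_fun (fun p hp => ?_) measurableSet_Ioi
  have hp : 0 < p := hp
  simp only [Real.rpow_one, pow_zero, one_mul]
  rw [borelProfile, Real.rpow_neg hp.le, ← Real.sqrt_eq_rpow,
    show -(σ - α) * p = -(σ * p) + α * p by ring,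
    show -((σ - α) * p) = -(σ * p) + α * p by ring, Real.exp_add]
  ring

/-! ### Laplace transform of the quadratic source -/

variable {μ β α ρ A C : ℝ} {a : E3 → C3} {U : ℝ → E3 → C3}

theorem BorelBounded.sourceIntegrand_of_nonpos (hU : BorelBounded μ β α ρ U) {p : ℝ} (hp : p ≤ 0)
    (k q : E3) : sourceIntegrand a U p k q = 0 := by
  have h0 : ∀ s, s ≤ 0 → ∀ q, U s q = 0 := fun s hs q => by
    have := hU.bound s q
    rw [borelProfile_of_nonpos hs] at this
    simpa using this
  have h1 : ∀ s : ℝ, kdot k (U s q) • U (p - s) (k - q) = 0 := fun s => by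
    rcases le_or_gt s 0 with hs | hs
    · rw [h0 s hs, ← kdotL_apply, map_zero, zero_smul]
    · rw [h0 (p - s) (by linarith), smul_zero]
  simp only [sourceIntegrand, h1, h0 p hp, integral_zero, add_zero, smul_zero, zero_add]
  rw [← kdotL_apply, map_zero, zero_smul]

/-- The convolution in s becomes a product of transforms, which completes the expansion of (a + L)(a
+ L) with L the transform of U. The product a·a is subtracted because it does not belong to the
source; it sits in v̂₁. -/
theorem laplace_sourceIntegrand (hU : ExpBounded μ β α C U) {τ : ℂ} (hτ : α < τ.re) (k q : E3) :
    ∫ p : ℝ, Complex.exp (-(p : ℂ) * τ) • sourceIntegrand a U p k q =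
      kdot k (a q + laplaceMoment 0 U τ q) • (a (k - q) + laplaceMoment 0 U τ (k - q)) -
        kdot k (a q) • a (k - q) := by
  have hI : ∀ q, Integrable fun p : ℝ => Complex.exp (-(p : ℂ) * τ) • U p q := hU.integrable_exp hτ
  have hL : ∀ q, laplaceMoment 0 U τ q = ∫ p : ℝ, Complex.exp (-(p : ℂ) * τ) • U p q := fun q => by
    simp [laplaceMoment]
  set f : ℝ → C3 := fun s => Complex.exp (-(s : ℂ) * τ) • U s q with hf
  set g : ℝ → C3 := fun s => Complex.exp (-(s : ℂ) * τ) • U s (k - q) with hg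
  have hconv : ∀ p : ℝ, Complex.exp (-(p : ℂ) * τ) • ∫ s : ℝ, kdot k (U s q) • U (p - s) (k - q) =
      convolution f g (kbil k) volume p := fun p => by
    rw [convolution, ← integral_smul]
    refine integral_congr_ae (Eventually.of_forall fun s => ?_)
    simp only [hf, hg, kbil_apply, map_smul, smul_apply, smul_smul]
    rw [← mul_assoc, ← Complex.exp_add]
    congr 3
    push_cast
    ring
  have i1 : Integrable fun p : ℝ => kdot k (a q) • g p := (hI (k - q)).fun_smul _
  have i2 : Integrable fun p : ℝ => kdot k (f p) • a (k - q) := by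
    have := ((kdotL k).integrable_comp (hI q)).smul_const (a (k - q))
    simpa only [kdotL_apply] using this
  have i3 : Integrable (convolution f g (kbil k) volume) :=
    Integrable.integrable_convolution (kbil k) (hI q) (hI (k - q))
  have e : ∀ p : ℝ, Complex.exp (-(p : ℂ) * τ) • sourceIntegrand a U p k q =
      kdot k (a q) • g p + kdot k (f p) • a (k - q) + convolution f g (kbil k) volume p := fun p => by
    rw [← hconv, sourceIntegrand, smul_add, smul_add]
    congr 2
    · rw [hg, smul_comm]
    · simp only [hf]
      rw [← kdotL_apply, ← kdotL_apply, map_smul, smul_eq_mul, smul_smul]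
  simp only [e]
  have i12 : Integrable fun p => kdot k (a q) • g p + kdot k (f p) • a (k - q) := i1.add i2
  rw [integral_add i12 i3, integral_add i1 i2, integral_smul, integral_smul_const,
    integral_convolution (kbil k) (hI q) (hI (k - q)), kbil_apply, ← hL, hL q]
  have : ∫ p, kdot k (f p) = kdot k (∫ p, f p) := by
    simp only [← kdotL_apply]
    exact (kdotL k).integral_comp_comm (hI q)
  rw [this]
  have hadd : ∀ w w' : C3, kdot k (w + w') = kdot k w + kdot k w' := fun w w' => by
    simp only [← kdotL_apply, map_add]
  rw [hadd, add_smul, smul_add, smul_add]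
  abel

/-- The transform in p is exchanged with the integral over q by domination with a product of the
profile in p and the weights in q. P_k, being linear and bounded for fixed k, passes through the
integral. -/
theorem laplace_borelSource (hB : BorelBounded μ β α ρ U) (hU : ExpBounded μ β α C U)
    (hμ : 3 < μ) (hβ : 0 ≤ β) (ham : Measurable a) (hA : 0 ≤ A)
    (ha : ∀ k, ‖a k‖ ≤ A / weight μ β k) {τ : ℂ} (hτ : α < τ.re) (k : E3) :
    ∫ p : ℝ, Complex.exp (-(p : ℂ) * τ) • borelSource a U p k =
      nonlin (fun k => a k + laplaceMoment 0 U τ k) (fun k => a k + laplaceMoment 0 U τ k) k -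
        nonlin a a k := by
  have hC := hU.nonneg
  have hv : ∀ k, ‖a k + laplaceMoment 0 U τ k‖ ≤ (A + C / (τ.re - α)) / weight μ β k := fun k =>
    (norm_add_le _ _).trans ((add_le_add (ha k) (hU.norm_laplaceMoment_zero_le hτ k)).trans_eq
      (add_div _ _ _).symm)
  have hvm : Measurable fun k => a k + laplaceMoment 0 U τ k :=
    ham.add (hU.measurable_laplaceMoment 0 τ)
  have hσ : 0 < τ.re - α := sub_pos.2 hτ
  have i1 := integrable_kconv hμ hβ hvm hvm (by positivity)
    (Eventually.of_forall hv) (Eventually.of_forall hv) k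
  have i2 := integrable_kconv hμ hβ ham ham hA
    (Eventually.of_forall ha) (Eventually.of_forall ha) k
  have hint : Integrable (Function.uncurry fun (p : ℝ) (q : E3) =>
      Complex.exp (-(p : ℂ) * τ) • sourceIntegrand a U p k q) (volume.prod volume) := by
    have hm0 := (measurable_sourceIntegrand ham hU.measurable).comp
      (((measurable_fst (α := ℝ) (β := E3)).prodMk (measurable_const (a := k))).prodMk
        measurable_snd)
    have hg := (integrable_borelProfile_exp (x := 2 * A * ρ) (y := 4 * ρ ^ 2) hτ).mul_prod
      ((integrable_weight_conv hμ hβ k).const_mul ‖k‖)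
    refine hg.mono' ?_ (Eventually.of_forall fun x => ?_)
    · have he : Measurable fun x : ℝ × E3 => Complex.exp (-(x.1 : ℂ) * τ) := by fun_prop
      exact (he.smul hm0).aestronglyMeasurable
    · obtain ⟨p, q⟩ := x
      simp only [Function.uncurry]
      by_cases hp : 0 < p
      · rw [indicator_of_mem (show p ∈ Ioi (0 : ℝ) from hp), norm_smul, norm_exp_neg_mul]
        calc _ ≤ Real.exp (-(τ.re * p)) * (‖k‖ * (2 * A * ρ * borelProfile α p +
              4 * ρ ^ 2 * Real.exp (α * p)) * ((weight μ β q)⁻¹ * (weight μ β (k - q))⁻¹)) := by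
              gcongr; exact hB.norm_sourceIntegrand_le hA ha p k q
          _ = _ := by ring
      · rw [hB.sourceIntegrand_of_nonpos (not_lt.1 hp), smul_zero, norm_zero,
          indicator_of_notMem (show p ∉ Ioi (0 : ℝ) from hp), zero_mul]
  have hswap : ∫ p : ℝ, Complex.exp (-(p : ℂ) * τ) • ∫ q, sourceIntegrand a U p k q =
      kconv (fun k => a k + laplaceMoment 0 U τ k) (fun k => a k + laplaceMoment 0 U τ k) k -
        kconv a a k := by
    simp only [← integral_smul]
    rw [integral_integral_swap hint]
    simp only [laplace_sourceIntegrand hU hτ]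
    rw [integral_sub i1 i2]
    rfl
  have hi : Integrable fun p : ℝ => Complex.exp (-(p : ℂ) * τ) • ∫ q, sourceIntegrand a U p k q := by
    simp only [← integral_smul]
    exact hint.integral_prod_left
  set T : C3 →L[ℂ] C3 := -(Complex.I • projL k) with hT
  have e : ∀ p : ℝ, Complex.exp (-(p : ℂ) * τ) • borelSource a U p k =
      T (Complex.exp (-(p : ℂ) * τ) • ∫ q, sourceIntegrand a U p k q) := fun p => by
    rw [map_smul]
    simp [hT, borelSource, projL_apply]
  simp only [e]
  rw [T.integral_comp_comm hi, hswap, map_sub]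
  simp [hT, nonlin, projL_apply]

theorem BorelBounded.integrable_exp_borelSource (hB : BorelBounded μ β α ρ U)
    (hμ : 3 < μ) (hβ : 0 ≤ β) (ham : Measurable a) (hA : 0 ≤ A)
    (ha : ∀ k, ‖a k‖ ≤ A / weight μ β k) {s : ℝ} (hs : α < s) (k : E3) :
    Integrable fun p : ℝ => Real.exp (-(s * p)) * ‖borelSource a U p k‖ := by
  have hm := measurable_borelSource_left ham hB.measurable k
  have hC0 := constC0_pos hμ
  have he : Measurable fun p : ℝ => Real.exp (-(s * p)) := by fun_prop
  refine ((integrable_borelProfile_exp (x := 2 * A * ρ) (y := 4 * ρ ^ 2) hs).const_mul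
    (‖k‖ * constC0 μ / weight μ β k)).mono' (he.mul hm.norm).aestronglyMeasurable
    (Eventually.of_forall fun p => ?_)
  rw [Real.norm_of_nonneg (by positivity)]
  by_cases hp : 0 < p
  · rw [indicator_of_mem (show p ∈ Ioi (0 : ℝ) from hp)]
    calc _ ≤ Real.exp (-(s * p)) * (‖k‖ * constC0 μ / weight μ β k *
          (2 * A * ρ * borelProfile α p + 4 * ρ ^ 2 * Real.exp (α * p))) := by
          gcongr; exact hB.norm_borelSource_le hμ hβ hA ha p k
      _ = _ := by ring
  · rw [hB.borelSource_of_nonpos (not_lt.1 hp), norm_zero, mul_zero,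
      indicator_of_notMem (show p ∉ Ioi (0 : ℝ) from hp), mul_zero]

theorem borelSource_zero_right (p : ℝ) : borelSource a U p 0 = 0 := by
  have h0 : ∀ w, kdot 0 w = 0 := fun w => by simp [kdot]
  simp only [borelSource, sourceIntegrand, h0, zero_smul, integral_zero, add_zero, ← projL_apply,
    map_zero, smul_zero, neg_zero]

/-- The Navier–Stokes equation in Fourier variables for the Laplace transform of the Borel
solution. -/
theorem laplace_solves_fourier {f : E3 → C3} (hB : BorelBounded μ β α ρ U)
    (hU : ExpBounded μ β α C U) (hμ : 3 < μ) (hβ : 0 ≤ β) (hα : 0 < α) (ham : Measurable a)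
    (hA : 0 ≤ A) (ha : ∀ k, ‖a k‖ ≤ A / weight μ β k)
    (hfix : ∀ p k, U p k = borelStep a (v1hat a f) U p k) {τ : ℂ} (hτ : α < τ.re) (k : E3) :
    τ ^ 2 • laplaceMoment 1 U τ k =
      -(((‖k‖ ^ 2 : ℝ) : ℂ) • (a k + laplaceMoment 0 U τ k)) +
        nonlin (fun k => a k + laplaceMoment 0 U τ k) (fun k => a k + laplaceMoment 0 U τ k) k +
        f k := by
  -- The rate s lies midway between α and Re τ: above the growth of the source, below the decay of
  -- e^{-pτ}.
  have h := borel_duhamel_laplace (norm_nonneg k) (s := (α + τ.re) / 2) (by linarith)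
    (τ := τ) (by linarith) (v1hat a f k) (r := fun p => borelSource a U p k)
    (measurable_borelSource_left ham hB.measurable k)
    (fun p hp => hB.borelSource_of_nonpos hp k)
    (hB.integrable_exp_borelSource hμ hβ ham hA ha (by linarith) k)
    (fun hk p => by rw [norm_eq_zero.1 hk, borelSource_zero_right])
    (U := fun p => U p k) (fun p => hfix p k)
  -- The term `nonlin a a` inside v̂₁ cancels the one subtracted in the transform of the source.
  rw [laplace_borelSource hB hU hμ hβ ham hA ha hτ, v1hat_eq hμ hβ ham ha] at h
  have h1 : laplaceMoment 1 U τ k = ∫ p : ℝ, (Complex.exp (-(p : ℂ) * τ) * p) • U p k := by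
    simp [laplaceMoment]
  have h0 : laplaceMoment 0 U τ k = ∫ p : ℝ, Complex.exp (-(p : ℂ) * τ) • U p k := by
    simp [laplaceMoment]
  rw [← h1, ← h0] at h
  rw [eq_sub_of_add_eq h, smul_add]
  push_cast
  abel

end

end NSBorel

namespace NSBorel
open MeasureTheory Set Filter Topology

/-! ### Fields given by their Fourier transforms -/

noncomputable section

theorem norm_phase_smul (r : ℝ) {E : Type*} [NormedAddCommGroup E] [NormedSpace ℂ E] (w : E) :
    ‖Complex.exp (Complex.I * (r : ℂ)) • w‖ = ‖w‖ := by
  rw [norm_smul, Complex.norm_exp_I_mul_ofReal, one_mul]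

theorem measurable_phase (x : E3) :
    Measurable fun k : E3 => Complex.exp (Complex.I * ((inner ℝ k x : ℝ) : ℂ)) :=
  Continuous.measurable (by fun_prop)

theorem integrable_phase_smul {E : Type*} [NormedAddCommGroup E] [NormedSpace ℂ E] {g : E3 → E}
    (hg : Integrable g) (x : E3) :
    Integrable fun k : E3 => Complex.exp (Complex.I * ((inner ℝ k x : ℝ) : ℂ)) • g k :=
  hg.norm.mono' ((measurable_phase x).aestronglyMeasurable.smul hg.1)
    (Eventually.of_forall fun _ => (norm_phase_smul _ _).le)

theorem invFourier_congr_ae {g h : E3 → C3} (e : g =ᵐ[volume] h) (x : E3) :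
    invFourier g x = invFourier h x :=
  integral_congr_ae (e.mono fun k hk => by simp only [hk])

theorem invFourier_add {g h : E3 → C3} (hg : Integrable g) (hh : Integrable h) (x : E3) :
    invFourier (fun k => g k + h k) x = invFourier g x + invFourier h x := by
  unfold invFourier
  rw [← integral_add (integrable_phase_smul hg x) (integrable_phase_smul hh x)]
  simp only [smul_add]

theorem invFourier_sub {g h : E3 → C3} (hg : Integrable g) (hh : Integrable h) (x : E3) :
    invFourier (fun k => g k - h k) x = invFourier g x - invFourier h x := by
  unfold invFourier
  rw [← integral_sub (integrable_phase_smul hg x) (integrable_phase_smul hh x)]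
  simp only [smul_sub]

theorem invFourier_neg (g : E3 → C3) (x : E3) :
    invFourier (fun k => -g k) x = -invFourier g x := by
  unfold invFourier
  rw [← integral_neg]
  simp only [smul_neg]

theorem invFourier_clm {g : E3 → C3} (hg : Integrable g) (T : C3 →L[ℂ] ℂ) (x : E3) :
    T (invFourier g x) = ∫ k : E3, Complex.exp (Complex.I * ((inner ℝ k x : ℝ) : ℂ)) • T (g k) := by
  unfold invFourier
  rw [← T.integral_comp_comm (integrable_phase_smul hg x)]
  simp only [map_smul]

theorem invFourier_apply {g : E3 → C3} (hg : Integrable g) (x : E3) (j : Fin 3) :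
    invFourier g x j = ∫ k : E3, Complex.exp (Complex.I * ((inner ℝ k x : ℝ) : ℂ)) • g k j :=
  invFourier_clm hg (EuclideanSpace.proj j) x

/-- The bilinear form realizing `invFourier` as a Fourier integral. -/
def phaseForm : E3 →L[ℝ] E3 →L[ℝ] ℝ := (-(1 / (2 * Real.pi))) • innerSL ℝ

theorem phaseForm_apply (k x : E3) : phaseForm k x = -(1 / (2 * Real.pi)) * inner ℝ k x := rfl

/-- The factor -1/(2π) in `phaseForm` undoes both the sign and the 2π of the standard Fourier
character. -/
theorem invFourier_eq_fourierIntegral (g : E3 → C3) :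
    invFourier g =
      VectorFourier.fourierIntegral Real.fourierChar volume phaseForm.toLinearMap₁₂ g := by
  ext1 x
  unfold invFourier VectorFourier.fourierIntegral
  refine integral_congr_ae (Eventually.of_forall fun k => ?_)
  simp only [ContinuousLinearMap.toLinearMap₁₂_apply_apply_apply, phaseForm_apply, Circle.smul_def,
    Real.fourierChar_apply]
  congr 2
  have := Real.pi_ne_zero
  push_cast
  field_simp

/-- The Fourier transform of `y · ∇ u`. -/
def gradHat (y : E3) (g : E3 → C3) (k : E3) : C3 := (Complex.I * ((inner ℝ k y : ℝ) : ℂ)) • g k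

theorem norm_gradHat_le (y : E3) (g : E3 → C3) (k : E3) : ‖gradHat y g k‖ ≤ ‖y‖ * (‖k‖ * ‖g k‖) := by
  rw [gradHat, norm_smul, norm_mul, Complex.norm_I, one_mul, Complex.norm_real]
  calc _ ≤ (‖k‖ * ‖y‖) * ‖g k‖ := by gcongr; exact norm_inner_le_norm k y
    _ = _ := by ring

theorem measurable_gradHat {g : E3 → C3} (hg : Measurable g) (y : E3) : Measurable (gradHat y g) := by
  have h : Measurable fun k : E3 => Complex.I * ((inner ℝ k y : ℝ) : ℂ) :=
    Continuous.measurable (by fun_prop)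
  exact h.smul hg

theorem aestronglyMeasurable_gradHat {g : E3 → C3} (hg : AEStronglyMeasurable g) (y : E3) :
    AEStronglyMeasurable (gradHat y g) := by
  have h : Measurable fun k : E3 => Complex.I * ((inner ℝ k y : ℝ) : ℂ) :=
    Continuous.measurable (by fun_prop)
  exact h.aestronglyMeasurable.smul hg

theorem integrable_gradHat {g : E3 → C3} (hg : AEStronglyMeasurable g)
    (hg' : Integrable fun k => ‖k‖ * ‖g k‖) (y : E3) : Integrable (gradHat y g) :=
  (hg'.const_mul ‖y‖).mono' (aestronglyMeasurable_gradHat hg y)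
    (Eventually.of_forall fun k => norm_gradHat_le y g k)

theorem hasFDerivAt_invFourier {g : E3 → C3} (hg : Integrable g)
    (hg' : Integrable fun k => ‖k‖ * ‖g k‖) (x : E3) : DifferentiableAt ℝ (invFourier g) x ∧
      ∀ y, fderiv ℝ (invFourier g) x y = invFourier (gradHat y g) x := by
  have h := VectorFourier.hasFDerivAt_fourierIntegral phaseForm hg hg' x
  rw [← invFourier_eq_fourierIntegral] at h
  refine ⟨h.differentiableAt, fun y => ?_⟩
  have hi : Integrable (VectorFourier.fourierSMulRight phaseForm g) :=
    (hg'.const_mul (2 * Real.pi * ‖phaseForm‖)).mono' hg.1.fourierSMulRight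
      (Eventually.of_forall fun k => (VectorFourier.norm_fourierSMulRight_le _ _ _).trans_eq (by ring))
  rw [h.fderiv, Real.fourierIntegral_continuousLinearMap_apply' hi,
    invFourier_eq_fourierIntegral]
  congr 1
  ext1 k
  simp only [VectorFourier.fourierSMulRight_apply, phaseForm_apply, gradHat]
  rw [← Complex.coe_smul, smul_smul]
  congr 1
  have := Real.pi_ne_zero
  push_cast
  field_simp

theorem contDiff_invFourier {g : E3 → C3}
    (h : ∀ n : ℕ, n ≤ 2 → Integrable fun k => ‖k‖ ^ n * ‖g k‖) : ContDiff ℝ 2 (invFourier g) := by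
  rw [invFourier_eq_fourierIntegral]
  exact VectorFourier.contDiff_fourierIntegral phaseForm (N := 2)
    (fun n hn => h n (by exact_mod_cast hn))

/-- `g` is measurable with two integrable moments. -/
structure SmoothHat (g : E3 → C3) : Prop where
  aestronglyMeasurable : AEStronglyMeasurable g
  moment : ∀ n : ℕ, n ≤ 2 → Integrable fun k => ‖k‖ ^ n * ‖g k‖

namespace SmoothHat

variable {g : E3 → C3}

theorem integrable (h : SmoothHat g) : Integrable g :=
  (integrable_norm_iff h.1).1 (by simpa using h.moment 0 (by norm_num))

theorem integrable_one (h : SmoothHat g) : Integrable fun k => ‖k‖ * ‖g k‖ := by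
  simpa using h.moment 1 (by norm_num)

theorem contDiff (h : SmoothHat g) : ContDiff ℝ 2 (invFourier g) := contDiff_invFourier h.2

theorem fderiv_apply (h : SmoothHat g) (x y : E3) :
    fderiv ℝ (invFourier g) x y = invFourier (gradHat y g) x :=
  (hasFDerivAt_invFourier h.integrable h.integrable_one x).2 y

theorem integrable_gradHat (h : SmoothHat g) (y : E3) : Integrable (gradHat y g) :=
  NSBorel.integrable_gradHat h.1 h.integrable_one y

theorem integrable_gradHat_one (h : SmoothHat g) (y : E3) :
    Integrable fun k => ‖k‖ * ‖gradHat y g k‖ := by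
  refine ((h.moment 2 le_rfl).const_mul ‖y‖).mono'
    (continuous_norm.aestronglyMeasurable.mul (aestronglyMeasurable_gradHat h.1 y).norm)
    (Eventually.of_forall fun k => ?_)
  rw [Real.norm_of_nonneg (by positivity)]
  calc _ ≤ ‖k‖ * (‖y‖ * (‖k‖ * ‖g k‖)) := by gcongr; exact norm_gradHat_le y g k
    _ = _ := by ring

theorem fderiv_fderiv_apply (h : SmoothHat g) (x y z : E3) :
    fderiv ℝ (fderiv ℝ (invFourier g)) x y z = invFourier (gradHat y (gradHat z g)) x := by
  have hd : DifferentiableAt ℝ (fderiv ℝ (invFourier g)) x :=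
    ((h.contDiff.fderiv_right (m := 1) (by norm_num)).differentiable (by norm_num)) x
  have e := fderiv_clm_apply hd (differentiableAt_const z)
  have e1 := DFunLike.congr_fun e y
  simp only [Pi.zero_apply, fderiv_fun_const] at e1
  have e2 : (fun x => fderiv ℝ (invFourier g) x z) = invFourier (gradHat z g) := by
    ext1 x; exact h.fderiv_apply x z
  rw [e2, (hasFDerivAt_invFourier (h.integrable_gradHat z) (h.integrable_gradHat_one z) x).2 y] at e1
  rw [e1]
  simp

theorem laplacian_eq (h : SmoothHat g) (x : E3) :
    Laplacian.laplacian (invFourier g) x =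
      invFourier (fun k => -(((‖k‖ ^ 2 : ℝ) : ℂ) • g k)) x := by
  rw [InnerProductSpace.laplacian_eq_iteratedFDeriv_orthonormalBasis _
    (EuclideanSpace.basisFun (Fin 3) ℝ)]
  simp only [iteratedFDeriv_two_apply, Matrix.cons_val_zero, Matrix.cons_val_one,
    h.fderiv_fderiv_apply]
  unfold invFourier
  rw [← integral_finsetSum]
  · refine integral_congr_ae (Eventually.of_forall fun k => ?_)
    dsimp only
    rw [← Finset.smul_sum]
    simp only [gradHat, smul_smul]
    rw [← Finset.sum_smul, ← neg_smul]
    congr 2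
    have := EuclideanSpace.norm_sq_eq k
    rw [this]
    push_cast
    rw [← Finset.sum_neg_distrib]
    refine Finset.sum_congr rfl fun j _ => ?_
    have : inner ℝ k (EuclideanSpace.basisFun (Fin 3) ℝ j) = k j := by
      simp [EuclideanSpace.inner_single_right]
    rw [this, ← Complex.ofReal_pow, Real.norm_eq_abs, sq_abs]
    push_cast
    linear_combination (k j : ℂ) ^ 2 * Complex.I_sq
  · intro j _
    exact integrable_phase_smul (NSBorel.integrable_gradHat
      (aestronglyMeasurable_gradHat h.1 _) (h.integrable_gradHat_one _) _) x

end SmoothHat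

/-- The two extra powers in the weight μ+2 pay for |k|², and (1+|k|)^{-μ} remains integrable as μ >
3. -/
theorem smoothHat_of_le {μ C : ℝ} (hμ : 3 < μ) {g : E3 → C3} (hg : AEStronglyMeasurable g)
    (h : ∀ k, ‖g k‖ ≤ C / weight (μ + 2) 0 k) : SmoothHat g := by
  refine ⟨hg, fun n hn => ?_⟩
  have hC := nonneg_of_norm_le_div_weight h
  refine integrable_of_norm_le_div_weight (C := C) hμ le_rfl
    ((by fun_prop : Continuous fun k : E3 => ‖k‖ ^ n).aestronglyMeasurable.mul hg.norm) fun k => ?_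
  have hw := weight_pos μ 0 k
  rw [Real.norm_of_nonneg (by positivity)]
  have h1 : ‖k‖ ^ n ≤ (1 + ‖k‖) ^ 2 :=
    (pow_le_pow_left₀ (norm_nonneg k) (by linarith) n).trans
      (pow_le_pow_right₀ (by linarith [norm_nonneg k]) hn)
  calc _ ≤ (1 + ‖k‖) ^ 2 * (C / weight (μ + 2) 0 k) := by gcongr; exact h k
    _ = _ := by rw [weight_add_two]; field_simp

/-! ### Products -/

theorem measurable_fconv {a : E3 → ℂ} {b : E3 → C3} (ha : Measurable a) (hb : Measurable b) :
    Measurable (fconv a b) := by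
  have h : Measurable fun x : E3 × E3 => a x.2 • b (x.1 - x.2) :=
    (ha.comp measurable_snd).smul (hb.comp (measurable_fst.sub measurable_snd))
  exact (StronglyMeasurable.integral_prod_right' h.stronglyMeasurable).measurable

theorem fconv_eq_convolution (a : E3 → ℂ) (b : E3 → C3) :
    fconv a b = convolution a b (ContinuousLinearMap.lsmul ℂ ℂ) volume := rfl

theorem integrable_fconv {a : E3 → ℂ} {b : E3 → C3} (ha : Integrable a) (hb : Integrable b) :
    Integrable (fconv a b) := by
  rw [fconv_eq_convolution]
  exact ha.integrable_convolution _ hb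

theorem invFourier_fconv {a : E3 → ℂ} {b : E3 → C3} (ha : Integrable a) (hb : Integrable b) (x : E3) :
    invFourier (fconv a b) x =
      (∫ k : E3, Complex.exp (Complex.I * ((inner ℝ k x : ℝ) : ℂ)) • a k) • invFourier b x := by
  have h := integral_convolution (ContinuousLinearMap.lsmul ℂ ℂ) (μ := volume) (ν := volume)
    (integrable_phase_smul ha x) (integrable_phase_smul hb x)
  rw [ContinuousLinearMap.lsmul_apply] at h
  rw [show invFourier b x = ∫ k : E3, Complex.exp (Complex.I * ((inner ℝ k x : ℝ) : ℂ)) • b k from rfl,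
    ← h]
  refine integral_congr_ae (Eventually.of_forall fun k => ?_)
  simp only [fconv, convolution, ← integral_smul, ContinuousLinearMap.lsmul_apply]
  refine integral_congr_ae (Eventually.of_forall fun q => ?_)
  simp only [smul_smul, smul_eq_mul]
  congr 1
  rw [inner_sub_left]
  rw [show Complex.I * ((inner ℝ k x : ℝ) : ℂ) = Complex.I * ((inner ℝ q x : ℝ) : ℂ) +
    Complex.I * ((inner ℝ k x - inner ℝ q x : ℝ) : ℂ) by push_cast; ring, Complex.exp_add]
  ring

/-- The Fourier transform of `u · ∇ u`. -/
def advHat (g : E3 → C3) (k : E3) : C3 :=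
  ∑ j, fconv (fun q => g q j) (gradHat (EuclideanSpace.single j 1) g) k

theorem measurable_coord {g : E3 → C3} (hg : Measurable g) (j : Fin 3) : Measurable fun q => g q j :=
  (Continuous.measurable (by fun_prop : Continuous fun w : C3 => w j)).comp hg

theorem integrable_coord {g : E3 → C3} (hg : Integrable g) (j : Fin 3) : Integrable fun q => g q j :=
  (EuclideanSpace.proj j : C3 →L[ℂ] ℂ).integrable_comp hg

theorem SmoothHat.isFourierTransform_advection {g : E3 → C3} (h : SmoothHat g) (hg : Measurable g) :
    IsFourierTransform (advection (invFourier g)) (advHat g) := by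
  refine ⟨?_, ?_, fun x => ?_⟩
  · exact Finset.measurable_sum _ fun j _ =>
      measurable_fconv (measurable_coord hg j) (measurable_gradHat hg _)
  · exact integrable_finsetSum _ fun j _ =>
      integrable_fconv (integrable_coord h.integrable j) (h.integrable_gradHat _)
  · unfold advection partialD
    simp only [h.fderiv_apply, invFourier_apply h.integrable]
    simp only [← invFourier_fconv (integrable_coord h.integrable _) (h.integrable_gradHat _)]
    unfold advHat
    rw [show invFourier (fun k => ∑ j, fconv (fun q => g q j)
      (gradHat (EuclideanSpace.single j 1) g) k) x = ∫ k : E3, ∑ j : Fin 3,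
        Complex.exp (Complex.I * ((inner ℝ k x : ℝ) : ℂ)) • fconv (fun q => g q j)
      (gradHat (EuclideanSpace.single j 1) g) k by
        unfold invFourier; simp only [Finset.smul_sum]]
    rw [integral_finsetSum]
    · rfl
    · exact fun j _ => integrable_phase_smul
        (integrable_fconv (integrable_coord h.integrable j) (h.integrable_gradHat _)) x

theorem inner_single (k : E3) (j : Fin 3) : inner ℝ k (EuclideanSpace.single j (1 : ℝ)) = k j := by
  simp [EuclideanSpace.inner_single_right]

/-- For divergence-free fields the advection term is in divergence form. -/
theorem advHat_eq {μ C : ℝ} (hμ : 3 < μ) {g : E3 → C3} (hg : Measurable g)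
    (h : ∀ k, ‖g k‖ ≤ C / weight (μ + 2) 0 k) (hdiv : ∀ᵐ k, kdot k (g k) = 0) (k : E3) :
    advHat g k = Complex.I • kconv g g k := by
  have hC := nonneg_of_norm_le_div_weight h
  have hw1 : ∀ k, ‖g k‖ ≤ C / weight μ 0 k := fun k => (h k).trans (by
    have := weight_pos μ 0 k
    rw [weight_add_two]
    gcongr
    nlinarith [norm_nonneg k, sq_nonneg ‖k‖])
  have hw2 : ∀ k y, ‖gradHat y g k‖ ≤ ‖y‖ * C / weight μ 0 k := fun k y => by
    have hw := weight_pos μ 0 k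
    have hk := norm_nonneg k
    calc _ ≤ ‖y‖ * (‖k‖ * ‖g k‖) := norm_gradHat_le y g k
      _ ≤ ‖y‖ * ((1 + ‖k‖) ^ 2 * (C / weight (μ + 2) 0 k)) := by
        gcongr
        · nlinarith
        · exact h k
      _ = _ := by rw [weight_add_two]; field_simp
  unfold advHat fconv
  rw [← integral_finsetSum]
  · unfold kconv
    rw [← integral_smul]
    refine integral_congr_ae ?_
    filter_upwards [hdiv] with q hq
    simp only [gradHat, smul_smul, inner_single, ← Finset.sum_smul]
    congr 1
    -- Subtracting q · ĝ(q) = 0 changes k · ĝ(q) into (k-q) · ĝ(q), the symbol of the gradient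
    -- acting on the second factor.
    have e : ∑ j, ((k j : ℝ) : ℂ) * g q j = ∑ j, (((k j : ℝ) : ℂ) * g q j - ((q j : ℝ) : ℂ) * g q j) := by
      rw [Finset.sum_sub_distrib]
      change _ = _ - kdot q (g q)
      rw [hq, sub_zero]
    unfold kdot
    rw [e, Finset.mul_sum]
    refine Finset.sum_congr rfl fun j _ => ?_
    simp only [PiLp.sub_apply]
    push_cast
    ring
  · intro j _
    refine ((integrable_weight_conv hμ le_rfl k).const_mul (C * C)).mono' ?_
      (Eventually.of_forall fun q => ?_)
    · exact ((measurable_coord hg j).smul ((measurable_gradHat hg _).comp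
        (measurable_const.sub measurable_id))).aestronglyMeasurable
    · rw [norm_smul]
      have h1 := (PiLp.norm_apply_le (g q) j).trans (hw1 q)
      have h2 := hw2 (k - q) (EuclideanSpace.single j (1 : ℝ))
      rw [PiLp.norm_single, norm_one, one_mul] at h2
      calc _ ≤ (C / weight μ 0 q) * (C / weight μ 0 (k - q)) :=
            mul_le_mul h1 h2 (norm_nonneg _) ((norm_nonneg _).trans h1)
        _ = _ := by simp only [div_eq_mul_inv]; ring

theorem divergence_invFourier {g : E3 → C3} (h : SmoothHat g) (hdiv : ∀ᵐ k, kdot k (g k) = 0)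
    (x : E3) : divergence (invFourier g) x = 0 := by
  unfold divergence partialD
  simp only [h.fderiv_apply, invFourier_apply (h.integrable_gradHat _)]
  rw [← integral_finsetSum]
  · refine integral_eq_zero_of_ae ?_
    filter_upwards [hdiv] with k hk
    rw [← Finset.smul_sum]
    have : ∑ j, gradHat (EuclideanSpace.single j 1) g k j = Complex.I * kdot k (g k) := by
      unfold kdot
      rw [Finset.mul_sum]
      refine Finset.sum_congr rfl fun j _ => ?_
      simp only [gradHat, inner_single, PiLp.smul_apply, smul_eq_mul]
      ring
    rw [this, hk, mul_zero, smul_zero, Pi.zero_apply]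
  · exact fun j _ => integrable_phase_smul (integrable_coord (h.integrable_gradHat _) j) x

/-! ### Dependence on parameters -/

/-- Dominated convergence, stated for a general filter so that it covers both interior times and the
one-sided limit at t = 0. -/
theorem continuousAt_invFourier {P : Type*} [TopologicalSpace P] [FirstCountableTopology P]
    {G : P → E3 → C3} {t₀ : P} {b : E3 → ℝ} {l : Filter P} [l.IsCountablyGenerated]
    (hm : ∀ᶠ t in l, AEStronglyMeasurable (G t))
    (hb : ∀ᶠ t in l, ∀ k, ‖G t k‖ ≤ b k) (hbi : Integrable b)
    (hc : ∀ k, Tendsto (fun t => G t k) l (𝓝 (G t₀ k))) (x₀ : E3) :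
    Tendsto (fun q : P × E3 => invFourier (G q.1) q.2) (l ×ˢ 𝓝 x₀) (𝓝 (invFourier (G t₀) x₀)) := by
  unfold invFourier
  refine tendsto_integral_filter_of_dominated_convergence b ?_ ?_ hbi ?_
  · filter_upwards [tendsto_fst.eventually hm] with q hq
    exact (measurable_phase q.2).aestronglyMeasurable.smul hq
  · filter_upwards [tendsto_fst.eventually hb] with q hq
    exact Eventually.of_forall fun k => (norm_phase_smul _ _).trans_le (hq k)
  · refine Eventually.of_forall fun k => ?_
    have h1 : Continuous fun x : E3 => Complex.exp (Complex.I * ((inner ℝ k x : ℝ) : ℂ)) := by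
      fun_prop
    exact ((h1.tendsto x₀).comp tendsto_snd).smul ((hc k).comp tendsto_fst)

end

end NSBorel

namespace NSBorel
open MeasureTheory Set Filter Topology

/-! ### Classical solutions from solutions in Fourier variables -/

noncomputable section

theorem div_weight_add_two_le {μ β C : ℝ} (hC : 0 ≤ C) (k : E3) :
    C / weight (μ + 2) β k ≤ C / weight μ β k := by
  have := weight_pos μ β k
  rw [weight_add_two]
  gcongr
  nlinarith [norm_nonneg k, sq_nonneg ‖k‖]

/-- `G` solves the Navier–Stokes equation in Fourier variables, with time derivative `G'`. -/
structure FourierFlow (μ : ℝ) (fhat : E3 → C3) (Ω : Set ℂ) (G G' : ℂ → E3 → C3) : Prop where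
  isOpen : IsOpen Ω
  measurable : ∀ t ∈ Ω, Measurable (G t)
  hasDerivAt : ∀ t ∈ Ω, ∀ k, HasDerivAt (fun s => G s k) (G' t k) t
  bound : ∀ t₀ ∈ Ω, ∃ C, ∀ᶠ t in 𝓝 t₀, ∀ k,
    ‖G t k‖ ≤ C / weight (μ + 2) 0 k ∧ ‖G' t k‖ ≤ C / weight μ 0 k
  kdot_eq_zero : ∀ t ∈ Ω, ∀ᵐ k, kdot k (G t k) = 0
  equation : ∀ t ∈ Ω, ∀ k,
    G' t k = -(((‖k‖ ^ 2 : ℝ) : ℂ) • G t k) + nonlin (G t) (G t) k + fhat k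

theorem continuousAt_gradHat {P : Type*} [TopologicalSpace P] {F : P → E3 → C3} {t : P} {k : E3}
    (h : ContinuousAt (fun s => F s k) t) (y : E3) :
    ContinuousAt (fun s => gradHat y (F s) k) t :=
  ContinuousAt.fun_const_smul h (Complex.I * ((inner ℝ k y : ℝ) : ℂ))

namespace FourierFlow

variable {μ : ℝ} {fhat : E3 → C3} {Ω : Set ℂ} {G G' : ℂ → E3 → C3}

theorem exists_bound (h : FourierFlow μ fhat Ω G G') {t : ℂ} (ht : t ∈ Ω) :
    ∃ C, ∀ k, ‖G t k‖ ≤ C / weight (μ + 2) 0 k :=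
  (h.bound t ht).imp fun _ hC k => (hC.self_of_nhds k).1

theorem smoothHat (h : FourierFlow μ fhat Ω G G') (hμ : 3 < μ) {t : ℂ} (ht : t ∈ Ω) :
    SmoothHat (G t) :=
  let ⟨_, hC⟩ := h.exists_bound ht
  smoothHat_of_le hμ (h.measurable t ht).aestronglyMeasurable hC

/-- The time derivative is measurable in k because the equation expresses it through G. -/
theorem measurable_deriv (h : FourierFlow μ fhat Ω G G') (hf : Measurable fhat) {t : ℂ}
    (ht : t ∈ Ω) : Measurable (G' t) := by
  have e : G' t = fun k => -(((‖k‖ ^ 2 : ℝ) : ℂ) • G t k) + nonlin (G t) (G t) k + fhat k :=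
    funext (h.equation t ht)
  have hk : Measurable fun k : E3 => ((‖k‖ ^ 2 : ℝ) : ℂ) := by fun_prop
  have hm := h.measurable t ht
  rw [e]
  exact ((hk.smul hm).neg.add (measurable_nonlin hm hm)).add hf

/-- On an open set of complex times the derivative of a holomorphic function is again holomorphic,
hence continuous. -/
theorem continuousAt_deriv (h : FourierFlow μ fhat Ω G G') {t : ℂ} (ht : t ∈ Ω) (k : E3) :
    ContinuousAt (fun s => G' s k) t := by
  have hd : DifferentiableOn ℂ (fun s => G s k) Ω := fun s hs =>
    (h.hasDerivAt s hs k).differentiableAt.differentiableWithinAt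
  have hc := ((hd.deriv h.isOpen).continuousOn.continuousAt (h.isOpen.mem_nhds ht))
  refine hc.congr ?_
  filter_upwards [h.isOpen.mem_nhds ht] with s hs
  exact (h.hasDerivAt s hs k).deriv

theorem hasDerivAt_invFourier (h : FourierFlow μ fhat Ω G G') (hμ : 3 < μ) (hf : Measurable fhat)
    {t : ℂ} (ht : t ∈ Ω) (x : E3) :
    HasDerivAt (fun s => invFourier (G s) x) (invFourier (G' t) x) t := by
  obtain ⟨C, hC⟩ := h.bound t ht
  have hs := hC.and (h.isOpen.mem_nhds ht)
  refine (hasDerivAt_integral_of_dominated_loc_of_deriv_le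
    (F := fun s k => Complex.exp (Complex.I * ((inner ℝ k x : ℝ) : ℂ)) • G s k)
    (F' := fun s k => Complex.exp (Complex.I * ((inner ℝ k x : ℝ) : ℂ)) • G' s k)
    (bound := fun k => C * (weight μ 0 k)⁻¹) hs ?_ ?_ ?_ ?_ ?_ ?_).2
  · filter_upwards [h.isOpen.mem_nhds ht] with s hs
    exact ((measurable_phase x).smul (h.measurable s hs)).aestronglyMeasurable
  · exact integrable_phase_smul (h.smoothHat hμ ht).integrable x
  · exact ((measurable_phase x).smul (h.measurable_deriv hf ht)).aestronglyMeasurable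
  · refine Eventually.of_forall fun k s hs => ?_
    rw [norm_phase_smul, ← div_eq_mul_inv]
    exact (hs.1 k).2
  · exact (integrable_inv_weight hμ le_rfl).const_mul C
  · exact Eventually.of_forall fun k s hs => (h.hasDerivAt s hs.2 k).fun_const_smul _

theorem continuousOn_of_bound (h : FourierFlow μ fhat Ω G G') (hμ : 3 < μ)
    {F : ℂ → E3 → C3} (hFm : ∀ t ∈ Ω, Measurable (F t))
    (hFc : ∀ t ∈ Ω, ∀ k, ContinuousAt (fun s => F s k) t)
    (hFb : ∀ t₀ ∈ Ω, ∃ C, ∀ᶠ t in 𝓝 t₀, ∀ k, ‖F t k‖ ≤ C / weight μ 0 k) :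
    ContinuousOn (fun q : ℂ × E3 => invFourier (F q.1) q.2) (Ω ×ˢ univ) := by
  rintro ⟨t, x⟩ ⟨ht, -⟩
  obtain ⟨C, hC⟩ := hFb t ht
  refine ContinuousAt.continuousWithinAt ?_
  rw [ContinuousAt, nhds_prod_eq]
  refine continuousAt_invFourier (b := fun k => C * (weight μ 0 k)⁻¹) ?_ ?_
    ((integrable_inv_weight hμ le_rfl).const_mul C) (hFc t ht) x
  · filter_upwards [h.isOpen.mem_nhds ht] with s hs using (hFm s hs).aestronglyMeasurable
  · simpa only [← div_eq_mul_inv] using hC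

theorem continuousOn (h : FourierFlow μ fhat Ω G G') (hμ : 3 < μ) :
    ContinuousOn (fun q : ℂ × E3 => invFourier (G q.1) q.2) (Ω ×ˢ univ) := by
  refine h.continuousOn_of_bound hμ h.measurable
    (fun t ht k => (h.hasDerivAt t ht k).continuousAt) fun t ht => ?_
  obtain ⟨C, hC⟩ := h.bound t ht
  refine ⟨C, hC.mono fun s hs k => (hs k).1.trans ?_⟩
  exact div_weight_add_two_le (nonneg_of_norm_le_div_weight fun k => (hs k).1) k

theorem continuousOn_fderiv (h : FourierFlow μ fhat Ω G G') (hμ : 3 < μ) :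
    ContinuousOn (fun q : ℂ × E3 => fderiv ℝ (invFourier (G q.1)) q.2) (Ω ×ˢ univ) := by
  rw [continuousOn_clm_apply]
  intro y
  refine ContinuousOn.congr (f := fun q : ℂ × E3 => invFourier (gradHat y (G q.1)) q.2) ?_
    fun q hq => (h.smoothHat hμ hq.1).fderiv_apply q.2 y
  refine h.continuousOn_of_bound hμ (fun t ht => measurable_gradHat (h.measurable t ht) y)
    (fun t ht k => continuousAt_gradHat (h.hasDerivAt t ht k).continuousAt y) fun t ht => ?_
  obtain ⟨C, hC⟩ := h.bound t ht
  refine ⟨‖y‖ * C, hC.mono fun s hs k => (norm_gradHat_le y _ k).trans ?_⟩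
  have hw := weight_pos μ 0 k
  have hk := norm_nonneg k
  calc _ ≤ ‖y‖ * ((1 + ‖k‖) ^ 2 * (C / weight (μ + 2) 0 k)) := by
        gcongr
        · nlinarith
        · exact (hs k).1
    _ = _ := by rw [weight_add_two]; field_simp

theorem continuousOn_fderiv_fderiv (h : FourierFlow μ fhat Ω G G') (hμ : 3 < μ) :
    ContinuousOn (fun q : ℂ × E3 => fderiv ℝ (fderiv ℝ (invFourier (G q.1))) q.2) (Ω ×ˢ univ) := by
  rw [continuousOn_clm_apply]
  intro y
  rw [continuousOn_clm_apply]
  intro z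
  refine ContinuousOn.congr
    (f := fun q : ℂ × E3 => invFourier (gradHat y (gradHat z (G q.1))) q.2) ?_
    fun q hq => (h.smoothHat hμ hq.1).fderiv_fderiv_apply q.2 y z
  refine h.continuousOn_of_bound hμ
    (F := fun t => gradHat y (gradHat z (G t)))
    (fun t ht => measurable_gradHat (measurable_gradHat (h.measurable t ht) z) y)
    (fun t ht k => continuousAt_gradHat
      (continuousAt_gradHat (h.hasDerivAt t ht k).continuousAt z) y) fun t ht => ?_
  obtain ⟨C, hC⟩ := h.bound t ht
  refine ⟨‖y‖ * ‖z‖ * C, hC.mono fun s hs k => (norm_gradHat_le y _ k).trans ?_⟩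
  have hw := weight_pos μ 0 k
  have hk := norm_nonneg k
  calc _ ≤ ‖y‖ * (‖k‖ * (‖z‖ * (‖k‖ * ‖G s k‖))) := by gcongr; exact norm_gradHat_le z _ k
    _ = ‖y‖ * ‖z‖ * (‖k‖ ^ 2 * ‖G s k‖) := by ring
    _ ≤ ‖y‖ * ‖z‖ * ((1 + ‖k‖) ^ 2 * (C / weight (μ + 2) 0 k)) := by
        gcongr
        · linarith
        · exact (hs k).1
    _ = _ := by rw [weight_add_two]; field_simp

theorem solvesNSOn (h : FourierFlow μ fhat Ω G G') (hμ : 3 < μ) {f : E3 → C3}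
    (hf : IsFourierTransform f fhat) :
    SolvesNSOn f Ω fun t => invFourier (G t) where
  contDiff t ht := (h.smoothHat hμ ht).contDiff
  differentiable_time t ht x := (h.hasDerivAt_invFourier hμ hf.measurable ht x).differentiableAt
  continuous_dx := h.continuousOn_fderiv hμ
  continuous_dxx := h.continuousOn_fderiv_fderiv hμ
  continuous_dt := by
    refine ContinuousOn.congr (f := fun q : ℂ × E3 => invFourier (G' q.1) q.2) ?_
      fun q hq => (h.hasDerivAt_invFourier hμ hf.measurable hq.1 q.2).deriv
    refine h.continuousOn_of_bound hμ (fun t ht => h.measurable_deriv hf.measurable ht)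
      (fun t ht k => h.continuousAt_deriv ht k) fun t ht => ?_
    obtain ⟨C, hC⟩ := h.bound t ht
    exact ⟨C, hC.mono fun s hs k => (hs k).2⟩
  divergence_free t ht x := divergence_invFourier (h.smoothHat hμ ht) (h.kdot_eq_zero t ht) x
  equation t ht := by
    have hs := h.smoothHat hμ ht
    have hm := h.measurable t ht
    obtain ⟨C, hC⟩ := h.bound t ht
    have hC := hC.self_of_nhds
    have hC1 : ∀ k, ‖G t k‖ ≤ C / weight (μ + 2) 0 k := fun k => (hC k).1
    refine ⟨_, ⟨advHat (G t), hs.isFourierTransform_advection hm, fun x => rfl⟩, fun x => ?_⟩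
    have e1 : invFourier (fun k => projSymbol k (advHat (G t) k)) x =
        -invFourier (nonlin (G t) (G t)) x := by
      rw [← invFourier_neg]
      refine invFourier_congr_ae (Eventually.of_forall fun k => ?_) x
      simp only [advHat_eq hμ hm hC1 (h.kdot_eq_zero t ht), nonlin, neg_neg]
      rw [← projL_apply, map_smul, projL_apply]
    have i1 : Integrable fun k => -(((‖k‖ ^ 2 : ℝ) : ℂ) • G t k) := by
      refine (hs.moment 2 le_rfl).mono' ?_ (Eventually.of_forall fun k => ?_)
      · have hk : Measurable fun k : E3 => ((‖k‖ ^ 2 : ℝ) : ℂ) := by fun_prop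
        exact (hk.smul hm).neg.aestronglyMeasurable
      · rw [norm_neg, norm_smul, Complex.norm_real, norm_pow, norm_norm]
    have i2 : Integrable (G' t) :=
      integrable_of_norm_le_div_weight hμ le_rfl
        (h.measurable_deriv hf.measurable ht).aestronglyMeasurable fun k => (hC k).2
    -- Integrability of the quadratic term is read off the equation, all other terms being
    -- integrable.
    have i3 : Integrable (nonlin (G t) (G t)) := by
      have : nonlin (G t) (G t) = fun k => G' t k - -(((‖k‖ ^ 2 : ℝ) : ℂ) • G t k) - fhat k := by
        ext1 k; rw [h.equation t ht]; abel
      rw [this]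
      exact (i2.sub i1).sub hf.integrable
    have i12 : Integrable fun k => -(((‖k‖ ^ 2 : ℝ) : ℂ) • G t k) + nonlin (G t) (G t) k := i1.add i3
    rw [(h.hasDerivAt_invFourier hμ hf.measurable ht x).deriv, hs.laplacian_eq, e1, hf.inversion,
      funext (h.equation t ht), invFourier_add i12 hf.integrable, invFourier_add i1 i3]
    abel

end FourierFlow

/-- Restriction of a solution for complex times to real times. -/
theorem SolvesNSOn.ofReal {f : E3 → C3} {Ω : Set ℂ} {w : ℂ → E3 → C3} (h : SolvesNSOn f Ω w)
    {I : Set ℝ} (hI : ∀ t ∈ I, (t : ℂ) ∈ Ω) : SolvesNSOn f I fun t : ℝ => w (t : ℂ) := by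
  have hd : ∀ t ∈ I, ∀ x, HasDerivAt (fun s : ℝ => w (s : ℂ) x) (deriv (fun s => w s x) (t : ℂ)) t :=
    fun t ht x => by
      have := (h.differentiable_time t (hI t ht) x).hasDerivAt.scomp t
        Complex.ofRealCLM.hasDerivAt
      rw [Complex.ofRealCLM_apply, Complex.ofReal_one, one_smul] at this
      exact this
  have hm : MapsTo (fun q : ℝ × E3 => ((q.1 : ℂ), q.2)) (I ×ˢ univ) (Ω ×ˢ univ) :=
    fun q hq => ⟨hI q.1 hq.1, trivial⟩
  have hc : ContinuousOn (fun q : ℝ × E3 => ((q.1 : ℂ), q.2)) (I ×ˢ univ) :=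
    Continuous.continuousOn (by fun_prop)
  refine ⟨fun t ht => h.contDiff t (hI t ht), fun t ht x => (hd t ht x).differentiableAt,
    h.continuous_dx.comp hc hm, h.continuous_dxx.comp hc hm, ?_,
    fun t ht => h.divergence_free t (hI t ht), fun t ht => ?_⟩
  · exact (h.continuous_dt.comp hc hm).congr fun q hq => (hd q.1 hq.1 q.2).deriv
  · obtain ⟨g, hg, he⟩ := h.equation t (hI t ht)
    exact ⟨g, hg, fun x => by rw [(hd t ht x).deriv]; exact he x⟩

end

end NSBorel

namespace NSBorel
open MeasureTheory Set Filter Topology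

/-! ### The velocity field in Fourier variables -/

noncomputable section

theorem ne_zero_of_mem_timeDisc {α : ℝ} (hα : 0 < α) {t : ℂ} (ht : t ∈ timeDisc α) : t ≠ 0 := by
  rintro rfl
  have : α < ((0 : ℂ)⁻¹).re := ht
  simp at this
  linarith

theorem isOpen_timeDisc {α : ℝ} (hα : 0 < α) : IsOpen (timeDisc α) := by
  rw [isOpen_iff_mem_nhds]
  intro t ht
  have hc : ContinuousAt (fun t : ℂ => t⁻¹.re) t :=
    Complex.continuous_re.continuousAt.comp (continuousAt_inv₀ (ne_zero_of_mem_timeDisc hα ht))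
  exact hc.eventually_const_lt ht

/-- The disc is the image under inversion of a convex half-plane. Connectedness is needed for the
identity theorem. -/
theorem isPreconnected_timeDisc {α : ℝ} (hα : 0 < α) : IsPreconnected (timeDisc α) := by
  have h1 : IsPreconnected {τ : ℂ | α < τ.re} := (convex_halfSpace_re_gt α).isPreconnected
  have h2 : (fun τ : ℂ => τ⁻¹) '' {τ : ℂ | α < τ.re} = timeDisc α := by
    ext t
    constructor
    · rintro ⟨τ, hτ, rfl⟩
      change α < (τ⁻¹⁻¹).re
      rwa [inv_inv]
    · exact fun ht => ⟨t⁻¹, ht, inv_inv t⟩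
  rw [← h2]
  refine h1.image _ fun τ hτ => (continuousAt_inv₀ ?_).continuousWithinAt
  rintro rfl
  have : α < (0 : ℂ).re := hτ
  simp at this
  linarith

theorem inv_ofReal_re (t : ℝ) : ((t : ℂ)⁻¹).re = t⁻¹ := by rw [← Complex.ofReal_inv, Complex.ofReal_re]

theorem ofReal_mem_timeDisc {α t : ℝ} (hα : 0 < α) (ht : t ∈ Ioo 0 (1 / α)) :
    (t : ℂ) ∈ timeDisc α := by
  change α < ((t : ℂ)⁻¹).re
  rw [inv_ofReal_re, ← one_div, lt_div_iff₀ ht.1]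
  have := (lt_div_iff₀ hα).1 ht.2
  linarith

/-- Two derivatives are gained from the equation. -/
theorem exists_bootstrap_bound {μ β A B F : ℝ} (hμ : 3 < μ) (hβ : 0 ≤ β) (hA : 0 ≤ A) (hB : 0 ≤ B)
    (hF : 0 ≤ F) : ∃ C, 0 ≤ C ∧ ∀ g g' f : E3 → C3, (∀ k, ‖g k‖ ≤ A / weight μ β k) →
      (∀ k, ‖g' k‖ ≤ B / weight μ β k) → (∀ k, ‖f k‖ ≤ F / weight μ β k) →
      (∀ k, g' k = -(((‖k‖ ^ 2 : ℝ) : ℂ) • g k) + nonlin g g k + f k) →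
      ∀ k, ‖g k‖ ≤ C / weight (μ + 2) β k := by
  have hc0 := constC0_pos hμ
  have hc1 := constC0_pos (show 3 < μ + 1 by linarith)
  set S := A + B + F with hS
  have hS0 : 0 ≤ S := by positivity
  set A' := 2 * (S + A * A * constC0 μ) with hA'
  have hA'0 : 0 ≤ A' := by positivity
  refine ⟨2 * (S + A' * A' * constC0 (μ + 1)), by positivity, fun g g' f hg hg' hf he => ?_⟩
  -- The equation is solved for |k|² g, and (1+|k|)² ≤ 2(1+|k|²).
  have key : ∀ k, (1 + ‖k‖) ^ 2 * ‖g k‖ ≤ 2 * (S / weight μ β k + ‖nonlin g g k‖) := fun k => by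
    have hw := weight_pos μ β k
    have h1 : ((‖k‖ ^ 2 : ℝ) : ℂ) • g k = -g' k + nonlin g g k + f k := by rw [he k]; abel
    have h2 : ‖k‖ ^ 2 * ‖g k‖ ≤ ‖g' k‖ + ‖nonlin g g k‖ + ‖f k‖ := by
      calc _ = ‖((‖k‖ ^ 2 : ℝ) : ℂ) • g k‖ := by
            rw [norm_smul, Complex.norm_real, norm_pow, norm_norm]
        _ ≤ _ := by
            rw [h1]
            refine (norm_add_le _ _).trans (add_le_add_left ((norm_add_le _ _).trans ?_) _)
            rw [norm_neg]
    have h3 : S / weight μ β k = A / weight μ β k + B / weight μ β k + F / weight μ β k := by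
      rw [hS]; ring
    have h4 := mul_nonneg (sq_nonneg (1 - ‖k‖)) (norm_nonneg (g k))
    have := hg k; have := hg' k; have := hf k
    nlinarith
  -- The quadratic term loses one power of |k|, so the first pass gains only one of the two.
  have first : ∀ k, ‖g k‖ ≤ A' / weight (μ + 1) β k := fun k => by
    have hw := weight_pos μ β k
    have hk := norm_nonneg k
    have h1 := norm_nonlin_le hμ hβ hA hA (Eventually.of_forall hg) (Eventually.of_forall hg) k
    have h2 : (1 + ‖k‖) * ((1 + ‖k‖) * ‖g k‖) ≤ (1 + ‖k‖) * (A' / weight μ β k) := by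
      calc _ = (1 + ‖k‖) ^ 2 * ‖g k‖ := by ring
        _ ≤ 2 * (S / weight μ β k + ‖k‖ * A * A * constC0 μ / weight μ β k) :=
          (key k).trans (by gcongr)
        _ = 2 * (S * 1 + A * A * constC0 μ * ‖k‖) / weight μ β k := by ring
        _ ≤ 2 * (S * (1 + ‖k‖) + A * A * constC0 μ * (1 + ‖k‖)) / weight μ β k := by
          gcongr <;> linarith
        _ = _ := by rw [hA']; ring
    have h3 := le_of_mul_le_mul_left h2 (by positivity)
    rw [weight_add_one, ← div_div, le_div_iff₀ (by positivity), mul_comm]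
    exact h3
  -- Second pass: with weight μ+1 for g, the lost power brings the quadratic term back to weight μ,
  -- and both powers are gained.
  intro k
  have hw := weight_pos μ β k
  have hk := norm_nonneg k
  have h1 := norm_nonlin_le (show 3 < μ + 1 by linarith) hβ hA'0 hA'0
    (Eventually.of_forall first) (Eventually.of_forall first) k
  rw [weight_add_two, ← div_div, le_div_iff₀ (by positivity), mul_comm]
  refine (key k).trans ?_
  calc _ ≤ 2 * (S / weight μ β k + A' * A' * constC0 (μ + 1) / weight μ β k) := by
        gcongr
        refine h1.trans ?_
        rw [weight_add_one, div_le_div_iff₀ (by positivity) hw]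
        have : 0 ≤ A' * A' * constC0 (μ + 1) * weight μ β k := by positivity
        nlinarith
    _ = _ := by ring

/-- The Fourier transform of the velocity field with Borel transform `U`. -/
def flowHat (a : E3 → C3) (U : ℝ → E3 → C3) (t : ℂ) (k : E3) : C3 :=
  if t = 0 then a k else a k + laplaceMoment 0 U t⁻¹ k

/-- The time derivative of `flowHat`. -/
def flowHatDeriv (U : ℝ → E3 → C3) (t : ℂ) (k : E3) : C3 := (t⁻¹) ^ 2 • laplaceMoment 1 U t⁻¹ k

/-- `U` is the Borel transform of the Navier–Stokes solution with data `a`, `f`. -/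
structure BorelSolution (μ β α : ℝ) (a f : E3 → C3) (U : ℝ → E3 → C3) : Prop where
  three_lt : 3 < μ
  nonneg : 0 ≤ β
  pos : 0 < α
  measurable_datum : Measurable a
  measurable_force : Measurable f
  init_bound : ∃ A, ∀ k, ‖a k‖ ≤ A / weight (μ + 2) β k
  force_bound : ∃ F, ∀ k, ‖f k‖ ≤ F / weight μ β k
  init_div : ∀ᵐ k, kdot k (a k) = 0
  force_div : ∀ᵐ k, kdot k (f k) = 0
  borelBounded : ∃ ρ, BorelBounded μ β α ρ U
  expBounded : ∃ C, ExpBounded μ β α C U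
  fixed : ∀ p k, U p k = borelStep a (v1hat a f) U p k

/-- Integrability is not required: otherwise the integral is 0 by definition. -/
theorem kdot_integral_eq_zero {k : E3} {g : ℝ → C3} (h : ∀ p, kdot k (g p) = 0) :
    kdot k (∫ p, g p) = 0 := by
  rw [← kdotL_apply]
  by_cases hg : Integrable g
  · rw [← (kdotL k).integral_comp_comm hg]
    simp [kdotL_apply, h]
  · rw [integral_undef hg, map_zero]

namespace BorelSolution

variable {μ β α : ℝ} {a f : E3 → C3} {U : ℝ → E3 → C3}

theorem init_bound' (h : BorelSolution μ β α a f U) :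
    ∃ A, 0 ≤ A ∧ ∀ k, ‖a k‖ ≤ A / weight μ β k := by
  obtain ⟨A, hA⟩ := h.init_bound
  have hA0 := nonneg_of_norm_le_div_weight hA
  exact ⟨A, hA0, fun k => (hA k).trans (div_weight_add_two_le hA0 k)⟩

/-- Read off the fixed-point equation: v̂₁ is divergence free with the data, and every source term
carries P_k. The exceptional null set is that of the data, so it does not depend on p. -/
theorem kdot_borel (h : BorelSolution μ β α a f U) : ∀ᵐ k, ∀ p, kdot k (U p k) = 0 := by
  obtain ⟨A, hA, ha⟩ := h.init_bound'
  have hs : ∀ (k : E3) (c : ℂ) (w : C3), kdot k (c • w) = c * kdot k w := fun k c w => by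
    rw [← kdotL_apply, map_smul, smul_eq_mul, kdotL_apply]
  have hadd : ∀ (k : E3) (w w' : C3), kdot k (w + w') = kdot k w + kdot k w' := fun k w w' => by
    simp only [← kdotL_apply, map_add]
  have hneg : ∀ (k : E3) (w : C3), kdot k (-w) = -kdot k w := fun k w => by
    simp only [← kdotL_apply, map_neg]
  filter_upwards [h.init_div, h.force_div] with k h1 h2 p
  rw [h.fixed p k, borelStep, hadd, hs, v1hat_eq h.three_lt h.nonneg h.measurable_datum ha, hadd,
    hadd, hneg, hs, h1, h2, nonlin, hneg, hs, kdot_projSymbol, kdot_integral_eq_zero]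
  · simp
  · intro p'
    rw [hs, borelSource, hneg, hs, kdot_projSymbol]
    simp

theorem kdot_flowHat (h : BorelSolution μ β α a f U) (t : ℂ) :
    ∀ᵐ k, kdot k (flowHat a U t k) = 0 := by
  filter_upwards [h.kdot_borel, h.init_div] with k h1 h2
  unfold flowHat
  split_ifs
  · exact h2
  · rw [← kdotL_apply, map_add, kdotL_apply, h2, kdotL_apply, laplaceMoment, kdot_integral_eq_zero,
      add_zero]
    intro p
    rw [← kdotL_apply, map_smul, kdotL_apply, h1, smul_zero]

theorem measurable_flowHat (h : BorelSolution μ β α a f U) (t : ℂ) : Measurable (flowHat a U t) := by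
  obtain ⟨C, hU⟩ := h.expBounded
  by_cases ht : t = 0
  · have : flowHat a U t = a := by ext1 k; simp [flowHat, ht]
    rw [this]; exact h.measurable_datum
  · have : flowHat a U t = fun k => a k + laplaceMoment 0 U t⁻¹ k := by ext1 k; simp [flowHat, ht]
    rw [this]; exact h.measurable_datum.add (hU.measurable_laplaceMoment 0 _)

theorem hasDerivAt_flowHat (h : BorelSolution μ β α a f U) {t : ℂ} (ht : t ∈ timeDisc α) (k : E3) :
    HasDerivAt (fun s => flowHat a U s k) (flowHatDeriv U t k) t := by
  obtain ⟨C, hU⟩ := h.expBounded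
  have h0 := ne_zero_of_mem_timeDisc h.pos ht
  have h1 := (hU.hasDerivAt_laplace (τ := t⁻¹) ht k).scomp t (hasDerivAt_inv h0)
  have h2 := h1.const_add (a k)
  refine (h2.congr_deriv ?_).congr_of_eventuallyEq ?_
  · rw [flowHatDeriv, smul_neg, neg_smul, neg_neg, inv_pow]
  · filter_upwards [isOpen_ne.mem_nhds h0] with s hs
    have hs : s ≠ 0 := hs
    simp [flowHat, hs]

theorem equation_flowHat (h : BorelSolution μ β α a f U) {t : ℂ} (ht : t ∈ timeDisc α) (k : E3) :
    flowHatDeriv U t k = -(((‖k‖ ^ 2 : ℝ) : ℂ) • flowHat a U t k) +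
      nonlin (flowHat a U t) (flowHat a U t) k + f k := by
  obtain ⟨C, hU⟩ := h.expBounded
  obtain ⟨ρ, hB⟩ := h.borelBounded
  obtain ⟨A, hA, ha⟩ := h.init_bound'
  have h0 := ne_zero_of_mem_timeDisc h.pos ht
  have e : flowHat a U t = fun k => a k + laplaceMoment 0 U t⁻¹ k := by ext1 k; simp [flowHat, h0]
  rw [e]
  exact laplace_solves_fourier hB hU h.three_lt h.nonneg h.pos h.measurable_datum hA ha h.fixed
    (τ := t⁻¹) ht k

/-- Bounds that are uniform on subsets of the disc. -/
theorem exists_uniform_bound (h : BorelSolution μ β α a f U) {d : ℝ} (hd : 0 < d) (M : ℝ) :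
    ∃ C, 0 ≤ C ∧ ∀ t ∈ timeDisc α, d ≤ t⁻¹.re - α → ‖t⁻¹‖ ≤ M * (t⁻¹.re - α) → ∀ k,
      ‖flowHat a U t k‖ ≤ C / weight (μ + 2) β k ∧ ‖flowHatDeriv U t k‖ ≤ C / weight μ β k := by
  obtain ⟨C, hU⟩ := h.expBounded
  obtain ⟨A, hA, ha⟩ := h.init_bound'
  obtain ⟨F, hF⟩ := h.force_bound
  have hF0 := nonneg_of_norm_le_div_weight hF
  have hC := hU.nonneg
  -- A gap Re(1/t) - α ≥ d bounds the Laplace integral by C/d. The derivative is |1/t|² times a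
  -- moment of size C/gap², and |1/t| ≤ M · gap keeps this at M²C even as t → 0.
  obtain ⟨K, hK, hb⟩ := exists_bootstrap_bound (A := A + C / d) (B := M ^ 2 * C) h.three_lt h.nonneg
    (by positivity) (by positivity) hF0
  refine ⟨max K (M ^ 2 * C), le_max_of_le_left hK, fun t ht hdt hM => ?_⟩
  have h0 := ne_zero_of_mem_timeDisc h.pos ht
  have hpos : 0 < t⁻¹.re - α := sub_pos.2 ht
  have b1 : ∀ k, ‖flowHat a U t k‖ ≤ (A + C / d) / weight μ β k := fun k => by
    have hw := weight_pos μ β k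
    simp only [flowHat, if_neg h0]
    calc _ ≤ A / weight μ β k + C / (t⁻¹.re - α) / weight μ β k :=
          (norm_add_le _ _).trans (add_le_add (ha k) (hU.norm_laplaceMoment_zero_le ht k))
      _ ≤ A / weight μ β k + C / d / weight μ β k := by gcongr
      _ = _ := by ring
  have b2 : ∀ k, ‖flowHatDeriv U t k‖ ≤ (M ^ 2 * C) / weight μ β k := fun k => by
    have hw := weight_pos μ β k
    rw [flowHatDeriv, norm_smul, norm_pow]
    calc _ ≤ (M * (t⁻¹.re - α)) ^ 2 * (C / (t⁻¹.re - α) ^ 2 / weight μ β k) := by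
          gcongr; exact hU.norm_laplaceMoment_one_le ht k
      _ = _ := by
          generalize t⁻¹.re - α = x at hpos
          field_simp
  intro k
  have hw := weight_pos μ β k
  have hw2 := weight_pos (μ + 2) β k
  refine ⟨(hb _ _ f b1 b2 hF (h.equation_flowHat ht) k).trans ?_, (b2 k).trans ?_⟩
  · gcongr; exact le_max_left _ _
  · gcongr; exact le_max_right _ _

theorem eventually_bound (h : BorelSolution μ β α a f U) {t₀ : ℂ} (ht₀ : t₀ ∈ timeDisc α) :
    ∃ C, 0 ≤ C ∧ ∀ᶠ t in 𝓝 t₀, ∀ k,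
      ‖flowHat a U t k‖ ≤ C / weight (μ + 2) β k ∧ ‖flowHatDeriv U t k‖ ≤ C / weight μ β k := by
  have h0 := ne_zero_of_mem_timeDisc h.pos ht₀
  have hpos : 0 < t₀⁻¹.re - α := sub_pos.2 ht₀
  have hd : 0 < (t₀⁻¹.re - α) / 2 := by positivity
  -- Near t₀ the gap stays above half its value and |1/t| below |1/t₀| + 1; M is the quotient of
  -- these two numbers.
  obtain ⟨C, hC, hb⟩ := h.exists_uniform_bound hd ((‖t₀⁻¹‖ + 1) / ((t₀⁻¹.re - α) / 2))
  refine ⟨C, hC, ?_⟩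
  have c1 : ContinuousAt (fun t : ℂ => t⁻¹.re) t₀ :=
    Complex.continuous_re.continuousAt.comp (continuousAt_inv₀ h0)
  have c2 : ContinuousAt (fun t : ℂ => ‖t⁻¹‖) t₀ := (continuousAt_inv₀ h0).norm
  filter_upwards [(isOpen_timeDisc h.pos).mem_nhds ht₀,
    c1.eventually_const_lt (show (t₀⁻¹.re + α) / 2 < t₀⁻¹.re by linarith),
    c2.eventually_lt_const (show ‖t₀⁻¹‖ < ‖t₀⁻¹‖ + 1 by linarith)] with t ht h1 h2
  refine hb t ht (by linarith) ?_
  rw [div_mul_eq_mul_div, le_div_iff₀ hd]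
  have := norm_nonneg t₀⁻¹
  exact mul_le_mul h2.le (by linarith) hd.le (by positivity)

theorem exists_real_bound (h : BorelSolution μ β α a f U) {T : ℝ} (hT : T < 1 / α) :
    ∃ C, 0 ≤ C ∧ ∀ t ∈ Icc 0 T, ∀ k, ‖flowHat a U (t : ℂ) k‖ ≤ C / weight (μ + 2) β k := by
  obtain ⟨A, hA⟩ := h.init_bound
  have hA0 := nonneg_of_norm_le_div_weight hA
  have hα := h.pos
  rcases le_or_gt T 0 with hT0 | hT0
  · refine ⟨A, hA0, fun t ht k => ?_⟩
    have : t = 0 := le_antisymm (ht.2.trans hT0) ht.1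
    simpa [flowHat, this] using hA k
  have hTα : 0 < 1 - α * T := by
    have := (lt_div_iff₀ hα).1 hT
    linarith
  -- For 0 < t ≤ T the gap is 1/t - α ≥ 1/T - α = d, and 1/t - α = (1-αt)/t ≥ (1-αT)/t, which gives
  -- M.
  obtain ⟨C, hC, hb⟩ := h.exists_uniform_bound (d := (1 - α * T) / T) (by positivity)
    (1 / (1 - α * T))
  refine ⟨max A C, le_max_of_le_left hA0, fun t ht k => ?_⟩
  have hw := weight_pos (μ + 2) β k
  rcases ht.1.eq_or_lt with h0 | h0
  · subst h0
    have := hA k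
    simp only [flowHat, Complex.ofReal_zero, if_true]
    refine this.trans ?_
    gcongr; exact le_max_left _ _
  · refine (hb t (ofReal_mem_timeDisc hα ⟨h0, ht.2.trans_lt hT⟩) ?_ ?_ k).1.trans ?_
    · rw [inv_ofReal_re, div_le_iff₀ hT0, sub_mul]
      have : 1 ≤ t⁻¹ * T := by
        rw [inv_mul_eq_div, le_div_iff₀ h0]; linarith [ht.2]
      linarith
    · rw [inv_ofReal_re, ← Complex.ofReal_inv, Complex.norm_real, Real.norm_of_nonneg (by positivity),
        one_div, inv_mul_eq_div, le_div_iff₀ hTα]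
      have : α * T * t⁻¹ ≥ α := by
        have : 1 ≤ T * t⁻¹ := by
          rw [mul_comm, inv_mul_eq_div, le_div_iff₀ h0]; linarith [ht.2]
        nlinarith
      linarith
    · gcongr; exact le_max_right _ _

theorem fourierFlow (h : BorelSolution μ β α a f U) :
    FourierFlow μ f (timeDisc α) (flowHat a U) (flowHatDeriv U) where
  isOpen := isOpen_timeDisc h.pos
  measurable t _ := h.measurable_flowHat t
  hasDerivAt t ht := h.hasDerivAt_flowHat ht
  bound t ht := by
    obtain ⟨C, hC, hb⟩ := h.eventually_bound ht
    refine ⟨C, hb.mono fun s hs k => ⟨(hs k).1.trans ?_, (hs k).2.trans ?_⟩⟩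
    · exact div_le_div_of_nonneg_left hC (weight_pos _ _ k) (weight_zero_le h.nonneg k)
    · exact div_le_div_of_nonneg_left hC (weight_pos _ _ k) (weight_zero_le h.nonneg k)
  kdot_eq_zero t _ := h.kdot_flowHat t
  equation t ht := h.equation_flowHat ht

theorem continuousOn_real (h : BorelSolution μ β α a f U) :
    ContinuousOn (fun q : ℝ × E3 => invFourier (flowHat a U (q.1 : ℂ)) q.2)
      (Ico 0 (1 / α) ×ˢ univ) := by
  have hα := h.pos
  rintro ⟨t, x⟩ ⟨ht, -⟩
  rcases ht.1.eq_or_lt with h0 | h0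
  · have h0 : t = 0 := h0.symm
    subst h0
    obtain ⟨C, hU⟩ := h.expBounded
    -- For t ≤ 1/(2α) the gap 1/t - α is at least 1/(2t), so the Laplace integral is O(t) and the
    -- initial value is attained.
    obtain ⟨K, hK, hb⟩ := h.exists_real_bound (T := 1 / (2 * α)) (by gcongr; linarith)
    rw [ContinuousWithinAt, nhdsWithin_prod_eq, nhdsWithin_univ]
    have hev : ∀ᶠ t in 𝓝[Ico 0 (1 / α)] (0 : ℝ), t ∈ Icc 0 (1 / (2 * α)) := by
      filter_upwards [self_mem_nhdsWithin, mem_nhdsWithin_of_mem_nhds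
        (Iio_mem_nhds (show (0 : ℝ) < 1 / (2 * α) by positivity))] with t h1 h2
      exact ⟨h1.1, le_of_lt h2⟩
    refine continuousAt_invFourier (G := fun t : ℝ => flowHat a U (t : ℂ)) (t₀ := 0)
      (b := fun k => K * (weight μ 0 k)⁻¹)
      (Eventually.of_forall fun t => (h.measurable_flowHat _).aestronglyMeasurable) ?_
      ((integrable_inv_weight h.three_lt le_rfl).const_mul K) (fun k => ?_) x
    · refine hev.mono fun t ht k => (hb t ht k).trans ((div_weight_add_two_le hK k).trans ?_)
      rw [← div_eq_mul_inv]
      exact div_le_div_of_nonneg_left hK (weight_pos _ _ k) (weight_zero_le h.nonneg k)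
    · rw [tendsto_iff_norm_sub_tendsto_zero]
      have hw := weight_pos μ β k
      have hC := hU.nonneg
      have hlim : Tendsto (fun t : ℝ => 2 * C / weight μ β k * t) (𝓝[Ico 0 (1 / α)] (0 : ℝ)) (𝓝 0) := by
        have : Continuous fun t : ℝ => 2 * C / weight μ β k * t := by fun_prop
        simpa using (this.tendsto 0).mono_left nhdsWithin_le_nhds
      refine squeeze_zero' (Eventually.of_forall fun t => norm_nonneg _) ?_ hlim
      filter_upwards [hev] with t ht
      rcases ht.1.eq_or_lt with h0 | h0
      · simp [← h0]
      · have htα : α * t ≤ 1 / 2 := by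
          have := (le_div_iff₀ (by positivity)).1 ht.2
          linarith
        have hmem : (t : ℂ) ∈ timeDisc α := ofReal_mem_timeDisc hα ⟨h0, by
          rw [lt_div_iff₀ hα]; linarith⟩
        have hne := ne_zero_of_mem_timeDisc hα hmem
        simp only [flowHat, if_neg hne, Complex.ofReal_zero, if_true, add_sub_cancel_left]
        refine (hU.norm_laplaceMoment_zero_le hmem k).trans ?_
        have h1 : (2 * t)⁻¹ ≤ ((t : ℂ)⁻¹).re - α := by
          rw [inv_ofReal_re, inv_le_iff_one_le_mul₀ (by positivity), sub_mul]
          have : t⁻¹ * (2 * t) = 2 := by field_simp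
          linarith
        calc _ ≤ C / (2 * t)⁻¹ / weight μ β k := by gcongr
          _ = _ := by rw [div_inv_eq_mul]; ring
  · have hmem := ofReal_mem_timeDisc hα ⟨h0, ht.2⟩
    have h1 := (h.fourierFlow.continuousOn h.three_lt).continuousAt (x := ((t : ℂ), x))
      (((isOpen_timeDisc hα).prod isOpen_univ).mem_nhds ⟨hmem, trivial⟩)
    have h2 : Continuous fun q : ℝ × E3 => ((q.1 : ℂ), q.2) := by fun_prop
    exact (ContinuousAt.comp (x := (t, x)) h1 h2.continuousAt).continuousWithinAt

theorem analyticOnNhd_lp (h : BorelSolution μ β α a f U) :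
    ∃ Φ : ℂ → lp (fun _ : E3 => C3) ⊤, AnalyticOnNhd ℂ Φ (timeDisc α) ∧
      ∀ t ∈ timeDisc α, ∀ k, Φ t k = ((weight μ β k : ℝ) : ℂ) • flowHat a U t k := by
  obtain ⟨C, hU⟩ := h.expBounded
  obtain ⟨A, hA, ha⟩ := h.init_bound'
  obtain ⟨F, hF, hd⟩ := hU.exists_lp_laplace
  have hmem : Memℓp (fun k => ((weight μ β k : ℝ) : ℂ) • a k) ⊤ := by
    refine memℓp_infty ⟨A, ?_⟩
    rintro _ ⟨k, rfl⟩
    simp only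
    rw [norm_smul, Complex.norm_real, Real.norm_of_nonneg (weight_pos μ β k).le]
    have := ha k
    rwa [le_div_iff₀ (weight_pos μ β k), mul_comm] at this
  refine ⟨fun t => ⟨_, hmem⟩ + F t⁻¹, ?_, fun t ht k => ?_⟩
  · refine DifferentiableOn.analyticOnNhd (fun t ht => ?_) (isOpen_timeDisc h.pos)
    have h0 := ne_zero_of_mem_timeDisc h.pos ht
    exact (((hd t⁻¹ ht).comp t (differentiableAt_inv h0)).const_add _).differentiableWithinAt
  · have h0 := ne_zero_of_mem_timeDisc h.pos ht
    rw [lp.coeFn_add, Pi.add_apply, hF t⁻¹ ht]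
    simp only [flowHat, if_neg h0, smul_add]

theorem analyticOnNhd_invFourier (h : BorelSolution μ β α a f U) (x : E3) :
    AnalyticOnNhd ℂ (fun t => invFourier (flowHat a U t) x) (timeDisc α) :=
  DifferentiableOn.analyticOnNhd (fun _ ht => (h.fourierFlow.hasDerivAt_invFourier h.three_lt
    h.measurable_force ht x).differentiableAt.differentiableWithinAt) (isOpen_timeDisc h.pos)

theorem exists_bound (h : BorelSolution μ β α a f U) {t : ℂ} (ht : t ∈ insert 0 (timeDisc α)) :
    ∃ C, 0 ≤ C ∧ ∀ k, ‖flowHat a U t k‖ ≤ C / weight μ β k := by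
  rcases ht with rfl | ht
  · obtain ⟨A, hA, ha⟩ := h.init_bound'
    exact ⟨A, hA, fun k => by simpa [flowHat] using ha k⟩
  · obtain ⟨C, hC, hb⟩ := h.eventually_bound ht
    exact ⟨C, hC, fun k => (hb.self_of_nhds k).1.trans (div_weight_add_two_le hC k)⟩

theorem integrable_flowHat (h : BorelSolution μ β α a f U) {t : ℂ}
    (ht : t ∈ insert 0 (timeDisc α)) : Integrable (flowHat a U t) :=
  let ⟨_, _, hb⟩ := h.exists_bound ht
  integrable_of_norm_le_div_weight h.three_lt h.nonneg (h.measurable_flowHat t).aestronglyMeasurable hb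

theorem isFourierTransform (h : BorelSolution μ β α a f U) {t : ℂ} (ht : t ∈ insert 0 (timeDisc α)) :
    IsFourierTransform (invFourier (flowHat a U t)) (flowHat a U t) :=
  ⟨h.measurable_flowHat t, h.integrable_flowHat ht, fun _ => rfl⟩

theorem flowHat_eq (h : BorelSolution μ β α a f U) {t : ℂ} (ht : t ∈ timeDisc α) (k : E3) :
    flowHat a U t k = a k + ∫ p in Ioi (0 : ℝ), Complex.exp (-(p : ℂ) / t) • U p k := by
  obtain ⟨C, hU⟩ := h.expBounded
  have h0 := ne_zero_of_mem_timeDisc h.pos ht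
  rw [setIntegral_Ioi_eq_integral fun p hp => by rw [hU.zero p hp, smul_zero]]
  simp [flowHat, h0, laplaceMoment, div_eq_mul_inv]

/-- Fubini in (k,p): the weight is integrable in k and e^{-p(Re(1/t)-α)} in p. -/
theorem invFourier_flowHat_eq (h : BorelSolution μ β α a f U) {t : ℂ} (ht : t ∈ timeDisc α)
    (x : E3) : invFourier (flowHat a U t) x = invFourier a x +
      ∫ p in Ioi (0 : ℝ), Complex.exp (-(p : ℂ) / t) • invFourier (U p) x := by
  obtain ⟨C, hU⟩ := h.expBounded
  obtain ⟨A, hA, ha⟩ := h.init_bound'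
  have h0 := ne_zero_of_mem_timeDisc h.pos ht
  have e : flowHat a U t = fun k => a k + laplaceMoment 0 U t⁻¹ k := by ext1 k; simp [flowHat, h0]
  have i1 : Integrable a := integrable_of_norm_le_div_weight h.three_lt h.nonneg
    h.measurable_datum.aestronglyMeasurable ha
  have i2 : Integrable (laplaceMoment 0 U t⁻¹) := integrable_of_norm_le_div_weight h.three_lt h.nonneg
    (hU.measurable_laplaceMoment 0 _).aestronglyMeasurable (hU.norm_laplaceMoment_zero_le ht)
  have hz : ∀ p : ℝ, p ≤ 0 → Complex.exp (-(p : ℂ) / t) • invFourier (U p) x = 0 := fun p hp => by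
    have : U p = fun _ => 0 := funext (hU.zero p hp)
    simp [this, invFourier]
  rw [e, invFourier_add i1 i2, setIntegral_Ioi_eq_integral hz]
  congr 1
  unfold invFourier laplaceMoment
  simp only [← integral_smul]
  rw [integral_integral_swap]
  · refine integral_congr_ae (Eventually.of_forall fun p => ?_)
    refine integral_congr_ae (Eventually.of_forall fun k => ?_)
    simp only [pow_zero, mul_one, div_eq_mul_inv]
    rw [smul_comm]
  · have hg := ((integrable_inv_weight h.three_lt h.nonneg).const_mul C).mul_prod
      (ExpBounded.integrable_indicator_pow 0 (sub_pos.2 ht))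
    refine hg.mono' ?_ (Eventually.of_forall fun y => ?_)
    · have he : Measurable fun y : E3 × ℝ => Complex.exp (-(y.2 : ℂ) * t⁻¹) * (y.2 : ℂ) ^ 0 := by
        fun_prop
      have hp : Measurable fun y : E3 × ℝ => Complex.exp (Complex.I * ((inner ℝ y.1 x : ℝ) : ℂ)) :=
        (measurable_phase x).comp measurable_fst
      have hu := hU.measurable.comp ((measurable_snd (α := E3) (β := ℝ)).prodMk measurable_fst)
      exact (hp.smul (he.smul hu)).aestronglyMeasurable
    · simp only [Function.uncurry, norm_phase_smul]
      refine (hU.norm_moment_integrand_le 0 t⁻¹ y.2 y.1).trans_eq ?_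
      rw [div_eq_mul_inv]

end BorelSolution

end

end NSBorel

namespace NSBorel
open MeasureTheory Set Filter Topology

/-! ### Existence of the Borel transform, symmetry and the strip of analyticity -/

noncomputable section

/-- The weight μ+2 on the datum is spent on |k|² v̂₀. For the quadratic term weight μ+1 is enough,
because it loses a single power of |k|. -/
theorem exists_v1hat_bound {μ β A F : ℝ} {a f : E3 → C3} (hμ : 3 < μ) (hβ : 0 ≤ β)
    (ham : Measurable a) (ha : ∀ k, ‖a k‖ ≤ A / weight (μ + 2) β k)
    (hf : ∀ k, ‖f k‖ ≤ F / weight μ β k) : ∃ B, ∀ k, ‖v1hat a f k‖ ≤ B / weight μ β k := by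
  have hA := nonneg_of_norm_le_div_weight ha
  have ha1 : ∀ k, ‖a k‖ ≤ A / weight (μ + 1) β k := fun k => (ha k).trans (by
    have := weight_pos (μ + 1) β k
    rw [show μ + 2 = μ + 1 + 1 by ring, weight_add_one]
    gcongr
    nlinarith [norm_nonneg k])
  have hc := constC0_pos (show 3 < μ + 1 by linarith)
  refine ⟨A + A * A * constC0 (μ + 1) + F, fun k => ?_⟩
  have hw := weight_pos μ β k
  have hk := norm_nonneg k
  have h1 := norm_nonlin_le (show 3 < μ + 1 by linarith) hβ hA hA
    (Eventually.of_forall ha1) (Eventually.of_forall ha1) k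
  have h2 : ‖((‖k‖ ^ 2 : ℝ) : ℂ) • a k‖ ≤ A / weight μ β k := by
    rw [norm_smul, Complex.norm_real, norm_pow, norm_norm]
    calc _ ≤ (1 + ‖k‖) ^ 2 * (A / weight (μ + 2) β k) := by
          gcongr
          · linarith
          · exact ha k
      _ = _ := by rw [weight_add_two]; field_simp
  have h3 : ‖nonlin a a k‖ ≤ A * A * constC0 (μ + 1) / weight μ β k := by
    refine h1.trans ?_
    rw [weight_add_one, div_le_div_iff₀ (by positivity) hw]
    have : 0 ≤ A * A * constC0 (μ + 1) * weight μ β k := by positivity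
    nlinarith
  rw [v1hat_eq (show 3 < μ + 1 by linarith) hβ ham ha1]
  calc _ ≤ ‖((‖k‖ ^ 2 : ℝ) : ℂ) • a k‖ + ‖nonlin a a k‖ + ‖f k‖ := by
        refine (norm_add_le _ _).trans (add_le_add_left ((norm_add_le _ _).trans ?_) _)
        rw [norm_neg]
    _ ≤ A / weight μ β k + A * A * constC0 (μ + 1) / weight μ β k + F / weight μ β k := by
        gcongr; exact hf k
    _ = _ := by ring

/-- With ρ = B/√α the condition on α yields the contraction condition with room to spare: √π ≥ 1 and
3/4 ≤ 1 are given away. -/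
theorem AlphaCondition.real {μ β α : ℝ} {a f : E3 → C3} (hμ : 3 < μ) (hα : 0 < α)
    (h : AlphaCondition μ β α a f) (ha : wnorm μ β a ≠ ⊤) (h1 : wnorm μ β (v1hat a f) ≠ ⊤) :
    constC2 μ / 4 * (3 * (wnorm μ β a).toReal / √α +
      8 * ((wnorm μ β (v1hat a f)).toReal / √α) / α) ≤ 1 / 2 := by
  have hC2 : 0 ≤ constC2 μ := by
    have := constC0_pos hμ
    have := supG_nonneg
    have := Real.pi_pos
    unfold constC2
    positivity
  have hpi : 1 ≤ √Real.pi := by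
    rw [Real.one_le_sqrt]
    linarith [Real.pi_gt_three]
  have hsα : 0 < √α := Real.sqrt_pos.2 hα
  unfold AlphaCondition at h
  set A := (wnorm μ β a).toReal with hA
  set B := (wnorm μ β (v1hat a f)).toReal with hB
  have hA0 : 0 ≤ A := ENNReal.toReal_nonneg
  have hB0 : 0 ≤ B := ENNReal.toReal_nonneg
  rw [← ENNReal.ofReal_toReal ha, ← ENNReal.ofReal_toReal h1, ← hA, ← hB,
    ← ENNReal.ofReal_mul (by positivity), ← ENNReal.ofReal_add hA0 (by positivity),
    ← ENNReal.ofReal_mul (by positivity), ENNReal.ofReal_lt_one] at h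
  have hr : α ^ (-(1 / 2) : ℝ) = (√α)⁻¹ := by
    rw [Real.rpow_neg hα.le, Real.sqrt_eq_rpow]
  rw [hr] at h
  have h2 : 2 * constC2 μ * 1 * (√α)⁻¹ * (A + 2 * α⁻¹ * B) ≤ 1 := by
    refine le_trans ?_ h.le
    gcongr
  have h3 : 0 ≤ constC2 μ * (√α)⁻¹ * A := by positivity
  calc _ = constC2 μ * (√α)⁻¹ * A * (3 / 4) + constC2 μ * (√α)⁻¹ * (2 * α⁻¹ * B) := by
        field_simp
        ring
    _ ≤ _ := by nlinarith

theorem exists_borelSolution {μ β α : ℝ} {a f : E3 → C3} (hμ : 3 < μ) (hβ : 0 ≤ β) (hα : 0 < α)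
    (ham : Measurable a) (hfm : Measurable f) (ha : wnorm (μ + 2) β a < ⊤) (hf : wnorm μ β f < ⊤)
    (hadiv : ∀ᵐ k : E3, kdot k (a k) = 0) (hfdiv : ∀ᵐ k : E3, kdot k (f k) = 0)
    (h : AlphaCondition μ β α a f) :
    ∃ U, BorelSolution μ β α a f U ∧ (HermitianSymm a → HermitianSymm (v1hat a f) →
      ∀ᵐ k : E3, ∀ p, U p (-k) = conj3 (U p k)) := by
  have ha2 := norm_le_toReal_wnorm ha
  have hA2 := nonneg_of_norm_le_div_weight ha2
  have hf1 := norm_le_toReal_wnorm hf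
  have ha0 : wnorm μ β a < ⊤ := (wnorm_le_of_norm_le fun k =>
    (ha2 k).trans (div_weight_add_two_le hA2 k)).trans_lt ENNReal.ofReal_lt_top
  obtain ⟨B, hB⟩ := exists_v1hat_bound hμ hβ ham ha2 hf1
  have hv1 : wnorm μ β (v1hat a f) < ⊤ := (wnorm_le_of_norm_le hB).trans_lt ENNReal.ofReal_lt_top
  have hvm : Measurable (v1hat a f) := by
    have hk : Measurable fun k : E3 => ((‖k‖ ^ 2 : ℝ) : ℂ) := by fun_prop
    have e : v1hat a f = fun k => -(((‖k‖ ^ 2 : ℝ) : ℂ) • a k) + nonlin a a k + f k :=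
      funext (v1hat_eq hμ hβ ham (norm_le_toReal_wnorm ha0))
    rw [e]
    exact ((hk.smul ham).neg.add (measurable_nonlin ham ham)).add hfm
  obtain ⟨U, hU, hfix, hsym⟩ := exists_borel_solution hμ hβ hα ham hvm ENNReal.toReal_nonneg
    ENNReal.toReal_nonneg (norm_le_toReal_wnorm ha0) (norm_le_toReal_wnorm hv1)
    (h.real hμ hα ha0.ne hv1.ne)
  obtain ⟨C, -, hC⟩ := hU.exp_bound hμ hβ hα ENNReal.toReal_nonneg (norm_le_toReal_wnorm ha0)
    (norm_le_toReal_wnorm hv1) ENNReal.toReal_nonneg hfix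
  refine ⟨U, ⟨hμ, hβ, hα, ham, hfm, ⟨_, ha2⟩, ⟨_, hf1⟩, hadiv, hfdiv, ⟨_, hU⟩,
    ⟨C, hU.measurable, fun p hp k => ?_, hC⟩, hfix⟩, hsym⟩
  have := hU.bound p k
  rw [borelProfile_of_nonpos hp] at this
  simpa using this

/-! ### Hermitian symmetry -/

theorem kconv_neg {a : E3 → C3} (ha : HermitianSymm a) (k : E3) :
    kconv a a (-k) = -conj3 (kconv a a k) := by
  have key : ∀ᵐ q : E3, kdot (-k) (a (-q)) • a (-k - -q) = -conj3 (kdot k (a q) • a (k - q)) := by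
    filter_upwards [ha, ae_comp_sub ha k] with q h1 h2
    rw [show -k - -q = -(k - q) by abel, h1, h2, conj3_smul, kdot_neg_conj3, neg_smul]
  unfold kconv
  rw [← integral_neg_eq_self, integral_congr_ae key, integral_neg,
    ContinuousLinearEquiv.integral_comp_comm]

theorem HermitianSymm.v1hat {μ β A : ℝ} {a f : E3 → C3} (hμ : 3 < μ) (hβ : 0 ≤ β)
    (ham : Measurable a) (haA : ∀ k, ‖a k‖ ≤ A / weight μ β k)
    (ha : HermitianSymm a) (hf : HermitianSymm f) : HermitianSymm (v1hat a f) := by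
  filter_upwards [ha, hf] with k h1 h2
  rw [v1hat_eq hμ hβ ham haA, v1hat_eq hμ hβ ham haA, nonlin, nonlin, kconv_neg ha, h1, h2, norm_neg,
    ← projL_apply, map_neg, projL_apply, projSymbol_neg_conj3]
  simp only [map_add, map_neg, conj3_smul, Complex.conj_ofReal, Complex.conj_I, smul_neg, neg_smul,
    neg_neg]

theorem conj3_invFourier (g : E3 → C3) (x : E3) :
    conj3 (invFourier g x) = invFourier (fun k => conj3 (g (-k))) x := by
  unfold invFourier
  rw [← ContinuousLinearEquiv.integral_comp_comm, ← integral_neg_eq_self]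
  refine integral_congr_ae (Eventually.of_forall fun k => ?_)
  simp only [conj3_smul, ← Complex.exp_conj, map_mul, Complex.conj_I, Complex.conj_ofReal,
    inner_neg_left]
  congr 2
  push_cast
  ring

theorem im_eq_zero_of_conj3_eq {w : C3} (h : conj3 w = w) (j : Fin 3) : (w j).im = 0 :=
  Complex.conj_eq_iff_im.1 (by rw [← conj3_apply, h])

theorem HermitianSymm.im_invFourier {g : E3 → C3} (hg : HermitianSymm g) (x : E3) (j : Fin 3) :
    (invFourier g x j).im = 0 := by
  refine im_eq_zero_of_conj3_eq ?_ j
  rw [conj3_invFourier]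
  refine invFourier_congr_ae ?_ x
  filter_upwards [hg] with k hk
  rw [hk]
  ext j
  simp [conj3_apply]

theorem hermitianSymm_flowHat {a : E3 → C3} {U : ℝ → E3 → C3} (ha : HermitianSymm a)
    (hU : ∀ᵐ k : E3, ∀ p, U p (-k) = conj3 (U p k)) (t : ℝ) :
    HermitianSymm (flowHat a U (t : ℂ)) := by
  filter_upwards [ha, hU] with k h1 h2
  unfold flowHat
  split_ifs
  · exact h1
  · rw [map_add, h1]
    congr 1
    unfold laplaceMoment
    rw [← ContinuousLinearEquiv.integral_comp_comm]
    refine integral_congr_ae (Eventually.of_forall fun p => ?_)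
    simp only [h2, conj3_smul]
    congr 1
    simp [← Complex.exp_conj]

/-! ### Holomorphic extension -/

theorem kdot_im (k : E3) (z : C3) : (kdot k z).im = inner ℝ k (imPart z) := by
  simp [kdot, imPart, PiLp.inner_apply, mul_comm]

theorem kdot_toC3 (k x : E3) : kdot k (toC3 x) = ((inner ℝ k x : ℝ) : ℂ) := by
  simp [kdot, toC3, PiLp.inner_apply, mul_comm]

theorem continuous_imPart : Continuous imPart := by
  unfold imPart
  fun_prop

theorem norm_exp_kdot_le (k : E3) (z : C3) :
    ‖Complex.exp (Complex.I * kdot k z)‖ ≤ Real.exp (‖k‖ * ‖imPart z‖) := by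
  rw [Complex.norm_exp]
  refine Real.exp_le_exp.2 ?_
  rw [Complex.mul_re, Complex.I_re, Complex.I_im, zero_mul, one_mul, zero_sub, kdot_im]
  have := (abs_le.1 (abs_real_inner_le_norm k (imPart z))).1
  linarith

theorem aestronglyMeasurable_smulRight {g : E3 → C3} (hg : Measurable g) :
    AEStronglyMeasurable (fun k : E3 => (kdotL k).smulRight (g k)) volume := by
  have hkL : Continuous kdotL := by
    unfold kdotL
    exact (innerSL ℂ).continuous.comp continuous_toC3
  have hsr : Continuous fun p : (C3 →L[ℂ] ℂ) × C3 => p.1.smulRight p.2 :=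
    (ContinuousLinearMap.smulRightL ℂ C3 C3).continuous₂
  have h := hsr.comp_aestronglyMeasurable
    ((hkL.aestronglyMeasurable (μ := volume)).prodMk hg.aestronglyMeasurable)
  exact h

/-- For |Im z| < b < β one has |e^{ik·z}| ≤ e^{b|k|}, so a factor e^{-ε|k|} with ε = β - b is left
over. It absorbs the |k| produced by differentiation, since ε|k| e^{-ε|k|} ≤ 1, and (1+|k|)^{-μ}
ensures integrability. -/
theorem differentiableOn_strip {μ β C : ℝ} (hμ : 3 < μ) {g : E3 → C3} (hg : Measurable g)
    (h : ∀ k, ‖g k‖ ≤ C / weight μ β k) :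
    DifferentiableOn ℂ (fun z => ∫ k : E3, Complex.exp (Complex.I * kdot k z) • g k)
      {z | ‖imPart z‖ < β} := by
  intro z₀ hz₀
  have hz₀ : ‖imPart z₀‖ < β := hz₀
  have hC := nonneg_of_norm_le_div_weight h
  obtain ⟨b, hb₀, hb⟩ := exists_between hz₀
  set ε := β - b with hε
  have hεpos : 0 < ε := sub_pos.2 hb
  have hs : {z : C3 | ‖imPart z‖ < b} ∈ 𝓝 z₀ :=
    (isOpen_lt continuous_imPart.norm continuous_const).mem_nhds hb₀
  have hexp : ∀ (k : E3) (z : C3), ‖imPart z‖ < b →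
      ‖Complex.exp (Complex.I * kdot k z)‖ * ‖g k‖ ≤
        C * (Real.exp (-(ε * ‖k‖)) * (1 + ‖k‖) ^ (-μ)) := fun k z hz => by
    calc _ ≤ Real.exp (‖k‖ * b) * (C / weight μ β k) := by
          gcongr
          · exact (norm_exp_kdot_le k z).trans (by gcongr)
          · exact h k
      _ = _ := by
          rw [weight, Real.rpow_neg (by positivity), div_mul_eq_div_div, div_eq_mul_inv _ (Real.exp _),
            ← Real.exp_neg, show -(ε * ‖k‖) = ‖k‖ * b + -(β * ‖k‖) by rw [hε]; ring, Real.exp_add]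
          ring
  have hmeas : ∀ z : C3, Measurable fun k : E3 => Complex.exp (Complex.I * kdot k z) := fun z => by
    have : Measurable fun k : E3 => kdot k z :=
      (continuous_kdot.comp (continuous_id.prodMk continuous_const)).measurable
    fun_prop
  refine (hasFDerivAt_integral_of_dominated_of_fderiv_le (𝕜 := ℂ)
    (F := fun z k => Complex.exp (Complex.I * kdot k z) • g k)
    (F' := fun z k => (Complex.exp (Complex.I * kdot k z) * Complex.I) • (kdotL k).smulRight (g k))
    (bound := fun k => C / ε * (1 + ‖k‖) ^ (-μ)) hs ?_ ?_ ?_ ?_ ?_ ?_).differentiableAt.differentiableWithinAt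
  · exact Eventually.of_forall fun z => ((hmeas z).smul hg).aestronglyMeasurable
  · refine ((integrable_one_add_norm_rpow hμ).const_mul C).mono'
      ((hmeas z₀).smul hg).aestronglyMeasurable (Eventually.of_forall fun k => ?_)
    rw [norm_smul]
    refine (hexp k z₀ hb₀).trans ?_
    have : Real.exp (-(ε * ‖k‖)) ≤ 1 := Real.exp_le_one_iff.2 (by
      have := norm_nonneg k
      nlinarith)
    have h2 : 0 ≤ (1 + ‖k‖) ^ (-μ) := by positivity
    gcongr
    nlinarith
  · exact ((hmeas z₀).mul_const _).aestronglyMeasurable.smul (aestronglyMeasurable_smulRight hg)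
  · refine Eventually.of_forall fun k z hz => ?_
    rw [norm_smul, norm_mul, Complex.norm_I, mul_one, ContinuousLinearMap.norm_smulRight_apply]
    have h1 : ‖kdotL k‖ = ‖k‖ := by rw [kdotL, innerSL_apply_norm, norm_toC3]
    rw [h1]
    have h2 : ε * ‖k‖ * Real.exp (-(ε * ‖k‖)) ≤ 1 := by
      rw [Real.exp_neg, ← div_eq_mul_inv, div_le_one (Real.exp_pos _)]
      linarith [Real.add_one_le_exp (ε * ‖k‖)]
    have h3 : 0 ≤ (1 + ‖k‖) ^ (-μ) := by positivity
    calc _ = ‖k‖ * (‖Complex.exp (Complex.I * kdot k z)‖ * ‖g k‖) := by ring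
      _ ≤ ‖k‖ * (C * (Real.exp (-(ε * ‖k‖)) * (1 + ‖k‖) ^ (-μ))) :=
          mul_le_mul_of_nonneg_left (hexp k z hz) (norm_nonneg k)
      _ = C / ε * (ε * ‖k‖ * Real.exp (-(ε * ‖k‖))) * (1 + ‖k‖) ^ (-μ) := by field_simp
      _ ≤ C / ε * 1 * (1 + ‖k‖) ^ (-μ) := by gcongr
      _ = _ := by rw [mul_one]
  · exact (integrable_one_add_norm_rpow hμ).const_mul _
  · refine Eventually.of_forall fun k z _ => ?_
    have h1 : HasFDerivAt (fun z => Complex.I * kdot k z) (Complex.I • kdotL k) z := by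
      simp only [← kdotL_apply]
      exact (kdotL k).hasFDerivAt.const_mul Complex.I
    refine (h1.cexp.smul_const (g k)).congr_fderiv ?_
    ext w
    simp [mul_assoc]

theorem BorelSolution.exists_strip {μ β α : ℝ} {a f : E3 → C3} {U : ℝ → E3 → C3}
    (h : BorelSolution μ β α a f U) {t : ℂ} (ht : t ∈ insert 0 (timeDisc α)) :
    ∃ V : C3 → C3, DifferentiableOn ℂ V {z | ‖imPart z‖ < β} ∧
      ∀ x, V (toC3 x) = invFourier (flowHat a U t) x := by
  obtain ⟨C, -, hb⟩ := h.exists_bound ht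
  refine ⟨_, differentiableOn_strip h.three_lt (h.measurable_flowHat t) hb, fun x => ?_⟩
  simp only [kdot_toC3]
  rfl

end

end NSBorel

namespace NSBorel
open MeasureTheory Set Filter Topology

/-! ### Fourier duality with test functions -/

noncomputable section

open scoped SchwartzMap FourierTransform ContDiff

/-- The transform `k ↦ ∫ e^{i k·x} ψ(x) dx` of a scalar function. -/
def testHat (ψ : E3 → ℂ) (k : E3) : ℂ :=
  ∫ x : E3, Complex.exp (Complex.I * ((inner ℝ k x : ℝ) : ℂ)) * ψ x

theorem integrable_phase_mul {ψ : E3 → ℂ} (hψ : Integrable ψ) (k : E3) :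
    Integrable fun x : E3 => Complex.exp (Complex.I * ((inner ℝ k x : ℝ) : ℂ)) * ψ x := by
  have h := integrable_phase_smul hψ k
  simpa only [real_inner_comm, smul_eq_mul] using h

theorem norm_phase (r : ℝ) : ‖Complex.exp (Complex.I * (r : ℂ))‖ = 1 :=
  Complex.norm_exp_I_mul_ofReal r

/-- Duality between `testHat` and `invFourier`. -/
theorem integral_testHat_smul {ψ : E3 → ℂ} {g : E3 → C3} (hψ : Integrable ψ) (hg : Integrable g) :
    ∫ k, testHat ψ k • g k = ∫ x, ψ x • invFourier g x := by
  unfold testHat invFourier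
  simp only [← integral_smul_const, ← integral_smul]
  rw [integral_integral_swap]
  · refine integral_congr_ae (Eventually.of_forall fun x => ?_)
    refine integral_congr_ae (Eventually.of_forall fun k => ?_)
    simp only [smul_smul]
    rw [mul_comm]
  · have hc : Continuous fun y : E3 × E3 => Complex.exp (Complex.I * ((inner ℝ y.1 y.2 : ℝ) : ℂ)) := by
      fun_prop
    have hm1 : AEStronglyMeasurable (fun y : E3 × E3 => ψ y.2) (volume.prod volume) := hψ.1.comp_snd
    have hm2 : AEStronglyMeasurable (fun y : E3 × E3 => g y.1) (volume.prod volume) := hg.1.comp_fst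
    refine (hg.norm.mul_prod hψ.norm).mono' ((hc.aestronglyMeasurable.mul hm1).smul hm2)
      (Eventually.of_forall fun y => ?_)
    simp only [Function.uncurry]
    rw [norm_smul, norm_mul, norm_phase, one_mul, mul_comm]

theorem testHat_eq_fourier (S : 𝓢(E3, ℂ)) (k : E3) :
    testHat S k = 𝓕 S (-(2 * Real.pi)⁻¹ • k) := by
  rw [SchwartzMap.fourier_coe, Real.fourier_eq']
  unfold testHat
  refine integral_congr_ae (Eventually.of_forall fun x => ?_)
  simp only [smul_eq_mul, inner_smul_right]
  congr 2
  have := Real.pi_ne_zero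
  rw [real_inner_comm]
  push_cast
  field_simp

theorem continuous_testHat (S : 𝓢(E3, ℂ)) : Continuous (testHat S) := by
  have : testHat S = fun k => 𝓕 S (-(2 * Real.pi)⁻¹ • k) := funext (testHat_eq_fourier S)
  rw [this]
  exact (𝓕 S).continuous.comp (by fun_prop)

theorem exists_testHat_decay (S : 𝓢(E3, ℂ)) (N : ℕ) :
    ∃ C, 0 ≤ C ∧ ∀ k, ‖testHat S k‖ ≤ C / (1 + ‖k‖) ^ N := by
  set C := 2 ^ N * (Finset.Iic (N, 0)).sup (fun m => SchwartzMap.seminorm ℝ m.1 m.2) (𝓕 S) with hC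
  have h1 : ∀ y, (1 + ‖y‖) ^ N * ‖(𝓕 S) y‖ ≤ C := fun y => by
    have := SchwartzMap.one_add_le_sup_seminorm_apply (𝕜 := ℝ) (m := (N, 0)) (k := N) (n := 0)
      le_rfl le_rfl (𝓕 S) y
    rwa [norm_iteratedFDeriv_zero] at this
  have hC0 : 0 ≤ C := le_trans (by positivity) (h1 0)
  have hpi := Real.pi_gt_three
  refine ⟨(2 * Real.pi) ^ N * C, by positivity, fun k => ?_⟩
  rw [testHat_eq_fourier, le_div_iff₀ (by positivity), mul_comm]
  have h2 := h1 (-(2 * Real.pi)⁻¹ • k)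
  have h3 : 1 + ‖k‖ ≤ 2 * Real.pi * (1 + ‖-(2 * Real.pi)⁻¹ • k‖) := by
    rw [norm_smul, norm_neg, norm_inv, Real.norm_of_nonneg (by positivity), mul_add, ← mul_assoc,
      mul_inv_cancel₀ (by positivity)]
    linarith
  calc _ ≤ (2 * Real.pi * (1 + ‖-(2 * Real.pi)⁻¹ • k‖)) ^ N * ‖(𝓕 S) (-(2 * Real.pi)⁻¹ • k)‖ := by
        gcongr
    _ = (2 * Real.pi) ^ N * ((1 + ‖-(2 * Real.pi)⁻¹ • k‖) ^ N * ‖(𝓕 S) (-(2 * Real.pi)⁻¹ • k)‖) := by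
        rw [mul_pow, mul_assoc]
    _ ≤ _ := by gcongr

theorem integrable_weight_testHat (ν : ℝ) (S : 𝓢(E3, ℂ)) :
    Integrable fun k => weight ν 0 k * ‖testHat S k‖ := by
  -- Decay of order N > ν + 4 leaves (1+|k|)^{-4}, integrable in three dimensions.
  obtain ⟨N, hN⟩ := exists_nat_gt (ν + 4)
  obtain ⟨C, hC, hb⟩ := exists_testHat_decay S N
  refine ((integrable_one_add_norm_rpow (μ := 4) (by norm_num)).const_mul C).mono'
    ((continuous_weight ν 0).mul (continuous_testHat S).norm).aestronglyMeasurable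
    (Eventually.of_forall fun k => ?_)
  have h0 : (0 : ℝ) < 1 + ‖k‖ := by positivity
  have hw := weight_pos ν 0 k
  rw [Real.norm_of_nonneg (by positivity)]
  calc _ ≤ weight ν 0 k * (C / (1 + ‖k‖) ^ N) := by gcongr; exact hb k
    _ = C * (1 + ‖k‖) ^ (ν - N) := by
        rw [weight, zero_mul, Real.exp_zero, mul_one, Real.rpow_sub h0, Real.rpow_natCast]; ring
    _ ≤ _ := by
        gcongr
        · linarith [norm_nonneg k]
        · linarith

theorem integrable_testHat (S : 𝓢(E3, ℂ)) : Integrable (testHat S) := by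
  have h := integrable_weight_testHat 0 S
  simp only [weight, Real.rpow_zero, zero_mul, Real.exp_zero, one_mul] at h
  exact (integrable_norm_iff (continuous_testHat S).aestronglyMeasurable).1 h

/-- Fourier inversion in the present normalization; the scaling by 2π in three dimensions produces
(2π)³. -/
theorem testHat_testHat_neg (S : 𝓢(E3, ℂ)) (k : E3) :
    testHat (fun x => testHat S (-x)) k = (2 * Real.pi : ℂ) ^ 3 * S k := by
  have hpi := Real.pi_pos
  have h1 : testHat (fun x => testHat S (-x)) k =
      ∫ x : E3, (fun y : E3 => Complex.exp (Complex.I * ((inner ℝ k ((2 * Real.pi) • y) : ℝ) : ℂ)) *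
        𝓕 S y) ((2 * Real.pi)⁻¹ • x) := by
    unfold testHat
    refine integral_congr_ae (Eventually.of_forall fun x => ?_)
    simp only
    rw [smul_inv_smul₀ (by positivity)]
    congr 1
    have := testHat_eq_fourier S (-x)
    rw [testHat, neg_smul_neg] at this
    exact this
  have h0 := Measure.integral_comp_inv_smul_of_nonneg (volume : Measure E3)
    (fun y : E3 => Complex.exp (Complex.I * ((inner ℝ k ((2 * Real.pi) • y) : ℝ) : ℂ)) *
      𝓕 S y) (R := 2 * Real.pi) (by positivity)
  rw [h1, h0]
  have h2 : S k = ∫ y : E3, Complex.exp (Complex.I * ((inner ℝ k ((2 * Real.pi) • y) : ℝ) : ℂ)) *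
      𝓕 S y := by
    have hS : 𝓕⁻ (𝓕 S) = S := FourierTransform.fourierInv_fourier_eq S
    conv_lhs => rw [← hS]
    rw [SchwartzMap.fourierInv_coe, Real.fourierInv_eq']
    refine integral_congr_ae (Eventually.of_forall fun y => ?_)
    simp only [smul_eq_mul, inner_smul_right]
    rw [real_inner_comm]
    congr 2
    push_cast
    ring
  rw [← h2, finrank_euclideanSpace, Fintype.card_fin, Complex.real_smul]
  push_cast
  ring

theorem integral_smul_eq_of_schwartz (S : 𝓢(E3, ℂ)) {g : E3 → C3} (hg : Integrable g) :
    (2 * Real.pi : ℂ) ^ 3 • ∫ k, S k • g k = ∫ x, testHat S (-x) • invFourier g x := by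
  rw [← integral_testHat_smul (integrable_testHat S).comp_neg hg]
  simp only [testHat_testHat_neg, ← smul_smul]
  rw [integral_smul]

/-- By inversion every test function is, up to (2π)³, a `testHat` of an integrable function. Duality
then shows that g integrates to zero against all test functions. -/
theorem ae_eq_zero_of_invFourier_eq_zero {g : E3 → C3} (hg : Integrable g)
    (h : ∀ x, invFourier g x = 0) : ∀ᵐ k, g k = 0 := by
  refine ae_eq_zero_of_integral_contDiff_smul_eq_zero hg.locallyIntegrable fun φ hφ hφc => ?_
  have h1 : HasCompactSupport (Complex.ofRealCLM ∘ φ) := hφc.comp_left rfl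
  have h2 : ContDiff ℝ ∞ (Complex.ofRealCLM ∘ φ) := by fun_prop
  have h3 := integral_smul_eq_of_schwartz (h1.toSchwartzMap h2) hg
  simp only [h, smul_zero, integral_zero] at h3
  have h4 : (2 * Real.pi : ℂ) ^ 3 ≠ 0 := by
    have := Real.pi_ne_zero
    exact pow_ne_zero _ (mul_ne_zero two_ne_zero (by exact_mod_cast this))
  have h5 := (smul_eq_zero.1 h3).resolve_left h4
  rw [← h5]
  refine integral_congr_ae (Eventually.of_forall fun k => ?_)
  simp

/-- Injectivity of the Fourier transform on integrable functions. -/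
theorem ae_eq_of_invFourier_eq {g h : E3 → C3} (hg : Integrable g) (hh : Integrable h)
    (e : ∀ x, invFourier g x = invFourier h x) : g =ᵐ[volume] h := by
  filter_upwards [ae_eq_zero_of_invFourier_eq_zero (hg.sub hh) fun x => by
    have := invFourier_sub hg hh x
    rw [e, sub_self] at this
    exact this] with k hk
  exact sub_eq_zero.1 hk

/-- Conjugating a real field leaves it unchanged, so by injectivity of the transform k ↦ conj û(-k)
agrees with û almost everywhere. -/
theorem hermitianSymm_of_real {u uhat : E3 → C3} (h : IsFourierTransform u uhat)
    (hr : ∀ x j, (u x j).im = 0) : HermitianSymm uhat := by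
  have hc : Integrable fun k => conj3 (uhat (-k)) :=
    (conj3 : C3 →L[ℝ] C3).integrable_comp h.integrable.comp_neg
  have e := ae_eq_of_invFourier_eq hc h.integrable fun x => by
    rw [← conj3_invFourier, ← h.inversion]
    ext j
    rw [conj3_apply, Complex.conj_eq_iff_im.2 (hr x j)]
  filter_upwards [e] with k hk
  rw [← hk]
  ext j
  simp [conj3_apply]

/-! ### Test functions -/

/-- A smooth compactly supported function. -/
structure IsTest (θ : E3 → ℂ) : Prop where
  contDiff : ContDiff ℝ ∞ θ
  compact : HasCompactSupport θ

/-- The partial derivative of a scalar function. -/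
def partialS (j : Fin 3) (θ : E3 → ℂ) (x : E3) : ℂ := fderiv ℝ θ x (EuclideanSpace.single j 1)

/-- The mass of `testHat θ` with respect to the weight `(1+|k|)^ν`. -/
def winNorm (ν : ℝ) (θ : E3 → ℂ) : ℝ := ∫ k, weight ν 0 k * ‖testHat θ k‖

theorem winNorm_nonneg (ν : ℝ) (θ : E3 → ℂ) : 0 ≤ winNorm ν θ :=
  integral_nonneg fun k => mul_nonneg (weight_pos ν 0 k).le (norm_nonneg _)

namespace IsTest

variable {θ : E3 → ℂ}

theorem continuous (h : IsTest θ) : Continuous θ := h.contDiff.continuous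

theorem integrable (h : IsTest θ) : Integrable θ := h.continuous.integrable_of_hasCompactSupport h.compact

theorem differentiable (h : IsTest θ) : Differentiable ℝ θ := h.contDiff.differentiable (by simp)

theorem pd (h : IsTest θ) (j : Fin 3) : IsTest (partialS j θ) := by
  refine ⟨?_, (h.compact.fderiv_apply ℝ _)⟩
  exact (h.contDiff.fderiv_right (m := ∞) (by simp)).clm_apply contDiff_const

theorem comp_smul (h : IsTest θ) {c : ℝ} (hc : c ≠ 0) : IsTest fun x => θ (c • x) :=
  ⟨h.contDiff.comp (contDiff_const_smul c), h.compact.comp_smul hc⟩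

theorem comp_sub (h : IsTest θ) (y : E3) : IsTest fun x => θ (x - y) :=
  ⟨h.contDiff.comp (contDiff_id.sub contDiff_const),
    h.compact.comp_homeomorph (Homeomorph.subRight y)⟩

theorem mul_contDiff (h : IsTest θ) {g : E3 → ℂ} (hg : ContDiff ℝ ∞ g) : IsTest fun x => θ x * g x :=
  ⟨h.contDiff.mul hg, h.compact.mul_right⟩

theorem continuous_testHat (h : IsTest θ) : Continuous (testHat θ) :=
  NSBorel.continuous_testHat (h.compact.toSchwartzMap h.contDiff)

theorem integrable_weight_testHat (h : IsTest θ) (ν : ℝ) :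
    Integrable fun k => weight ν 0 k * ‖testHat θ k‖ :=
  NSBorel.integrable_weight_testHat ν (h.compact.toSchwartzMap h.contDiff)

theorem integral_smul_fderiv (h : IsTest θ) {g : E3 → C3} (hg : ContDiff ℝ 1 g) (j : Fin 3) :
    ∫ x, θ x • partialD j g x = -∫ x, partialS j θ x • g x := by
  refine integral_smul_fderiv_eq_neg_fderiv_smul_of_integrable ?_ ?_ ?_ ?_ ?_
  · exact ((h.pd j).continuous.smul hg.continuous).integrable_of_hasCompactSupport
      (h.pd j).compact.smul_right
  · exact (h.continuous.smul ((hg.continuous_fderiv (by norm_num)).clm_apply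
      continuous_const)).integrable_of_hasCompactSupport h.compact.smul_right
  · exact (h.continuous.smul hg.continuous).integrable_of_hasCompactSupport h.compact.smul_right
  · exact fun x _ => h.differentiable x
  · exact fun x _ => (hg.differentiable (by norm_num)) x

theorem testHat_pd (h : IsTest θ) (j : Fin 3) (k : E3) :
    testHat (partialS j θ) k = -(Complex.I * ((k j : ℝ) : ℂ)) * testHat θ k := by
  have hd : ∀ x, HasFDerivAt (fun x : E3 => Complex.exp (Complex.I * ((inner ℝ k x : ℝ) : ℂ)))
      (Complex.exp (Complex.I * ((inner ℝ k x : ℝ) : ℂ)) •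
        (Complex.I • (Complex.ofRealCLM ∘L innerSL ℝ k))) x := fun x => by
    have h1 : HasFDerivAt (fun x : E3 => Complex.I * ((inner ℝ k x : ℝ) : ℂ))
        (Complex.I • (Complex.ofRealCLM ∘L innerSL ℝ k)) x :=
      ((Complex.ofRealCLM ∘L innerSL ℝ k).hasFDerivAt).const_mul Complex.I
    exact h1.cexp
  have hf : ∀ x, fderiv ℝ (fun x : E3 => Complex.exp (Complex.I * ((inner ℝ k x : ℝ) : ℂ))) x
      (EuclideanSpace.single j 1) =
        Complex.I * ((k j : ℝ) : ℂ) * Complex.exp (Complex.I * ((inner ℝ k x : ℝ) : ℂ)) := fun x => by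
    rw [(hd x).fderiv]
    simp only [smul_apply, ContinuousLinearMap.comp_apply, innerSL_apply_apply, inner_single,
      Complex.ofRealCLM_apply, smul_eq_mul]
    ring
  have key := integral_mul_fderiv_eq_neg_fderiv_mul_of_integrable (μ := volume) (𝕜 := ℂ)
    (f := fun x : E3 => Complex.exp (Complex.I * ((inner ℝ k x : ℝ) : ℂ))) (g := θ)
    (v := EuclideanSpace.single j 1)
    (by
      simp only [hf, mul_assoc]
      exact ((integrable_phase_mul h.integrable k).const_mul _).const_mul _)
    (integrable_phase_mul (h.pd j).integrable k) (integrable_phase_mul h.integrable k)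
    (fun x _ => (hd x).differentiableAt) (fun x _ => h.differentiable x)
  unfold testHat partialS
  rw [key]
  simp only [hf, mul_assoc]
  rw [integral_const_mul, integral_const_mul]
  ring

end IsTest

theorem testHat_comp_sub (θ : E3 → ℂ) (y k : E3) :
    testHat (fun x => θ (x - y)) k =
      Complex.exp (Complex.I * ((inner ℝ k y : ℝ) : ℂ)) * testHat θ k := by
  unfold testHat
  rw [← integral_const_mul, ← integral_add_right_eq_self _ y]
  refine integral_congr_ae (Eventually.of_forall fun x => ?_)
  simp only [add_sub_cancel_right, inner_add_right]
  rw [← mul_assoc, ← Complex.exp_add]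
  push_cast
  ring_nf

theorem testHat_modulate (θ : E3 → ℂ) (k q : E3) :
    testHat (fun x => θ x * Complex.exp (-(Complex.I * ((inner ℝ k x : ℝ) : ℂ)))) q =
      testHat θ (q - k) := by
  unfold testHat
  refine integral_congr_ae (Eventually.of_forall fun x => ?_)
  simp only [inner_sub_left]
  rw [mul_comm (θ x), ← mul_assoc, ← Complex.exp_add]
  push_cast
  ring_nf

theorem testHat_comp_inv_smul (θ : E3 → ℂ) {R : ℝ} (hR : 0 < R) (k : E3) :
    testHat (fun x => θ (R⁻¹ • x)) k = (R : ℂ) ^ 3 * testHat θ (R • k) := by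
  have h := Measure.integral_comp_inv_smul_of_nonneg (volume : Measure E3)
    (fun y : E3 => Complex.exp (Complex.I * ((inner ℝ (R • k) y : ℝ) : ℂ)) * θ y) hR.le
  rw [finrank_euclideanSpace, Fintype.card_fin, Complex.real_smul, Complex.ofReal_pow] at h
  unfold testHat
  rw [← h]
  refine integral_congr_ae (Eventually.of_forall fun x => ?_)
  simp only [inner_smul_left, inner_smul_right, RCLike.conj_to_real]
  rw [← mul_assoc R⁻¹, inv_mul_cancel₀ hR.ne', one_mul]

/-- Widening the window by R ≥ 1 gives R³ θ̂(Rk): the same total mass, moved towards k = 0 where the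
weight is smaller. This uniformity lets the cutoff be removed. -/
theorem winNorm_comp_inv_smul_le {θ : E3 → ℂ} (h : IsTest θ) {ν R : ℝ} (hν : 0 ≤ ν) (hR : 1 ≤ R) :
    winNorm ν (fun x => θ (R⁻¹ • x)) ≤ winNorm ν θ := by
  have hR0 : 0 < R := by linarith
  have e : winNorm ν (fun x => θ (R⁻¹ • x)) = ∫ k, weight ν 0 (R⁻¹ • k) * ‖testHat θ k‖ := by
    have h1 := Measure.integral_comp_smul (volume : Measure E3)
      (fun k : E3 => weight ν 0 (R⁻¹ • k) * ‖testHat θ k‖) R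
    rw [finrank_euclideanSpace, Fintype.card_fin, abs_of_pos (by positivity), smul_eq_mul] at h1
    have h2 : ∫ k, weight ν 0 (R⁻¹ • k) * ‖testHat θ k‖ =
        R ^ 3 * ∫ x, weight ν 0 (R⁻¹ • R • x) * ‖testHat θ (R • x)‖ := by
      rw [h1, ← mul_assoc, mul_inv_cancel₀ (by positivity), one_mul]
    rw [h2, ← integral_const_mul]
    unfold winNorm
    refine integral_congr_ae (Eventually.of_forall fun k => ?_)
    simp only
    rw [testHat_comp_inv_smul θ hR0, inv_smul_smul₀ hR0.ne', norm_mul, norm_pow, Complex.norm_real,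
      Real.norm_of_nonneg hR0.le]
    ring
  rw [e]
  have hle : ∀ k, weight ν 0 (R⁻¹ • k) ≤ weight ν 0 k := fun k => by
    simp only [weight, zero_mul, Real.exp_zero, mul_one]
    refine Real.rpow_le_rpow (by positivity) ?_ hν
    rw [norm_smul, norm_inv, Real.norm_of_nonneg hR0.le]
    have := mul_le_of_le_one_left (norm_nonneg k) (inv_le_one_of_one_le₀ hR)
    linarith
  refine integral_mono_of_nonneg (Eventually.of_forall fun k => ?_) (h.integrable_weight_testHat ν)
    (Eventually.of_forall fun k => ?_)
  · exact mul_nonneg (weight_pos _ _ _).le (norm_nonneg _)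
  · exact mul_le_mul_of_nonneg_right (hle k) (norm_nonneg _)

/-- Peetre's inequality, from 1+|k| ≤ (1+|q|)(1+|q-k|). -/
theorem weight_le_mul {ν : ℝ} (hν : 0 ≤ ν) (k q : E3) :
    weight ν 0 k ≤ weight ν 0 q * weight ν 0 (q - k) := by
  simp only [weight, zero_mul, Real.exp_zero, mul_one]
  rw [← Real.mul_rpow (by positivity) (by positivity)]
  refine Real.rpow_le_rpow (by positivity) ?_ hν
  have h1 : ‖k‖ ≤ ‖q‖ + ‖q - k‖ := by
    calc ‖k‖ = ‖q - (q - k)‖ := by rw [sub_sub_cancel]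
      _ ≤ _ := norm_sub_le _ _
  nlinarith [norm_nonneg q, norm_nonneg (q - k)]

/-- Windowing in x is convolution with θ̂ in k. By Peetre's inequality it preserves the weighted
bound, at the cost of the weighted mass of θ̂. -/
theorem norm_integral_testHat_smul_le {θ : E3 → ℂ} (h : IsTest θ) {ν M : ℝ} (hν : 0 ≤ ν) (hM : 0 ≤ M)
    {g : E3 → C3} (hg : ∀ᵐ q, ‖g q‖ ≤ M / weight ν 0 q) (k : E3) :
    ‖∫ q, testHat θ (q - k) • g q‖ ≤ M * winNorm ν θ / weight ν 0 k := by
  have hw := weight_pos ν 0 k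
  have hi := ((h.integrable_weight_testHat ν).comp_sub_right k).const_mul (M / weight ν 0 k)
  have e : M * winNorm ν θ / weight ν 0 k =
      ∫ q, M / weight ν 0 k * (weight ν 0 (q - k) * ‖testHat θ (q - k)‖) := by
    rw [integral_const_mul, integral_sub_right_eq_self (fun q => weight ν 0 q * ‖testHat θ q‖) k]
    unfold winNorm
    ring
  rw [e]
  refine norm_integral_le_of_norm_le hi (hg.mono fun q hq => ?_)
  have hwq := weight_pos ν 0 q
  rw [norm_smul]
  calc _ ≤ ‖testHat θ (q - k)‖ * (M / weight ν 0 q) := by gcongr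
    _ ≤ ‖testHat θ (q - k)‖ * (M / weight ν 0 k * weight ν 0 (q - k)) := by
        gcongr
        rw [div_mul_eq_mul_div, div_le_div_iff₀ hwq hw, mul_assoc]
        gcongr
        rw [mul_comm]
        exact weight_le_mul hν k q
    _ = _ := by ring

end

end NSBorel

namespace NSBorel
open MeasureTheory Set Filter Topology

/-! ### The advection term of a classical solution in Fourier variables -/

noncomputable section

open scoped ContDiff

theorem norm_testHat_le (ψ : E3 → ℂ) (k : E3) : ‖testHat ψ k‖ ≤ ∫ x, ‖ψ x‖ := by
  refine (norm_integral_le_integral_norm _).trans_eq ?_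
  simp only [norm_mul, norm_phase, one_mul]

theorem IsTest.integrable_testHat_smul {θ : E3 → ℂ} (h : IsTest θ) {g : E3 → C3}
    (hg : Integrable g) : Integrable fun k => testHat θ k • g k :=
  hg.bdd_smul (∫ x, ‖θ x‖) h.continuous_testHat.aestronglyMeasurable
    (Eventually.of_forall fun k => norm_testHat_le θ k)

theorem hasFDerivAt_coord {w : E3 → C3} (hw : ContDiff ℝ 1 w) (j : Fin 3) (x : E3) :
    HasFDerivAt (fun x => w x j)
      (((EuclideanSpace.proj j : C3 →L[ℂ] ℂ).restrictScalars ℝ) ∘L fderiv ℝ w x) x := by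
  have h1 := ((hw.differentiable (by norm_num)) x).hasFDerivAt
  exact (((EuclideanSpace.proj j : C3 →L[ℂ] ℂ).restrictScalars ℝ).hasFDerivAt).comp x h1

theorem contDiff_coord {w : E3 → C3} {n : ℕ∞ω} (hw : ContDiff ℝ n w) (j : Fin 3) :
    ContDiff ℝ n fun x => w x j :=
  (((EuclideanSpace.proj j : C3 →L[ℂ] ℂ).restrictScalars ℝ).contDiff).comp hw

theorem continuous_partialD {w : E3 → C3} (hw : ContDiff ℝ 1 w) (j : Fin 3) :
    Continuous (partialD j w) :=
  (hw.continuous_fderiv (by norm_num)).clm_apply continuous_const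

/-- The advection term of a divergence-free field is a divergence. -/
theorem IsTest.integral_smul_advection {φ : E3 → ℂ} (h : IsTest φ) {w : E3 → C3}
    (hw : ContDiff ℝ 1 w) (hdiv : ∀ x, divergence w x = 0) :
    ∫ x, φ x • advection w x = -∑ j, ∫ x, partialS j φ x • (w x j • w x) := by
  have hwc := hw.continuous
  have hcj : ∀ j : Fin 3, Continuous fun x => w x j := fun j => (contDiff_coord hw j).continuous
  have i1 : ∀ j : Fin 3, Integrable fun x => (φ x * w x j) • partialD j w x := fun j =>
    ((h.continuous.mul (hcj j)).smul (continuous_partialD hw j)).integrable_of_hasCompactSupport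
      (h.compact.mul_right).smul_right
  have i2 : ∀ j : Fin 3, Integrable fun x => partialS j φ x • (w x j • w x) := fun j =>
    ((h.pd j).continuous.smul ((hcj j).smul hwc)).integrable_of_hasCompactSupport
      (h.pd j).compact.smul_right
  have i3 : ∀ j : Fin 3, Integrable fun x => (φ x * partialD j w x j) • w x := fun j =>
    ((h.continuous.mul (Continuous.comp (by fun_prop : Continuous fun w : C3 => w j)
      (continuous_partialD hw j))).smul hwc).integrable_of_hasCompactSupport
      (h.compact.mul_right).smul_right
  have e : ∀ j : Fin 3, ∫ x, (φ x * w x j) • partialD j w x =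
      -((∫ x, partialS j φ x • (w x j • w x)) + ∫ x, (φ x * partialD j w x j) • w x) := fun j => by
    have hd : ∀ x, fderiv ℝ (fun x => φ x * w x j) x (EuclideanSpace.single j 1) =
        partialS j φ x * w x j + φ x * partialD j w x j := fun x => by
      have hm : HasFDerivAt (fun x => φ x * w x j) _ x :=
        ((h.differentiable x).hasFDerivAt).mul (hasFDerivAt_coord hw j x)
      rw [hm.fderiv]
      simp only [add_apply, smul_apply, ContinuousLinearMap.comp_apply, smul_eq_mul, partialS, partialD,
        ContinuousLinearMap.coe_restrictScalars', PiLp.proj_apply]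
      ring
    have i4 : Integrable fun x => partialS j φ x • (w x j • w x) + (φ x * partialD j w x j) • w x :=
      (i2 j).add (i3 j)
    rw [← integral_add (i2 j) (i3 j)]
    have key := integral_smul_fderiv_eq_neg_fderiv_smul_of_integrable (μ := volume) (𝕜 := ℂ)
      (f := fun x => φ x * w x j) (g := w) (v := EuclideanSpace.single j 1)
      (by simpa only [hd, add_smul, mul_smul] using i4)
      (i1 j)
      (((h.continuous.mul (hcj j)).smul hwc).integrable_of_hasCompactSupport
        (h.compact.mul_right).smul_right)
      (fun x _ => ((h.differentiable x).mul (hasFDerivAt_coord hw j x).differentiableAt))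
      (fun x _ => (hw.differentiable (by norm_num)) x)
    simp only [hd, add_smul, mul_smul] at key
    simp only [mul_smul]
    exact key
  have h1 : ∫ x, φ x • advection w x = ∑ j, ∫ x, (φ x * w x j) • partialD j w x := by
    rw [← integral_finsetSum _ fun j _ => i1 j]
    simp only [advection, Finset.smul_sum, smul_smul]
  have h2 : ∑ j, ∫ x, (φ x * partialD j w x j) • w x = 0 := by
    rw [← integral_finsetSum _ fun j _ => i3 j]
    simp only [← Finset.sum_smul, ← Finset.mul_sum]
    have : ∀ x, ∑ j, partialD j w x j = 0 := hdiv
    simp [this]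
  rw [h1, Finset.sum_congr rfl fun j _ => e j, Finset.sum_neg_distrib, Finset.sum_add_distrib, h2,
    add_zero]

variable {μ C : ℝ} {w what ghat : E3 → C3}

theorem integrable_fconv_coord (hw : Integrable what) (j : Fin 3) :
    Integrable (fconv (fun q => what q j) what) := integrable_fconv (integrable_coord hw j) hw

/-- For a merely classical w, weight μ > 3 does not make |k| ŵ integrable, so the product formula
cannot be applied to w · ∇w. Incompressibility puts the derivative on the test function, and only
the products w_j w have to be transformed. -/
theorem IsTest.integral_testHat_smul_advection {φ : E3 → ℂ} (h : IsTest φ) (hμ : 3 < μ)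
    (hw : ContDiff ℝ 1 w) (hdiv : ∀ x, divergence w x = 0) (hwhat : IsFourierTransform w what)
    (hb : ∀ k, ‖what k‖ ≤ C / weight μ 0 k) (hg : IsFourierTransform (advection w) ghat) :
    (Integrable fun k => testHat φ k • (Complex.I • kconv what what k)) ∧
      ∫ k, testHat φ k • ghat k = ∫ k, testHat φ k • (Complex.I • kconv what what k) := by
  have hi := hwhat.integrable
  have hprod : ∀ j x, w x j • w x = invFourier (fconv (fun q => what q j) what) x := fun j x => by
    rw [invFourier_fconv (integrable_coord hi j) hi, ← invFourier_apply hi, ← hwhat.inversion]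
  have hk : ∀ k, testHat φ k • (Complex.I • kconv what what k) =
      -∑ j, testHat (partialS j φ) k • fconv (fun q => what q j) what k := fun k => by
    rw [← sum_smul_fconv hμ le_rfl hwhat.measurable hwhat.measurable hb hb k, Finset.smul_sum,
      Finset.smul_sum, ← Finset.sum_neg_distrib]
    refine Finset.sum_congr rfl fun j _ => ?_
    rw [h.testHat_pd, smul_smul, smul_smul, ← neg_smul]
    congr 1
    ring
  have hj : ∀ j : Fin 3, Integrable fun k =>
      testHat (partialS j φ) k • fconv (fun q => what q j) what k := fun j =>
    (h.pd j).integrable_testHat_smul (integrable_fconv_coord hi j)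
  simp only [hk]
  refine ⟨(integrable_finsetSum _ fun j _ => hj j).neg, ?_⟩
  rw [integral_neg, integral_finsetSum _ fun j _ => hj j,
    integral_testHat_smul h.integrable hg.integrable]
  simp only [← hg.inversion]
  rw [h.integral_smul_advection hw hdiv]
  congr 1
  refine Finset.sum_congr rfl fun j _ => ?_
  rw [integral_testHat_smul (h.pd j).integrable (integrable_fconv_coord hi j)]
  simp only [hprod]

/-- The standard cutoff function. -/
def cutoff (x : E3) : ℂ := ((default : ContDiffBump (0 : E3)) x : ℝ)

theorem isTest_cutoff : IsTest cutoff where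
  contDiff := Complex.ofRealCLM.contDiff.comp (default : ContDiffBump (0 : E3)).contDiff
  compact := ((default : ContDiffBump (0 : E3)).hasCompactSupport).comp_left Complex.ofReal_zero

theorem cutoff_zero : cutoff 0 = 1 := by
  unfold cutoff
  rw [(default : ContDiffBump (0 : E3)).one_of_mem_closedBall
    (Metric.mem_closedBall_self (default : ContDiffBump (0 : E3)).rIn_pos.le), Complex.ofReal_one]

theorem norm_cutoff_le (x : E3) : ‖cutoff x‖ ≤ 1 := by
  unfold cutoff
  rw [Complex.norm_real, Real.norm_of_nonneg (default : ContDiffBump (0 : E3)).nonneg]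
  exact (default : ContDiffBump (0 : E3)).le_one

theorem testHat_cutoff_zero : testHat cutoff 0 ≠ 0 := by
  have h : testHat cutoff 0 = ((∫ x, (default : ContDiffBump (0 : E3)) x : ℝ) : ℂ) := by
    unfold testHat cutoff
    simp only [inner_zero_left, Complex.ofReal_zero, mul_zero, Complex.exp_zero, one_mul]
    exact integral_ofReal
  rw [h]
  exact_mod_cast ((default : ContDiffBump (0 : E3)).integral_pos (μ := volume)).ne'

theorem advection_hat_eq (hμ : 3 < μ) (hw : ContDiff ℝ 1 w) (hdiv : ∀ x, divergence w x = 0)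
    (hwhat : IsFourierTransform w what) (hb : ∀ k, ‖what k‖ ≤ C / weight μ 0 k)
    (hg : IsFourierTransform (advection w) ghat) :
    ∀ᵐ k, ghat k = Complex.I • kconv what what k := by
  -- Translating φ multiplies its transform by a phase. The tested identity thus says that θ̂ times
  -- the difference has vanishing inverse transform everywhere.
  have hae : ∀ φ, IsTest φ → ∀ᵐ k, testHat φ k • (ghat k - Complex.I • kconv what what k) = 0 := by
    intro φ hφ
    have key := fun (φ : E3 → ℂ) (hφ : IsTest φ) =>
      hφ.integral_testHat_smul_advection hμ hw hdiv hwhat hb hg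
    have hint : ∀ φ, IsTest φ →
        Integrable fun k => testHat φ k • (ghat k - Complex.I • kconv what what k) := fun φ hφ => by
      simp only [smul_sub]
      exact (hφ.integrable_testHat_smul hg.integrable).sub (key φ hφ).1
    refine ae_eq_zero_of_invFourier_eq_zero (hint φ hφ) fun y => ?_
    have h1 := (key _ (hφ.comp_sub y)).2
    have h2 := integral_sub ((hφ.comp_sub y).integrable_testHat_smul hg.integrable)
      (key _ (hφ.comp_sub y)).1
    rw [h1, sub_self] at h2
    rw [← h2]
    refine integral_congr_ae (Eventually.of_forall fun k => ?_)
    simp only [testHat_comp_sub, smul_sub, smul_smul, mul_assoc]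
  -- A single window might have zeros in k. Shrinking windows have transforms proportional to that
  -- of the cutoff at k/(n+1), which tends to a nonzero value.
  have hall : ∀ᵐ k, ∀ n : ℕ, testHat (fun x => cutoff ((1 / ((n : ℝ) + 1))⁻¹ • x)) k •
      (ghat k - Complex.I • kconv what what k) = 0 :=
    ae_all_iff.2 fun n => hae _ (isTest_cutoff.comp_smul (inv_ne_zero (by positivity)))
  filter_upwards [hall] with k hk
  by_contra hne
  have hne' : ghat k - Complex.I • kconv what what k ≠ 0 := sub_ne_zero.2 hne
  have hz : ∀ n : ℕ, testHat cutoff ((1 / ((n : ℝ) + 1)) • k) = 0 := fun n => by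
    have h1 := (smul_eq_zero.1 (hk n)).resolve_right hne'
    rw [testHat_comp_inv_smul _ (by positivity)] at h1
    refine (mul_eq_zero.1 h1).resolve_left (pow_ne_zero _ ?_)
    exact_mod_cast (show (1 / ((n : ℝ) + 1)) ≠ 0 by positivity)
  have hlim : Tendsto (fun n : ℕ => testHat cutoff ((1 / ((n : ℝ) + 1)) • k)) atTop
      (𝓝 (testHat cutoff 0)) := by
    refine (isTest_cutoff.continuous_testHat.tendsto 0).comp ?_
    have := (tendsto_one_div_add_atTop_nhds_zero_nat (𝕜 := ℝ)).smul_const k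
    simpa using this
  simp only [hz] at hlim
  exact testHat_cutoff_zero (tendsto_nhds_unique tendsto_const_nhds hlim).symm

/-- The Hodge projection of the advection term in Fourier variables. -/
theorem projSymbol_advection_hat_eq (hμ : 3 < μ) (hw : ContDiff ℝ 1 w)
    (hdiv : ∀ x, divergence w x = 0) (hwhat : IsFourierTransform w what)
    (hb : ∀ k, ‖what k‖ ≤ C / weight μ 0 k) (hg : IsFourierTransform (advection w) ghat) :
    ∀ᵐ k, projSymbol k (ghat k) = -nonlin what what k := by
  filter_upwards [advection_hat_eq hμ hw hdiv hwhat hb hg] with k hk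
  rw [hk, nonlin, neg_neg, ← projL_apply, map_smul, projL_apply]

end

end NSBorel

namespace NSBorel
open MeasureTheory Set Filter Topology

/-! ### Localized Fourier modes of the difference of two solutions -/

noncomputable section

open scoped ContDiff

theorem continuous_invFourier {g : E3 → C3} (hg : Integrable g) : Continuous (invFourier g) := by
  rw [invFourier_eq_fourierIntegral]
  exact VectorFourier.fourierIntegral_continuous Real.continuous_fourierChar
    (by exact phaseForm.continuous₂) hg

theorem laplacian_eq_sum_partialD {g : E3 → C3} (hg : ContDiff ℝ 2 g) (x : E3) :
    Laplacian.laplacian g x = ∑ j, partialD j (partialD j g) x := by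
  rw [InnerProductSpace.laplacian_eq_iteratedFDeriv_orthonormalBasis _
    (EuclideanSpace.basisFun (Fin 3) ℝ)]
  simp only [iteratedFDeriv_two_apply, Matrix.cons_val_zero, Matrix.cons_val_one]
  refine Finset.sum_congr rfl fun j _ => ?_
  have hd : DifferentiableAt ℝ (fderiv ℝ g) x :=
    ((hg.fderiv_right (m := 1) (by norm_num)).differentiable (by norm_num)) x
  have e := DFunLike.congr_fun (fderiv_clm_apply hd
    (differentiableAt_const (EuclideanSpace.single j (1 : ℝ)))) (EuclideanSpace.single j 1)
  rw [EuclideanSpace.basisFun_apply]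
  unfold partialD
  rw [e]
  simp

theorem contDiff_partialD {g : E3 → C3} (hg : ContDiff ℝ 2 g) (j : Fin 3) :
    ContDiff ℝ 1 (partialD j g) :=
  (hg.fderiv_right (m := 1) (by norm_num)).clm_apply contDiff_const

theorem IsTest.integral_smul_laplacian {χ : E3 → ℂ} (h : IsTest χ) {g : E3 → C3}
    (hg : ContDiff ℝ 2 g) :
    ∫ x, χ x • Laplacian.laplacian g x = ∑ j, ∫ x, partialS j (partialS j χ) x • g x := by
  have hg1 : ContDiff ℝ 1 g := hg.of_le (by norm_num)
  simp only [laplacian_eq_sum_partialD hg, Finset.smul_sum]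
  rw [integral_finsetSum]
  · refine Finset.sum_congr rfl fun j _ => ?_
    rw [h.integral_smul_fderiv (contDiff_partialD hg j), (h.pd j).integral_smul_fderiv hg1, neg_neg]
  · exact fun j _ => (h.continuous.smul (continuous_partialD (contDiff_partialD hg j)
      j)).integrable_of_hasCompactSupport h.compact.smul_right

theorem IsTest.integrable_smul {χ : E3 → ℂ} (h : IsTest χ) {g : E3 → C3} (hg : Continuous g) :
    Integrable fun x => χ x • g x :=
  (h.continuous.smul hg).integrable_of_hasCompactSupport h.compact.smul_right

theorem SolvesNSOn.continuous_deriv {f : E3 → C3} {T : ℝ} {w : ℝ → E3 → C3}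
    (hw : SolvesNSOn f (Ioo 0 T) w) {t : ℝ} (ht : t ∈ Ioo 0 T) :
    Continuous fun x => deriv (fun s => w s x) t := by
  rw [← continuousOn_univ]
  exact hw.continuous_dt.comp (f := fun x : E3 => (t, x)) (by fun_prop) fun x _ => ⟨ht, trivial⟩

/-- Continuity of w_t bounds it on compact sets only; the compact support of χ supplies the
dominating function. -/
theorem IsTest.hasDerivAt_integral {χ : E3 → ℂ} (h : IsTest χ) {f : E3 → C3} {T : ℝ}
    {w : ℝ → E3 → C3} (hw : SolvesNSOn f (Ioo 0 T) w) {t : ℝ} (ht : t ∈ Ioo 0 T) :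
    HasDerivAt (fun s => ∫ x, χ x • w s x) (∫ x, χ x • deriv (fun s => w s x) t) t := by
  obtain ⟨ε, hε, hεs⟩ := Metric.nhds_basis_closedBall.mem_iff.1 (isOpen_Ioo.mem_nhds ht)
  have hcomp : IsCompact (Metric.closedBall t ε ×ˢ tsupport χ) :=
    (isCompact_closedBall t ε).prod h.compact
  obtain ⟨B, hB⟩ := hcomp.exists_bound_of_continuousOn
    (hw.continuous_dt.mono (prod_mono hεs (subset_univ _)))
  refine (hasDerivAt_integral_of_dominated_loc_of_deriv_le
    (F := fun s x => χ x • w s x) (F' := fun s x => χ x • deriv (fun s => w s x) s)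
    (bound := fun x => B * ‖χ x‖) (Metric.closedBall_mem_nhds t hε) ?_ ?_ ?_ ?_ ?_ ?_).2
  · filter_upwards [isOpen_Ioo.mem_nhds ht] with s hs
    exact (h.integrable_smul (hw.contDiff s hs).continuous).aestronglyMeasurable
  · exact h.integrable_smul (hw.contDiff t ht).continuous
  · exact (h.integrable_smul (hw.continuous_deriv ht)).aestronglyMeasurable
  · refine Eventually.of_forall fun x s hs => ?_
    rw [norm_smul, mul_comm]
    by_cases hx : x ∈ tsupport χ
    · exact mul_le_mul_of_nonneg_right (hB (s, x) ⟨hs, hx⟩) (norm_nonneg _)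
    · rw [image_eq_zero_of_notMem_tsupport hx, norm_zero, mul_zero, mul_zero]
  · exact h.integrable.norm.const_mul B
  · exact Eventually.of_forall fun x s hs =>
      (hw.differentiable_time s (hεs hs) x).hasDerivAt.fun_const_smul (χ x)

/-! ### Modulated test functions -/

/-- The test function `θ(x) e^{-i k·x}`. -/
def modulate (k : E3) (θ : E3 → ℂ) (x : E3) : ℂ :=
  θ x * Complex.exp (-(Complex.I * ((inner ℝ k x : ℝ) : ℂ)))

theorem contDiff_phase_neg (k : E3) :
    ContDiff ℝ ∞ fun x : E3 => Complex.exp (-(Complex.I * ((inner ℝ k x : ℝ) : ℂ))) := by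
  have h : ContDiff ℝ ∞ fun x : E3 => ((inner ℝ k x : ℝ) : ℂ) :=
    (Complex.ofRealCLM ∘L innerSL ℝ k).contDiff
  exact (contDiff_const.mul h).neg.cexp

theorem IsTest.modulate {θ : E3 → ℂ} (h : IsTest θ) (k : E3) : IsTest (modulate k θ) :=
  h.mul_contDiff (contDiff_phase_neg k)

theorem partialS_modulate {θ : E3 → ℂ} (h : IsTest θ) (k : E3) (j : Fin 3) (x : E3) :
    partialS j (modulate k θ) x =
      modulate k (partialS j θ) x - Complex.I * ((k j : ℝ) : ℂ) * modulate k θ x := by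
  have h1 : HasFDerivAt (fun x : E3 => -(Complex.I * ((inner ℝ k x : ℝ) : ℂ)))
      (-(Complex.I • (Complex.ofRealCLM ∘L innerSL ℝ k))) x :=
    (((Complex.ofRealCLM ∘L innerSL ℝ k).hasFDerivAt).const_mul Complex.I).neg
  have h2 : HasFDerivAt (modulate k θ) _ x := ((h.differentiable x).hasFDerivAt).mul h1.cexp
  unfold partialS
  rw [h2.fderiv]
  simp only [add_apply, smul_apply, neg_apply, ContinuousLinearMap.comp_apply, innerSL_apply_apply,
    inner_single, Complex.ofRealCLM_apply, smul_eq_mul, modulate]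
  ring

theorem IsTest.partialS_partialS_modulate {θ : E3 → ℂ} (h : IsTest θ) (k : E3) (j : Fin 3) (x : E3) :
    partialS j (partialS j (NSBorel.modulate k θ)) x =
      NSBorel.modulate k (partialS j (partialS j θ)) x -
        2 * (Complex.I * ((k j : ℝ) : ℂ)) * NSBorel.modulate k (partialS j θ) x -
        ((k j : ℝ) : ℂ) ^ 2 * NSBorel.modulate k θ x := by
  have e : partialS j (NSBorel.modulate k θ) = fun x => NSBorel.modulate k (partialS j θ) x -
      Complex.I * ((k j : ℝ) : ℂ) * NSBorel.modulate k θ x := funext (partialS_modulate h k j)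
  have d1 := (((h.pd j).modulate k).differentiable x).hasFDerivAt
  have d2 := ((h.modulate k).differentiable x).hasFDerivAt.const_mul (Complex.I * ((k j : ℝ) : ℂ))
  have d3 : partialS j (partialS j (NSBorel.modulate k θ)) x =
      partialS j (NSBorel.modulate k (partialS j θ)) x -
        Complex.I * ((k j : ℝ) : ℂ) * partialS j (NSBorel.modulate k θ) x := by
    conv_lhs => rw [e]
    have d4 : HasFDerivAt (fun x => NSBorel.modulate k (partialS j θ) x -
      Complex.I * ((k j : ℝ) : ℂ) * NSBorel.modulate k θ x) _ x := d1.sub d2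
    unfold partialS at d4 ⊢
    rw [d4.fderiv]
    simp only [sub_apply, smul_apply, smul_eq_mul]
  rw [d3, partialS_modulate (h.pd j), partialS_modulate h]
  linear_combination (((k j : ℝ) : ℂ) ^ 2 * NSBorel.modulate k θ x) * Complex.I_sq

/-- The localized mode is the Fourier transform averaged around k with kernel θ̂, and therefore
satisfies the same weighted bounds. -/
theorem IsTest.integral_modulate_smul {θ : E3 → ℂ} (h : IsTest θ) {g : E3 → C3} (hg : Integrable g)
    (k : E3) : ∫ x, NSBorel.modulate k θ x • invFourier g x = ∫ q, testHat θ (q - k) • g q := by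
  rw [← integral_testHat_smul (h.modulate k).integrable hg]
  refine integral_congr_ae (Eventually.of_forall fun q => ?_)
  simp only
  rw [← testHat_modulate]
  rfl

/-! ### Pairs of solutions -/

/-- Two solutions whose Fourier transforms are bounded by `C` in the norm `‖·‖_{μ,0}` on
`[0, T']`. -/
structure SolutionPair (μ C T T' : ℝ) (f : E3 → C3) (w₁ w₂ W₁ W₂ : ℝ → E3 → C3) : Prop where
  three_lt : 3 < μ
  lt : T' < T
  solves₁ : SolvesNSOn f (Ioo 0 T) w₁
  solves₂ : SolvesNSOn f (Ioo 0 T) w₂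
  continuousOn₁ : ContinuousOn (fun q : ℝ × E3 => w₁ q.1 q.2) (Ico 0 T ×ˢ univ)
  continuousOn₂ : ContinuousOn (fun q : ℝ × E3 => w₂ q.1 q.2) (Ico 0 T ×ˢ univ)
  fourier₁ : ∀ t ∈ Icc 0 T', IsFourierTransform (w₁ t) (W₁ t)
  fourier₂ : ∀ t ∈ Icc 0 T', IsFourierTransform (w₂ t) (W₂ t)
  bound₁ : ∀ t ∈ Icc 0 T', ∀ k, ‖W₁ t k‖ ≤ C / weight μ 0 k
  bound₂ : ∀ t ∈ Icc 0 T', ∀ k, ‖W₂ t k‖ ≤ C / weight μ 0 k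

theorem nonlin_sub_nonlin {μ C : ℝ} (hμ : 3 < μ) {a b : E3 → C3} (ha : Measurable a)
    (hb : Measurable b) (haC : ∀ k, ‖a k‖ ≤ C / weight μ 0 k) (hbC : ∀ k, ‖b k‖ ≤ C / weight μ 0 k)
    (k : E3) : nonlin a a k - nonlin b b k =
      nonlin (fun q => a q - b q) a k + nonlin b (fun q => a q - b q) k := by
  have hC := nonneg_of_norm_le_div_weight haC
  have i := fun (a b : E3 → C3) (ha : Measurable a) (hb : Measurable b)
    (haC : ∀ k, ‖a k‖ ≤ C / weight μ 0 k) (hbC : ∀ k, ‖b k‖ ≤ C / weight μ 0 k) =>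
    integrable_kconv hμ le_rfl ha hb hC (Eventually.of_forall haC) (Eventually.of_forall hbC) k
  have e1 : kconv (fun q => a q - b q) a k = kconv a a k - kconv b a k := by
    unfold kconv
    rw [← integral_sub (i a a ha ha haC haC) (i b a hb ha hbC haC)]
    refine integral_congr_ae (Eventually.of_forall fun q => ?_)
    simp only [← kdotL_apply, map_sub, sub_smul]
  have e2 : kconv b (fun q => a q - b q) k = kconv b a k - kconv b b k := by
    unfold kconv
    rw [← integral_sub (i b a hb ha hbC haC) (i b b hb hb hbC hbC)]
    refine integral_congr_ae (Eventually.of_forall fun q => ?_)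
    simp only [smul_sub]
  unfold nonlin
  rw [e1, e2]
  simp only [← projL_apply, map_sub, smul_sub]
  abel

/-- The constant in the localized energy inequality. -/
def pairConst (μ C : ℝ) (θ : E3 → ℂ) : ℝ :=
  ∑ j, (winNorm μ (partialS j (partialS j θ)) + 2 * winNorm μ (partialS j θ)) +
    2 * C * constC0 μ * winNorm (μ - 1) θ

namespace SolutionPair

variable {μ C T T' : ℝ} {f : E3 → C3} {w₁ w₂ W₁ W₂ : ℝ → E3 → C3}

theorem integrable_sub (h : SolutionPair μ C T T' f w₁ w₂ W₁ W₂) {t : ℝ} (ht : t ∈ Icc 0 T') :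
    Integrable fun k => W₁ t k - W₂ t k :=
  (h.fourier₁ t ht).integrable.sub (h.fourier₂ t ht).integrable

theorem sub_eq_invFourier (h : SolutionPair μ C T T' f w₁ w₂ W₁ W₂) {t : ℝ} (ht : t ∈ Icc 0 T')
    (x : E3) : w₁ t x - w₂ t x = invFourier (fun k => W₁ t k - W₂ t k) x := by
  rw [invFourier_sub (h.fourier₁ t ht).integrable (h.fourier₂ t ht).integrable,
    ← (h.fourier₁ t ht).inversion, ← (h.fourier₂ t ht).inversion]

/-- The function N is taken from the Hodge projection in the equation, where integrability comes
with the hypothesis; its identification with the quadratic term holds almost everywhere, which is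
enough for integrals. -/
theorem deriv_eq {w W : ℝ → E3 → C3} (hμ : 3 < μ) (hw : SolvesNSOn f (Ioo 0 T) w) {t : ℝ}
    (ht : t ∈ Ioo 0 T) (hF : IsFourierTransform (w t) (W t))
    (hb : ∀ k, ‖W t k‖ ≤ C / weight μ 0 k) :
    ∃ N : E3 → C3, Integrable N ∧ (∀ᵐ k, N k = nonlin (W t) (W t) k) ∧
      ∀ x, deriv (fun s => w s x) t = Laplacian.laplacian (w t) x + invFourier N x + f x := by
  obtain ⟨g, ⟨ghat, hg, hh⟩, he⟩ := hw.equation t ht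
  have hae := projSymbol_advection_hat_eq hμ ((hw.contDiff t ht).of_le (by norm_num))
    (hw.divergence_free t ht) hF hb hg
  refine ⟨fun k => -projSymbol k (ghat k), ?_, ?_, fun x => ?_⟩
  · refine (hg.integrable.norm.const_mul 2).mono' ?_ (Eventually.of_forall fun k => ?_)
    · exact (measurable_projSymbol.comp
        (measurable_id.prodMk hg.measurable)).neg.aestronglyMeasurable
    · rw [norm_neg]; exact norm_projSymbol_le k _
  · filter_upwards [hae] with k hk
    rw [hk, neg_neg]
  · have := he x
    rw [hh x] at this
    rw [invFourier_neg, ← sub_add_cancel (deriv (fun s => w s x) t) (Laplacian.laplacian (w t) x), this]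
    abel

/-- The localized Fourier mode satisfies a heat equation with a small source. -/
theorem exists_hasDerivAt (h : SolutionPair μ C T T' f w₁ w₂ W₁ W₂) {θ : E3 → ℂ} (hθ : IsTest θ)
    {t M : ℝ} (ht : t ∈ Ioc 0 T') (hM : 0 ≤ M)
    (hδ : ∀ᵐ k, ‖W₁ t k - W₂ t k‖ ≤ M / weight μ 0 k) (k : E3) :
    ∃ a' : C3, HasDerivAt (fun s => ∫ x, modulate k θ x • (w₁ s x - w₂ s x)) a' t ∧
      ‖a' + (‖k‖ ^ 2 : ℝ) • ∫ x, modulate k θ x • (w₁ t x - w₂ t x)‖ ≤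
        M * pairConst μ C θ * (1 + ‖k‖) / weight μ 0 k := by
  have ht0 : t ∈ Ioo 0 T := ⟨ht.1, ht.2.trans_lt h.lt⟩
  have ht1 : t ∈ Icc 0 T' := ⟨ht.1.le, ht.2⟩
  have hμ := h.three_lt
  have hC := nonneg_of_norm_le_div_weight (h.bound₁ t ht1)
  have hχ := hθ.modulate k
  obtain ⟨N₁, iN₁, aN₁, e₁⟩ := deriv_eq hμ h.solves₁ ht0 (h.fourier₁ t ht1) (h.bound₁ t ht1)
  obtain ⟨N₂, iN₂, aN₂, e₂⟩ := deriv_eq hμ h.solves₂ ht0 (h.fourier₂ t ht1) (h.bound₂ t ht1)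
  have c₁ := h.solves₁.contDiff t ht0
  have c₂ := h.solves₂.contDiff t ht0
  have cu : ContDiff ℝ 2 fun x => w₁ t x - w₂ t x := c₁.sub c₂
  have hd : HasDerivAt (fun s => ∫ x, modulate k θ x • (w₁ s x - w₂ s x))
      ((∫ x, modulate k θ x • deriv (fun s => w₁ s x) t) -
        ∫ x, modulate k θ x • deriv (fun s => w₂ s x) t) t := by
    refine ((hχ.hasDerivAt_integral h.solves₁ ht0).sub
      (hχ.hasDerivAt_integral h.solves₂ ht0)).congr_of_eventuallyEq ?_
    filter_upwards [isOpen_Ioo.mem_nhds ht0] with s hs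
    simp only [Pi.sub_apply, smul_sub]
    exact integral_sub (hχ.integrable_smul (h.solves₁.contDiff s hs).continuous)
      (hχ.integrable_smul (h.solves₂.contDiff s hs).continuous)
  refine ⟨_, hd, ?_⟩
  set δ : E3 → C3 := fun k => W₁ t k - W₂ t k with hδdef
  have iδ : Integrable δ := h.integrable_sub ht1
  have iN : Integrable fun k => N₁ k - N₂ k := iN₁.sub iN₂
  have hu : ∀ x, w₁ t x - w₂ t x = invFourier δ x := h.sub_eq_invFourier ht1
  have hlap : ∀ x, Laplacian.laplacian (w₁ t) x - Laplacian.laplacian (w₂ t) x =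
      Laplacian.laplacian (fun x => w₁ t x - w₂ t x) x := fun x => by
    simp only [laplacian_eq_sum_partialD c₁, laplacian_eq_sum_partialD c₂,
      laplacian_eq_sum_partialD cu, ← Finset.sum_sub_distrib]
    refine Finset.sum_congr rfl fun j _ => ?_
    have hp : partialD j (fun x => w₁ t x - w₂ t x) = fun x => partialD j (w₁ t) x - partialD j (w₂ t) x := by
      ext1 x
      unfold partialD
      rw [fderiv_fun_sub (c₁.differentiable (by norm_num) x) (c₂.differentiable (by norm_num) x)]
      rfl
    have d₁ := (contDiff_partialD c₁ j).differentiable (by norm_num) x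
    have d₂ := (contDiff_partialD c₂ j).differentiable (by norm_num) x
    rw [hp]
    change _ = fderiv ℝ (fun x => partialD j (w₁ t) x - partialD j (w₂ t) x) x
      (EuclideanSpace.single j 1)
    rw [fderiv_fun_sub d₁ d₂]
    rfl
  have hdiff : ∀ x, deriv (fun s => w₁ s x) t - deriv (fun s => w₂ s x) t =
      Laplacian.laplacian (fun x => w₁ t x - w₂ t x) x + invFourier (fun k => N₁ k - N₂ k) x := fun x => by
    rw [e₁, e₂, ← hlap, invFourier_sub iN₁ iN₂]
    abel
  have cN := continuous_invFourier iN
  have clap : Continuous (Laplacian.laplacian fun x => w₁ t x - w₂ t x) := by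
    have : Laplacian.laplacian (fun x => w₁ t x - w₂ t x) =
        fun x => ∑ j, partialD j (partialD j fun x => w₁ t x - w₂ t x) x :=
      funext (laplacian_eq_sum_partialD cu)
    rw [this]
    exact continuous_finsetSum _ fun j _ => continuous_partialD (contDiff_partialD cu j) j
  have hD : (∫ x, modulate k θ x • deriv (fun s => w₁ s x) t) -
      ∫ x, modulate k θ x • deriv (fun s => w₂ s x) t =
      ∑ j, (∫ x, partialS j (partialS j (modulate k θ)) x • invFourier δ x) +
        ∫ q, testHat θ (q - k) • (N₁ q - N₂ q) := by
    rw [← integral_sub (hχ.integrable_smul (h.solves₁.continuous_deriv ht0))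
      (hχ.integrable_smul (h.solves₂.continuous_deriv ht0))]
    simp only [← smul_sub, hdiff, smul_add]
    rw [integral_add (hχ.integrable_smul clap) (hχ.integrable_smul cN),
      hχ.integral_smul_laplacian cu, hθ.integral_modulate_smul iN]
    simp only [hu]
  have cδ : Continuous (invFourier δ) := by
    have : invFourier δ = fun x => w₁ t x - w₂ t x := funext fun x => (hu x).symm
    rw [this]; exact cu.continuous
  -- Leibniz on θ e^{-ik·x}: the principal part -k_j² builds the heat operator, while the commutator
  -- terms carry derivatives of θ and at most one power of k.
  have hj : ∀ j : Fin 3, ∫ x, partialS j (partialS j (modulate k θ)) x • invFourier δ x =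
      (∫ q, testHat (partialS j (partialS j θ)) (q - k) • δ q) -
        (2 * (Complex.I * ((k j : ℝ) : ℂ))) • (∫ q, testHat (partialS j θ) (q - k) • δ q) -
        ((k j : ℝ) : ℂ) ^ 2 • ∫ x, modulate k θ x • invFourier δ x := fun j => by
    have i1 := (((hθ.pd j).pd j).modulate k).integrable_smul cδ
    have i2 := (((hθ.pd j).modulate k).integrable_smul cδ).fun_smul (2 * (Complex.I * ((k j : ℝ) : ℂ)))
    have i3 := (hχ.integrable_smul cδ).fun_smul (((k j : ℝ) : ℂ) ^ 2)
    have i12 : Integrable fun x => modulate k (partialS j (partialS j θ)) x • invFourier δ x -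
      (2 * (Complex.I * ((k j : ℝ) : ℂ))) • modulate k (partialS j θ) x • invFourier δ x := i1.sub i2
    rw [← ((hθ.pd j).pd j).integral_modulate_smul iδ, ← (hθ.pd j).integral_modulate_smul iδ,
      ← integral_smul, ← integral_smul, ← integral_sub i1 i2, ← integral_sub i12 i3]
    refine integral_congr_ae (Eventually.of_forall fun x => ?_)
    simp only [hθ.partialS_partialS_modulate, sub_smul, mul_smul]
  have hsum : ((‖k‖ ^ 2 : ℝ)) • (∫ x, modulate k θ x • invFourier δ x) =
      ∑ j, ((k j : ℝ) : ℂ) ^ 2 • ∫ x, modulate k θ x • invFourier δ x := by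
    rw [← Finset.sum_smul, EuclideanSpace.norm_sq_eq, ← Complex.coe_smul]
    congr 1
    push_cast
    refine Finset.sum_congr rfl fun j _ => ?_
    rw [← Complex.ofReal_pow, ← Complex.ofReal_pow, Real.norm_eq_abs, sq_abs]
  -- The factor |q| of the nonlinearity lowers the weight from μ to μ-1; the factor 1+|k| in the
  -- conclusion pays for it.
  have hNb : ∀ᵐ q, ‖N₁ q - N₂ q‖ ≤ 2 * C * constC0 μ * M / weight (μ - 1) 0 q := by
    filter_upwards [aN₁, aN₂] with q h1 h2
    have hc0 := constC0_pos hμ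
    have hw := weight_pos (μ - 1) 0 q
    have hq := norm_nonneg q
    rw [h1, h2, nonlin_sub_nonlin hμ (h.fourier₁ t ht1).measurable (h.fourier₂ t ht1).measurable
      (h.bound₁ t ht1) (h.bound₂ t ht1)]
    have b1 := norm_nonlin_le hμ le_rfl hM hC hδ (Eventually.of_forall (h.bound₁ t ht1)) q
    have b2 := norm_nonlin_le hμ le_rfl hC hM (Eventually.of_forall (h.bound₂ t ht1)) hδ q
    have e : weight μ 0 q = weight (μ - 1) 0 q * (1 + ‖q‖) := by
      rw [← weight_add_one, sub_add_cancel]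
    calc _ ≤ ‖q‖ * M * C * constC0 μ / weight μ 0 q + ‖q‖ * C * M * constC0 μ / weight μ 0 q :=
          (norm_add_le _ _).trans (add_le_add b1 b2)
      _ = 2 * C * constC0 μ * M * ‖q‖ / (weight (μ - 1) 0 q * (1 + ‖q‖)) := by rw [e]; ring
      _ ≤ 2 * C * constC0 μ * M * (1 + ‖q‖) / (weight (μ - 1) 0 q * (1 + ‖q‖)) := by
          gcongr; linarith
      _ = _ := by field_simp
  have hw := weight_pos μ 0 k
  have hk := norm_nonneg k
  have hc0 := constC0_pos hμ
  simp only [hu]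
  rw [hD, hsum, Finset.sum_congr rfl fun j _ => hj j, add_right_comm, ← Finset.sum_add_distrib]
  simp only [sub_add_cancel]
  have bj : ∀ j : Fin 3, ‖(∫ q, testHat (partialS j (partialS j θ)) (q - k) • δ q) -
      (2 * (Complex.I * ((k j : ℝ) : ℂ))) • (∫ q, testHat (partialS j θ) (q - k) • δ q)‖ ≤
        M * (winNorm μ (partialS j (partialS j θ)) + 2 * winNorm μ (partialS j θ)) * (1 + ‖k‖) /
          weight μ 0 k := fun j => by
    have b1 := norm_integral_testHat_smul_le ((hθ.pd j).pd j) (by linarith) hM hδ k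
    have b2 := norm_integral_testHat_smul_le (hθ.pd j) (by linarith) hM hδ k
    have n1 := winNorm_nonneg μ (partialS j (partialS j θ))
    have n2 := winNorm_nonneg μ (partialS j θ)
    have hkj : |k j| ≤ 1 + ‖k‖ := by
      have := PiLp.norm_apply_le k j
      rw [Real.norm_eq_abs] at this
      linarith
    refine (norm_sub_le _ _).trans ?_
    rw [norm_smul]
    have hn : ‖2 * (Complex.I * ((k j : ℝ) : ℂ))‖ = 2 * |k j| := by simp
    rw [hn]
    calc _ ≤ M * winNorm μ (partialS j (partialS j θ)) / weight μ 0 k * (1 + ‖k‖) +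
          2 * (1 + ‖k‖) * (M * winNorm μ (partialS j θ) / weight μ 0 k) := by
          refine add_le_add (b1.trans ?_) (by gcongr)
          exact le_mul_of_one_le_right (by positivity) (by linarith)
      _ = _ := by ring
  have bN : ‖∫ q, testHat θ (q - k) • (N₁ q - N₂ q)‖ ≤
      M * (2 * C * constC0 μ * winNorm (μ - 1) θ) * (1 + ‖k‖) / weight μ 0 k := by
    refine (norm_integral_testHat_smul_le hθ (by linarith) (by positivity) hNb k).trans_eq ?_
    have hw' := weight_pos (μ - 1) 0 k
    have e : weight μ 0 k = weight (μ - 1) 0 k * (1 + ‖k‖) := by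
      rw [← weight_add_one, sub_add_cancel]
    rw [e]
    field_simp
  calc _ ≤ ∑ j, M * (winNorm μ (partialS j (partialS j θ)) + 2 * winNorm μ (partialS j θ)) *
        (1 + ‖k‖) / weight μ 0 k + M * (2 * C * constC0 μ * winNorm (μ - 1) θ) * (1 + ‖k‖) /
          weight μ 0 k :=
        (norm_add_le _ _).trans (add_le_add ((norm_sum_le _ _).trans
          (Finset.sum_le_sum fun j _ => bj j)) bN)
    _ = _ := by
        unfold pairConst
        rw [← Finset.sum_div, ← Finset.sum_mul, ← Finset.mul_sum]
        ring

end SolutionPair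

end

end NSBorel

namespace NSBorel
open MeasureTheory Set Filter Topology

/-! ### Uniqueness -/

noncomputable section

open scoped ContDiff SchwartzMap

theorem testHat_const_mul (c : ℂ) (θ : E3 → ℂ) (k : E3) :
    testHat (fun x => c * θ x) k = c * testHat θ k := by
  unfold testHat
  rw [← integral_const_mul]
  refine integral_congr_ae (Eventually.of_forall fun x => ?_)
  simp only
  ring

theorem winNorm_const_mul (ν : ℝ) (c : ℂ) (θ : E3 → ℂ) :
    winNorm ν (fun x => c * θ x) = ‖c‖ * winNorm ν θ := by
  unfold winNorm
  rw [← integral_const_mul]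
  refine integral_congr_ae (Eventually.of_forall fun x => ?_)
  simp only [testHat_const_mul, norm_mul]
  ring

theorem partialS_const_mul {θ : E3 → ℂ} (h : IsTest θ) (c : ℂ) (j : Fin 3) :
    partialS j (fun x => c * θ x) = fun x => c * partialS j θ x := by
  ext1 x
  have d := (h.differentiable x).hasFDerivAt.const_mul c
  unfold partialS
  rw [d.fderiv]
  rfl

theorem partialS_comp_smul (θ : E3 → ℂ) (c : ℝ) (j : Fin 3) :
    partialS j (fun x => θ (c • x)) = fun x => (c : ℂ) * partialS j θ (c • x) := by
  ext1 x
  unfold partialS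
  rw [fderiv_comp_smul]
  simp

theorem pairConst_nonneg {μ C : ℝ} (hμ : 3 < μ) (hC : 0 ≤ C) (θ : E3 → ℂ) : 0 ≤ pairConst μ C θ := by
  have hc0 := constC0_pos hμ
  have := winNorm_nonneg (μ - 1) θ
  refine add_nonneg (Finset.sum_nonneg fun j _ => ?_) (by positivity)
  have := winNorm_nonneg μ (partialS j (partialS j θ))
  have := winNorm_nonneg μ (partialS j θ)
  positivity

/-- Each derivative of the widened window brings a factor 1/R ≤ 1, and the weighted masses do not
grow. -/
theorem pairConst_comp_inv_smul_le {μ C R : ℝ} (hμ : 3 < μ) (hC : 0 ≤ C) {θ : E3 → ℂ} (h : IsTest θ)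
    (hR : 1 ≤ R) : pairConst μ C (fun x => θ (R⁻¹ • x)) ≤ pairConst μ C θ := by
  have hR0 : 0 < R := by linarith
  have hc : ‖((R⁻¹ : ℝ) : ℂ)‖ ≤ 1 := by
    rw [Complex.norm_real, Real.norm_of_nonneg (by positivity)]
    exact inv_le_one_of_one_le₀ hR
  have key : ∀ φ : E3 → ℂ, IsTest φ →
      ‖((R⁻¹ : ℝ) : ℂ)‖ * winNorm μ (fun x => φ (R⁻¹ • x)) ≤ winNorm μ φ := fun φ hφ =>
    (mul_le_of_le_one_left (winNorm_nonneg _ _) hc).trans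
      (winNorm_comp_inv_smul_le hφ (by linarith) hR)
  unfold pairConst
  refine add_le_add (Finset.sum_le_sum fun j _ => add_le_add ?_ ?_) ?_
  · rw [partialS_comp_smul, partialS_const_mul ((h.pd j).comp_smul (inv_ne_zero hR0.ne')),
      partialS_comp_smul, winNorm_const_mul, winNorm_const_mul]
    exact (mul_le_of_le_one_left (mul_nonneg (norm_nonneg _) (winNorm_nonneg _ _)) hc).trans
      (key _ ((h.pd j).pd j))
  · rw [partialS_comp_smul, winNorm_const_mul]
    exact mul_le_mul_of_nonneg_left (key _ (h.pd j)) zero_le_two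
  · have hc0 := constC0_pos hμ
    exact mul_le_mul_of_nonneg_left (winNorm_comp_inv_smul_le h (by linarith) hR) (by positivity)

/-! ### A scalar heat estimate -/

/-- Integrating factor e^{κ²(r-s)} applied to the inequality; the decay of the initial value is not
used. -/
theorem norm_le_of_hasDerivAt_heat_of_pos {a : ℝ → C3} {s t κ E : ℝ} (hst : s ≤ t) (hκ : 0 < κ)
    (hd : ∀ r ∈ Icc s t, ∃ a', HasDerivAt a a' r ∧ ‖a' + (κ ^ 2 : ℝ) • a r‖ ≤ E) :
    ‖a t‖ ≤ ‖a s‖ + E * ((1 - Real.exp (-(κ ^ 2 * (t - s)))) / κ ^ 2) := by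
  choose! a' ha' hb using hd
  have hexp : ∀ r, HasDerivAt (fun r => Real.exp (κ ^ 2 * (r - s)))
      (Real.exp (κ ^ 2 * (r - s)) * κ ^ 2) r := fun r => by
    have h1 : HasDerivAt (fun r => κ ^ 2 * (r - s)) (κ ^ 2) r := by
      simpa using ((hasDerivAt_id r).sub_const s).const_mul (κ ^ 2)
    exact h1.exp
  have hf : ∀ r ∈ Icc s t, HasDerivAt (fun r => Real.exp (κ ^ 2 * (r - s)) • a r)
      (Real.exp (κ ^ 2 * (r - s)) • (a' r + (κ ^ 2 : ℝ) • a r)) r := fun r hr =>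
    ((hexp r).smul (ha' r hr)).congr_deriv (by rw [smul_add, smul_smul])
  have hB : ∀ r, HasDerivAt (fun r => ‖a s‖ + E * ((Real.exp (κ ^ 2 * (r - s)) - 1) / κ ^ 2))
      (E * Real.exp (κ ^ 2 * (r - s))) r := fun r =>
    (((((hexp r).sub_const 1).div_const (κ ^ 2)).const_mul E).const_add ‖a s‖).congr_deriv (by
      field_simp)
  have main := image_norm_le_of_norm_deriv_right_le_deriv_boundary'
    (f := fun r => Real.exp (κ ^ 2 * (r - s)) • a r) (a := s) (b := t)
    (fun r hr => (hf r hr).continuousAt.continuousWithinAt)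
    (fun r hr => (hf r ⟨hr.1, hr.2.le⟩).hasDerivWithinAt) (by simp)
    (fun r _ => (hB r).continuousAt.continuousWithinAt) (fun r _ => (hB r).hasDerivWithinAt)
    (fun r hr => by
      rw [norm_smul, Real.norm_of_nonneg (Real.exp_pos _).le, mul_comm]
      exact mul_le_mul_of_nonneg_right (hb r ⟨hr.1, hr.2.le⟩) (Real.exp_pos _).le)
    (right_mem_Icc.2 hst)
  simp only [norm_smul, Real.norm_of_nonneg (Real.exp_pos _).le] at main
  have hp := Real.exp_pos (κ ^ 2 * (t - s))
  have hone : 1 ≤ Real.exp (κ ^ 2 * (t - s)) :=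
    Real.one_le_exp (mul_nonneg (by positivity) (by linarith))
  rw [Real.exp_neg]
  generalize Real.exp (κ ^ 2 * (t - s)) = X at *
  have e : ‖a s‖ * X + E * ((X - 1) / κ ^ 2) = (‖a s‖ + E * ((1 - X⁻¹) / κ ^ 2)) * X := by
    field_simp
  refine le_of_mul_le_mul_right ?_ hp
  rw [← e, mul_comm]
  exact main.trans (add_le_add_left (le_mul_of_one_le_right (norm_nonneg _) hone) _)

/-- Parabolic smoothing of one derivative. The quotient y = ∫₀^r e^{-κ²σ} dσ satisfies y ≤ r and κ²
y ≤ 1, hence (κy)² = (κ² y) y ≤ r. -/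
theorem one_add_mul_heat_le {κ r : ℝ} (hκ : 0 < κ) (hr : 0 ≤ r) :
    (1 + κ) * ((1 - Real.exp (-(κ ^ 2 * r))) / κ ^ 2) ≤ r + √r := by
  set y := (1 - Real.exp (-(κ ^ 2 * r))) / κ ^ 2 with hy
  have h0 : 0 ≤ y := div_nonneg (sub_nonneg.2 (Real.exp_le_one_iff.2 (by
    have : 0 ≤ κ ^ 2 * r := by positivity
    linarith))) (by positivity)
  have h1 : y ≤ r := by
    rw [hy, div_le_iff₀ (by positivity)]
    have := Real.add_one_le_exp (-(κ ^ 2 * r))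
    linarith
  have h2 : κ ^ 2 * y ≤ 1 := by
    rw [hy, mul_div_cancel₀ _ (by positivity)]
    have := Real.exp_pos (-(κ ^ 2 * r))
    linarith
  have h3 : κ * y ≤ √r := by
    refine Real.le_sqrt_of_sq_le ?_
    calc (κ * y) ^ 2 = κ ^ 2 * y * y := by ring
      _ ≤ 1 * r := mul_le_mul h2 h1 h0 zero_le_one
      _ = r := one_mul r
  linarith

/-- The equation is available only after t₀, so the estimate is started at s > t₀ and s tends to t₀,
where continuity makes a(s) tend to 0. -/
theorem norm_le_of_hasDerivAt_heat {a : ℝ → C3} {t₀ t₁ κ E : ℝ} (hκ : 0 < κ) (hE : 0 ≤ E)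
    (hc : ContinuousOn a (Icc t₀ t₁))
    (hd : ∀ r ∈ Ioc t₀ t₁, ∃ a', HasDerivAt a a' r ∧ ‖a' + (κ ^ 2 : ℝ) • a r‖ ≤ E * (1 + κ))
    (h0 : a t₀ = 0) {t : ℝ} (ht : t ∈ Icc t₀ t₁) :
    ‖a t‖ ≤ E * ((t - t₀) + √(t - t₀)) := by
  rcases ht.1.eq_or_lt with rfl | hlt
  · simp [h0]
  have hlim : Tendsto (fun s => ‖a s‖ + E * ((t - t₀) + √(t - t₀))) (𝓝[>] t₀)
      (𝓝 (0 + E * ((t - t₀) + √(t - t₀)))) := by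
    refine Tendsto.add_const _ ?_
    have h1 := (hc t₀ ⟨le_rfl, ht.1.trans ht.2⟩).norm.tendsto
    rw [h0, norm_zero] at h1
    exact h1.mono_left (nhdsWithin_le_of_mem (mem_of_superset
      (Ioc_mem_nhdsGT (hlt.trans_le ht.2)) Ioc_subset_Icc_self))
  rw [zero_add] at hlim
  refine ge_of_tendsto hlim ?_
  filter_upwards [Ioo_mem_nhdsGT hlt] with s hs
  refine (norm_le_of_hasDerivAt_heat_of_pos hs.2.le hκ fun r hr =>
    hd r ⟨hs.1.trans_le hr.1, hr.2.trans ht.2⟩).trans (add_le_add_right ?_ _)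
  rw [mul_assoc]
  refine mul_le_mul_of_nonneg_left ?_ hE
  have hs1 := hs.1
  refine (one_add_mul_heat_le hκ (sub_nonneg.2 hs.2.le)).trans ?_
  gcongr

/-! ### Removing the localization -/

theorem integral_modulate_eq_invFourier (θ : E3 → ℂ) (u : E3 → C3) (k : E3) :
    ∫ x, modulate k θ x • u x = invFourier (fun x => θ x • u x) (-k) := by
  unfold invFourier modulate
  refine integral_congr_ae (Eventually.of_forall fun x => ?_)
  simp only [inner_neg_right, smul_smul, real_inner_comm x k]
  push_cast
  rw [mul_neg, mul_comm (θ x)]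

theorem testHat_comp_neg (ψ : E3 → ℂ) (x : E3) : testHat (fun k => ψ (-k)) x = testHat ψ (-x) := by
  unfold testHat
  rw [← integral_neg_eq_self]
  simp

theorem norm_invFourier_le (g : E3 → C3) (x : E3) : ‖invFourier g x‖ ≤ ∫ k, ‖g k‖ := by
  refine (norm_integral_le_integral_norm _).trans_eq ?_
  simp only [norm_phase_smul]

/-- As the cutoff tends to 1 the windowed mode converges weakly to the full Fourier integral, that
is, to (2π)³ g. Moving the transform to the Schwartz function makes dominated convergence
applicable, as g has a bounded inverse transform. -/
theorem tendsto_integral_smul_mode (S : 𝓢(E3, ℂ)) {g : E3 → C3} (hg : Integrable g) :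
    Tendsto (fun n : ℕ => ∫ k, S k •
      ∫ x, modulate k (fun x => cutoff ((n + 1 : ℝ)⁻¹ • x)) x • invFourier g x) atTop
      (𝓝 ((2 * Real.pi : ℂ) ^ 3 • ∫ k, S k • g k)) := by
  have hT : ∀ n : ℕ, IsTest fun x => cutoff ((n + 1 : ℝ)⁻¹ • x) := fun n =>
    isTest_cutoff.comp_smul (by positivity)
  have hcg := continuous_invFourier hg
  have e : ∀ n : ℕ, ∫ k, S k •
      ∫ x, modulate k (fun x => cutoff ((n + 1 : ℝ)⁻¹ • x)) x • invFourier g x =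
      ∫ x, testHat S (-x) • cutoff ((n + 1 : ℝ)⁻¹ • x) • invFourier g x := fun n => by
    simp only [integral_modulate_eq_invFourier]
    rw [← integral_neg_eq_self]
    simp only [neg_neg]
    have h1 := integral_testHat_smul (ψ := fun k => S (-k)) S.integrable.comp_neg
      ((hT n).integrable_smul hcg)
    rw [← h1]
    simp only [testHat_comp_neg]
  simp only [e]
  rw [integral_smul_eq_of_schwartz S hg]
  have hS := (integrable_testHat S).comp_neg
  have hSc := (continuous_testHat S).comp continuous_neg
  refine tendsto_integral_of_dominated_convergence (fun x => ‖testHat S (-x)‖ * ∫ k, ‖g k‖) ?_ ?_ ?_ ?_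
  · exact fun n => (hSc.smul ((hT n).continuous.smul hcg)).aestronglyMeasurable
  · exact hS.norm.mul_const _
  · refine fun n => Eventually.of_forall fun x => ?_
    rw [norm_smul, norm_smul]
    refine mul_le_mul_of_nonneg_left ?_ (norm_nonneg _)
    exact (mul_le_of_le_one_left (norm_nonneg _) (norm_cutoff_le _)).trans (norm_invFourier_le g x)
  · refine Eventually.of_forall fun x => Tendsto.const_smul ?_ _
    have h1 : Tendsto (fun n : ℕ => (n + 1 : ℝ)⁻¹ • x) atTop (𝓝 ((0 : ℝ) • x)) := by
      refine Tendsto.smul_const ?_ x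
      simpa only [one_div] using tendsto_one_div_add_atTop_nhds_zero_nat (𝕜 := ℝ)
    rw [zero_smul] at h1
    have h2 := ((isTest_cutoff.continuous.tendsto 0).comp h1).smul_const (invFourier g x)
    rw [cutoff_zero, one_smul] at h2
    exact h2

theorem norm_integral_smul_le_of_modes {μ B : ℝ} {g : E3 → C3} (hg : Integrable g)
    (h : ∀ R : ℝ, 1 ≤ R → ∀ k ≠ 0,
      ‖∫ x, modulate k (fun x => cutoff (R⁻¹ • x)) x • invFourier g x‖ ≤ B / weight μ 0 k)
    {φ : E3 → ℝ} (hφ : ContDiff ℝ ∞ φ) (hφc : HasCompactSupport φ) (hφ0 : ∀ k, 0 ≤ φ k) :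
    ‖∫ k, φ k • g k‖ ≤ ∫ k, φ k * (B / weight μ 0 k) := by
  have h1 : HasCompactSupport (Complex.ofRealCLM ∘ φ) := hφc.comp_left rfl
  have h2 : ContDiff ℝ ∞ (Complex.ofRealCLM ∘ φ) := by fun_prop
  have hlim := (tendsto_integral_smul_mode (h1.toSchwartzMap h2) hg).norm
  have hcoe : ∀ k, (h1.toSchwartzMap h2) k = ((φ k : ℝ) : ℂ) := fun k => rfl
  simp only [hcoe, Complex.coe_smul] at hlim
  have hint : Integrable fun k => φ k * (B / weight μ 0 k) :=
    (hφ.continuous.mul (continuous_const.div (continuous_weight μ 0) fun k =>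
      (weight_pos μ 0 k).ne')).integrable_of_hasCompactSupport hφc.mul_right
  -- The heat estimate excludes k = 0, a null set.
  have hne : ∀ᵐ k : E3, k ≠ 0 := by simp [ae_iff]
  have hb := le_of_tendsto' hlim fun n => norm_integral_le_of_norm_le hint (by
    filter_upwards [hne] with k hk
    rw [norm_smul, Real.norm_of_nonneg (hφ0 k)]
    exact mul_le_mul_of_nonneg_left (h _ (by simp) k hk) (hφ0 k))
  refine le_trans ?_ hb
  rw [norm_smul]
  refine le_mul_of_one_le_left (norm_nonneg _) ?_
  rw [norm_pow, norm_mul, Complex.norm_real, Real.norm_of_nonneg Real.pi_pos.le, Complex.norm_ofNat]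
  exact one_le_pow₀ (by linarith [Real.pi_gt_three])

/-- The weak bound becomes pointwise by Lebesgue differentiation along shrinking normalized bumps.
The factor 2^μ covers the variation of the weight over a ball of radius at most 1. -/
theorem ae_norm_le_of_modes {μ B : ℝ} (hμ : 0 ≤ μ) (hB : 0 ≤ B) {g : E3 → C3} (hg : Integrable g)
    (h : ∀ R : ℝ, 1 ≤ R → ∀ k ≠ 0,
      ‖∫ x, modulate k (fun x => cutoff (R⁻¹ • x)) x • invFourier g x‖ ≤ B / weight μ 0 k) :
    ∀ᵐ k, ‖g k‖ ≤ 2 ^ μ * B / weight μ 0 k := by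
  -- The fixed ratio 2 of outer to inner radius is what the differentiation theorem requires of a
  -- shrinking family.
  let φ : ℕ → ContDiffBump (0 : E3) := fun n =>
    { rIn := (2 * (n + 1 : ℝ))⁻¹
      rOut := (n + 1 : ℝ)⁻¹
      rIn_pos := by positivity
      rIn_lt_rOut := by
        rw [mul_inv]
        exact mul_lt_of_lt_one_left (by positivity) (by norm_num) }
  have hr : Tendsto (fun n => (φ n).rOut) atTop (𝓝 0) := by
    simpa only [one_div] using tendsto_one_div_add_atTop_nhds_zero_nat (𝕜 := ℝ)
  filter_upwards [ContDiffBump.ae_convolution_tendsto_right_of_locallyIntegrable (μ := volume) (K := 2) hr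
    (Eventually.of_forall fun n => by
      change (n + 1 : ℝ)⁻¹ ≤ 2 * (2 * (n + 1 : ℝ))⁻¹
      rw [mul_inv, ← mul_assoc, mul_inv_cancel₀ two_ne_zero, one_mul]) hg.locallyIntegrable] with k₀ hk
  refine le_of_tendsto' hk.norm fun n => ?_
  rw [convolution_lsmul_swap]
  have hs : HasCompactSupport fun k => (φ n).normed volume (k₀ - k) :=
    (φ n).hasCompactSupport_normed.comp_homeomorph (Homeomorph.subLeft k₀)
  have hsm : ContDiff ℝ ∞ fun k => (φ n).normed volume (k₀ - k) :=
    (φ n).contDiff_normed.comp (contDiff_const.sub contDiff_id)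
  refine (norm_integral_smul_le_of_modes hg h hsm hs fun k => (φ n).nonneg_normed _).trans ?_
  have hi : Integrable fun k => (φ n).normed volume (k₀ - k) :=
    hsm.continuous.integrable_of_hasCompactSupport hs
  calc _ ≤ ∫ k, (φ n).normed volume (k₀ - k) * (2 ^ μ * B / weight μ 0 k₀) := by
        refine integral_mono ?_ (hi.mul_const _) fun k => ?_
        · exact (hsm.continuous.mul (continuous_const.div (continuous_weight μ 0) fun k =>
            (weight_pos μ 0 k).ne')).integrable_of_hasCompactSupport hs.mul_right
        · by_cases hz : (φ n).normed volume (k₀ - k) = 0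
          · simp [hz]
          refine mul_le_mul_of_nonneg_left ?_ ((φ n).nonneg_normed _)
          have hm : k₀ - k ∈ Metric.ball (0 : E3) (n + 1 : ℝ)⁻¹ := by
            rw [← show Function.support ((φ n).normed volume) = Metric.ball (0 : E3) (n + 1 : ℝ)⁻¹
              from (φ n).support_normed_eq]
            exact hz
          rw [mem_ball_zero_iff, ← norm_neg, neg_sub] at hm
          have hm1 : ‖k - k₀‖ ≤ 1 := hm.le.trans (inv_le_one_of_one_le₀ (by simp))
          have hw : weight μ 0 (k - k₀) ≤ 2 ^ μ := by
            simp only [weight, zero_mul, Real.exp_zero, mul_one]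
            exact Real.rpow_le_rpow (by positivity) (by linarith) hμ
          have h1 := weight_pos μ 0 k
          have h2 := weight_pos μ 0 k₀
          rw [div_le_div_iff₀ h1 h2, mul_comm (2 ^ μ) B, mul_assoc]
          refine mul_le_mul_of_nonneg_left ((weight_le_mul hμ k₀ k).trans ?_) hB
          rw [mul_comm]
          exact mul_le_mul_of_nonneg_right hw h1.le
    _ = _ := by
        rw [integral_mul_const, integral_sub_left_eq_self, (φ n).integral_normed, one_mul]

/-! ### Contraction for the difference of two solutions -/

namespace SolutionPair

variable {μ C T T' : ℝ} {f : E3 → C3} {w₁ w₂ W₁ W₂ : ℝ → E3 → C3}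

theorem continuousOn_mode (h : SolutionPair μ C T T' f w₁ w₂ W₁ W₂) {χ : E3 → ℂ} (hχ : IsTest χ) :
    ContinuousOn (fun s => ∫ x, χ x • (w₁ s x - w₂ s x)) (Icc 0 T') := by
  have hsub : Icc 0 T' ×ˢ (univ : Set E3) ⊆ Ico 0 T ×ˢ univ :=
    prod_mono (fun s hs => ⟨hs.1, hs.2.trans_lt h.lt⟩) le_rfl
  refine continuousOn_integral_of_compact_support hχ.compact ?_ fun s x _ hx => ?_
  · exact (hχ.continuous.comp continuous_snd).continuousOn.smul
      ((h.continuousOn₁.sub h.continuousOn₂).mono hsub)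
  · rw [image_eq_zero_of_notMem_tsupport hx, zero_smul]

theorem norm_mode_le (h : SolutionPair μ C T T' f w₁ w₂ W₁ W₂) {θ : E3 → ℂ} (hθ : IsTest θ)
    {t₀ t₁ M : ℝ} (ht₀ : 0 ≤ t₀) (ht₁ : t₁ ≤ T') (hM : 0 ≤ M) (h0 : w₁ t₀ = w₂ t₀)
    (hδ : ∀ t ∈ Icc t₀ t₁, ∀ᵐ k, ‖W₁ t k - W₂ t k‖ ≤ M / weight μ 0 k) {k : E3} (hk : k ≠ 0)
    {t : ℝ} (ht : t ∈ Icc t₀ t₁) :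
    ‖∫ x, modulate k θ x • (w₁ t x - w₂ t x)‖ ≤
      M * pairConst μ C θ / weight μ 0 k * ((t - t₀) + √(t - t₀)) := by
  have hC : 0 ≤ C := nonneg_of_norm_le_div_weight
    (h.bound₁ t ⟨ht₀.trans ht.1, ht.2.trans ht₁⟩)
  have hp := pairConst_nonneg h.three_lt hC θ
  have hw := weight_pos μ 0 k
  refine norm_le_of_hasDerivAt_heat (a := fun s => ∫ x, modulate k θ x • (w₁ s x - w₂ s x))
    (norm_pos_iff.2 hk) (by positivity)
    ((h.continuousOn_mode (hθ.modulate k)).mono (Icc_subset_Icc ht₀ ht₁)) (fun r hr => ?_) ?_ ht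
  · obtain ⟨a', ha', hb⟩ := h.exists_hasDerivAt hθ ⟨ht₀.trans_lt hr.1, hr.2.trans ht₁⟩ hM
      (hδ r ⟨hr.1.le, hr.2⟩) k
    exact ⟨a', ha', hb.trans_eq (by ring)⟩
  · simp [h0]

theorem ae_norm_sub_le (h : SolutionPair μ C T T' f w₁ w₂ W₁ W₂) {t₀ t₁ M : ℝ} (ht₀ : 0 ≤ t₀)
    (ht₁ : t₁ ≤ T') (hM : 0 ≤ M) (h0 : w₁ t₀ = w₂ t₀)
    (hδ : ∀ t ∈ Icc t₀ t₁, ∀ᵐ k, ‖W₁ t k - W₂ t k‖ ≤ M / weight μ 0 k) {t : ℝ}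
    (ht : t ∈ Icc t₀ t₁) :
    ∀ᵐ k, ‖W₁ t k - W₂ t k‖ ≤
      2 ^ μ * (M * (pairConst μ C cutoff * ((t - t₀) + √(t - t₀)))) / weight μ 0 k := by
  have htT : t ∈ Icc 0 T' := ⟨ht₀.trans ht.1, ht.2.trans ht₁⟩
  have hC : 0 ≤ C := nonneg_of_norm_le_div_weight (h.bound₁ t htT)
  have hμ := h.three_lt
  have hs : 0 ≤ (t - t₀) + √(t - t₀) := add_nonneg (sub_nonneg.2 ht.1) (Real.sqrt_nonneg _)
  have hp := pairConst_nonneg h.three_lt hC cutoff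
  refine ae_norm_le_of_modes (by linarith) (by positivity) (h.integrable_sub htT) fun R hR k hk => ?_
  simp only [← h.sub_eq_invFourier htT]
  refine (h.norm_mode_le (isTest_cutoff.comp_smul (inv_ne_zero (by linarith))) ht₀ ht₁ hM h0 hδ hk
    ht).trans ?_
  have hw := weight_pos μ 0 k
  have hle := pairConst_comp_inv_smul_le hμ hC isTest_cutoff hR
  calc _ ≤ M * pairConst μ C cutoff / weight μ 0 k * ((t - t₀) + √(t - t₀)) := by gcongr
    _ = _ := by ring

/-- A bound M for the difference on the interval improves to M times a factor small with its length.
Iteration from the trivial bound 2C halves it each time. The length τ does not depend on t₀. -/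
theorem exists_step (h : SolutionPair μ C T T' f w₁ w₂ W₁ W₂) :
    ∃ τ > 0, ∀ t₀, 0 ≤ t₀ → w₁ t₀ = w₂ t₀ → ∀ t ∈ Icc t₀ T', t ≤ t₀ + τ → w₁ t = w₂ t := by
  obtain ⟨τ, hτ, hsmall⟩ : ∃ τ > 0, ∀ r ∈ Icc 0 τ,
      2 ^ μ * (pairConst μ C cutoff * (r + √r)) ≤ 1 / 2 := by
    have hcont : ContinuousAt (fun r => 2 ^ μ * (pairConst μ C cutoff * (r + √r))) 0 := by fun_prop
    have hev := hcont.eventually_lt (continuousAt_const (y := (1 / 2 : ℝ))) (by simp)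
    obtain ⟨ε, hε, hb⟩ := Metric.eventually_nhds_iff.1 hev
    refine ⟨ε / 2, by positivity, fun r hr => (hb ?_).le⟩
    rw [Real.dist_0_eq_abs, abs_of_nonneg hr.1]
    linarith [hr.2]
  refine ⟨τ, hτ, fun t₀ ht₀ h0 t ht htτ => ?_⟩
  have htT : t ∈ Icc 0 T' := ⟨ht₀.trans ht.1, ht.2⟩
  have hC : 0 ≤ C := nonneg_of_norm_le_div_weight (h.bound₁ t htT)
  have hn : ∀ n : ℕ, ∀ s ∈ Icc t₀ t, ∀ᵐ k, ‖W₁ s k - W₂ s k‖ ≤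
      2 * C * (1 / 2) ^ n / weight μ 0 k := by
    intro n
    induction n with
    | zero =>
      intro s hs
      have hsT : s ∈ Icc 0 T' := ⟨ht₀.trans hs.1, hs.2.trans ht.2⟩
      refine Eventually.of_forall fun k => (norm_sub_le _ _).trans ?_
      refine (add_le_add (h.bound₁ s hsT k) (h.bound₂ s hsT k)).trans_eq ?_
      ring
    | succ n ih =>
      intro s hs
      filter_upwards [h.ae_norm_sub_le ht₀ ht.2 (by positivity) h0 ih hs] with k hk
      refine hk.trans (div_le_div_of_nonneg_right ?_ (weight_pos μ 0 k).le)
      have := hsmall (s - t₀) ⟨sub_nonneg.2 hs.1, by linarith [hs.2]⟩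
      calc _ = 2 * C * (1 / 2) ^ n * (2 ^ μ * (pairConst μ C cutoff * ((s - t₀) + √(s - t₀)))) := by
            ring
        _ ≤ 2 * C * (1 / 2) ^ n * (1 / 2) := mul_le_mul_of_nonneg_left this (by positivity)
        _ = _ := by ring
  have hz : (fun k => W₁ t k - W₂ t k) =ᵐ[volume] 0 := by
    filter_upwards [ae_all_iff.2 fun n => hn n t ⟨ht.1, le_rfl⟩] with k hk
    have hlim : Tendsto (fun n : ℕ => 2 * C * (1 / 2 : ℝ) ^ n / weight μ 0 k) atTop (𝓝 0) := by
      have := ((tendsto_pow_atTop_nhds_zero_of_lt_one (r := (1 / 2 : ℝ)) (by norm_num)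
        (by norm_num)).const_mul (2 * C)).div_const (weight μ 0 k)
      simpa using this
    exact norm_le_zero_iff.1 (ge_of_tendsto' hlim hk)
  funext x
  rw [← sub_eq_zero, h.sub_eq_invFourier htT, invFourier_congr_ae hz]
  simp [invFourier]

/-- Steps of the fixed length τ exhaust [0, T'], agreement at the end of one step being the initial
condition of the next. -/
theorem eq (h : SolutionPair μ C T T' f w₁ w₂ W₁ W₂) (h0 : w₁ 0 = w₂ 0) :
    ∀ t ∈ Icc 0 T', w₁ t = w₂ t := by
  obtain ⟨τ, hτ, hstep⟩ := h.exists_step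
  have hn : ∀ n : ℕ, ∀ t ∈ Icc 0 T', t ≤ n * τ → w₁ t = w₂ t := by
    intro n
    induction n with
    | zero =>
      intro t ht hle
      rw [show t = 0 from le_antisymm (by simpa using hle) ht.1, h0]
    | succ n ih =>
      intro t ht hle
      rcases le_total t (n * τ) with h1 | h1
      · exact ih t ht h1
      have hp : (0 : ℝ) ≤ n * τ := by positivity
      refine hstep (n * τ) hp (ih _ ⟨hp, h1.trans ht.2⟩ le_rfl) t ⟨h1, ht.2⟩ (hle.trans_eq ?_)
      push_cast
      ring
  intro t ht
  obtain ⟨n, hn'⟩ := exists_nat_ge (t / τ)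
  exact hn n t ht ((div_le_iff₀ hτ).1 hn')

end SolutionPair

end

end NSBorel

namespace NSBorel
open MeasureTheory Set Filter Topology

/-! ### Uniqueness of classical solutions and assembly of the result -/

noncomputable section

theorem IsClassicalSolution.mono {v0 f : E3 → C3} {T T₁ : ℝ} {w : ℝ → E3 → C3}
    (h : IsClassicalSolution v0 f T w) (hT : T₁ ≤ T) : IsClassicalSolution v0 f T₁ w where
  initial := h.initial
  continuousOn := h.continuousOn.mono (prod_mono (Ico_subset_Ico_right hT) le_rfl)
  solves :=
    have hsub : Ioo 0 T₁ ⊆ Ioo 0 T := Ioo_subset_Ioo_right hT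
    { contDiff := fun t ht => h.solves.contDiff t (hsub ht)
      differentiable_time := fun t ht => h.solves.differentiable_time t (hsub ht)
      continuous_dx := h.solves.continuous_dx.mono (prod_mono hsub le_rfl)
      continuous_dxx := h.solves.continuous_dxx.mono (prod_mono hsub le_rfl)
      continuous_dt := h.solves.continuous_dt.mono (prod_mono hsub le_rfl)
      divergence_free := fun t ht => h.solves.divergence_free t (hsub ht)
      equation := fun t ht => h.solves.equation t (hsub ht) }

/-- Classical solutions with locally bounded norm are unique. -/
theorem IsClassicalSolution.eq {v0 f : E3 → C3} {μ β T : ℝ} (hμ : 3 < μ) (hβ : 0 ≤ β)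
    {w₁ w₂ : ℝ → E3 → C3} (h₁ : IsClassicalSolution v0 f T w₁) (h₂ : IsClassicalSolution v0 f T w₂)
    (b₁ : LocallyBoundedNorm μ β T w₁) (b₂ : LocallyBoundedNorm μ β T w₂) :
    ∀ t ∈ Ico 0 T, w₁ t = w₂ t := by
  intro t ht
  obtain ⟨C₁, hC₁⟩ := b₁ t ht.2
  obtain ⟨C₂, hC₂⟩ := b₂ t ht.2
  choose! W₁ hW₁ hn₁ using hC₁
  choose! W₂ hW₂ hn₂ using hC₂
  -- The exponential weight is dropped: uniqueness is proved with β = 0 and a common bound for both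
  -- solutions.
  have key : ∀ (C : ℝ≥0) (g : E3 → C3), C ≤ max C₁ C₂ → wnorm μ β g ≤ C → ∀ k,
      ‖g k‖ ≤ (max C₁ C₂ : ℝ≥0) / weight μ 0 k := fun C g hC hg k => by
    refine (norm_le_of_wnorm_le_nnreal (hg.trans (ENNReal.coe_le_coe.2 hC)) k).trans ?_
    exact div_le_div_of_nonneg_left (NNReal.coe_nonneg _) (weight_pos μ 0 k) (weight_zero_le hβ k)
  have hp : SolutionPair μ (max C₁ C₂ : ℝ≥0) T t f w₁ w₂ W₁ W₂ :=
    { three_lt := hμ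
      lt := ht.2
      solves₁ := h₁.solves
      solves₂ := h₂.solves
      continuousOn₁ := h₁.continuousOn
      continuousOn₂ := h₂.continuousOn
      fourier₁ := hW₁
      fourier₂ := hW₂
      bound₁ := fun s hs => key C₁ _ (le_max_left _ _) (hn₁ s hs)
      bound₂ := fun s hs => key C₂ _ (le_max_right _ _) (hn₂ s hs) }
  exact hp.eq (h₁.initial.trans h₂.initial.symm) t ⟨ht.1, le_rfl⟩

theorem LocallyBoundedNorm.mono {μ β T T₁ : ℝ} {w : ℝ → E3 → C3} (h : LocallyBoundedNorm μ β T w)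
    (hT : T₁ ≤ T) : LocallyBoundedNorm μ β T₁ w := fun T' hT' => h T' (hT'.trans_le hT)

/-- One complex time derivative on an open set already gives analyticity, so a complex competitor is
determined by its real times. -/
theorem SolvesNSOn.analyticOnNhd {f : E3 → C3} {Ω : Set ℂ} (hΩ : IsOpen Ω) {w : ℂ → E3 → C3}
    (h : SolvesNSOn f Ω w) (x : E3) : AnalyticOnNhd ℂ (fun t => w t x) Ω :=
  DifferentiableOn.analyticOnNhd
    (fun t ht => (h.differentiable_time t ht x).differentiableWithinAt) hΩ

/-- Analytic functions on the disc that agree for real times agree. -/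
theorem eqOn_timeDisc {α : ℝ} (hα : 0 < α) {g h : ℂ → C3} (hg : AnalyticOnNhd ℂ g (timeDisc α))
    (hh : AnalyticOnNhd ℂ h (timeDisc α)) (e : ∀ t ∈ Ioo 0 (1 / α), g (t : ℝ) = h (t : ℝ)) :
    EqOn g h (timeDisc α) := by
  have hpos : 0 < 1 / α := by positivity
  set t₀ := 1 / α / 2 with ht₀
  have ht : t₀ ∈ Ioo 0 (1 / α) := ⟨by positivity, half_lt_self hpos⟩
  refine hg.eqOn_of_preconnected_of_frequently_eq hh (isPreconnected_timeDisc hα)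
    (ofReal_mem_timeDisc hα ht) ?_
  have hlim : Tendsto (fun s : ℝ => (s : ℂ)) (𝓝[≠] t₀) (𝓝[≠] (t₀ : ℂ)) :=
    tendsto_nhdsWithin_of_tendsto_nhds_of_eventually_within _
      (Complex.continuous_ofReal.continuousAt.tendsto.mono_left nhdsWithin_le_nhds)
      (by filter_upwards [self_mem_nhdsWithin] with s hs using by simpa using hs)
  refine hlim.frequently (Eventually.frequently ?_)
  filter_upwards [nhdsWithin_le_nhds (isOpen_Ioo.mem_nhds ht)] with s hs using e s hs

namespace BorelSolution

variable {μ β α : ℝ} {v0 a f fhat : E3 → C3} {U : ℝ → E3 → C3}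

theorem isClassicalSolution (h : BorelSolution μ β α a fhat U) (ha : IsFourierTransform v0 a)
    (hf : IsFourierTransform f fhat) :
    IsClassicalSolution v0 f (1 / α) fun t : ℝ => invFourier (flowHat a U (t : ℂ)) where
  initial := by
    funext x
    rw [ha.inversion]
    congr 1
    ext1 k
    simp [flowHat]
  continuousOn := h.continuousOn_real
  solves := (h.fourierFlow.solvesNSOn h.three_lt hf).ofReal fun t ht => ofReal_mem_timeDisc h.pos ht

theorem ofReal_mem (h : BorelSolution μ β α a fhat U) {t : ℝ} (ht : t ∈ Ico 0 (1 / α)) :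
    (t : ℂ) ∈ insert 0 (timeDisc α) := by
  rcases ht.1.eq_or_lt with rfl | h0
  · exact Or.inl Complex.ofReal_zero
  · exact Or.inr (ofReal_mem_timeDisc h.pos ⟨h0, ht.2⟩)

theorem exists_wnorm_le (h : BorelSolution μ β α a fhat U) {T : ℝ} (hT : T < 1 / α) :
    ∃ C : ℝ≥0, ∀ t ∈ Icc 0 T, wnorm μ β (flowHat a U (t : ℂ)) ≤ C ∧
      wnorm (μ + 2) β (flowHat a U (t : ℂ)) ≤ C := by
  obtain ⟨C, hC, hb⟩ := h.exists_real_bound hT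
  exact ⟨C.toNNReal, fun t ht => ⟨wnorm_le_of_norm_le fun k =>
    (hb t ht k).trans (div_weight_add_two_le hC k), wnorm_le_of_norm_le (hb t ht)⟩⟩

theorem locallyBoundedNorm (h : BorelSolution μ β α a fhat U) :
    LocallyBoundedNorm μ β (1 / α) fun t : ℝ => invFourier (flowHat a U (t : ℂ)) := fun T hT => by
  obtain ⟨C, hC⟩ := h.exists_wnorm_le hT
  exact ⟨C, fun t ht => ⟨_, h.isFourierTransform (h.ofReal_mem ⟨ht.1, ht.2.trans_lt hT⟩),
    (hC t ht).1⟩⟩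

theorem exists_wnorm_borel_le (h : BorelSolution μ β α a fhat U) :
    ∃ C : ℝ, ∀ p : ℝ, 0 ≤ p → wnorm μ β (U p) ≤ ENNReal.ofReal (C * Real.exp (α * p)) :=
  let ⟨C, hC⟩ := h.expBounded
  ⟨C, fun p _ => wnorm_le_of_norm_le (hC.bound p)⟩

end BorelSolution

end

end NSBorel

theorem mainTheorem1
    (μ β α : ℝ) (hμ : 3 < μ) (hβ : 0 ≤ β) (hα : 0 < α)
    (v0 v0hat f fhat : E3 → C3)
    (hv0 : IsFourierTransform v0 v0hat) (hf : IsFourierTransform f fhat)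
    (hv0norm : wnorm (μ + 2) β v0hat < ⊤) (hfnorm : wnorm μ β fhat < ⊤)
    (hv0div : ∀ᵐ k : E3, kdot k (v0hat k) = 0) (hfdiv : ∀ᵐ k : E3, kdot k (fhat k) = 0)
    (hαcond : AlphaCondition μ β α v0hat fhat) :
    ∃ (v vhat : ℂ → E3 → C3) (Uhat : ℝ → E3 → C3),
      -- `v` is a classical solution, for real times in `[0, 1/α)` and for complex times
      IsClassicalSolution v0 f (1 / α) (fun t : ℝ => v (t : ℂ)) ∧
      SolvesNSOn f (timeDisc α) v ∧
      -- `vhat` is its Fourier transform, with finite norm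
      vhat 0 = v0hat ∧
      (∀ t ∈ insert 0 (timeDisc α),
        IsFourierTransform (v t) (vhat t) ∧ wnorm μ β (vhat t) < ⊤) ∧
      LocallyBoundedNorm μ β (1 / α) (fun t : ℝ => v (t : ℂ)) ∧
      -- uniqueness, for real and for complex times
      (∀ T : ℝ, 0 < T → T ≤ 1 / α → ∀ w : ℝ → E3 → C3,
        IsClassicalSolution v0 f T w → LocallyBoundedNorm μ β T w →
        ∀ t ∈ Set.Ico 0 T, w t = v (t : ℂ)) ∧
      (∀ w : ℂ → E3 → C3, SolvesNSOn f (timeDisc α) w →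
        IsClassicalSolution v0 f (1 / α) (fun t : ℝ => w (t : ℂ)) →
        LocallyBoundedNorm μ β (1 / α) (fun t : ℝ => w (t : ℂ)) →
        ∀ t ∈ timeDisc α, w t = v t) ∧
      -- Laplace representation
      Measurable (fun q : ℝ × E3 => Uhat q.1 q.2) ∧
      (∃ C : ℝ, ∀ p : ℝ, 0 ≤ p → wnorm μ β (Uhat p) ≤ ENNReal.ofReal (C * Real.exp (α * p))) ∧
      (∀ t ∈ timeDisc α, ∀ k, vhat t k =
        v0hat k + ∫ p in Set.Ioi (0 : ℝ), Complex.exp (-(p : ℂ) / t) • Uhat p k) ∧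
      (∀ t ∈ timeDisc α, ∀ x, v t x =
        v0 x + ∫ p in Set.Ioi (0 : ℝ), Complex.exp (-(p : ℂ) / t) • invFourier (Uhat p) x) ∧
      -- analyticity in `t`: of `v̂(·,t)` in the norm `‖·‖_{μ,β}`, and of `v(x,t)` for each `x`
      (∃ Φ : ℂ → lp (fun _ : E3 => C3) ⊤, AnalyticOnNhd ℂ Φ (timeDisc α) ∧
        ∀ t ∈ timeDisc α, ∀ k, Φ t k = ((weight μ β k : ℝ) : ℂ) • vhat t k) ∧
      (∀ x, AnalyticOnNhd ℂ (fun t => v t x) (timeDisc α)) ∧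
      -- persistence of the stronger norm
      (∀ T < 1 / α, ∃ C : NNReal, ∀ t ∈ Set.Icc 0 T, wnorm (μ + 2) β (vhat (t : ℂ)) ≤ C) ∧
      -- for `β > 0`, the strip of analyticity in `x` keeps its width
      (0 < β → ∀ t ∈ insert 0 (timeDisc α), ∃ V : C3 → C3,
        DifferentiableOn ℂ V {z | ‖imPart z‖ < β} ∧ ∀ x, V (toC3 x) = v t x) ∧
      -- real data give a real solution
      ((∀ x j, (v0 x j).im = 0) → (∀ x j, (f x j).im = 0) →
        ∀ t ∈ Set.Ico 0 (1 / α), ∀ x j, (v ((t : ℝ) : ℂ) x j).im = 0) := by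
  obtain ⟨U, hU, hsymm⟩ := exists_borelSolution hμ hβ hα hv0.measurable hf.measurable hv0norm
    hfnorm hv0div hfdiv hαcond
  have hcl := hU.isClassicalSolution hv0 hf
  have hsol := hU.fourierFlow.solvesNSOn hμ hf
  have huniq : ∀ T : ℝ, 0 < T → T ≤ 1 / α → ∀ w : ℝ → E3 → C3,
      IsClassicalSolution v0 f T w → LocallyBoundedNorm μ β T w →
      ∀ t ∈ Set.Ico 0 T, w t = invFourier (flowHat v0hat U (t : ℂ)) := fun T _ hT w hw hb =>
    hw.eq hμ hβ (hcl.mono hT) hb (hU.locallyBoundedNorm.mono hT)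
  refine ⟨fun t => invFourier (flowHat v0hat U t), flowHat v0hat U, U, hcl, hsol, ?_, fun t ht => ?_,
    hU.locallyBoundedNorm, huniq, fun w hw hwcl hwb t ht => funext fun x => ?_,
    hU.expBounded.choose_spec.measurable, hU.exists_wnorm_borel_le, fun t ht => hU.flowHat_eq ht,
    fun t ht x => ?_, hU.analyticOnNhd_lp, hU.analyticOnNhd_invFourier, fun T hT => ?_,
    fun _ t ht => hU.exists_strip ht, fun hv0real hfreal t _ x j => ?_⟩
  · ext1 k
    simp [flowHat]
  · obtain ⟨C, -, hC⟩ := hU.exists_bound ht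
    exact ⟨hU.isFourierTransform ht, (wnorm_le_of_norm_le hC).trans_lt ENNReal.ofReal_lt_top⟩
  -- The real-time restriction of w equals that of v by uniqueness; both sides are analytic in t for
  -- each x, so they agree on the whole disc.
  · refine eqOn_timeDisc hα (hw.analyticOnNhd (isOpen_timeDisc hα) x)
      (hU.analyticOnNhd_invFourier x) (fun s hs => ?_) ht
    exact congrFun (huniq (1 / α) (by positivity) le_rfl _ hwcl hwb s ⟨hs.1.le, hs.2⟩) x
  · rw [hv0.inversion]
    exact hU.invFourier_flowHat_eq ht x
  · obtain ⟨C, hC⟩ := hU.exists_wnorm_le hT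
    exact ⟨C, fun t ht => (hC t ht).2⟩
  -- Real data are Hermitian in k, hence so is v̂₁, and the symmetry of the Borel solution then
  -- passes to its Laplace transform at real t.
  · obtain ⟨A, -, hA⟩ := hU.init_bound'
    have h0 := hermitianSymm_of_real hv0 hv0real
    have h1 := HermitianSymm.v1hat hμ hβ hv0.measurable hA h0 (hermitianSymm_of_real hf hfreal)
    exact (hermitianSymm_flowHat h0 (hsymm h0 h1) t).im_invFourier x j
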